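/- Let $\mathcal V=(\mathcal V_0,\otimes,I)$ be a complete and cocomplete symmetric monoidal closed category with small hom-sets. A small category is *sifted* if colimits indexed by it commute in $\mathbf{Set}$ with finite products; sifted colimits are colimits indexed by such categories. An object $X$ of an ordinary category $\mathcal C$ is *strongly finitely presentable* in $\mathcal C$ if $\mathcal C(X,-):\mathcal C\to\mathbf{Set}$ preserves sifted colimits. An object $X$ of a $\mathcal V$-category $\mathcal K$ is *strongly finitely presentable* in $\mathcal K$ if the $\mathcal V$-functor $\mathcal K(X,-):\mathcal K\to\mathcal V$ preserves (conical) sifted colimits; write $\mathcal V_{sf}$ for the full subcategory of $\mathcal V$, regarded as a $\mathcal V$-category, on the objects that are strongly finitely presentable in this sense. Suppose that $\mathcal V$ is *locally strongly finitely presentable as a $\otimes$-category*: there is a small set of strongly finitely presentable objects of the ordinary category $\mathcal V_0$ such that every object of $\mathcal V_0$ is a sifted colimit of objects from this set, and whenever $X$ and $Y$ are strongly finitely presentable in $\mathcal V_0$, so is $X\otimes Y$ (the unit $I$ is not assumed to be strongly finitely presentable). A weight is a $\mathcal V$-functor $F:\mathcal A^{\mathrm{op}}\to\mathcal V$ with $\mathcal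 A$ a small $\mathcal V$-category, and $\{F,S\}$ and $F*R$ denote $F$-weighted limits and colimits. Let $\Phi$ be the *saturation* of the class of weights for finite products and for powers by objects of $\mathcal V_{sf}$: the smallest class of weights that contains these and the representable weights, and that contains the colimit $F*S\in[\mathcal A^{\mathrm{op}},\mathcal V]$ whenever it contains $F:\mathcal D^{\mathrm{op}}\to\mathcal V$ and every value of $S:\mathcal D\to[\mathcal A^{\mathrm{op}},\mathcal V]$. A weight $H:\mathcal B^{\mathrm{op}}\to\mathcal V$ is *$\Phi$-flat* if $H$-weighted colimits commute in $\mathcal V$ with $\Phi$-limits, that is, if $H*-:[\mathcal B,\mathcal V]\to\mathcal V$ preserves all limits with weight in $\Phi$. An object $X$ of a $\mathcal V$-category $\mathcal M$ is *$\Phi$-presentable* if $\mathcal M(X,-):\mathcal M\to\mathcal V$ preserves colimits with $\Phi$-flat weight. A $\mathcal V$-category is *cocomplete* if it has all small weighted colimits. A $\mathcal V$-category $\mathcal M$ is *locally strongly finitely presentable* (respectively *locally $\Phi$-presentable*) if it is cocomplete and has a small full subcategory $\mathcal G$ consisting of strongly finitely presentable (respectively $\Phi$-presentable) objects such that every object of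 $\mathcal M$ is a sifted (respectively $\Phi$-flat) colimit of objects in $\mathcal G$. Then for every $\mathcal V$-category $\mathcal M$ the following are equivalent: 1. $\mathcal M$ is locally strongly finitely presentable; 2. $\mathcal M$ is locally $\Phi$-presentable; 3. there is a small $\mathcal V$-category $\mathcal T$ with finite products and $\mathcal V_{sf}$-powers such that $\mathcal M$ is equivalent, as a $\mathcal V$-category, to the full subcategory of $[\mathcal T,\mathcal V]$ consisting of the $\mathcal V$-functors $\mathcal T\to\mathcal V$ that preserve finite products and $\mathcal V_{sf}$-powers. -/

import Mathlib

open CategoryTheory MonoidalCategory Limits Opposite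
open scoped CategoryTheory.MonoidalClosed

universe v u w w'

noncomputable section

namespace EnrichedLSFP

section Tensor
variable {V : Type u} [Category.{v} V] [MonoidalCategory V]

lemma comp_tensor_eq {P Q R S T : V} (x : P ⟶ Q) (y : Q ⟶ S) (z : R ⟶ T) :
    ((x ≫ y) ⊗ₘ z) = x ▷ R ≫ (y ⊗ₘ z) := by
  rw [← tensorHom_id, tensorHom_comp_tensorHom, Category.id_comp]

lemma tensor_comp_eq {P Q R S T : V} (x : P ⟶ T) (y : R ⟶ Q) (z : Q ⟶ S) :
    (x ⊗ₘ (y ≫ z)) = P ◁ y ≫ (x ⊗ₘ z) := by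
  rw [← id_tensorHom, tensorHom_comp_tensorHom, Category.id_comp]

lemma comp_tensor_eq' {P Q R S T : V} (x : P ⟶ Q) (y : Q ⟶ S) (z : R ⟶ T) :
    ((x ≫ y) ⊗ₘ z) = (x ⊗ₘ z) ≫ y ▷ T := by
  rw [← tensorHom_id, tensorHom_comp_tensorHom, Category.comp_id]

lemma tensor_comp_eq' {P Q R S T : V} (x : P ⟶ T) (y : R ⟶ Q) (z : Q ⟶ S) :
    (x ⊗ₘ (y ≫ z)) = (x ⊗ₘ y) ≫ T ◁ z := by
  rw [← id_tensorHom, tensorHom_comp_tensorHom, Category.comp_id]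

lemma comp_tensor_eq_assoc {P Q R S T U : V} (x : P ⟶ Q) (y : Q ⟶ S) (z : R ⟶ T)
    (w : S ⊗ T ⟶ U) : ((x ≫ y) ⊗ₘ z) ≫ w = x ▷ R ≫ (y ⊗ₘ z) ≫ w := by
  rw [comp_tensor_eq, Category.assoc]

lemma tensor_comp_eq_assoc {P Q R S T U : V} (x : P ⟶ T) (y : R ⟶ Q) (z : Q ⟶ S)
    (w : T ⊗ S ⟶ U) : (x ⊗ₘ (y ≫ z)) ≫ w = P ◁ y ≫ (x ⊗ₘ z) ≫ w := by
  rw [tensor_comp_eq, Category.assoc]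

variable {K : Type w} [EnrichedCategory V K]

lemma comp_assoc' {x y z t : K} {P Q R : V} (f : P ⟶ (x ⟶[V] y)) (g : Q ⟶ (y ⟶[V] z))
    (h : R ⟶ (z ⟶[V] t)) :
    (f ⊗ₘ ((g ⊗ₘ h) ≫ eComp V y z t)) ≫ eComp V x y t =
      (α_ P Q R).inv ≫ (((f ⊗ₘ g) ≫ eComp V x y z) ⊗ₘ h) ≫ eComp V x z t := by
  rw [tensor_comp_eq', comp_tensor_eq', Category.assoc, Category.assoc, ← e_assoc,
    associator_inv_naturality_assoc]

end Tensor

section Action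

variable {V : Type u} [Category.{v} V] [MonoidalCategory V] [MonoidalClosed V]
variable {K : Type w} [EnrichedCategory V K]

lemma uncurry_eId_self (X : V) :
    MonoidalClosed.uncurry (eId V X : 𝟙_ V ⟶ (ihom X).obj X) = (ρ_ X).hom := by
  rw [MonoidalClosed.enrichedCategorySelf_id, MonoidalClosed.id_eq, MonoidalClosed.uncurry_curry]

lemma uncurry_comp_self {X Y Z A B : V} (f : A ⟶ (ihom X).obj Y) (g : B ⟶ (ihom Y).obj Z) :
    MonoidalClosed.uncurry ((f ⊗ₘ g) ≫ (eComp V X Y Z : _ ⟶ (ihom X).obj Z)) =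
      (α_ X A B).inv ≫ MonoidalClosed.uncurry f ▷ B ≫ MonoidalClosed.uncurry g := by
  rw [MonoidalClosed.uncurry_natural_left, MonoidalClosed.enrichedCategorySelf_comp,
    MonoidalClosed.comp_eq, MonoidalClosed.uncurry_curry, MonoidalClosed.compTranspose_eq,
    MonoidalClosed.uncurry_eq f, MonoidalClosed.uncurry_eq g]
  simp only [MonoidalCategory.tensorHom_def, MonoidalCategory.whiskerLeft_comp, Category.assoc,
    comp_whiskerRight]
  simp only [associator_inv_naturality_right_assoc, whisker_exchange_assoc,
    associator_inv_naturality_middle_assoc]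
  rfl

/-- The action `F a ⊗ A(a,b) ⟶ F b` of a `V`-functor `F : A ⟶ V`: the transpose of
`F : A(a,b) ⟶ [F a, F b]`. -/
def act (F : EnrichedFunctor V K V) (a b : K) : F.obj a ⊗ (a ⟶[V] b) ⟶ F.obj b :=
  MonoidalClosed.uncurry (F.map a b : (a ⟶[V] b) ⟶ (ihom (F.obj a)).obj (F.obj b))

/-- A `V`-functor into `V` from its (unital, associative) action maps. -/
def ofAction (obj : K → V) (m : ∀ a b, obj a ⊗ (a ⟶[V] b) ⟶ obj b)
    (m_id : ∀ a, obj a ◁ eId V a ≫ m a a = (ρ_ _).hom)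
    (m_comp : ∀ a b c, obj a ◁ eComp V a b c ≫ m a c =
      (α_ _ _ _).inv ≫ m a b ▷ _ ≫ m b c) : EnrichedFunctor V K V where
  obj := obj
  map a b := (MonoidalClosed.curry (m a b) : (a ⟶[V] b) ⟶ (ihom (obj a)).obj (obj b))
  map_id a := by
    apply MonoidalClosed.uncurry_injective
    rw [uncurry_eId_self, MonoidalClosed.uncurry_natural_left, MonoidalClosed.uncurry_curry, m_id]
  map_comp a b c := by
    apply MonoidalClosed.uncurry_injective
    rw [uncurry_comp_self, MonoidalClosed.uncurry_natural_left, MonoidalClosed.uncurry_curry,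
      MonoidalClosed.uncurry_curry, MonoidalClosed.uncurry_curry, m_comp]

/-- The representable `V`-functor `K(X,-) : K ⟶ V`. -/
def homFunctor (X : K) : EnrichedFunctor V K V :=
  ofAction (fun Y => X ⟶[V] Y) (fun Y Z => eComp V X Y Z)
    (fun Y => by
      have := e_comp_id V X Y
      rw [Iso.inv_comp_eq] at this
      simpa using this)
    (fun Y Z T => (e_assoc V X Y Z T).symm)

end Action

section NatHom
variable {V : Type u} [Category.{v} V] [MonoidalCategory V] [SymmetricCategory V]
   [MonoidalClosed V]
variable {A : Type w'} [EnrichedCategory V A] {K : Type w} [EnrichedCategory V K]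

variable (F G : EnrichedFunctor V A K)

/-- A `W`-indexed `V`-natural family: morphisms `W ⟶ K(F a, G a)`, `V`-natural in `a`. These
are the morphisms from `W` into the end `∫ₐ K(F a, G a)`. -/
structure NatFamily (W : V) where
  app : ∀ a, W ⟶ (F.obj a ⟶[V] G.obj a)
  natural : ∀ a b : A,
    (F.map a b ⊗ₘ app b) ≫ eComp V (F.obj a) (F.obj b) (G.obj b) =
      (β_ (a ⟶[V] b) W).hom ≫ (app a ⊗ₘ G.map a b) ≫ eComp V (F.obj a) (G.obj a) (G.obj b)

end NatHom

section FunctorCategory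
variable {V : Type u} [Category.{v} V] [MonoidalCategory V] [SymmetricCategory V]
   [MonoidalClosed V] [HasLimits V]
variable {A : Type v} [EnrichedCategory V A] {K : Type w} [EnrichedCategory V K]
variable (F G : EnrichedFunctor V A K)

/-- The first of the two maps whose equalizer is `∫ₐ K(F a, G a)`. -/
def natHomLeft : (∏ᶜ fun a : A => (F.obj a ⟶[V] G.obj a)) ⟶
    ∏ᶜ fun p : A × A => (ihom (p.1 ⟶[V] p.2)).obj (F.obj p.1 ⟶[V] G.obj p.2) :=
  Pi.lift fun p => MonoidalClosed.curry
    ((F.map p.1 p.2 ⊗ₘ Pi.π _ p.2) ≫ eComp V (F.obj p.1) (F.obj p.2) (G.obj p.2))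

/-- The second of the two maps whose equalizer is `∫ₐ K(F a, G a)`. -/
def natHomRight : (∏ᶜ fun a : A => (F.obj a ⟶[V] G.obj a)) ⟶
    ∏ᶜ fun p : A × A => (ihom (p.1 ⟶[V] p.2)).obj (F.obj p.1 ⟶[V] G.obj p.2) :=
  Pi.lift fun p => MonoidalClosed.curry
    ((β_ _ _).hom ≫ (Pi.π _ p.1 ⊗ₘ G.map p.1 p.2) ≫
      eComp V (F.obj p.1) (G.obj p.1) (G.obj p.2))

/-- The hom-object `[A,K](F,G) = ∫ₐ K(F a, G a)` of `V`-natural transformations. -/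
def natHom : V := equalizer (natHomLeft F G) (natHomRight F G)

/-- The inclusion of the end in the product. -/
def natHomι : natHom F G ⟶ ∏ᶜ fun a : A => (F.obj a ⟶[V] G.obj a) :=
  equalizer.ι (natHomLeft F G) (natHomRight F G)

/-- The universal `V`-natural family. -/
def natHomFamily : NatFamily F G (natHom F G) where
  app a := natHomι F G ≫ Pi.π _ a
  natural a b := by
    have h := equalizer.condition (natHomLeft F G) (natHomRight F G) =≫ Pi.π _ (a, b)
    simp only [natHomLeft, natHomRight, Category.assoc, Pi.lift_π] at h
    have h' := congrArg MonoidalClosed.uncurry h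
    rw [MonoidalClosed.uncurry_natural_left, MonoidalClosed.uncurry_natural_left,
      MonoidalClosed.uncurry_curry, MonoidalClosed.uncurry_curry,
      BraidedCategory.braiding_naturality_right_assoc] at h'
    simp only [← id_tensorHom, ← tensorHom_id, tensorHom_comp_tensorHom_assoc, Category.id_comp]
      at h'
    exact h'

variable {F G}

lemma natHom_ext {W : V} {f g : W ⟶ natHom F G}
    (h : ∀ a, f ≫ (natHomFamily F G).app a = g ≫ (natHomFamily F G).app a) : f = g := by
  apply equalizer.hom_ext
  change f ≫ natHomι F G = g ≫ natHomι F G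
  apply Pi.hom_ext
  intro a
  simpa only [natHomFamily, Category.assoc] using h a

/-- The morphism into the end given by a `V`-natural family. -/
def natHomLift {W : V} (t : NatFamily F G W) : W ⟶ natHom F G :=
  equalizer.lift (Pi.lift t.app) (by
    apply Pi.hom_ext
    rintro ⟨a, b⟩
    simp only [natHomLeft, natHomRight, Category.assoc, Pi.lift_π]
    apply MonoidalClosed.uncurry_injective
    rw [MonoidalClosed.uncurry_natural_left, MonoidalClosed.uncurry_natural_left,
      MonoidalClosed.uncurry_curry, MonoidalClosed.uncurry_curry,
      BraidedCategory.braiding_naturality_right_assoc]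
    simp only [← id_tensorHom, ← tensorHom_id, tensorHom_comp_tensorHom_assoc, Category.id_comp,
      Pi.lift_π]
    exact t.natural a b)

lemma natHomLift_app {W : V} (t : NatFamily F G W) (a : A) :
    natHomLift t ≫ (natHomFamily F G).app a = t.app a := by
  have h : natHomLift t ≫ natHomι F G = Pi.lift t.app := equalizer.lift_ι _ _
  simp only [natHomFamily]
  rw [reassoc_of% h, Pi.lift_π]

variable (F) in
/-- The family of identities. -/
def idFamily : NatFamily F F (𝟙_ V) where
  app a := eId V (F.obj a)
  natural a b := by
    have h1 := e_id_comp V (F.obj a) (F.obj b)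
    have h2 := e_comp_id V (F.obj a) (F.obj b)
    rw [Iso.inv_comp_eq, Category.comp_id] at h1 h2
    rw [MonoidalCategory.tensorHom_def, Category.assoc, h2, MonoidalCategory.tensorHom_def',
      Category.assoc, h1]
    simp

variable (F G) in
/-- Componentwise composition. -/
def compFamily (H : EnrichedFunctor V A K) : NatFamily F H (natHom F G ⊗ natHom G H) where
  app a := ((natHomFamily F G).app a ⊗ₘ (natHomFamily G H).app a) ≫ eComp V _ _ _
  natural a b := by
    rw [comp_assoc', (natHomFamily F G).natural]
    have h3 := comp_assoc' ((natHomFamily F G).app a) (G.map a b) ((natHomFamily G H).app b)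
    rw [eq_comm, Iso.inv_comp_eq] at h3
    rw [comp_tensor_eq, Category.assoc, h3, (natHomFamily G H).natural, tensor_comp_eq, Category.assoc, comp_assoc',
      BraidedCategory.braiding_tensor_right_hom]
    simp only [Category.assoc]

/-- The `V`-functor category `[A,K]`, for `A` small. -/
instance functorCategory : EnrichedCategory V (EnrichedFunctor V A K) where
  Hom F G := natHom F G
  id F := natHomLift (idFamily F)
  comp F G H := natHomLift (compFamily F G H)
  id_comp F G := by
    apply natHom_ext
    intro a
    simp only [Category.assoc, natHomLift_app, compFamily, Category.id_comp]
    rw [← comp_tensor_eq_assoc, natHomLift_app]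
    simp only [idFamily]
    rw [MonoidalCategory.tensorHom_def', Category.assoc,
      ← leftUnitor_inv_naturality_assoc, e_id_comp, Category.comp_id]
  comp_id F G := by
    apply natHom_ext
    intro a
    simp only [Category.assoc, natHomLift_app, compFamily, Category.id_comp]
    rw [← tensor_comp_eq_assoc, natHomLift_app]
    simp only [idFamily]
    rw [MonoidalCategory.tensorHom_def, Category.assoc,
      ← rightUnitor_inv_naturality_assoc, e_comp_id, Category.comp_id]
  assoc F G H L := by
    apply natHom_ext
    intro a
    simp only [Category.assoc, natHomLift_app, compFamily]
    rw [← comp_tensor_eq_assoc, ← tensor_comp_eq_assoc, natHomLift_app, natHomLift_app]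
    rw [comp_assoc']

/-- The effect on homs of evaluation at `a`. -/
def evalMap (F G : EnrichedFunctor V A K) (a : A) : (F ⟶[V] G) ⟶ (F.obj a ⟶[V] G.obj a) :=
  (natHomFamily F G).app a

lemma evalMap_natural (F G : EnrichedFunctor V A K) (a b : A) :
    (F.map a b ⊗ₘ evalMap F G b) ≫ eComp V (F.obj a) (F.obj b) (G.obj b) =
      (β_ (a ⟶[V] b) (F ⟶[V] G)).hom ≫ (evalMap F G a ⊗ₘ G.map a b) ≫
        eComp V (F.obj a) (G.obj a) (G.obj b) :=
  (natHomFamily F G).natural a b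

lemma eId_evalMap (F : EnrichedFunctor V A K) (a : A) :
    eId V F ≫ evalMap F F a = eId V (F.obj a) :=
  natHomLift_app (idFamily F) a

lemma eComp_evalMap (F G H : EnrichedFunctor V A K) (a : A) :
    eComp V F G H ≫ evalMap F H a =
      (evalMap F G a ⊗ₘ evalMap G H a) ≫ eComp V (F.obj a) (G.obj a) (H.obj a) :=
  natHomLift_app (compFamily F G H) a

end FunctorCategory

section Weighted

variable {V : Type u} [Category.{v} V] [MonoidalCategory V] [MonoidalClosed V]
variable {D : Type w'} [EnrichedCategory V D] {K : Type w} [EnrichedCategory V K]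

/-- A `V`-natural transformation `F ⟶ K(X, S-)`, that is, an `F`-weighted cone over `S` with
vertex `X`. -/
structure WeightedCone (F : EnrichedFunctor V D V) (S : EnrichedFunctor V D K) (X : K) where
  leg : ∀ a, F.obj a ⟶ (X ⟶[V] S.obj a)
  natural : ∀ a b,
    (leg a ⊗ₘ S.map a b) ≫ eComp V X (S.obj a) (S.obj b) = act F a b ≫ leg b

/-- A morphism `W ⟶ [D,V](F, K(X, S-))`, in transposed form: a family of morphisms
`W ⊗ F a ⟶ K(X, S a)` which is `V`-natural in `a`. -/
structure ParamCone (F : EnrichedFunctor V D V) (S : EnrichedFunctor V D K) (W : V)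
    (X : K) where
  leg : ∀ a, W ⊗ F.obj a ⟶ (X ⟶[V] S.obj a)
  natural : ∀ a b,
    (leg a ⊗ₘ S.map a b) ≫ eComp V X (S.obj a) (S.obj b) =
      (α_ _ _ _).hom ≫ W ◁ act F a b ≫ leg b

/-- The cone exhibits `L` as the weighted limit `{F,S}`: composition with it is an isomorphism
`K(X,L) ≅ [D,V](F, K(X, S-))` in `V` for every `X`, which is expressed through the generalized
elements `W ⟶ K(X,L)`. -/
def WeightedCone.IsLimit {F : EnrichedFunctor V D V} {S : EnrichedFunctor V D K} {L : K}
    (c : WeightedCone F S L) : Prop :=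
  ∀ (W : V) (X : K) (t : ParamCone F S W X), ∃! f : W ⟶ (X ⟶[V] L),
    ∀ a, (f ⊗ₘ c.leg a) ≫ eComp V X L (S.obj a) = t.leg a

/-- The image of a weighted cone under a `V`-functor. -/
def WeightedCone.map {F : EnrichedFunctor V D V} {S : EnrichedFunctor V D K} {L : K}
    (c : WeightedCone F S L) {K' : Type*} [EnrichedCategory V K'] (P : EnrichedFunctor V K K') :
    WeightedCone F (S.comp V P) (P.obj L) where
  leg a := c.leg a ≫ P.map L (S.obj a)
  natural a b := by
    have h := c.natural a b =≫ P.map L (S.obj b)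
    rw [Category.assoc, P.map_comp, tensorHom_comp_tensorHom_assoc, Category.assoc] at h
    exact h

end Weighted

section WeightedColimit

variable {V : Type u} [Category.{v} V] [MonoidalCategory V] [SymmetricCategory V]
  [MonoidalClosed V]
variable {A : Type w'} [EnrichedCategory V A] {K : Type w} [EnrichedCategory V K]

/-- The action `A(a,b) ⊗ F b ⟶ F a` of a presheaf `F` on `A`. -/
def lact (F : EnrichedFunctor V Aᵒᵖ V) (a b : A) :
    (a ⟶[V] b) ⊗ F.obj (op b) ⟶ F.obj (op a) :=
  (β_ _ _).hom ≫ act F (op b) (op a)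

/-- A `V`-natural transformation `F ⟶ K(R-, X)`, that is, an `F`-weighted cocone under `R` with
vertex `X`. -/
structure WeightedCocone (F : EnrichedFunctor V Aᵒᵖ V) (R : EnrichedFunctor V A K) (X : K) where
  leg : ∀ a, F.obj (op a) ⟶ (R.obj a ⟶[V] X)
  natural : ∀ a b,
    (R.map a b ⊗ₘ leg b) ≫ eComp V (R.obj a) (R.obj b) X = lact F a b ≫ leg a

/-- A morphism `W ⟶ [Aᵒᵖ,V](F, K(R-, X))`, in transposed form: a family of morphisms
`F a ⊗ W ⟶ K(R a, X)` which is `V`-natural in `a`. -/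
structure ParamCocone (F : EnrichedFunctor V Aᵒᵖ V) (R : EnrichedFunctor V A K) (W : V)
    (X : K) where
  leg : ∀ a, F.obj (op a) ⊗ W ⟶ (R.obj a ⟶[V] X)
  natural : ∀ a b,
    (R.map a b ⊗ₘ leg b) ≫ eComp V (R.obj a) (R.obj b) X =
      (α_ _ _ _).inv ≫ lact F a b ▷ W ≫ leg a

/-- The cocone exhibits `C` as the weighted colimit `F * R`: composition with it is an
isomorphism `K(C,X) ≅ [Aᵒᵖ,V](F, K(R-, X))` in `V` for every `X`, which is expressed through the
generalized elements `W ⟶ K(C,X)`. -/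
def WeightedCocone.IsColimit {F : EnrichedFunctor V Aᵒᵖ V} {R : EnrichedFunctor V A K} {C : K}
    (c : WeightedCocone F R C) : Prop :=
  ∀ (W : V) (X : K) (t : ParamCocone F R W X), ∃! f : W ⟶ (C ⟶[V] X),
    ∀ a, (c.leg a ⊗ₘ f) ≫ eComp V (R.obj a) C X = t.leg a

/-- The image of a weighted cocone under a `V`-functor. -/
def WeightedCocone.map {F : EnrichedFunctor V Aᵒᵖ V} {R : EnrichedFunctor V A K} {C : K}
    (c : WeightedCocone F R C) {K' : Type*} [EnrichedCategory V K']
    (P : EnrichedFunctor V K K') : WeightedCocone F (R.comp V P) (P.obj C) where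
  leg a := c.leg a ≫ P.map (R.obj a) C
  natural a b := by
    have h := c.natural a b =≫ P.map (R.obj a) C
    rw [Category.assoc, P.map_comp, tensorHom_comp_tensorHom_assoc, Category.assoc] at h
    exact h

/-- The family obtained by composing a cocone with `f : W ⟶ K(C,X)`. -/
def WeightedCocone.param {F : EnrichedFunctor V Aᵒᵖ V} {R : EnrichedFunctor V A K} {C : K}
    (c : WeightedCocone F R C) {W : V} {X : K} (f : W ⟶ (C ⟶[V] X)) : ParamCocone F R W X where
  leg a := (c.leg a ⊗ₘ f) ≫ eComp V (R.obj a) C X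
  natural a b := by
    rw [comp_assoc', c.natural, comp_tensor_eq, Category.assoc]

lemma WeightedCocone.IsColimit.hom_ext {F : EnrichedFunctor V Aᵒᵖ V}
    {R : EnrichedFunctor V A K} {C : K} {c : WeightedCocone F R C} (hc : c.IsColimit)
    {W : V} {X : K} {f g : W ⟶ (C ⟶[V] X)}
    (h : ∀ a, (c.leg a ⊗ₘ f) ≫ eComp V (R.obj a) C X = (c.leg a ⊗ₘ g) ≫ eComp V (R.obj a) C X) :
    f = g :=
  (hc W X (c.param g)).unique h (fun _ => rfl)

end WeightedColimit

section ColimFunctor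

variable {V : Type u} [Category.{v} V] [MonoidalCategory V] [SymmetricCategory V]
   [MonoidalClosed V] [HasLimits V]
variable {B : Type v} [EnrichedCategory V B] {K : Type w} [EnrichedCategory V K]
variable (H : EnrichedFunctor V Bᵒᵖ V)

/-- Composing the universal family `[B,K](T,T')` with a cocone under `T'`. -/
def transCocone {T T' : EnrichedFunctor V B K} {C : K} (c : WeightedCocone H T' C) :
    ParamCocone H T (T ⟶[V] T') C where
  leg b := (β_ _ _).hom ≫ (evalMap T T' b ⊗ₘ c.leg b) ≫
    eComp V (T.obj b) (T'.obj b) C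
  natural a b := by
    rw [tensor_comp_eq, Category.assoc, comp_assoc', evalMap_natural, comp_tensor_eq]
    have h3 := comp_assoc' (evalMap T T' a) (T'.map a b) (c.leg b)
    rw [eq_comm, Iso.inv_comp_eq] at h3
    rw [Category.assoc, h3, c.natural, tensor_comp_eq, Category.assoc,
      BraidedCategory.braiding_naturality_left_assoc, BraidedCategory.braiding_tensor_left_hom]
    simp only [Category.assoc, Iso.inv_hom_id_assoc]

variable {H}

/-- The map `[B,K](T,T') ⟶ K(H * T, H * T')` given by the universal property. -/
def colimMap {T T' : EnrichedFunctor V B K} {C C' : K} {c : WeightedCocone H T C}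
    (hc : c.IsColimit) (c' : WeightedCocone H T' C') : (T ⟶[V] T') ⟶ (C ⟶[V] C') :=
  (hc (T ⟶[V] T') _ (transCocone H c')).choose

lemma colimMap_spec {T T' : EnrichedFunctor V B K} {C C' : K} {c : WeightedCocone H T C}
    (hc : c.IsColimit) (c' : WeightedCocone H T' C') (b : B) :
    (c.leg b ⊗ₘ colimMap hc c') ≫ eComp V (T.obj b) C C' =
      (β_ _ _).hom ≫ (evalMap T T' b ⊗ₘ c'.leg b) ≫
        eComp V (T.obj b) (T'.obj b) C' :=
  (hc (T ⟶[V] T') _ (transCocone H c')).choose_spec.1 b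

/-- The `V`-functor `H * - : [B,K] ⟶ K`, given a choice of the `H`-weighted colimits. -/
def colimFunctor (C : EnrichedFunctor V B K → K) (c : ∀ T, WeightedCocone H T (C T))
    (hc : ∀ T, (c T).IsColimit) : EnrichedFunctor V (EnrichedFunctor V B K) K where
  obj := C
  map T T' := colimMap (hc T) (c T')
  map_id T := by
    apply (hc T).hom_ext
    intro b
    have h1 := e_id_comp V (T.obj b) (C T)
    have h2 := e_comp_id V (T.obj b) (C T)
    rw [Iso.inv_comp_eq, Category.comp_id] at h1 h2
    rw [tensor_comp_eq, Category.assoc, colimMap_spec,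
      BraidedCategory.braiding_naturality_right_assoc, ← comp_tensor_eq_assoc, eId_evalMap,
      MonoidalCategory.tensorHom_def', Category.assoc, h1, MonoidalCategory.tensorHom_def,
      Category.assoc, h2]
    simp
  map_comp T T' T'' := by
    apply (hc T).hom_ext
    intro b
    have h4 := comp_assoc' (evalMap T T' b) (evalMap T' T'' b) ((c T'').leg b)
    have h5 := comp_assoc' (evalMap T T' b) ((c T').leg b) (colimMap (hc T') (c T''))
    rw [eq_comm, Iso.inv_comp_eq] at h4 h5
    rw [tensor_comp_eq, Category.assoc, colimMap_spec,
      BraidedCategory.braiding_naturality_right_assoc, ← comp_tensor_eq_assoc, eComp_evalMap,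
      h4, comp_assoc' ((c T).leg b), colimMap_spec, comp_tensor_eq, Category.assoc, h5,
      colimMap_spec, tensor_comp_eq (evalMap T T' b) (β_ _ _).hom, Category.assoc,
      BraidedCategory.braiding_tensor_right_hom]
    simp only [Category.assoc, Iso.inv_hom_id_assoc]

end ColimFunctor

section ColimV

variable {V : Type u} [Category.{v} V] [MonoidalCategory V] [SymmetricCategory V]
   [MonoidalClosed V] [HasColimits V]
variable {B : Type v} [EnrichedCategory V B]
variable (H : EnrichedFunctor V Bᵒᵖ V) (T : EnrichedFunctor V B V)

/-- The first of the two maps whose coequalizer is `∫ᵇ T b ⊗ H b`. -/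
def coendLeft : (∐ fun p : B × B => T.obj p.1 ⊗ ((p.1 ⟶[V] p.2) ⊗ H.obj (op p.2))) ⟶
    ∐ fun b : B => T.obj b ⊗ H.obj (op b) :=
  Sigma.desc fun p => T.obj p.1 ◁ lact H p.1 p.2 ≫
    Sigma.ι (fun b : B => T.obj b ⊗ H.obj (op b)) p.1

/-- The second of the two maps whose coequalizer is `∫ᵇ T b ⊗ H b`. -/
def coendRight : (∐ fun p : B × B => T.obj p.1 ⊗ ((p.1 ⟶[V] p.2) ⊗ H.obj (op p.2))) ⟶
    ∐ fun b : B => T.obj b ⊗ H.obj (op b) :=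
  Sigma.desc fun p => (α_ _ _ _).inv ≫ act T p.1 p.2 ▷ _ ≫
    Sigma.ι (fun b : B => T.obj b ⊗ H.obj (op b)) p.2

/-- The weighted colimit `H * T = ∫ᵇ T b ⊗ H b` in `V`. -/
def coend : V := coequalizer (coendLeft H T) (coendRight H T)

/-- The projection onto the coend. -/
def coendπ : (∐ fun b : B => T.obj b ⊗ H.obj (op b)) ⟶ coend H T :=
  coequalizer.π (coendLeft H T) (coendRight H T)

/-- The coprojections of the coend. -/
def coendι (b : B) : T.obj b ⊗ H.obj (op b) ⟶ coend H T :=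
  Sigma.ι (fun b : B => T.obj b ⊗ H.obj (op b)) b ≫ coendπ H T

lemma coend_condition (a b : B) :
    T.obj a ◁ lact H a b ≫ coendι H T a = (α_ _ _ _).inv ≫ act T a b ▷ _ ≫ coendι H T b := by
  have h := Sigma.ι (fun p : B × B => T.obj p.1 ⊗ ((p.1 ⟶[V] p.2) ⊗ H.obj (op p.2))) (a, b) ≫=
    (show coendLeft H T ≫ coendπ H T = coendRight H T ≫ coendπ H T from
      coequalizer.condition (coendLeft H T) (coendRight H T))
  simpa [coendLeft, coendRight, coendι] using h

variable {H T}

lemma coend_hom_ext {X : V} {f g : coend H T ⟶ X}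
    (h : ∀ b, coendι H T b ≫ f = coendι H T b ≫ g) : f = g := by
  apply coequalizer.hom_ext
  change coendπ H T ≫ f = coendπ H T ≫ g
  apply Sigma.hom_ext
  intro b
  simpa [coendι] using h b

lemma coend_exists_desc {X : V} (t : ∀ b, T.obj b ⊗ H.obj (op b) ⟶ X)
    (ht : ∀ a b, T.obj a ◁ lact H a b ≫ t a = (α_ _ _ _).inv ≫ act T a b ▷ _ ≫ t b) :
    ∃ f : coend H T ⟶ X, ∀ b, coendι H T b ≫ f = t b := by
  have h : coendLeft H T ≫ Sigma.desc t = coendRight H T ≫ Sigma.desc t := by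
    apply Sigma.hom_ext
    rintro ⟨a, b⟩
    simpa [coendLeft, coendRight] using ht a b
  obtain ⟨d, hd⟩ : ∃ d : coend H T ⟶ X, coendπ H T ≫ d = Sigma.desc t :=
    ⟨coequalizer.desc (Sigma.desc t) h, coequalizer.π_desc _ _⟩
  refine ⟨d, fun b => ?_⟩
  rw [coendι, Category.assoc, hd, Sigma.ι_desc]

variable (H T)

/-- The coend as the vertex of an `H`-weighted cocone. -/
def coendCocone : WeightedCocone H T (coend H T) where
  leg b := (MonoidalClosed.curry (coendι H T b) : _ ⟶ (ihom (T.obj b)).obj (coend H T))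
  natural a b := by
    apply MonoidalClosed.uncurry_injective
    rw [uncurry_comp_self, MonoidalClosed.uncurry_natural_left, MonoidalClosed.uncurry_curry,
      MonoidalClosed.uncurry_curry, coend_condition]
    rfl

lemma coendCocone_isColimit : (coendCocone H T).IsColimit := by
  intro W X t
  let s : ∀ b, T.obj b ⊗ H.obj (op b) ⟶ (ihom W).obj X := fun b =>
    MonoidalClosed.curry ((β_ _ _).hom ≫ (α_ _ _ _).hom ≫
      MonoidalClosed.uncurry (t.leg b : _ ⟶ (ihom (T.obj b)).obj X))
  obtain ⟨g, hg⟩ := coend_exists_desc (H := H) (T := T) s (by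
    intro a b
    have h := congrArg MonoidalClosed.uncurry (t.natural a b)
    erw [uncurry_comp_self] at h
    rw [MonoidalClosed.uncurry_natural_left, MonoidalClosed.uncurry_natural_left] at h
    apply MonoidalClosed.uncurry_injective
    simp only [s, MonoidalClosed.uncurry_natural_left, MonoidalClosed.uncurry_curry]
    rw [BraidedCategory.braiding_naturality_right_assoc,
      BraidedCategory.braiding_naturality_right_assoc,
      BraidedCategory.braiding_naturality_right_assoc]
    congr 1
    have h' : T.obj a ◁ lact H a b ▷ W ≫
        MonoidalClosed.uncurry (t.leg a : _ ⟶ (ihom (T.obj a)).obj X) =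
        T.obj a ◁ (α_ _ _ _).hom ≫ (α_ _ _ _).inv ≫ act T a b ▷ _ ≫
          MonoidalClosed.uncurry (t.leg b : _ ⟶ (ihom (T.obj b)).obj X) := by
      change (α_ _ _ _).inv ≫ act T a b ▷ _ ≫ _ = _ at h
      rw [h, ← whiskerLeft_comp_assoc, Iso.hom_inv_id, whiskerLeft_id, Category.id_comp]
    have h'' : (α_ (T.obj a) ((a ⟶[V] b) ⊗ H.obj (op b)) W).hom ≫ T.obj a ◁ (α_ _ _ _).hom ≫
        (α_ _ _ _).inv = (α_ _ _ _).inv ▷ W ≫ (α_ _ _ _).hom := by monoidal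
    simp only [comp_whiskerRight, Category.assoc, whisker_assoc, Iso.inv_hom_id_assoc]
    rw [h', reassoc_of% h'']
    simp only [comp_whiskerRight, Category.assoc, associator_naturality_left_assoc])
  have key : ∀ f : W ⟶ (ihom (coend H T)).obj X,
      (∀ b, ((coendCocone H T).leg b ⊗ₘ f) ≫ eComp V (T.obj b) (coend H T) X = t.leg b) ↔
        MonoidalClosed.curry ((β_ _ _).hom ≫ MonoidalClosed.uncurry f) = g := by
    intro f
    have h1 : ∀ b, ((coendCocone H T).leg b ⊗ₘ f) ≫ eComp V (T.obj b) (coend H T) X = t.leg b ↔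
        (α_ _ _ _).inv ≫ coendι H T b ▷ W ≫ MonoidalClosed.uncurry f =
          MonoidalClosed.uncurry (t.leg b : _ ⟶ (ihom (T.obj b)).obj X) := by
      intro b
      rw [← (MonoidalClosed.uncurry_injective (A := T.obj b)).eq_iff]
      erw [uncurry_comp_self, MonoidalClosed.uncurry_curry]
    have h2 : ∀ b, coendι H T b ≫ MonoidalClosed.curry ((β_ _ _).hom ≫ MonoidalClosed.uncurry f) =
        s b ↔ (α_ _ _ _).inv ≫ coendι H T b ▷ W ≫ MonoidalClosed.uncurry f =
          MonoidalClosed.uncurry (t.leg b : _ ⟶ (ihom (T.obj b)).obj X) := by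
      intro b
      rw [← (MonoidalClosed.uncurry_injective (A := W)).eq_iff,
        MonoidalClosed.uncurry_natural_left, MonoidalClosed.uncurry_curry,
        MonoidalClosed.uncurry_curry, BraidedCategory.braiding_naturality_right_assoc,
        Iso.cancel_iso_hom_left, Iso.inv_comp_eq]
    simp only [h1, ← h2, ← hg]
    exact ⟨fun h => coend_hom_ext h, fun h b => by rw [h]⟩
  refine ⟨(MonoidalClosed.curry ((β_ _ _).hom ≫ MonoidalClosed.uncurry g) :
    W ⟶ (ihom (coend H T)).obj X), (key _).2 (by simp), fun f hf => ?_⟩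
  rw [← (key f).1 hf]
  simp

/-- The `V`-functor `H * - : [B,V] ⟶ V` calculating `H`-weighted colimits in `V`. -/
def weightedColimitFunctor [HasLimits V] : EnrichedFunctor V (EnrichedFunctor V B V) V :=
  colimFunctor (coend H) (coendCocone H) (coendCocone_isColimit H)

end ColimV

section FreeDiscrete

/-- The objects of the free `V`-category on the discrete category with object set `ι`. -/
def FreeDiscrete (ι : Type v) : Type v := ι

variable {V : Type u} [Category.{v} V] [MonoidalCategory V] [SymmetricCategory V]
  [MonoidalClosed V] [HasColimits V]
variable {ι : Type v}

open Classical in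
variable (V) in
/-- The hom-objects of the free `V`-category on a discrete category: the unit object `I` on the
diagonal and the initial object off the diagonal. -/
def discHom (i j : FreeDiscrete ι) : V := if i = j then 𝟙_ V else ⊥_ V

lemma discHom_self (i : FreeDiscrete ι) : discHom V i i = 𝟙_ V := if_pos rfl

/-- `X ⊗ Y` is initial if `Y` is. -/
def tensorInitial (X : V) {Y : V} (h : IsInitial Y) : IsInitial (X ⊗ Y) :=
  IsInitial.isInitialObj (tensorLeft X) Y h

/-- `Y ⊗ X` is initial if `Y` is. -/
def initialTensor (X : V) {Y : V} (h : IsInitial Y) : IsInitial (Y ⊗ X) :=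
  (tensorInitial X h).ofIso (β_ X Y)

/-- The hom-objects off the diagonal are initial. -/
def discHomInitial {i j : FreeDiscrete ι} (h : i ≠ j) : IsInitial (discHom V i j) :=
  initialIsInitial.ofIso (eqToIso (if_neg h).symm)

open Classical in
variable (V) in
/-- The canonical map from the hom-objects to `I`: the identity on the diagonal. -/
def discε (i j : FreeDiscrete ι) : discHom V i j ⟶ 𝟙_ V :=
  if h : i = j then eqToHom (if_pos h) else (discHomInitial h).to _

open Classical in
variable (V) in
/-- Composition in the free `V`-category on a discrete category. -/
def discComp (i j k : FreeDiscrete ι) : discHom V i j ⊗ discHom V j k ⟶ discHom V i k :=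
  if h : i = j then discε V i j ▷ _ ≫ (λ_ _).hom ≫ eqToHom (by rw [h])
  else (initialTensor _ (discHomInitial h)).to _

lemma discComp_self (i k : FreeDiscrete ι) : discComp V i i k = discε V i i ▷ _ ≫ (λ_ _).hom := by
  simp [discComp]

lemma discε_self (i : FreeDiscrete ι) : discε V i i = eqToHom (discHom_self i) := dif_pos rfl

lemma discComp_discε (i j k : FreeDiscrete ι) :
    discComp V i j k ≫ discε V i k = (discε V i j ⊗ₘ discε V j k) ≫ (λ_ _).hom := by
  by_cases h : i = j
  · subst h
    rw [discComp_self, MonoidalCategory.tensorHom_def]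
    simp
  · exact (initialTensor _ (discHomInitial h)).hom_ext _ _

variable (V) in
/-- The free `V`-category on the discrete category with object set `ι`. -/
instance freeDiscrete : EnrichedCategory V (FreeDiscrete ι) where
  Hom i j := discHom V i j
  id i := eqToHom (discHom_self i).symm
  comp i j k := discComp V i j k
  id_comp i j := by
    rw [discComp_self, discε_self, ← comp_whiskerRight_assoc]
    simp
  comp_id i j := by
    by_cases h : i = j
    · subst h
      rw [discComp_self, discε_self, whisker_exchange_assoc, leftUnitor_naturality,
        ← rightUnitor_inv_naturality_assoc, unitors_equal, Iso.inv_hom_id_assoc, eqToHom_trans,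
        eqToHom_refl]
    · exact (discHomInitial h).hom_ext _ _
  assoc i j k l := by
    by_cases h : i = j
    · subst h
      rw [discComp_self, discComp_self, whisker_exchange_assoc, leftUnitor_naturality]
      simp
    · exact (initialTensor _ (discHomInitial h)).hom_ext _ _

/-- The weight on the free `V`-category on the discrete category `ι` which is constant at `C`. -/
def constWeight (ι : Type v) (C : V) : EnrichedFunctor V (FreeDiscrete ι)ᵒᵖ V :=
  ofAction (fun _ => C) (fun a b => C ◁ discε V b.unop a.unop ≫ (ρ_ C).hom)
    (fun a => by
      change C ◁ eqToHom (discHom_self (V := V) a.unop).symm ≫ _ = _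
      rw [discε_self, ← MonoidalCategory.whiskerLeft_comp_assoc]
      simp)
    (fun a b c => by
      have h : eComp V a b c ≫ discε V c.unop a.unop =
          (discε V b.unop a.unop ⊗ₘ discε V c.unop b.unop) ≫ (λ_ _).hom := by
        have h1 : eComp V a b c = (β_ _ _).hom ≫ discComp V c.unop b.unop a.unop := rfl
        have h2 := discComp_discε (V := V) c.unop b.unop a.unop
        rw [h1, Category.assoc]
        erw [h2]
        erw [← BraidedCategory.braiding_naturality_assoc]
        rw [braiding_leftUnitor, unitors_equal]
      rw [← MonoidalCategory.whiskerLeft_comp_assoc, h, MonoidalCategory.tensorHom_def]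
      simp
      rfl)

end FreeDiscrete

section Sub

variable {V : Type u} [Category.{v} V] [MonoidalCategory V]
variable {K : Type w} [EnrichedCategory V K]

/-- The objects of the full sub-`V`-category of `K` on the objects satisfying `P`. -/
def FullSub (P : K → Prop) : Type w := {X : K // P X}

/-- The full sub-`V`-category of `K` on the objects satisfying `P`. -/
instance fullSub (P : K → Prop) : EnrichedCategory V (FullSub P) where
  Hom X Y := X.1 ⟶[V] Y.1
  id X := eId V X.1
  comp X Y Z := eComp V X.1 Y.1 Z.1
  id_comp X Y := e_id_comp V X.1 Y.1
  comp_id X Y := e_comp_id V X.1 Y.1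
  assoc W X Y Z := e_assoc V W.1 X.1 Y.1 Z.1

end Sub

section Equiv

variable {V : Type u} [Category.{v} V] [MonoidalCategory V] [SymmetricCategory V]
  [MonoidalClosed V]

/-- Two `V`-functors are `V`-naturally isomorphic: there is a `V`-natural family of morphisms
`I ⟶ K(F a, G a)` all of which are isomorphisms in the underlying category of `K`. -/
def NaturallyIsomorphic {A : Type w'} [EnrichedCategory V A] {K : Type w} [EnrichedCategory V K]
    (F G : EnrichedFunctor V A K) : Prop :=
  ∃ t : NatFamily F G (𝟙_ V), ∀ a, IsIso (ForgetEnrichment.homOf V (t.app a))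

variable (V) in
/-- Equivalence of `V`-categories. -/
def IsEquivalentTo (C : Type w) [EnrichedCategory V C] (D : Type w') [EnrichedCategory V D] :
    Prop :=
  ∃ (E : EnrichedFunctor V C D) (E' : EnrichedFunctor V D C),
    NaturallyIsomorphic (E.comp V E') (EnrichedFunctor.id V C) ∧
      NaturallyIsomorphic (E'.comp V E) (EnrichedFunctor.id V D)

end Equiv

section Conical

variable {V : Type u} [Category.{v} V] [MonoidalCategory V]

/-- A cocone in the underlying ordinary category of `K` is a (conical) colimit in the `V`-category
`K` if every `K(-,Y)` sends it to a limit cone in `V`. -/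
def IsConicalColimit {K : Type w} [EnrichedCategory V K] {J : Type v} [SmallCategory J]
    {D : J ⥤ ForgetEnrichment V K} (c : Cocone D) : Prop :=
  ∀ Y : ForgetEnrichment V K,
    Nonempty (IsLimit (((eHomFunctor V (ForgetEnrichment V K)).flip.obj Y).mapCone c.op))

variable (V) in
/-- `X` is strongly finitely presentable in the `V`-category `K`: the `V`-functor
`K(X,-) : K ⟶ V` preserves sifted colimits. -/
def IsStronglyFinitelyPresentable {K : Type w} [EnrichedCategory V K] (X : K) : Prop :=
  ∀ (J : Type v) [SmallCategory J] [IsSifted J] (D : J ⥤ ForgetEnrichment V K) (c : Cocone D),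
    IsConicalColimit c →
      Nonempty (IsColimit ((eCoyoneda V (ForgetEnrichment.of V X)).mapCocone c))

end Conical

section Base

/-- `X` is strongly finitely presentable in the ordinary category `C`: `C(X,-) : C ⟶ Set`
preserves sifted colimits. -/
def IsSFP₀ {C : Type u} [Category.{v} C] (X : C) : Prop :=
  ∀ (J : Type v) [SmallCategory J] [IsSifted J],
    PreservesColimitsOfShape J (coyoneda.obj (op X))

/-- The (complete and cocomplete) category `V` is locally strongly finitely presentable as a
`⊗`-category: every object of the ordinary category `V` is a sifted colimit of objects from a
small set of strongly finitely presentable objects, and the strongly finitely presentable objects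
of the ordinary category `V` are closed under the tensor product (the unit object need not be
one of them). -/
def IsLocallySFPTensor (V : Type u) [Category.{v} V] [MonoidalCategory V] : Prop :=
  (∃ G : Set V, Small.{v} G ∧ (∀ X ∈ G, IsSFP₀ X) ∧
    ∀ X : V, ∃ (J : Type v) (_ : SmallCategory J) (_ : IsSifted J) (D : J ⥤ V) (c : Cocone D),
      c.pt = X ∧ (∀ j, D.obj j ∈ G) ∧ Nonempty (IsColimit c)) ∧
  ∀ X Y : V, IsSFP₀ X → IsSFP₀ Y → IsSFP₀ (X ⊗ Y)

end Base

section Main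

variable (V : Type u) [Category.{v} V] [MonoidalCategory V] [SymmetricCategory V]
  [MonoidalClosed V]

/-- A class of weights `F : Aᵒᵖ ⟶ V`, with `A` a small `V`-category. -/
def WeightClass := ∀ (A : Type v) [EnrichedCategory V A], EnrichedFunctor V Aᵒᵖ V → Prop

variable {V}

/-- `K` has all limits with weight in `Ψ`. -/
def HasLimitsIn (Ψ : WeightClass V) (K : Type w) [EnrichedCategory V K] : Prop :=
  ∀ (A : Type v) [EnrichedCategory V A] (F : EnrichedFunctor V Aᵒᵖ V), Ψ A F →
    ∀ S : EnrichedFunctor V Aᵒᵖ K, ∃ (L : K) (c : WeightedCone F S L), c.IsLimit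

/-- `P` preserves all limits with weight in `Ψ`. -/
def PreservesLimitsIn (Ψ : WeightClass V) {K : Type w} [EnrichedCategory V K] {K' : Type w'}
    [EnrichedCategory V K'] (P : EnrichedFunctor V K K') : Prop :=
  ∀ (A : Type v) [EnrichedCategory V A] (F : EnrichedFunctor V Aᵒᵖ V), Ψ A F →
    ∀ (S : EnrichedFunctor V Aᵒᵖ K) (L : K) (c : WeightedCone F S L),
      c.IsLimit → (c.map P).IsLimit

variable (V) in
/-- `K` is cocomplete: it has all small weighted colimits. -/
def IsCocomplete (K : Type w) [EnrichedCategory V K] : Prop :=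
  ∀ (A : Type v) [EnrichedCategory V A] (F : EnrichedFunctor V Aᵒᵖ V)
    (R : EnrichedFunctor V A K), ∃ (C : K) (c : WeightedCocone F R C), c.IsColimit

variable (V) in
/-- The weights for finite products and for powers by the objects of `V_sf`, the strongly finitely
presentable objects of the `V`-category `V`. -/
inductive StrongGen [HasColimits V] :
    ∀ (A : Type v) [EnrichedCategory V A], EnrichedFunctor V Aᵒᵖ V → Prop
  | finiteProduct (ι : Type v) [Finite ι] : StrongGen (FreeDiscrete ι) (constWeight ι (𝟙_ V))
  | power (G : V) (hG : IsStronglyFinitelyPresentable V G) :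
      StrongGen (FreeDiscrete PUnit.{v + 1}) (constWeight PUnit.{v + 1} G)

/-- The saturation of a class of weights: the smallest class which contains it and the
representable weights, and which contains the colimit `F * S` in `[Aᵒᵖ,V]` whenever it contains
`F : Dᵒᵖ ⟶ V` and all values of `S : D ⟶ [Aᵒᵖ,V]`. -/
inductive Saturation [HasLimits V] (Ψ : WeightClass V) :
    ∀ (A : Type v) [EnrichedCategory V A], EnrichedFunctor V Aᵒᵖ V → Prop
  | base (A : Type v) [EnrichedCategory V A] (F : EnrichedFunctor V Aᵒᵖ V) (hF : Ψ A F) :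
      Saturation Ψ A F
  | representable (A : Type v) [EnrichedCategory V A] (a : A) :
      Saturation Ψ A (homFunctor (V := V) (op a))
  | colimit (D : Type v) [EnrichedCategory V D] (A : Type v) [EnrichedCategory V A]
      (F : EnrichedFunctor V Dᵒᵖ V) (S : EnrichedFunctor V D (EnrichedFunctor V Aᵒᵖ V))
      (L : EnrichedFunctor V Aᵒᵖ V) (c : WeightedCocone F S L) (hc : c.IsColimit)
      (hF : Saturation Ψ D F) (hS : ∀ d, Saturation Ψ A (S.obj d)) : Saturation Ψ A L

/-- The weight `H` is `Φ`-flat: `H`-weighted colimits commute in `V` with `Φ`-limits, that is,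
`H * - : [B,V] ⟶ V` preserves all limits with weight in `Φ`. -/
def IsFlat [HasLimits V] [HasColimits V] (Φ : WeightClass V) {B : Type v} [EnrichedCategory V B]
    (H : EnrichedFunctor V Bᵒᵖ V) : Prop :=
  PreservesLimitsIn Φ (weightedColimitFunctor H)

/-- `X` is `Φ`-presentable: `M(X,-) : M ⟶ V` preserves `Φ`-flat colimits. -/
def IsPresentable [HasLimits V] [HasColimits V] (Φ : WeightClass V) {M : Type w}
    [EnrichedCategory V M] (X : M) : Prop :=
  ∀ (B : Type v) [EnrichedCategory V B] (H : EnrichedFunctor V Bᵒᵖ V), IsFlat Φ H →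
    ∀ (R : EnrichedFunctor V B M) (C : M) (c : WeightedCocone H R C),
      c.IsColimit → (c.map (homFunctor X)).IsColimit

/-- `M` is locally `Φ`-presentable: it is cocomplete, and there is a small set of `Φ`-presentable
objects such that every object of `M` is a `Φ`-flat colimit of objects from this set. -/
def IsLocallyPresentable [HasLimits V] [HasColimits V] (Φ : WeightClass V) (M : Type w)
    [EnrichedCategory V M] : Prop :=
  IsCocomplete V M ∧ ∃ G : Set M, Small.{v} G ∧ (∀ X ∈ G, IsPresentable Φ X) ∧
    ∀ X : M, ∃ (B : Type v) (_ : EnrichedCategory V B) (H : EnrichedFunctor V Bᵒᵖ V)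
      (R : EnrichedFunctor V B M) (c : WeightedCocone H R X),
      IsFlat Φ H ∧ (∀ b, R.obj b ∈ G) ∧ c.IsColimit

variable (V) in
/-- `M` is locally strongly finitely presentable: it is cocomplete, and there is a small set of
strongly finitely presentable objects such that every object of `M` is a sifted (conical) colimit
of objects from this set. -/
def IsLocallyStronglyFinitelyPresentable (M : Type w) [EnrichedCategory V M] : Prop :=
  IsCocomplete V M ∧ ∃ G : Set M, Small.{v} G ∧
    (∀ X ∈ G, IsStronglyFinitelyPresentable V X) ∧
    ∀ X : M, ∃ (J : Type v) (_ : SmallCategory J) (_ : IsSifted J)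
      (D : J ⥤ ForgetEnrichment V M) (c : Cocone D),
      c.pt = ForgetEnrichment.of V X ∧ (∀ j, ForgetEnrichment.to V (D.obj j) ∈ G) ∧
        IsConicalColimit c

/-- The `V`-category of `Ψ`-continuous `V`-functors `T ⟶ V`, as a full sub-`V`-category of
`[T,V]`. -/
abbrev ContinuousFunctors [HasLimits V] (Ψ : WeightClass V) (T : Type v) [EnrichedCategory V T] :
    Type (max u v) :=
  FullSub (K := EnrichedFunctor V T V) (PreservesLimitsIn Ψ)

end Main

end EnrichedLSFP

end

/-!
Write `Ψ` for the class of weights for finite products and for powers by the objects of `V_sf`, and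
`Φ` for its saturation. The theorem rests on one commutation property: a weight `L` commutes with
sifted colimits if `[B,V](L,-)` preserves the pointwise sifted colimits (`CommutesWithSifted`). The
weights in `Ψ` have this property (`IsSiftedDense.commutesWithSifted_constWeight`), because sifted
colimits in `V` are detected by the functors `V(Z,-)` for `Z` in the given small set, and sifted
colimits of sets commute with finite products. The property passes to the saturation
(`commutesWithSifted_saturation`). Hence the weights of sifted conical colimits are `Φ`-flat
(`IsSiftedDense.isFlat_unitWeight`), and `Φ`-presentable objects are strongly finitely presentable.

The second ingredient concerns a `V`-category `T` with the limits in `Ψ`, and a `V`-functor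
`F : T ⟶ V` that preserves them, called continuous. The category of elements of the underlying
functor of `F` is sifted, as it has finite products up to variance (`isSifted_el`), and `F` is the
conical colimit of the representables over it. This needs no enriched category of elements:
composing with `V(Z,-)`, for `Z` in the given set of generators, and using the power of an object of
`T` by `Z`, the claim reduces to the density of the representables among functors into sets
(`IsSiftedDense.isColim_elements`).

*From `M` to a theory.* Suppose that `M` is cocomplete and that a small family of strongly finitely
presentable objects generates it under colimits; both kinds of local presentability give this. The
strongly finitely presentable objects of `V` form an essentially small class
(`IsLocallySFPTensor.exists_small`): such an `X` need not be a retract of a generator, as the unit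
object need not be strongly finitely presentable, but each canonical map `X ⊗ I k ⟶ X`, for a sifted
cover `I k` of the unit, factors through a generator, and this determines `X` by a small amount of
data. So the given family can be closed under finite coproducts of copowers by objects of `V_sf`
without leaving the small families of strongly finitely presentable objects
(`IsCocomplete.exists_nerveData`). The opposite `T` of the resulting full subcategory has the limits
in `Ψ`, and the nerve sends each object `Y` of `M` to the continuous functor `M(-,Y)` on `T`. As `Y`
is the sifted colimit of its category of elements (`NerveData.conical_mor`), the nerve is fully
faithful (`NerveData.isFF`); as the objects of the family are strongly finitely presentable, the
nerve preserves sifted colimits, and so every continuous functor, being a sifted colimit of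
representables, is in its image (`NerveData.exists_viso_obj`).

*From a theory to `M`.* Let `M` be equivalent to the `V`-category of continuous functors on `T`
(`IsSemantics`). Flat colimits of continuous functors are calculated pointwise
(`IsFlat.preservesLimitsIn`), so the representables are `Φ`-presentable, hence also strongly
finitely presentable, and every object is a sifted colimit of them. It remains to show that `M` is
cocomplete, that is, reflective in `[T,V]` (`IsSemantics.exists_universalArrow`). The first half of
the argument, applied to the cocomplete `V`-category `[T,V]` and the representables, writes every
`V`-functor as a sifted colimit of functors obtained from representables by iterating finite
coproducts of copowers by objects of `V_sf`. Each of these has a representable reflection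
(`IsCopower.hasRepReflection`), which is calculated by the corresponding limit in `T`, and the
reflection of a colimit is the colimit of the reflections.

Conventions: `V`-functors into `V` are handled through their actions `F a ⊗ A(a,b) ⟶ F b`, and
natural transformations between them, with a parameter object `W`, as families `W ⊗ F a ⟶ G a`
(`GNat`); this presents both weighted limits and colimits by one kind of datum.
-/

set_option linter.unusedSectionVars false

noncomputable section

namespace EnrichedLSFP

/-! ### Actions and graded natural transformations -/

section Uncurry

variable {V : Type u} [Category.{v} V] [MonoidalCategory V] [MonoidalClosed V]

/-- The uncurried form of a morphism into a hom-object of the self-enriched category `V`. -/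
def uc {W X Y : V} (f : W ⟶ EnrichedCategory.Hom (V := V) X Y) : X ⊗ W ⟶ Y :=
  MonoidalClosed.uncurry (f : _ ⟶ (ihom X).obj Y)

/-- The curried form of a morphism, as a morphism into a hom-object of the self-enriched
category `V`. -/
def cc {W X Y : V} (f : X ⊗ W ⟶ Y) : W ⟶ EnrichedCategory.Hom (V := V) X Y :=
  (MonoidalClosed.curry f : _ ⟶ (ihom X).obj Y)

@[simp]
lemma uc_cc {W X Y : V} (f : X ⊗ W ⟶ Y) : uc (cc f) = f := MonoidalClosed.uncurry_curry _

@[simp]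
lemma cc_uc {W X Y : V} (f : W ⟶ EnrichedCategory.Hom (V := V) X Y) : cc (uc f) = f :=
  MonoidalClosed.curry_uncurry _

lemma uc_injective {W X Y : V} :
    Function.Injective (uc : (W ⟶ EnrichedCategory.Hom (V := V) X Y) → _) :=
  MonoidalClosed.uncurry_injective

lemma uc_natural_left {W W' X Y : V} (a : W' ⟶ W) (f : W ⟶ EnrichedCategory.Hom (V := V) X Y) :
    uc (a ≫ f) = X ◁ a ≫ uc f :=
  MonoidalClosed.uncurry_natural_left _ _

lemma uc_eId (X : V) : uc (eId V X) = (ρ_ X).hom := uncurry_eId_self X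

lemma uc_comp {X Y Z P Q : V} (f : P ⟶ EnrichedCategory.Hom (V := V) X Y)
    (g : Q ⟶ EnrichedCategory.Hom (V := V) Y Z) :
    uc ((f ⊗ₘ g) ≫ eComp V X Y Z) = (α_ X P Q).inv ≫ uc f ▷ Q ≫ uc g :=
  uncurry_comp_self f g

end Uncurry

section Actions

variable {V : Type u} [Category.{v} V] [MonoidalCategory V] [MonoidalClosed V]
variable {A : Type w'} [EnrichedCategory V A] {K : Type w} [EnrichedCategory V K]

lemma act_eq_uc (F : EnrichedFunctor V A V) (a b : A) : act F a b = uc (F.map a b) := rfl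

lemma act_id (F : EnrichedFunctor V A V) (a : A) :
    F.obj a ◁ eId V a ≫ act F a a = (ρ_ _).hom := by
  rw [act_eq_uc, ← uc_natural_left, F.map_id, uc_eId]

lemma act_comp (F : EnrichedFunctor V A V) (a b c : A) :
    F.obj a ◁ eComp V a b c ≫ act F a c =
      (α_ _ _ _).inv ≫ act F a b ▷ _ ≫ act F b c := by
  rw [act_eq_uc, ← uc_natural_left, F.map_comp, uc_comp]
  rfl

end Actions

section GNat

variable {V : Type u} [Category.{v} V] [MonoidalCategory V] [SymmetricCategory V]
  [MonoidalClosed V]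
variable {A : Type w'} [EnrichedCategory V A] {K : Type w} [EnrichedCategory V K]

/-- A `W`-graded `V`-natural transformation between `V`-functors into `V`: a family of morphisms
`W ⊗ F a ⟶ G a` compatible with the right actions. As `W` stands on the left and the hom-objects
act on the right, no braiding is needed to state this. -/
@[ext]
structure GNat (W : V) (F G : EnrichedFunctor V A V) where
  app : ∀ a, W ⊗ F.obj a ⟶ G.obj a
  natural : ∀ a b, W ◁ act F a b ≫ app b = (α_ _ _ _).inv ≫ app a ▷ _ ≫ act G a b

variable {F G H : EnrichedFunctor V A V} {W W' : V}

/-- Restriction of the grading along a morphism. -/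
@[simps]
def GNat.restrict (φ : GNat W F G) (f : W' ⟶ W) : GNat W' F G where
  app a := f ▷ _ ≫ φ.app a
  natural a b := by
    rw [whisker_exchange_assoc, φ.natural, comp_whiskerRight, Category.assoc,
      associator_inv_naturality_left_assoc]

/-- The uncurried form of a `V`-natural family of morphisms in `V`. -/
@[simps]
def NatFamily.toGNat (t : NatFamily F G W) : GNat W F G where
  app a := (β_ _ _).hom ≫ uc (t.app a)
  natural a b := by
    have h := congrArg uc (t.natural a b)
    rw [uc_comp, uc_natural_left, uc_comp, Iso.inv_comp_eq, ← act_eq_uc, ← act_eq_uc] at h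
    rw [BraidedCategory.braiding_naturality_right_assoc, comp_whiskerRight, Category.assoc, h]
    simp only [BraidedCategory.braiding_tensor_right_hom, Category.assoc, Iso.inv_hom_id_assoc]
    rw [← MonoidalCategory.whiskerLeft_comp_assoc, SymmetricCategory.symmetry]
    simp

/-- The `V`-natural family given by a graded `V`-natural transformation. -/
@[simps]
def GNat.toNatFamily (φ : GNat W F G) : NatFamily F G W where
  app a := cc ((β_ _ _).hom ≫ φ.app a)
  natural a b := by
    apply uc_injective
    rw [uc_comp, uc_natural_left, uc_comp, uc_cc, uc_cc, Iso.inv_comp_eq, ← act_eq_uc,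
      ← act_eq_uc, BraidedCategory.braiding_naturality_left_assoc, φ.natural]
    simp only [BraidedCategory.braiding_tensor_left_hom, Category.assoc, comp_whiskerRight,
      Iso.hom_inv_id_assoc]

end GNat

section NatHom

variable {V : Type u} [Category.{v} V] [MonoidalCategory V] [SymmetricCategory V]
  [MonoidalClosed V] [HasLimits V]
variable {A : Type v} [EnrichedCategory V A]
variable {F G H : EnrichedFunctor V A V} {W W' : V}

variable (F G) in
/-- The universal graded `V`-natural transformation `[A,V](F,G) ⊗ F a ⟶ G a`. -/
def evL : GNat (F ⟶[V] G) F G := (natHomFamily F G).toGNat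

/-- The morphism `W ⟶ [A,V](F,G)` classifying a `W`-graded `V`-natural transformation. -/
def GNat.lift (φ : GNat W F G) : W ⟶ (F ⟶[V] G) := natHomLift φ.toNatFamily

lemma evL_app (f : W ⟶ (F ⟶[V] G)) (a : A) :
    f ▷ _ ≫ (evL F G).app a = (β_ _ _).hom ≫ uc (f ≫ evalMap F G a) := by
  rw [uc_natural_left, evL, NatFamily.toGNat_app,
    BraidedCategory.braiding_naturality_left_assoc]
  rfl

@[simp]
lemma GNat.lift_evL (φ : GNat W F G) (a : A) : φ.lift ▷ _ ≫ (evL F G).app a = φ.app a := by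
  have h : φ.lift ≫ evalMap F G a = φ.toNatFamily.app a := natHomLift_app _ _
  rw [evL_app, h]
  simp

lemma natHom_hom_ext {f g : W ⟶ (F ⟶[V] G)}
    (h : ∀ a, f ▷ _ ≫ (evL F G).app a = g ▷ _ ≫ (evL F G).app a) : f = g := by
  apply natHom_ext
  intro a
  have := h a
  rw [evL_app, evL_app, Iso.cancel_iso_hom_left] at this
  exact uc_injective this

lemma evL_eq (a : A) : (evL F G).app a = (β_ _ _).hom ≫ uc (evalMap F G a) := rfl

lemma eComp_evL (a : A) : eComp V F G H ▷ _ ≫ (evL F H).app a =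
    (β_ _ _).hom ▷ _ ≫ (α_ _ _ _).hom ≫ _ ◁ (evL F G).app a ≫ (evL G H).app a := by
  rw [evL_app, eComp_evalMap, uc_comp, evL_eq, evL_eq,
    BraidedCategory.braiding_naturality_right_assoc, comp_whiskerRight_assoc]
  simp only [← Category.assoc]
  congr 2
  simp [BraidedCategory.braiding_tensor_left_hom, BraidedCategory.braiding_tensor_right_hom]
  rw [← comp_whiskerRight_assoc (β_ (F ⟶[V] G) _).hom, SymmetricCategory.symmetry]
  simp

end NatHom

/-! ### Underlying functors of `V`-functors into `V` -/

section Under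

variable {V : Type u} [Category.{v} V] [MonoidalCategory V] [MonoidalClosed V]
variable {A : Type w'} [EnrichedCategory V A] {K : Type w} [EnrichedCategory V K]

/-- The representable `V`-functor `K(X,-)`, in the reducible form used throughout. -/
@[simps, reducible]
def rep (X : K) : EnrichedFunctor V K V where
  obj Y := X ⟶[V] Y
  map Y Z := cc (eComp V X Y Z)
  map_id Y := (homFunctor (V := V) X).map_id Y
  map_comp Y Z T := (homFunctor (V := V) X).map_comp Y Z T

lemma homFunctor_eq (X : K) : homFunctor (V := V) X = rep X := rfl

/-- Composition of `V`-functors, in the reducible form used throughout. -/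
@[simps, reducible]
def vcomp {L : Type*} [EnrichedCategory V L] (S : EnrichedFunctor V A K)
    (P : EnrichedFunctor V K L) : EnrichedFunctor V A L where
  obj a := P.obj (S.obj a)
  map a b := S.map a b ≫ P.map _ _

lemma act_rep (X Y Z : K) : act (rep (V := V) X) Y Z = eComp V X Y Z := uc_cc _

lemma act_vcomp (S : EnrichedFunctor V A K) (P : EnrichedFunctor V K V) (a b : A) :
    act (vcomp S P) a b = P.obj (S.obj a) ◁ S.map a b ≫ act P (S.obj a) (S.obj b) :=
  uc_natural_left _ _

/-- Composition of arrows in the underlying category of a `V`-category. -/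
def ecomp {X Y Z : K} (f : 𝟙_ V ⟶ (X ⟶[V] Y)) (g : 𝟙_ V ⟶ (Y ⟶[V] Z)) :
    𝟙_ V ⟶ (X ⟶[V] Z) :=
  (λ_ _).inv ≫ (f ⊗ₘ g) ≫ eComp V X Y Z

/-- The effect of a `V`-functor into `V` on an arrow of the underlying category. -/
def fmap (F : EnrichedFunctor V A V) {a b : A} (f : 𝟙_ V ⟶ (a ⟶[V] b)) : F.obj a ⟶ F.obj b :=
  (ρ_ _).inv ≫ F.obj a ◁ f ≫ act F a b

/-- Precomposition with an arrow of the underlying category. -/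
def pre {X Y : K} (f : 𝟙_ V ⟶ (X ⟶[V] Y)) (Z : K) : (Y ⟶[V] Z) ⟶ (X ⟶[V] Z) :=
  (λ_ _).inv ≫ f ▷ _ ≫ eComp V X Y Z

/-- Postcomposition with an arrow of the underlying category. -/
def post (X : K) {Y Z : K} (f : 𝟙_ V ⟶ (Y ⟶[V] Z)) : (X ⟶[V] Y) ⟶ (X ⟶[V] Z) :=
  (ρ_ _).inv ≫ _ ◁ f ≫ eComp V X Y Z

lemma fmap_rep (X : K) {Y Z : K} (f : 𝟙_ V ⟶ (Y ⟶[V] Z)) :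
    fmap (rep (V := V) X) f = post X f := by
  rw [fmap, act_rep]; rfl

lemma act_post (F : EnrichedFunctor V A V) (a : A) {b c : A} (f : 𝟙_ V ⟶ (b ⟶[V] c)) :
    F.obj a ◁ post a f ≫ act F a c = act F a b ≫ fmap F f := by
  rw [post, fmap, MonoidalCategory.whiskerLeft_comp_assoc, MonoidalCategory.whiskerLeft_comp_assoc,
    act_comp, rightUnitor_inv_naturality_assoc, ← whisker_exchange_assoc]
  simp

lemma act_pre (F : EnrichedFunctor V A V) {a b : A} (c : A) (f : 𝟙_ V ⟶ (a ⟶[V] b)) :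
    F.obj a ◁ pre f c ≫ act F a c = fmap F f ▷ _ ≫ act F b c := by
  rw [pre, fmap, MonoidalCategory.whiskerLeft_comp_assoc, MonoidalCategory.whiskerLeft_comp_assoc,
    act_comp, comp_whiskerRight_assoc, comp_whiskerRight_assoc]
  simp

lemma eComp_post (X Y : K) {Z T : K} (f : 𝟙_ V ⟶ (Z ⟶[V] T)) :
    _ ◁ post Y f ≫ eComp V X Y T = eComp V X Y Z ≫ post X f := by
  have := act_post (rep (V := V) X) Y f
  rwa [act_rep, act_rep, fmap_rep] at this

lemma pre_eComp {X Y : K} (Z T : K) (f : 𝟙_ V ⟶ (X ⟶[V] Y)) :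
    pre f Z ▷ _ ≫ eComp V X Z T = eComp V Y Z T ≫ pre f T := by
  rw [pre, pre, comp_whiskerRight_assoc, comp_whiskerRight_assoc, leftUnitor_inv_naturality_assoc,
    whisker_exchange_assoc, ← e_assoc]
  simp [e_assoc']

lemma eComp_pre_mid (X : K) {Y Y' : K} (Z : K) (f : 𝟙_ V ⟶ (Y ⟶[V] Y')) :
    _ ◁ pre f Z ≫ eComp V X Y Z = post X f ▷ _ ≫ eComp V X Y' Z := by
  have := act_pre (rep (V := V) X) Z f
  rwa [act_rep, act_rep, fmap_rep] at this

@[simp]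
lemma fmap_id (F : EnrichedFunctor V A V) (a : A) : fmap F (eId V a) = 𝟙 _ := by
  rw [fmap, act_id, Iso.inv_hom_id]

@[simp]
lemma pre_id (X Y : K) : pre (eId V X) Y = 𝟙 _ := e_id_comp V X Y

@[simp]
lemma post_id (X Y : K) : post X (eId V Y) = 𝟙 _ := e_comp_id V X Y

lemma comp_pre {X Y Z : K} (f : 𝟙_ V ⟶ (X ⟶[V] Y)) (g : 𝟙_ V ⟶ (Y ⟶[V] Z)) :
    g ≫ pre f Z = ecomp f g := by
  rw [pre, leftUnitor_inv_naturality_assoc, ecomp, MonoidalCategory.tensorHom_def',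
    Category.assoc]

lemma comp_post {X Y Z : K} (f : 𝟙_ V ⟶ (X ⟶[V] Y)) (g : 𝟙_ V ⟶ (Y ⟶[V] Z)) :
    f ≫ post X g = ecomp f g := by
  rw [post, rightUnitor_inv_naturality_assoc, ecomp, MonoidalCategory.tensorHom_def,
    Category.assoc, unitors_inv_equal]

lemma fmap_comp (F : EnrichedFunctor V A V) {a b c : A} (f : 𝟙_ V ⟶ (a ⟶[V] b))
    (g : 𝟙_ V ⟶ (b ⟶[V] c)) : fmap F (ecomp f g) = fmap F f ≫ fmap F g := by
  conv_lhs => rw [fmap, ← comp_pre, MonoidalCategory.whiskerLeft_comp_assoc, act_pre,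
    whisker_exchange_assoc, ← rightUnitor_inv_naturality_assoc]
  rfl

lemma post_comp (X : K) {Y Z T : K} (f : 𝟙_ V ⟶ (Y ⟶[V] Z)) (g : 𝟙_ V ⟶ (Z ⟶[V] T)) :
    post X (ecomp f g) = post X f ≫ post X g := by
  have := fmap_comp (rep (V := V) X) f g
  rwa [fmap_rep, fmap_rep, fmap_rep] at this

lemma pre_comp {X Y Z : K} (T : K) (f : 𝟙_ V ⟶ (X ⟶[V] Y)) (g : 𝟙_ V ⟶ (Y ⟶[V] Z)) :
    pre (ecomp f g) T = pre g T ≫ pre f T := by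
  conv_lhs => rw [pre, ← comp_pre, comp_whiskerRight_assoc, pre_eComp]
  simp [pre]

lemma post_pre {X X' Y Y' : K} (f : 𝟙_ V ⟶ (X ⟶[V] X')) (g : 𝟙_ V ⟶ (Y ⟶[V] Y')) :
    post X' g ≫ pre f Y' = pre f Y ≫ post X g := by
  rw [post, post, Category.assoc, Category.assoc, ← pre_eComp, whisker_exchange_assoc,
    rightUnitor_inv_naturality_assoc]

lemma fmap_vcomp (S : EnrichedFunctor V A K) (P : EnrichedFunctor V K V) {a b : A}
    (f : 𝟙_ V ⟶ (a ⟶[V] b)) : fmap (vcomp S P) f = fmap P (f ≫ S.map a b) := by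
  rw [fmap, act_vcomp, fmap, MonoidalCategory.whiskerLeft_comp_assoc]

lemma ecomp_map (S : EnrichedFunctor V A K) {a b c : A} (f : 𝟙_ V ⟶ (a ⟶[V] b))
    (g : 𝟙_ V ⟶ (b ⟶[V] c)) :
    ecomp f g ≫ S.map a c = ecomp (f ≫ S.map a b) (g ≫ S.map b c) := by
  simp [ecomp]

lemma pre_map (S : EnrichedFunctor V A K) {a b : A} (c : A) (f : 𝟙_ V ⟶ (a ⟶[V] b)) :
    pre f c ≫ S.map a c = S.map b c ≫ pre (f ≫ S.map a b) (S.obj c) := by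
  simp only [pre, Category.assoc, EnrichedFunctor.map_comp, comp_whiskerRight]
  rw [leftUnitor_inv_naturality_assoc, MonoidalCategory.tensorHom_def_assoc,
    whisker_exchange_assoc, whisker_exchange_assoc]

lemma post_map (S : EnrichedFunctor V A K) (a : A) {b c : A} (f : 𝟙_ V ⟶ (b ⟶[V] c)) :
    post a f ≫ S.map a c = S.map a b ≫ post (S.obj a) (f ≫ S.map b c) := by
  simp only [post, Category.assoc, EnrichedFunctor.map_comp, MonoidalCategory.whiskerLeft_comp]
  rw [rightUnitor_inv_naturality_assoc, MonoidalCategory.tensorHom_def'_assoc,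
    whisker_exchange_assoc, whisker_exchange_assoc]

open ForgetEnrichment in
lemma homTo_comp' {X Y Z : ForgetEnrichment V K} (f : X ⟶ Y) (g : Y ⟶ Z) :
    homTo V (f ≫ g) = ecomp (homTo V f) (homTo V g) := by
  rw [homTo_comp, Category.assoc]; rfl

open ForgetEnrichment in
/-- The underlying functor of a `V`-functor into `V`. -/
@[simps]
def under (F : EnrichedFunctor V A V) : ForgetEnrichment V A ⥤ V where
  obj a := F.obj (ForgetEnrichment.to V a)
  map f := fmap F (homTo V f)
  map_id a := by rw [homTo_id, fmap_id]
  map_comp f g := by rw [homTo_comp', fmap_comp]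

end Under

section GNatMaps

variable {V : Type u} [Category.{v} V] [MonoidalCategory V] [SymmetricCategory V]
  [MonoidalClosed V]
variable {A : Type w'} [EnrichedCategory V A] {K : Type w} [EnrichedCategory V K]
variable {F G H : EnrichedFunctor V A V} {W : V}

lemma GNat.fmap_naturality (φ : GNat W F G) {a b : A} (f : 𝟙_ V ⟶ (a ⟶[V] b)) :
    W ◁ fmap F f ≫ φ.app b = φ.app a ≫ fmap G f := by
  rw [fmap, fmap, MonoidalCategory.whiskerLeft_comp_assoc, MonoidalCategory.whiskerLeft_comp_assoc,
    φ.natural, rightUnitor_inv_naturality_assoc, ← whisker_exchange_assoc]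
  simp

/-- The representable transformation with values given by the action on an element. -/
@[simps]
def yonL {t : A} (x : W ⟶ F.obj t) : GNat W (rep t) F where
  app s := x ▷ _ ≫ act F t s
  natural a b := by
    rw [act_rep, whisker_exchange_assoc, act_comp, comp_whiskerRight_assoc,
      associator_inv_naturality_left_assoc]

/-- The Yoneda lemma for graded transformations out of a representable. -/
lemma GNat.eq_yonL {t : A} (φ : GNat W (rep t) F) :
    φ = yonL ((ρ_ _).inv ≫ W ◁ eId V t ≫ φ.app t) := by
  ext s
  have h := φ.natural t s
  rw [act_rep] at h
  have h1 := e_id_comp V t s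
  have h2 : (ρ_ W).inv ▷ (t ⟶[V] s) ≫ (W ◁ eId V t) ▷ _ ≫ (α_ _ _ _).hom ≫
      W ◁ eComp V t t s = 𝟙 _ := by
    rw [associator_naturality_middle_assoc, ← MonoidalCategory.whiskerLeft_comp]
    rw [Iso.inv_comp_eq] at h1
    rw [h1]
    simp
  rw [yonL_app, comp_whiskerRight_assoc, comp_whiskerRight_assoc, ← Category.id_comp (φ.app s),
    ← h2]
  simp only [Category.assoc]
  rw [h]
  simp

lemma yonL_eval {t : A} (x : W ⟶ F.obj t) :
    (ρ_ _).inv ≫ W ◁ eId V t ≫ (yonL x : GNat W (rep t) F).app t = x := by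
  rw [yonL_app, whisker_exchange_assoc, act_id, rightUnitor_naturality, Iso.inv_hom_id_assoc]

end GNatMaps

section Bifunctors

variable {V : Type u} [Category.{v} V] [MonoidalCategory V] [SymmetricCategory V]
  [MonoidalClosed V] [HasLimits V]
variable {A : Type v} [EnrichedCategory V A] {K : Type w} [EnrichedCategory V K]

/-- Evaluation at `a`, as a `V`-functor `[A,K] ⟶ K`. -/
@[simps, reducible]
def evFunctor (K : Type w) [EnrichedCategory V K] (a : A) :
    EnrichedFunctor V (EnrichedFunctor V A K) K where
  obj F := F.obj a
  map F G := evalMap F G a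
  map_id F := eId_evalMap F a
  map_comp F G H := eComp_evalMap F G H a

lemma act_evFunctor (a : A) (F G : EnrichedFunctor V A V) :
    act (evFunctor V a) F G = (β_ _ _).hom ≫ (evL F G).app a := by
  rw [evL_eq, SymmetricCategory.symmetry_assoc]; rfl

lemma fmap_evFunctor (a : A) {F G : EnrichedFunctor V A V} (α : 𝟙_ V ⟶ (F ⟶[V] G)) :
    fmap (evFunctor V a) α = (λ_ _).inv ≫ α ▷ _ ≫ (evL F G).app a := by
  rw [fmap, act_evFunctor, BraidedCategory.braiding_naturality_right_assoc]
  simp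

lemma post_evL (L : EnrichedFunctor V A V) {F G : EnrichedFunctor V A V}
    (α : 𝟙_ V ⟶ (F ⟶[V] G)) (a : A) :
    post L α ▷ _ ≫ (evL L G).app a = (evL L F).app a ≫ fmap (evFunctor V a) α := by
  rw [post, comp_whiskerRight_assoc, comp_whiskerRight_assoc, eComp_evL, fmap_evFunctor,
    ← comp_whiskerRight_assoc (_ ◁ α), BraidedCategory.braiding_naturality_right,
    comp_whiskerRight_assoc, associator_naturality_left_assoc, ← whisker_exchange_assoc,
    leftUnitor_inv_naturality_assoc]
  simp

/-- A `V`-functor `K ⟶ [A,V]` from two commuting actions. -/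
@[reducible]
def ofBiaction (obj : K → EnrichedFunctor V A V)
    (m : ∀ a X Y, (obj X).obj a ⊗ (X ⟶[V] Y) ⟶ (obj Y).obj a)
    (m_id : ∀ a X, (obj X).obj a ◁ eId V X ≫ m a X X = (ρ_ _).hom)
    (m_comp : ∀ a X Y Z, (obj X).obj a ◁ eComp V X Y Z ≫ m a X Z =
      (α_ _ _ _).inv ≫ m a X Y ▷ _ ≫ m a Y Z)
    (comm : ∀ a b X Y, act (obj X) a b ▷ _ ≫ m b X Y = (α_ _ _ _).hom ≫ _ ◁ (β_ _ _).hom ≫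
      (α_ _ _ _).inv ≫ m a X Y ▷ _ ≫ act (obj Y) a b) :
    EnrichedFunctor V K (EnrichedFunctor V A V) where
  obj := obj
  map X Y := natHomLift
    { app a := cc (m a X Y)
      natural a b := by
        apply uc_injective
        rw [uc_comp, uc_natural_left, uc_comp, uc_cc, uc_cc, ← act_eq_uc, ← act_eq_uc, comm]
        simp }
  map_id X := by
    apply natHom_ext
    intro a
    rw [Category.assoc, natHomLift_app]
    apply uc_injective
    have h := eId_evalMap (obj X) a
    refine Eq.trans ?_ (congrArg uc h).symm
    rw [uc_natural_left, uc_cc, m_id, uc_eId]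
  map_comp X Y Z := by
    apply natHom_ext
    intro a
    rw [Category.assoc, natHomLift_app, Category.assoc]
    apply uc_injective
    have h := eComp_evalMap (obj X) (obj Y) (obj Z) a
    refine Eq.trans ?_ (congrArg (fun z => uc (_ ≫ z)) h).symm
    rw [tensorHom_comp_tensorHom_assoc]
    erw [natHomLift_app, natHomLift_app]
    rw [uc_natural_left, uc_cc, uc_comp, uc_cc, uc_cc, m_comp]

variable (obj : K → EnrichedFunctor V A V)
    (m : ∀ a X Y, (obj X).obj a ⊗ (X ⟶[V] Y) ⟶ (obj Y).obj a) (h1 h2 h3)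

lemma ofBiaction_map_evalMap (a : A) (X Y : K) :
    (ofBiaction obj m h1 h2 h3).map X Y ≫ evalMap _ _ a = cc (m a X Y) :=
  natHomLift_app _ _

lemma act_ofBiaction (a : A) (X Y : K) :
    act ((ofBiaction obj m h1 h2 h3).comp V (evFunctor V a)) X Y = m a X Y := by
  rw [act_eq_uc]
  refine Eq.trans (congrArg uc (ofBiaction_map_evalMap obj m h1 h2 h3 a X Y)) (uc_cc _)

end Bifunctors

lemma whiskerLeft_braiding_cancel {V : Type u} [Category.{v} V] [MonoidalCategory V]
    [SymmetricCategory V] (X P Q : V) {Z : V} (h : X ⊗ (P ⊗ Q) ⟶ Z) :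
    X ◁ (β_ P Q).hom ≫ X ◁ (β_ Q P).hom ≫ h = h := by
  rw [← MonoidalCategory.whiskerLeft_comp_assoc, SymmetricCategory.symmetry]
  simp

/-! ### Nerves of `V`-functors -/

section Nerve

variable {V : Type u} [Category.{v} V] [MonoidalCategory V] [SymmetricCategory V]
  [MonoidalClosed V]
variable {A : Type w'} [EnrichedCategory V A] {K : Type w} [EnrichedCategory V K]

/-- The opposite of a `V`-functor. -/
@[simps, reducible]
def opFunctor (R : EnrichedFunctor V A K) : EnrichedFunctor V Aᵒᵖ Kᵒᵖ where
  obj a := op (R.obj a.unop)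
  map a b := R.map b.unop a.unop
  map_id a := R.map_id a.unop
  map_comp a b c := by
    rw [eComp_op_eq, eComp_op_eq, Category.assoc, R.map_comp]
    exact (BraidedCategory.braiding_naturality_assoc _ _ _).symm

/-- The presheaf `K(R-, X)` on `A`. -/
@[simps, reducible]
def nerveObj (R : EnrichedFunctor V A K) (X : K) : EnrichedFunctor V Aᵒᵖ V where
  obj a := R.obj a.unop ⟶[V] X
  map a b := (vcomp (opFunctor R) (rep (op X))).map a b
  map_id a := (vcomp (opFunctor R) (rep (op X))).map_id a
  map_comp a b c := (vcomp (opFunctor R) (rep (op X))).map_comp a b c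

lemma act_nerveObj (R : EnrichedFunctor V A K) (X : K) (a b : Aᵒᵖ) :
    act (nerveObj R X) a b =
      (β_ _ _).hom ≫ R.map b.unop a.unop ▷ _ ≫ eComp V _ _ X := by
  have h := act_vcomp (opFunctor R) (rep (op X)) a b
  rw [act_rep, eComp_op_eq] at h
  exact h.trans (BraidedCategory.braiding_naturality_right_assoc _ _ _)

lemma fmap_nerveObj (R : EnrichedFunctor V A K) (X : K) {a b : A} (f : 𝟙_ V ⟶ (a ⟶[V] b)) :
    fmap (nerveObj R X) (a := op b) (b := op a) f = pre (f ≫ R.map a b) X := by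
  rw [fmap, act_nerveObj, pre, comp_whiskerRight_assoc]
  have h := BraidedCategory.braiding_naturality_right_assoc (R.obj b ⟶[V] X) f
    (R.map a b ▷ _ ≫ eComp V _ _ X)
  refine (congrArg ((ρ_ _).inv ≫ ·) h).trans ?_
  simp

end Nerve

section NerveFunctor

variable {V : Type u} [Category.{v} V] [MonoidalCategory V] [SymmetricCategory V]
  [MonoidalClosed V] [HasLimits V]
variable {A : Type v} [EnrichedCategory V A] {K : Type w} [EnrichedCategory V K]

/-- The `V`-functor `K ⟶ [Aᵒᵖ,V]` sending `X` to `K(R-, X)`. -/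
@[reducible]
def nerve (R : EnrichedFunctor V A K) : EnrichedFunctor V K (EnrichedFunctor V Aᵒᵖ V) :=
  ofBiaction (nerveObj R) (fun a X Y => eComp V (R.obj a.unop) X Y)
    (fun a X => by
      have h := act_id (rep (V := V) (R.obj a.unop)) X
      rwa [act_rep] at h)
    (fun a X Y Z => (e_assoc V (R.obj a.unop) X Y Z).symm)
    (fun a b X Y => by
      rw [act_nerveObj, act_nerveObj]
      have h := comp_assoc' (R.map b.unop a.unop) (𝟙 (R.obj a.unop ⟶[V] X)) (𝟙 (X ⟶[V] Y))
      rw [id_tensorHom_id, Category.id_comp, eq_comm, Iso.inv_comp_eq] at h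
      simp only [tensorHom_id] at h
      rw [comp_whiskerRight_assoc]
      rw [h, MonoidalCategory.tensorHom_def', Category.assoc]
      have h2 := BraidedCategory.braiding_naturality_left_assoc (eComp V (R.obj a.unop) X Y)
        (b.unop ⟶[V] a.unop) (R.map b.unop a.unop ▷ _ ≫ eComp V _ _ Y)
      refine Eq.trans ?_ (congrArg (fun z => (α_ _ _ _).hom ≫ _ ◁ (β_ _ _).hom ≫
        (α_ _ _ _).inv ≫ z) h2).symm
      have h3 : (β_ ((R.obj a.unop ⟶[V] X) ⊗ (X ⟶[V] Y)) (b.unop ⟶[V] a.unop)).hom = _ :=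
        BraidedCategory.braiding_tensor_left_hom _ _ _
      rw [h3]
      change _ = (α_ (R.obj a.unop ⟶[V] X) (b.unop ⟶[V] a.unop) (X ⟶[V] Y)).hom ≫
        (R.obj a.unop ⟶[V] X) ◁ (β_ (b.unop ⟶[V] a.unop) (X ⟶[V] Y)).hom ≫
        (α_ (R.obj a.unop ⟶[V] X) (X ⟶[V] Y) (b.unop ⟶[V] a.unop)).inv ≫ _
      simp only [Category.assoc, Iso.inv_hom_id_assoc]
      rw [whiskerLeft_braiding_cancel, Iso.hom_inv_id_assoc])

lemma act_nerve_ev (R : EnrichedFunctor V A K) (a : A) (X Y : K) :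
    act (vcomp (nerve R) (evFunctor V (op a))) X Y = eComp V (R.obj a) X Y :=
  act_ofBiaction _ _ _ _ _ _ _ _

lemma fmap_nerve_ev (R : EnrichedFunctor V A K) (a : A) {X Y : K} (f : 𝟙_ V ⟶ (X ⟶[V] Y)) :
    fmap (vcomp (nerve R) (evFunctor V (op a))) f = post (R.obj a) f := by
  rw [fmap, act_nerve_ev]; rfl

/-- The `V`-functor `C ⟶ [B,V]` obtained from `R : B ⟶ [C,V]` by exchanging the variables. -/
@[reducible]
def swap {B C : Type v} [EnrichedCategory V B] [EnrichedCategory V C]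
    (R : EnrichedFunctor V B (EnrichedFunctor V C V)) :
    EnrichedFunctor V C (EnrichedFunctor V B V) :=
  ofBiaction (fun t => vcomp R (evFunctor V t)) (fun b t t' => act (R.obj b) t t')
    (fun b t => act_id (R.obj b) t)
    (fun b t t' t'' => act_comp (R.obj b) t t' t'')
    (fun b b' t t' => by
      rw [act_vcomp, act_vcomp, act_evFunctor, act_evFunctor]
      have h1 := ((evL (R.obj b) (R.obj b')).restrict (R.map b b')).natural t t'
      simp only [GNat.restrict_app] at h1
      rw [BraidedCategory.braiding_naturality_right_assoc,
        BraidedCategory.braiding_naturality_right_assoc, comp_whiskerRight_assoc,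
        (Iso.inv_comp_eq _).1 h1.symm, BraidedCategory.braiding_naturality_left_assoc,
        BraidedCategory.braiding_tensor_left_hom]
      simp only [Category.assoc, Iso.inv_hom_id_assoc]
      rw [whiskerLeft_braiding_cancel, Iso.hom_inv_id_assoc])

end NerveFunctor

/-! ### Weighted limits and colimits through graded transformations -/

section ConesGNat

variable {V : Type u} [Category.{v} V] [MonoidalCategory V] [SymmetricCategory V]
  [MonoidalClosed V]
variable {D : Type w'} [EnrichedCategory V D] {K : Type w} [EnrichedCategory V K]

/-- A parametrized cone is a graded transformation into `K(X, S-)`. -/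
@[simps]
def ParamCone.toGNat {F : EnrichedFunctor V D V} {S : EnrichedFunctor V D K} {W : V} {X : K}
    (t : ParamCone F S W X) : GNat W F (vcomp S (rep X)) where
  app := t.leg
  natural a b := by
    rw [act_vcomp, act_rep, Iso.eq_inv_comp, ← t.natural, MonoidalCategory.tensorHom_def]
    simp

/-- A graded transformation into `K(X, S-)` is a parametrized cone. -/
@[simps]
def GNat.toParamCone {F : EnrichedFunctor V D V} {S : EnrichedFunctor V D K} {W : V} {X : K}
    (t : GNat W F (vcomp S (rep X))) : ParamCone F S W X where
  leg := t.app
  natural a b := by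
    have := t.natural a b
    rw [act_vcomp, act_rep, Iso.eq_inv_comp] at this
    rw [this, MonoidalCategory.tensorHom_def]
    simp

lemma WeightedCone.isLimit_iff {F : EnrichedFunctor V D V} {S : EnrichedFunctor V D K} {L : K}
    (c : WeightedCone F S L) : c.IsLimit ↔ ∀ (W : V) (X : K) (t : GNat W F (vcomp S (rep X))),
      ∃! f : W ⟶ (X ⟶[V] L), ∀ a, (f ⊗ₘ c.leg a) ≫ eComp V X L (S.obj a) = t.app a :=
  ⟨fun h W X t => h W X t.toParamCone, fun h W X t => h W X t.toGNat⟩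

lemma braiding_coherence (W P Q : V) :
    (α_ W P Q).inv ≫ (β_ W P).hom ▷ Q ≫ (β_ (P ⊗ W) Q).hom ≫ (α_ Q P W).inv ≫
      (β_ Q P).hom ▷ W = (β_ W (P ⊗ Q)).hom := by
  rw [BraidedCategory.braiding_tensor_left_hom, BraidedCategory.braiding_tensor_right_hom]
  simp only [Category.assoc, Iso.hom_inv_id_assoc]
  rw [← comp_whiskerRight, SymmetricCategory.symmetry]
  simp

/-- The naturality of a cocone, whose parameter stands on the right, is that of the graded
transformation obtained by moving the parameter to the left. -/
lemma natural_cocone_iff {F : EnrichedFunctor V Dᵒᵖ V} {R : EnrichedFunctor V D K} {W : V} {X : K}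
    (leg : ∀ a, F.obj (op a) ⊗ W ⟶ (R.obj a ⟶[V] X)) (a b : D) :
    (R.map a b ⊗ₘ leg b) ≫ eComp V (R.obj a) (R.obj b) X =
      (α_ _ _ _).inv ≫ lact F a b ▷ W ≫ leg a ↔
    W ◁ act F (op b) (op a) ≫ (β_ W (F.obj (op a))).hom ≫ leg a =
      (α_ _ _ _).inv ≫ ((β_ W (F.obj (op b))).hom ≫ leg b) ▷ _ ≫
        act (nerveObj R X) (op b) (op a) := by
  have h1 : W ◁ act F (op b) (op a) ≫ (β_ W (F.obj (op a))).hom ≫ leg a =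
      (α_ W _ (a ⟶[V] b)).inv ≫ (β_ W _).hom ▷ _ ≫ (β_ (F.obj (op b) ⊗ W) (a ⟶[V] b)).hom ≫
        (α_ _ _ _).inv ≫ lact F a b ▷ W ≫ leg a := by
    have h := BraidedCategory.braiding_naturality_right_assoc W (act F (op b) (op a)) (leg a)
    refine h.trans ?_
    have h2 := braiding_coherence W (F.obj (op b)) (a ⟶[V] b)
    refine (congrArg (· ≫ act F (op b) (op a) ▷ W ≫ leg a) h2.symm).trans ?_
    simp [lact]
  have h3 : (α_ _ _ _).inv ≫ ((β_ W (F.obj (op b))).hom ≫ leg b) ▷ _ ≫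
        act (nerveObj R X) (op b) (op a) =
      (α_ W _ (a ⟶[V] b)).inv ≫ (β_ W _).hom ▷ _ ≫ (β_ (F.obj (op b) ⊗ W) (a ⟶[V] b)).hom ≫
        (R.map a b ⊗ₘ leg b) ≫ eComp V (R.obj a) (R.obj b) X := by
    have h := BraidedCategory.braiding_naturality_left_assoc (leg b) (a ⟶[V] b)
      (R.map a b ▷ _ ≫ eComp V (R.obj a) (R.obj b) X)
    rw [act_nerveObj, comp_whiskerRight_assoc, MonoidalCategory.tensorHom_def', Category.assoc]
    exact congrArg (fun z => (α_ W _ (a ⟶[V] b)).inv ≫ (β_ W _).hom ▷ _ ≫ z) h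
  rw [h3, h1, Iso.cancel_iso_inv_left, cancel_epi, Iso.cancel_iso_hom_left]
  exact eq_comm

/-- A parametrized cocone is a graded transformation into `K(R-, X)`. -/
@[simps]
def ParamCocone.toGNat {F : EnrichedFunctor V Dᵒᵖ V} {R : EnrichedFunctor V D K} {W : V} {X : K}
    (t : ParamCocone F R W X) : GNat W F (nerveObj R X) where
  app a := (β_ W (F.obj a)).hom ≫ t.leg a.unop
  natural b a := (natural_cocone_iff t.leg a.unop b.unop).1 (t.natural a.unop b.unop)

/-- A graded transformation into `K(R-, X)` is a parametrized cocone. -/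
@[simps]
def GNat.toParamCocone {F : EnrichedFunctor V Dᵒᵖ V} {R : EnrichedFunctor V D K} {W : V} {X : K}
    (t : GNat W F (nerveObj R X)) : ParamCocone F R W X where
  leg a := (β_ (F.obj (op a)) W).hom ≫ t.app (op a)
  natural a b := by
    refine (natural_cocone_iff (fun a => (β_ (F.obj (op a)) W).hom ≫ t.app (op a)) a b).2 ?_
    rw [SymmetricCategory.symmetry_assoc, SymmetricCategory.symmetry_assoc]
    exact t.natural (op b) (op a)

lemma WeightedCocone.isColimit_iff {F : EnrichedFunctor V Dᵒᵖ V} {R : EnrichedFunctor V D K}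
    {C : K} (c : WeightedCocone F R C) :
    c.IsColimit ↔ ∀ (W : V) (X : K) (t : GNat W F (nerveObj R X)), ∃! f : W ⟶ (C ⟶[V] X),
      ∀ a, (β_ W (F.obj (op a))).hom ≫ (c.leg a ⊗ₘ f) ≫ eComp V (R.obj a) C X = t.app (op a) := by
  constructor
  · intro h W X t
    refine (existsUnique_congr fun f => forall_congr' fun a => ?_).1 (h W X t.toParamCocone)
    rw [GNat.toParamCocone_leg, ← Iso.cancel_iso_hom_left (β_ W (F.obj (op a))),
      SymmetricCategory.symmetry_assoc]
  · intro h W X t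
    refine (existsUnique_congr fun f => forall_congr' fun a => ?_).1 (h W X t.toGNat)
    rw [ParamCocone.toGNat_app, Iso.cancel_iso_hom_left]

/-- A weighted cocone, as an ungraded transformation into `K(R-, C)`. -/
def WeightedCocone.gnat {F : EnrichedFunctor V Dᵒᵖ V} {R : EnrichedFunctor V D K}
    {C : K} (c : WeightedCocone F R C) : GNat (𝟙_ V) F (nerveObj R C) where
  app a := (λ_ _).hom ≫ c.leg a.unop
  natural b a := by
    have h := (natural_cocone_iff (W := 𝟙_ V) (F := F) (R := R) (X := C)
      (fun a => (ρ_ _).hom ≫ c.leg a) a.unop b.unop).1 (by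
        rw [tensor_comp_eq, Category.assoc, c.natural]
        simp)
    simpa only [braiding_rightUnitor_assoc, braiding_leftUnitor_assoc] using h

end ConesGNat

section LimitsInV

variable {V : Type u} [Category.{v} V] [MonoidalCategory V] [SymmetricCategory V]
  [MonoidalClosed V]
variable {D : Type w'} [EnrichedCategory V D] {K : Type w} [EnrichedCategory V K]

lemma isIso_of_existsUnique {X Y : V} (h : X ⟶ Y)
    (H : ∀ (W : V) (y : W ⟶ Y), ∃! x : W ⟶ X, x ≫ h = y) : IsIso h := by
  obtain ⟨g, hg, -⟩ := H Y (𝟙 Y)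
  exact ⟨g, (H X h).unique (by rw [Category.assoc, hg, Category.comp_id]) (Category.id_comp _), hg⟩

variable {L S : EnrichedFunctor V D V} {X : V}

/-- A weighted cone in `V`, as a transformation graded by its vertex. -/
@[simps]
def WeightedCone.gnat (c : WeightedCone L S X) : GNat X L S where
  app a := uc (c.leg a)
  natural a b := by
    rw [← uc_natural_left, ← c.natural, uc_comp]
    rfl

/-- Currying one factor of the grading object. -/
@[simps]
def GNat.curry {W Y : V} (φ : GNat (Y ⊗ W) L S) : GNat W L (vcomp S (rep Y)) where
  app a := cc ((α_ _ _ _).inv ≫ φ.app a)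
  natural a b := by
    apply uc_injective
    have h := φ.natural a b
    rw [act_vcomp, act_rep, uc_natural_left, uc_natural_left, uc_cc,
      associator_inv_naturality_right_assoc, h]
    have h2 := uc_comp (cc ((α_ _ _ _).inv ≫ φ.app a)) (S.map a b)
    rw [MonoidalCategory.tensorHom_def, Category.assoc] at h2
    rw [h2, uc_cc, ← act_eq_uc]
    simp

/-- Uncurrying the target of a graded transformation. -/
@[simps]
def GNat.uncurry {W Y : V} (φ : GNat W L (vcomp S (rep Y))) : GNat (Y ⊗ W) L S where
  app a := (α_ _ _ _).hom ≫ uc (φ.app a)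
  natural a b := by
    have h := congrArg uc (φ.natural a b)
    have h2 := uc_comp (φ.app a) (S.map a b)
    rw [MonoidalCategory.tensorHom_def, Category.assoc] at h2
    rw [act_vcomp, act_rep, uc_natural_left, uc_natural_left, h2, ← act_eq_uc] at h
    rw [associator_naturality_right_assoc, h]
    simp

/-- A weighted cone in `V` is a limit cone if and only if the corresponding graded
transformation is universal. -/
lemma WeightedCone.isLimit_iff_gnat (c : WeightedCone L S X) :
    c.IsLimit ↔ ∀ (W : V) (φ : GNat W L S), ∃! g : W ⟶ X, ∀ a, g ▷ _ ≫ uc (c.leg a) = φ.app a := by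
  have key : ∀ (W Y : V) (f : W ⟶ EnrichedCategory.Hom (V := V) Y X) (a : D),
      uc ((f ⊗ₘ c.leg a) ≫ eComp V Y X (S.obj a)) =
        (α_ _ _ _).inv ≫ uc f ▷ _ ≫ uc (c.leg a) := fun W Y f a => uc_comp _ _
  rw [c.isLimit_iff]
  constructor
  · intro h W φ
    obtain ⟨f, hf, hu⟩ := h W (𝟙_ V) (φ.restrict (λ_ W).hom).curry
    refine ⟨(λ_ W).inv ≫ uc f, fun a => ?_, fun g hg => ?_⟩
    · have := congrArg uc (hf a)
      rw [key, GNat.curry_app, uc_cc, GNat.restrict_app] at this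
      rw [Iso.cancel_iso_inv_left] at this
      rw [comp_whiskerRight_assoc, this]
      simp
    · have := hu (cc ((λ_ W).hom ≫ g)) (fun a => by
        apply uc_injective
        rw [key, uc_cc, GNat.curry_app, uc_cc, GNat.restrict_app, comp_whiskerRight_assoc, hg])
      rw [← this, uc_cc, Iso.inv_hom_id_assoc]
  · intro h W Y t
    obtain ⟨g, hg, hu⟩ := h _ t.uncurry
    refine ⟨cc g, fun a => ?_, fun f hf => ?_⟩
    · apply uc_injective
      rw [key, uc_cc, hg, GNat.uncurry_app, Iso.inv_hom_id_assoc]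
    · have := hu (uc f) (fun a => by
        rw [GNat.uncurry_app, ← hf, key, Iso.hom_inv_id_assoc])
      rw [← this, cc_uc]

/-- Representable `V`-functors preserve limits. -/
lemma WeightedCone.map_rep_isLimit {L : EnrichedFunctor V D V} {S : EnrichedFunctor V D K} {Y : K}
    {c : WeightedCone L S Y} (hc : c.IsLimit) (X : K) : (c.map (rep X)).IsLimit := by
  rw [WeightedCone.isLimit_iff_gnat]
  intro W φ
  rw [WeightedCone.isLimit_iff] at hc
  have := hc W X φ
  refine (existsUnique_congr fun g => forall_congr' fun a => ?_).1 this
  have h : uc ((c.map (rep X)).leg a) = _ ◁ c.leg a ≫ eComp V X Y (S.obj a) := by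
    change uc (c.leg a ≫ cc _) = _
    exact (uc_natural_left _ _).trans (congrArg _ (uc_cc _))
  rw [h, MonoidalCategory.tensorHom_def, Category.assoc]
  exact Iff.rfl

end LimitsInV

/-! ### Uniqueness of weighted limits and colimits -/

section Uniqueness

variable {V : Type u} [Category.{v} V] [MonoidalCategory V] [SymmetricCategory V]
  [MonoidalClosed V]
variable {D : Type w'} [EnrichedCategory V D] {K : Type w} [EnrichedCategory V K]

/-- An isomorphism in the underlying category of a `V`-category. -/
structure VIso (X Y : K) where
  hom : 𝟙_ V ⟶ (X ⟶[V] Y)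
  inv : 𝟙_ V ⟶ (Y ⟶[V] X)
  hom_inv : ecomp hom inv = eId V X
  inv_hom : ecomp inv hom = eId V Y

/-- The inverse of an isomorphism. -/
@[simps]
def VIso.symm {X Y : K} (e : VIso (V := V) X Y) : VIso (V := V) Y X where
  hom := e.inv
  inv := e.hom
  hom_inv := e.inv_hom
  inv_hom := e.hom_inv

/-- The image of an isomorphism under a `V`-functor. -/
@[simps]
def VIso.map {K' : Type*} [EnrichedCategory V K'] (P : EnrichedFunctor V K K') {X Y : K}
    (e : VIso (V := V) X Y) : VIso (V := V) (P.obj X) (P.obj Y) where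
  hom := e.hom ≫ P.map X Y
  inv := e.inv ≫ P.map Y X
  hom_inv := by rw [← ecomp_map, e.hom_inv, P.map_id]
  inv_hom := by rw [← ecomp_map, e.inv_hom, P.map_id]

/-- The isomorphism `K(Z,X) ≅ K(Z,Y)` induced by `X ≅ Y`. -/
@[simps]
def VIso.post (Z : K) {X Y : K} (e : VIso (V := V) X Y) : (Z ⟶[V] X) ≅ (Z ⟶[V] Y) where
  hom := EnrichedLSFP.post Z e.hom
  inv := EnrichedLSFP.post Z e.inv
  hom_inv_id := by rw [← post_comp, e.hom_inv, post_id]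
  inv_hom_id := by rw [← post_comp, e.inv_hom, post_id]

/-- The isomorphism `K(Y,Z) ≅ K(X,Z)` induced by `X ≅ Y`. -/
@[simps]
def VIso.pre (Z : K) {X Y : K} (e : VIso (V := V) X Y) : (Y ⟶[V] Z) ≅ (X ⟶[V] Z) where
  hom := EnrichedLSFP.pre e.hom Z
  inv := EnrichedLSFP.pre e.inv Z
  hom_inv_id := by rw [← pre_comp, e.inv_hom, pre_id]
  inv_hom_id := by rw [← pre_comp, e.hom_inv, pre_id]

/-- The isomorphism `F a ≅ F b` induced by `a ≅ b`. -/
@[simps]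
def VIso.fmap (F : EnrichedFunctor V K V) {X Y : K} (e : VIso (V := V) X Y) :
    F.obj X ≅ F.obj Y where
  hom := EnrichedLSFP.fmap F e.hom
  inv := EnrichedLSFP.fmap F e.inv
  hom_inv_id := by rw [← fmap_comp, e.hom_inv, fmap_id]
  inv_hom_id := by rw [← fmap_comp, e.inv_hom, fmap_id]

lemma existsUnique_iso {W X Y : V} (e : X ≅ Y) {p : (W ⟶ Y) → Prop}
    (h : ∃! f, p f) : ∃! f : W ⟶ X, p (f ≫ e.hom) := by
  obtain ⟨f, hf, hu⟩ := h
  refine ⟨f ≫ e.inv, by simpa using hf, fun g hg => ?_⟩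
  rw [← hu _ hg]
  simp

lemma tensor_pre_eComp {W P : V} {X Y Y' Z : K} (h : W ⟶ (X ⟶[V] Y)) (k : P ⟶ (Y' ⟶[V] Z))
    (f : 𝟙_ V ⟶ (Y ⟶[V] Y')) :
    (h ⊗ₘ (k ≫ pre f Z)) ≫ eComp V X Y Z = ((h ≫ post X f) ⊗ₘ k) ≫ eComp V X Y' Z := by
  rw [tensor_comp_eq', Category.assoc, eComp_pre_mid, comp_tensor_eq', Category.assoc]

lemma WeightedCone.IsLimit.of_iso {F : EnrichedFunctor V D V} {S : EnrichedFunctor V D K}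
    {L L₀ : K} {c₀ : WeightedCone F S L₀} (h : c₀.IsLimit) (c : WeightedCone F S L)
    (e : VIso (V := V) L L₀) (he : ∀ a, c.leg a = c₀.leg a ≫ pre e.hom _) : c.IsLimit := by
  intro W X t
  simp only [he, tensor_pre_eComp]
  exact existsUnique_iso (e.post X) (h W X t)

lemma WeightedCocone.IsColimit.of_iso {F : EnrichedFunctor V Dᵒᵖ V} {R : EnrichedFunctor V D K}
    {C C₀ : K} {c₀ : WeightedCocone F R C₀} (h : c₀.IsColimit) (c : WeightedCocone F R C)
    (e : VIso (V := V) C₀ C) (he : ∀ a, c.leg a = c₀.leg a ≫ post _ e.hom) : c.IsColimit := by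
  intro W X t
  simp only [he, ← tensor_pre_eComp]
  exact existsUnique_iso (e.pre X) (h W X t)

/-- The family obtained by composing `f : W ⟶ K(X,L)` with a cone. -/
@[simps]
def WeightedCone.param {F : EnrichedFunctor V D V} {S : EnrichedFunctor V D K}
    {L : K} (c : WeightedCone F S L) {W : V} {X : K} (f : W ⟶ (X ⟶[V] L)) :
    ParamCone F S W X where
  leg a := (f ⊗ₘ c.leg a) ≫ eComp V X L (S.obj a)
  natural a b := by
    have h := comp_assoc' f (c.leg a) (S.map a b)
    rw [eq_comm, Iso.inv_comp_eq] at h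
    rw [h, c.natural, tensor_comp_eq, Category.assoc]

lemma eId_comp_tensor {X Y : K} {W : V} (h : W ⟶ (X ⟶[V] Y)) :
    (eId V X ⊗ₘ h) ≫ eComp V X X Y = (λ_ _).hom ≫ h := by
  have h1 := e_id_comp V X Y
  rw [Iso.inv_comp_eq, Category.comp_id] at h1
  rw [MonoidalCategory.tensorHom_def', Category.assoc, h1, leftUnitor_naturality]

lemma comp_eId_tensor {X Y : K} {W : V} (h : W ⟶ (X ⟶[V] Y)) :
    (h ⊗ₘ eId V Y) ≫ eComp V X Y Y = (ρ_ _).hom ≫ h := by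
  have h1 := e_comp_id V X Y
  rw [Iso.inv_comp_eq, Category.comp_id] at h1
  rw [MonoidalCategory.tensorHom_def, Category.assoc, h1, rightUnitor_naturality]

lemma comp_pre_eq {W : V} {X Y Z : K} (f : 𝟙_ V ⟶ (X ⟶[V] Y)) (h : W ⟶ (Y ⟶[V] Z)) :
    h ≫ pre f Z = (λ_ _).inv ≫ (f ⊗ₘ h) ≫ eComp V X Y Z := by
  rw [pre, leftUnitor_inv_naturality_assoc, MonoidalCategory.tensorHom_def', Category.assoc]

lemma comp_post_eq {W : V} {X Y Z : K} (f : 𝟙_ V ⟶ (Y ⟶[V] Z)) (h : W ⟶ (X ⟶[V] Y)) :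
    h ≫ post X f = (ρ_ _).inv ≫ (h ⊗ₘ f) ≫ eComp V X Y Z := by
  rw [post, rightUnitor_inv_naturality_assoc, MonoidalCategory.tensorHom_def, Category.assoc]

lemma WeightedCone.IsLimit.exists_map {F : EnrichedFunctor V D V} {S : EnrichedFunctor V D K}
    {L L₀ : K} {c₀ : WeightedCone F S L₀} (h₀ : c₀.IsLimit) (c : WeightedCone F S L) :
    ∃ f : 𝟙_ V ⟶ (L ⟶[V] L₀), ∀ a, c₀.leg a ≫ pre f _ = c.leg a := by
  obtain ⟨f, hf, -⟩ := h₀ _ L (c.param (eId V L))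
  refine ⟨f, fun a => ?_⟩
  rw [comp_pre_eq, hf, WeightedCone.param_leg, eId_comp_tensor, Iso.inv_hom_id_assoc]

lemma WeightedCone.IsLimit.eq_eId {F : EnrichedFunctor V D V} {S : EnrichedFunctor V D K}
    {L : K} {c : WeightedCone F S L} (h : c.IsLimit) {f : 𝟙_ V ⟶ (L ⟶[V] L)}
    (hf : ∀ a, c.leg a ≫ pre f _ = c.leg a) : f = eId V L := by
  refine (h _ L (c.param (eId V L))).unique (fun a => ?_) (fun _ => rfl)
  have := hf a
  rw [comp_pre_eq, Iso.inv_comp_eq] at this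
  rw [this, WeightedCone.param_leg, eId_comp_tensor]

/-- Two limits of the same diagram are isomorphic, compatibly with the cones. -/
lemma WeightedCone.IsLimit.exists_iso {F : EnrichedFunctor V D V} {S : EnrichedFunctor V D K}
    {L L₀ : K} {c : WeightedCone F S L} {c₀ : WeightedCone F S L₀} (h : c.IsLimit)
    (h₀ : c₀.IsLimit) : ∃ e : VIso (V := V) L L₀, ∀ a, c.leg a = c₀.leg a ≫ pre e.hom _ := by
  obtain ⟨f, hf⟩ := h₀.exists_map c
  obtain ⟨g, hg⟩ := h.exists_map c₀
  refine ⟨⟨f, g, h.eq_eId fun a => ?_, h₀.eq_eId fun a => ?_⟩, fun a => (hf a).symm⟩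
  · rw [pre_comp, ← Category.assoc, hg, hf]
  · rw [pre_comp, ← Category.assoc, hf, hg]

/-- A `V`-functor that preserves one limit of a diagram preserves every limit of this diagram. -/
lemma WeightedCone.IsLimit.map_of_map {F : EnrichedFunctor V D V} {S : EnrichedFunctor V D K}
    {L L₀ : K} {c : WeightedCone F S L} {c₀ : WeightedCone F S L₀} (h : c.IsLimit)
    (h₀ : c₀.IsLimit) {K' : Type*} [EnrichedCategory V K'] (P : EnrichedFunctor V K K')
    (hP : (c₀.map P).IsLimit) : (c.map P).IsLimit := by
  obtain ⟨e, he⟩ := h.exists_iso h₀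
  refine hP.of_iso _ (e.map P) fun a => ?_
  change c.leg a ≫ P.map _ _ = (c₀.leg a ≫ P.map _ _) ≫ pre (e.hom ≫ P.map _ _) _
  rw [he, Category.assoc, Category.assoc, pre_map]

lemma WeightedCocone.IsColimit.exists_map {F : EnrichedFunctor V Dᵒᵖ V}
    {R : EnrichedFunctor V D K} {C C₀ : K} {c₀ : WeightedCocone F R C₀} (h₀ : c₀.IsColimit)
    (c : WeightedCocone F R C) :
    ∃ f : 𝟙_ V ⟶ (C₀ ⟶[V] C), ∀ a, c₀.leg a ≫ post _ f = c.leg a := by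
  obtain ⟨f, hf, -⟩ := h₀ _ C (c.param (eId V C))
  refine ⟨f, fun a => ?_⟩
  rw [comp_post_eq, hf]
  change _ ≫ (c.leg a ⊗ₘ eId V C) ≫ eComp V _ _ _ = _
  rw [comp_eId_tensor, Iso.inv_hom_id_assoc]

lemma WeightedCocone.IsColimit.eq_eId {F : EnrichedFunctor V Dᵒᵖ V}
    {R : EnrichedFunctor V D K} {C : K} {c : WeightedCocone F R C} (h : c.IsColimit)
    {f : 𝟙_ V ⟶ (C ⟶[V] C)} (hf : ∀ a, c.leg a ≫ post _ f = c.leg a) : f = eId V C := by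
  refine h.hom_ext fun a => ?_
  have := hf a
  rw [comp_post_eq, Iso.inv_comp_eq] at this
  rw [this, comp_eId_tensor]

/-- Two colimits of the same diagram are isomorphic, compatibly with the cocones. -/
lemma WeightedCocone.IsColimit.exists_iso {F : EnrichedFunctor V Dᵒᵖ V}
    {R : EnrichedFunctor V D K} {C C₀ : K} {c : WeightedCocone F R C} {c₀ : WeightedCocone F R C₀}
    (h : c.IsColimit) (h₀ : c₀.IsColimit) :
    ∃ e : VIso (V := V) C₀ C, ∀ a, c.leg a = c₀.leg a ≫ post _ e.hom := by
  obtain ⟨f, hf⟩ := h₀.exists_map c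
  obtain ⟨g, hg⟩ := h.exists_map c₀
  refine ⟨⟨f, g, h₀.eq_eId fun a => ?_, h.eq_eId fun a => ?_⟩, fun a => (hf a).symm⟩
  · rw [post_comp, ← Category.assoc, hf, hg]
  · rw [post_comp, ← Category.assoc, hg, hf]

/-- A `V`-functor that preserves one colimit of a diagram preserves every colimit of this
diagram. -/
lemma WeightedCocone.IsColimit.map_of_map {F : EnrichedFunctor V Dᵒᵖ V}
    {R : EnrichedFunctor V D K} {C C₀ : K} {c : WeightedCocone F R C} {c₀ : WeightedCocone F R C₀}
    (h : c.IsColimit) (h₀ : c₀.IsColimit) {K' : Type*} [EnrichedCategory V K']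
    (P : EnrichedFunctor V K K') (hP : (c₀.map P).IsColimit) : (c.map P).IsColimit := by
  obtain ⟨e, he⟩ := h.exists_iso h₀
  refine hP.of_iso _ (e.map P) fun a => ?_
  change c.leg a ≫ P.map _ _ = (c₀.leg a ≫ P.map _ _) ≫ post _ (e.hom ≫ P.map _ _)
  rw [he, Category.assoc, Category.assoc, post_map]

end Uniqueness

/-! ### Conical colimits -/

section IsColim

variable {J : Type w} [Category J] {C : Type u} [Category.{v} C]

/-- The family `x` of morphisms `o j ⟶ X` is a colimit of the diagram with objects `o` and
transition morphisms `m`. Leaving the diagram unbundled makes the composites of a diagram with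
various functors definitionally equal. -/
def IsColim (o : J → C) (m : ∀ i j : J, (i ⟶ j) → (o i ⟶ o j)) {X : C} (x : ∀ j, o j ⟶ X) :
    Prop :=
  ∀ (Y : C) (t : ∀ j, o j ⟶ Y), (∀ i j (u : i ⟶ j), m i j u ≫ t j = t i) →
    ∃! f : X ⟶ Y, ∀ j, x j ≫ f = t j

lemma nonempty_isColimit_iff {D : J ⥤ C} (c : Cocone D) :
    Nonempty (IsColimit c) ↔ IsColim D.obj (fun _ _ u => D.map u) c.ι.app := by
  constructor
  · rintro ⟨h⟩ Y t ht
    let s : Cocone D := ⟨Y, { app := t, naturality := fun i j u => by simpa using ht i j u }⟩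
    exact ⟨h.desc s, fun j => h.fac s j, fun g hg => h.uniq s g hg⟩
  · intro h
    have hs := fun s : Cocone D => h s.pt s.ι.app (fun i j u => s.w u)
    exact ⟨{ desc := fun s => (hs s).choose
             fac := fun s => (hs s).choose_spec.1
             uniq := fun s g hg => (hs s).choose_spec.2 g hg }⟩

lemma isColim_colimit [HasColimitsOfShape J C] (D : J ⥤ C) :
    IsColim D.obj (fun _ _ u => D.map u) (colimit.ι D) :=
  (nonempty_isColimit_iff (colimit.cocone D)).1 ⟨colimit.isColimit D⟩

variable {o : J → C} {m : ∀ i j : J, (i ⟶ j) → (o i ⟶ o j)} {X : C} {x : ∀ j, o j ⟶ X}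

lemma IsColim.hom_ext (h : IsColim o m x) (hx : ∀ i j (u : i ⟶ j), m i j u ≫ x j = x i) {Y : C}
    {f g : X ⟶ Y} (hfg : ∀ j, x j ≫ f = x j ≫ g) : f = g :=
  (h Y (fun j => x j ≫ g) (fun i j u => by rw [← Category.assoc, hx])).unique hfg fun _ => rfl

lemma existsUnique_iso' {C : Type u} [Category.{v} C] {W X Y : C} (e : X ≅ Y) {p : (X ⟶ W) → Prop}
    (h : ∃! f, p f) : ∃! f : Y ⟶ W, p (e.hom ≫ f) := by
  obtain ⟨f, hf, hu⟩ := h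
  refine ⟨e.inv ≫ f, by simpa using hf, fun g hg => ?_⟩
  rw [← hu _ hg]
  simp

lemma IsColim.of_iso {o' : J → C} {m' : ∀ i j : J, (i ⟶ j) → (o' i ⟶ o' j)} {X' : C}
    {x' : ∀ j, o' j ⟶ X'} (h : IsColim o m x) (e : ∀ j, o j ≅ o' j) (eX : X ≅ X')
    (hm : ∀ i j (u : i ⟶ j), m i j u ≫ (e j).hom = (e i).hom ≫ m' i j u)
    (hx : ∀ j, x j ≫ eX.hom = (e j).hom ≫ x' j) : IsColim o' m' x' := by
  intro Y t ht
  have := h Y (fun j => (e j).hom ≫ t j) (fun i j u => by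
    rw [← Category.assoc, hm, Category.assoc, ht])
  refine (existsUnique_congr fun f => forall_congr' fun j => ?_).1
    (existsUnique_iso' eX this)
  rw [← Category.assoc, hx, Category.assoc, cancel_epi]

lemma IsColim.congr {m' : ∀ i j : J, (i ⟶ j) → (o i ⟶ o j)} {x' : ∀ j, o j ⟶ X}
    (h : IsColim o m x) (hm : ∀ i j (u : i ⟶ j), m i j u = m' i j u) (hx : ∀ j, x j = x' j) :
    IsColim o m' x' := by
  obtain rfl : m = m' := by
    funext i j u
    exact hm i j u
  obtain rfl : x = x' := funext hx
  exact h

/-- Two colimits of the same diagram are isomorphic. -/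
lemma IsColim.isIso (h : IsColim o m x) (hx : ∀ i j (u : i ⟶ j), m i j u ≫ x j = x i)
    {X' : C} {x' : ∀ j, o j ⟶ X'}
    (h' : IsColim o m x') (hx' : ∀ i j (u : i ⟶ j), m i j u ≫ x' j = x' i) {f : X ⟶ X'}
    (hf : ∀ j, x j ≫ f = x' j) : IsIso f := by
  obtain ⟨g, hg, -⟩ := h' X x hx
  refine ⟨g, h.hom_ext hx fun j => ?_, h'.hom_ext hx' fun j => ?_⟩
  · rw [← Category.assoc, hf, hg, Category.comp_id]
  · rw [← Category.assoc, hg, hf, Category.comp_id]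

lemma IsColim.of_isIso (h : IsColim o m x) {X' : C} {x' : ∀ j, o j ⟶ X'} (f : X ⟶ X') [IsIso f]
    (hf : ∀ j, x j ≫ f = x' j) : IsColim o m x' :=
  h.of_iso (fun j => Iso.refl _) (asIso f) (by simp) (by simpa using hf)

end IsColim

section Tensor

variable {J : Type w} [Category J] {V : Type u} [Category.{v} V] [MonoidalCategory V]
  [SymmetricCategory V] [MonoidalClosed V]
variable {o : J → V} {m : ∀ i j : J, (i ⟶ j) → (o i ⟶ o j)} {X : V} {x : ∀ j, o j ⟶ X}

/-- Tensoring preserves colimits. -/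
lemma IsColim.whiskerRight (h : IsColim o m x) (W : V) :
    IsColim (fun j => o j ⊗ W) (fun i j u => m i j u ▷ W) fun j => x j ▷ W := by
  intro Y t ht
  obtain ⟨f, hf, hu⟩ := h _ (fun j => MonoidalClosed.curry ((β_ W (o j)).hom ≫ t j))
    (fun i j u => by
      apply MonoidalClosed.uncurry_injective
      rw [MonoidalClosed.uncurry_natural_left, MonoidalClosed.uncurry_curry,
        MonoidalClosed.uncurry_curry, BraidedCategory.braiding_naturality_right_assoc, ht])
  refine ⟨(β_ X W).hom ≫ MonoidalClosed.uncurry f, fun j => ?_, fun g hg => ?_⟩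
  · rw [BraidedCategory.braiding_naturality_left_assoc, ← MonoidalClosed.uncurry_natural_left, hf,
      MonoidalClosed.uncurry_curry, SymmetricCategory.symmetry_assoc]
  · rw [← hu (MonoidalClosed.curry ((β_ W X).hom ≫ g)), MonoidalClosed.uncurry_curry,
      SymmetricCategory.symmetry_assoc]
    intro j
    apply MonoidalClosed.uncurry_injective
    rw [MonoidalClosed.uncurry_natural_left, MonoidalClosed.uncurry_curry,
      MonoidalClosed.uncurry_curry, BraidedCategory.braiding_naturality_right_assoc, hg]

lemma IsColim.whiskerLeft (h : IsColim o m x) (W : V) :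
    IsColim (fun j => W ⊗ o j) (fun i j u => W ◁ m i j u) fun j => W ◁ x j :=
  (h.whiskerRight W).of_iso (fun _ => β_ _ _) (β_ _ _)
    (fun _ _ _ => BraidedCategory.braiding_naturality_left _ _)
    (fun _ => BraidedCategory.braiding_naturality_left _ _)

end Tensor

section Conical

variable {V : Type u} [Category.{v} V] [MonoidalCategory V] [MonoidalClosed V]
variable {J : Type v} [SmallCategory J] {K : Type w} [EnrichedCategory V K]

/-- The `j`-th object of a diagram in the underlying category of a `V`-category. -/
abbrev dob (D : J ⥤ ForgetEnrichment V K) (j : J) : K := ForgetEnrichment.to V (D.obj j)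

/-- The transition morphisms of a diagram in the underlying category of a `V`-category. -/
abbrev dmap (D : J ⥤ ForgetEnrichment V K) (i j : J) (u : i ⟶ j) : 𝟙_ V ⟶ (dob D i ⟶[V] dob D j) :=
  ForgetEnrichment.homTo V (D.map u)

lemma dmap_id (D : J ⥤ ForgetEnrichment V K) (i : J) : dmap D i i (𝟙 i) = eId V _ := by
  rw [dmap, D.map_id, ForgetEnrichment.homTo_id]

lemma dmap_comp (D : J ⥤ ForgetEnrichment V K) {i j k : J} (f : i ⟶ j) (g : j ⟶ k) :
    dmap D i k (f ≫ g) = ecomp (dmap D i j f) (dmap D j k g) := by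
  rw [dmap, D.map_comp, homTo_comp']

/-- Compatibility of a family of legs with a diagram. -/
def IsCompat (D : J ⥤ ForgetEnrichment V K) {X : K} (x : ∀ j, 𝟙_ V ⟶ (dob D j ⟶[V] X)) : Prop :=
  ∀ i j (u : i ⟶ j), ecomp (dmap D i j u) (x j) = x i

/-- The elementary form of `IsConicalColimit`. -/
def Conical (D : J ⥤ ForgetEnrichment V K) {X : K} (x : ∀ j, 𝟙_ V ⟶ (dob D j ⟶[V] X)) : Prop :=
  ∀ (Y : K) (W : V) (t : ∀ j, W ⟶ (dob D j ⟶[V] Y)),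
    (∀ i j (u : i ⟶ j), t j ≫ pre (dmap D i j u) Y = t i) →
      ∃! f : W ⟶ (X ⟶[V] Y), ∀ j, f ≫ pre (x j) Y = t j

/-- The cocone with the given legs. -/
@[simps]
def mkCocone (D : J ⥤ ForgetEnrichment V K) {X : K} (x : ∀ j, 𝟙_ V ⟶ (dob D j ⟶[V] X))
    (hx : IsCompat D x) : Cocone D where
  pt := ForgetEnrichment.of V X
  ι := { app := fun j => ForgetEnrichment.homOf V (x j)
         naturality := fun i j u => by
          have h := congrArg (ForgetEnrichment.homOf V) (hx i j u)
          have h2 : ForgetEnrichment.homOf V (ecomp (dmap D i j u) (x j)) =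
              D.map u ≫ ForgetEnrichment.homOf V (x j) :=
            congrArg (ForgetEnrichment.homOf V)
              (homTo_comp' (D.map u) (ForgetEnrichment.homOf V (x j))).symm
          exact (h2.symm.trans h).trans (Category.comp_id _).symm }

lemma isCompat_cocone {D : J ⥤ ForgetEnrichment V K} (c : Cocone D) :
    IsCompat D (X := ForgetEnrichment.to V c.pt) fun j => ForgetEnrichment.homTo V (c.ι.app j) := by
  intro i j u
  rw [dmap, ← homTo_comp', c.w]

lemma isConicalColimit_iff {D : J ⥤ ForgetEnrichment V K} (c : Cocone D) :
    IsConicalColimit c ↔ Conical D (X := ForgetEnrichment.to V c.pt)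
      fun j => ForgetEnrichment.homTo V (c.ι.app j) := by
  refine forall_congr' fun Y => ?_
  constructor
  · rintro ⟨h⟩ W t ht
    let s : Cone (D.op ⋙ (eHomFunctor V (ForgetEnrichment V K)).flip.obj Y) :=
      ⟨W, { app := fun j => t j.unop
            naturality := fun i j u => by
              refine (Category.id_comp _).trans (ht j.unop i.unop u.unop).symm }⟩
    exact ⟨h.lift s, fun j => h.fac s (op j), fun g hg => h.uniq s g fun j => hg j.unop⟩
  · intro h
    have hs := fun s : Cone (D.op ⋙ (eHomFunctor V (ForgetEnrichment V K)).flip.obj Y) =>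
      h s.pt (fun j => s.π.app (op j)) (fun i j u => s.w u.op)
    exact ⟨{ lift := fun s => (hs s).choose
             fac := fun s j => (hs s).choose_spec.1 j.unop
             uniq := fun s g hg => (hs s).choose_spec.2 g fun j => hg (op j) }⟩

end Conical

section Pres

variable {V : Type u} [Category.{v} V] [MonoidalCategory V] [MonoidalClosed V]
variable {J : Type v} [SmallCategory J] {K : Type w} [EnrichedCategory V K]

/-- The `V`-functor `P` sends the cocone `x` to a colimit cocone in `V`. -/
def Pres (P : EnrichedFunctor V K V) (D : J ⥤ ForgetEnrichment V K) {X : K}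
    (x : ∀ j, 𝟙_ V ⟶ (dob D j ⟶[V] X)) : Prop :=
  IsColim (fun j => P.obj (dob D j)) (fun i j u => fmap P (dmap D i j u)) fun j => fmap P (x j)

lemma fmap_compat (P : EnrichedFunctor V K V) {D : J ⥤ ForgetEnrichment V K} {X : K}
    {x : ∀ j, 𝟙_ V ⟶ (dob D j ⟶[V] X)} (hx : IsCompat D x) (i j) (u : i ⟶ j) :
    fmap P (dmap D i j u) ≫ fmap P (x j) = fmap P (x i) := by
  rw [← fmap_comp, hx]

/-- The composite of a `V`-functor into `V` with a diagram. -/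
abbrev dunder (P : EnrichedFunctor V K V) (D : J ⥤ ForgetEnrichment V K) : J ⥤ V := D ⋙ under P

lemma Pres.of_natIso {P Q : EnrichedFunctor V K V} {D : J ⥤ ForgetEnrichment V K} {X : K}
    {x : ∀ j, 𝟙_ V ⟶ (dob D j ⟶[V] X)} (e : ∀ X, P.obj X ≅ Q.obj X)
    (he : ∀ (X Y : K) (f : 𝟙_ V ⟶ (X ⟶[V] Y)), fmap P f ≫ (e Y).hom = (e X).hom ≫ fmap Q f)
    (h : Pres P D x) : Pres Q D x :=
  IsColim.of_iso h (fun _ => e _) (e _) (fun _ _ _ => he _ _ _) (fun _ => he _ _ _)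

lemma isStronglyFinitelyPresentable_iff (X : K) : IsStronglyFinitelyPresentable V X ↔
    ∀ (J : Type v) [SmallCategory J] [IsSifted J] (D : J ⥤ ForgetEnrichment V K) (Y : K)
      (y : ∀ j, 𝟙_ V ⟶ (dob D j ⟶[V] Y)), IsCompat D y → Conical D y → Pres (rep X) D y := by
  have key : ∀ (J : Type v) [SmallCategory J] (D : J ⥤ ForgetEnrichment V K) (c : Cocone D),
      Nonempty (IsColimit ((eCoyoneda V (ForgetEnrichment.of V X)).mapCocone c)) ↔
        Pres (rep X) D (X := ForgetEnrichment.to V c.pt)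
          fun j => ForgetEnrichment.homTo V (c.ι.app j) := by
    intro J _ D c
    rw [nonempty_isColimit_iff, Pres]
    simp only [fmap_rep]
    exact Iff.rfl
  constructor
  · intro h J _ _ D Y y hy hc
    exact (key J D (mkCocone D y hy)).1 (h J D _ ((isConicalColimit_iff _).2 hc))
  · intro h J _ _ D c hc
    exact (key J D c).2 (h J D _ _ (isCompat_cocone c) ((isConicalColimit_iff c).1 hc))

end Pres

section ConicalV

variable {V : Type u} [Category.{v} V] [MonoidalCategory V] [SymmetricCategory V]
  [MonoidalClosed V]
variable {J : Type v} [SmallCategory J]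

/-- The morphism of `V` named by an element of a hom-object. -/
def un {X Y : V} (f : 𝟙_ V ⟶ EnrichedCategory.Hom (V := V) X Y) : X ⟶ Y := (ρ_ X).inv ≫ uc f

/-- The element of the hom-object given by a morphism of `V`. -/
def nm {X Y : V} (f : X ⟶ Y) : 𝟙_ V ⟶ EnrichedCategory.Hom (V := V) X Y := cc ((ρ_ X).hom ≫ f)

@[simp] lemma un_nm {X Y : V} (f : X ⟶ Y) : un (nm f) = f := by simp [un, nm]

@[simp] lemma nm_un {X Y : V} (f : 𝟙_ V ⟶ EnrichedCategory.Hom (V := V) X Y) : nm (un f) = f := by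
  simp [un, nm]

lemma uc_comp_pre {W X Y Z : V} (f : 𝟙_ V ⟶ EnrichedCategory.Hom (V := V) X Y)
    (g : W ⟶ EnrichedCategory.Hom (V := V) Y Z) : uc (g ≫ pre f Z) = un f ▷ W ≫ uc g := by
  rw [comp_pre_eq, uc_natural_left, uc_comp, un]
  simp

lemma uc_comp_post {W X Y Z : V} (f : 𝟙_ V ⟶ EnrichedCategory.Hom (V := V) Y Z)
    (g : W ⟶ EnrichedCategory.Hom (V := V) X Y) : uc (g ≫ post X f) = uc g ≫ un f := by
  rw [comp_post_eq, uc_natural_left, uc_comp, un]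
  simp

lemma un_eId (X : V) : un (eId V X) = 𝟙 X := by rw [un, uc_eId, Iso.inv_hom_id]

lemma un_ecomp {X Y Z : V} (f : 𝟙_ V ⟶ EnrichedCategory.Hom (V := V) X Y)
    (g : 𝟙_ V ⟶ EnrichedCategory.Hom (V := V) Y Z) : un (ecomp f g) = un f ≫ un g := by
  rw [← comp_post, un, uc_comp_post, ← Category.assoc]; rfl

lemma un_comp_map {A : Type w} [EnrichedCategory V A] (P : EnrichedFunctor V A V) {a b : A}
    (f : 𝟙_ V ⟶ (a ⟶[V] b)) : un (f ≫ P.map a b) = fmap P f := by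
  rw [un, uc_natural_left, fmap]; rfl

/-- In `V`, conical colimits are the same as ordinary colimits. -/
lemma conical_self_iff (D : J ⥤ ForgetEnrichment V V) {X : V}
    (x : ∀ j, 𝟙_ V ⟶ EnrichedCategory.Hom (V := V) (dob D j) X) :
    Conical D x ↔
      IsColim (fun j => dob D j) (fun i j u => un (dmap D i j u)) fun j => un (x j) := by
  constructor
  · intro h Y t ht
    obtain ⟨f, hf, hu⟩ := h Y (𝟙_ V) (fun j => nm (t j)) (fun i j u => by
      apply uc_injective
      rw [uc_comp_pre, nm, uc_cc, nm, uc_cc, rightUnitor_naturality_assoc, ht])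
    refine ⟨un f, fun j => ?_, fun g hg => ?_⟩
    · rw [← un_ecomp, ← comp_pre, hf, un_nm]
    · rw [← hu (nm g), un_nm]
      intro j
      apply uc_injective
      rw [uc_comp_pre, nm, uc_cc, nm, uc_cc, rightUnitor_naturality_assoc, hg]
  · intro h Y W t ht
    obtain ⟨f, hf, hu⟩ := h.whiskerRight W Y (fun j => uc (t j)) (fun i j u => by
      rw [← uc_comp_pre, ht])
    refine ⟨cc f, fun j => ?_, fun g hg => ?_⟩
    · apply uc_injective
      rw [uc_comp_pre, uc_cc, hf]
    · rw [← hu (uc g), cc_uc]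
      intro j
      rw [← uc_comp_pre, hg]

end ConicalV

/-! ### Sifted colimits of sets and detection of sifted colimits in `V` -/

section IsColimT

variable {J : Type v} [SmallCategory J]

/-- The family of functions `x` is a colimit of a diagram of sets, in unbundled form. -/
def IsColimT (o : J → Type v) (m : ∀ i j : J, (i ⟶ j) → o i → o j) {X : Type v}
    (x : ∀ j, o j → X) : Prop :=
  ∀ (Y : Type v) (t : ∀ j, o j → Y), (∀ i j (u : i ⟶ j) a, t j (m i j u a) = t i a) →
    ∃! f : X → Y, ∀ j a, f (x j a) = t j a

lemma isColim_type_iff {D : J ⥤ Type v} {X : Type v} (x : ∀ j, D.obj j ⟶ X) :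
    IsColim D.obj (fun _ _ u => D.map u) x ↔
      IsColimT D.obj (fun _ _ u a => D.map u a) (fun j a => x j a) := by
  constructor
  · intro h Y t ht
    obtain ⟨f, hf, hu⟩ := h Y (fun j => ↾(t j)) (fun i j u => by ext a; exact ht i j u a)
    refine ⟨fun a => f a, fun j a => ?_, fun g hg => ?_⟩
    · exact ConcreteCategory.congr_hom (hf j) a
    · rw [← hu (↾g) (fun j => by ext a; exact hg j a)]; rfl
  · intro h Y t ht
    obtain ⟨f, hf, hu⟩ := h Y (fun j a => t j a) (fun i j u a =>
      ConcreteCategory.congr_hom (ht i j u) a)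
    refine ⟨↾f, fun j => by ext a; exact hf j a, fun g hg => ?_⟩
    have := hu (fun a => g a) (fun j a => ConcreteCategory.congr_hom (hg j) a)
    rw [← this]; rfl

variable {o o' : J → Type v} {m : ∀ i j : J, (i ⟶ j) → o i → o j}
  {m' : ∀ i j : J, (i ⟶ j) → o' i → o' j} {X X' : Type v} {x : ∀ j, o j → X} {x' : ∀ j, o' j → X'}

lemma IsColimT.of_equiv (h : IsColimT o m x) (e : ∀ j, o j ≃ o' j) (eX : X ≃ X')
    (hm : ∀ i j (u : i ⟶ j) a, e j (m i j u a) = m' i j u (e i a))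
    (hx : ∀ j a, eX (x j a) = x' j (e j a)) : IsColimT o' m' x' := by
  intro Y t ht
  obtain ⟨f, hf, hu⟩ := h Y (fun j a => t j (e j a)) (fun i j u a => by rw [hm, ht])
  refine ⟨fun a => f (eX.symm a), fun j a => ?_, fun g hg => ?_⟩
  · obtain ⟨a, rfl⟩ := (e j).surjective a
    change f (eX.symm (x' j (e j a))) = _
    rw [← hx, Equiv.symm_apply_apply, hf]
  · rw [← hu (fun a => g (eX a)) (fun j a => (congrArg g (hx j a)).trans (hg j _))]
    simp

lemma IsColimT.bijective (h : IsColimT o m x) (hx : ∀ i j (u : i ⟶ j) a, x j (m i j u a) = x i a)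
    {x' : ∀ j, o j → X'} (h' : IsColimT o m x')
    (hx' : ∀ i j (u : i ⟶ j) a, x' j (m i j u a) = x' i a)
    {f : X → X'} (hf : ∀ j a, f (x j a) = x' j a) : Function.Bijective f := by
  obtain ⟨g, hg, -⟩ := h' X x hx
  refine Function.bijective_iff_has_inverse.2 ⟨g, ?_, ?_⟩
  · exact congrFun ((h X x hx).unique (y₁ := fun a => g (f a)) (y₂ := id)
      (fun j a => by rw [hf, hg]) (fun j a => rfl))
  · exact congrFun ((h' X' x' hx').unique (y₁ := fun a => f (g a)) (y₂ := id)
      (fun j a => by rw [hg, hf]) (fun j a => rfl))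

/-- The pointwise product of a family of diagrams of sets. -/
@[simps]
def piDiagram {ι : Type v} (D : ι → J ⥤ Type v) : J ⥤ Type v where
  obj j := ∀ i, (D i).obj j
  map u := ↾fun a i => (D i).map u (a i)

/-- The product fan of a pointwise product. -/
def piFan {ι : Type v} (D : ι → J ⥤ Type v) : Fan D :=
  Fan.mk (piDiagram D) fun i => { app := fun j => ↾fun a => a i }

/-- The pointwise product is a product. -/
def piFanIsLimit {ι : Type v} (D : ι → J ⥤ Type v) : IsLimit (piFan D) :=
  Fan.IsLimit.mk _
    (fun s =>
      { app := fun j => ↾fun a i => (s.proj i).app j a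
        naturality := fun j k u => by
          ext a
          funext i
          exact NatTrans.naturality_apply (s.proj i) u a })
    (fun s i => by ext; rfl)
    (fun s f hf => by
      ext j a
      funext i
      exact ConcreteCategory.congr_hom (NatTrans.congr_app (hf i) j) a)

/-- Sifted colimits of sets commute with finite products. -/
lemma IsColimT.pi [IsSifted J] {ι : Type v} [Finite ι] (D : ι → J ⥤ Type v) {X : ι → Type v}
    (x : ∀ i j, (D i).obj j → X i)
    (hx : ∀ i j k (u : j ⟶ k) a, x i k ((D i).map u a) = x i j a)
    (h : ∀ i, IsColimT (D i).obj (fun _ _ u a => (D i).map u a) (x i)) :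
    IsColimT (fun j => ∀ i, (D i).obj j) (fun _ _ u a i => (D i).map u (a i))
      (X := ∀ i, X i) fun j a i => x i j (a i) := by
  have h1 : ∀ i, IsColimT (D i).obj (fun _ _ u a => (D i).map u a)
      (X := colimit (D i)) (fun j a => colimit.ι (D i) j a) := fun i =>
    (isColim_type_iff _).1 (isColim_colimit (D i))
  have h2 : IsColimT (fun j => ∀ i, (D i).obj j) (fun _ _ u a i => (D i).map u (a i))
      (X := colimit (piDiagram D)) (fun j a => colimit.ι (piDiagram D) j a) :=
    (isColim_type_iff (D := piDiagram D) _).1 (isColim_colimit (piDiagram D))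
  have hl := isLimitOfPreserves (colim : (J ⥤ Type v) ⥤ Type v) (piFanIsLimit D)
  choose e he _ using fun i => h1 i (X i) (x i) (hx i)
  have hw : ∀ i j k (u : j ⟶ k) a, colimit.ι (D i) k ((D i).map u a) = colimit.ι (D i) j a :=
    fun i j k u a => ConcreteCategory.congr_hom (colimit.w (D i) u) a
  have hb : ∀ i, Function.Bijective (e i) := fun i =>
    (h1 i).bijective (hw i) (h i) (hx i) (he i)
  let p : colimit (piDiagram D) → ∀ i, colimit (D i) := fun a i =>
    (colim.map ((piFan D).proj i)) a
  have hp : ∀ j a i, p (colimit.ι (piDiagram D) j a) i = colimit.ι (D i) j (a i) := by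
    intro j a i
    exact ConcreteCategory.congr_hom (ι_colimMap ((piFan D).proj i) j) a
  have hpb : Function.Bijective p := by
    have key : ∀ b : ∀ i, colimit (D i), ∃! f : PUnit.{v + 1} ⟶ colim.obj (piDiagram D),
        ∀ i, f ≫ colim.map ((piFan D).proj i) = ↾fun _ => b i := by
      intro b
      let s : Cone (Discrete.functor D ⋙ (colim : (J ⥤ Type v) ⥤ Type v)) :=
        ⟨PUnit.{v + 1}, { app := fun i => ↾fun _ => b i.as
                          naturality := fun i k u => by
                            obtain ⟨i⟩ := i; obtain ⟨k⟩ := k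
                            obtain rfl : i = k := Discrete.eq_of_hom u
                            have : u = 𝟙 _ := Subsingleton.elim _ _
                            rw [this]
                            simp }⟩
      exact ⟨hl.lift s, fun i => hl.fac s ⟨i⟩, fun g hg => hl.uniq s g fun i => hg i.as⟩
    constructor
    · intro a a' haa
      have := (key (p a)).unique (y₁ := ↾fun _ => a) (y₂ := ↾fun _ => a') (fun i => rfl)
        (fun i => by ext; exact (congrFun haa i).symm)
      exact ConcreteCategory.congr_hom this PUnit.unit
    · intro b
      obtain ⟨f, hf, -⟩ := key b
      exact ⟨f PUnit.unit, funext fun i => ConcreteCategory.congr_hom (hf i) PUnit.unit⟩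
  refine h2.of_equiv (fun j => Equiv.refl _)
    ((Equiv.ofBijective p hpb).trans (Equiv.piCongrRight fun i => Equiv.ofBijective (e i) (hb i)))
    (fun _ _ _ _ => rfl) (fun j a => ?_)
  funext i
  change e i (p _ i) = _
  exact (congrArg (e i) (hp j a i)).trans (he i j (a i))

end IsColimT

section Detect

variable {V : Type u} [Category.{v} V]

/-- The ordinary category `V` has a small set `G` of strongly finitely presentable objects such
that every object is a sifted colimit of objects of `G`. -/
structure IsSiftedDense (G : Set V) : Prop where
  sfp : ∀ Z ∈ G, IsSFP₀ Z
  dense : ∀ X : V, ∃ (J : Type v) (_ : SmallCategory J) (_ : IsSifted J) (D : J ⥤ V)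
    (c : Cocone D), c.pt = X ∧ (∀ j, D.obj j ∈ G) ∧ Nonempty (IsColimit c)

lemma IsSFP₀.isColimT {X : V} (hX : IsSFP₀ X) {J : Type v} [SmallCategory J] [IsSifted J]
    {D : J ⥤ V} {Y : V} {y : ∀ j, D.obj j ⟶ Y} (hy : ∀ i j (u : i ⟶ j), D.map u ≫ y j = y i)
    (h : IsColim D.obj (fun _ _ u => D.map u) y) :
    IsColimT (fun j => X ⟶ D.obj j) (fun _ _ u a => a ≫ D.map u) (fun j a => a ≫ y j) := by
  let c : Cocone D := ⟨Y, { app := y, naturality := fun i j u => by simpa using hy i j u }⟩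
  obtain ⟨hc⟩ := (nonempty_isColimit_iff c).2 h
  have := hX J
  have h2 := (nonempty_isColimit_iff _).1 ⟨isColimitOfPreserves (coyoneda.obj (op X)) hc⟩
  exact (isColim_type_iff (D := D ⋙ coyoneda.obj (op X)) _).1 h2

variable {G : Set V}

lemma IsSiftedDense.exists_cover (hG : IsSiftedDense G) (X : V) :
    ∃ (J : Type v) (_ : SmallCategory J) (_ : IsSifted J) (D : J ⥤ V) (x : ∀ j, D.obj j ⟶ X),
      (∀ j, D.obj j ∈ G) ∧ (∀ i j (u : i ⟶ j), D.map u ≫ x j = x i) ∧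
        IsColim D.obj (fun _ _ u => D.map u) x := by
  obtain ⟨J, _, _, D, c, rfl, hD, hc⟩ := hG.dense X
  exact ⟨J, _, ‹_›, D, c.ι.app, hD, fun i j u => c.w u, (nonempty_isColimit_iff c).1 hc⟩

lemma IsSiftedDense.hom_ext (hG : IsSiftedDense G) {X Y : V} {f g : X ⟶ Y}
    (h : ∀ Z ∈ G, ∀ z : Z ⟶ X, z ≫ f = z ≫ g) : f = g := by
  obtain ⟨J, _, _, D, x, hD, hx, hc⟩ := hG.exists_cover X
  exact hc.hom_ext hx fun j => h _ (hD j) _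

/-- A morphism that induces bijections on generalized elements of shape `Z ∈ G` is invertible. -/
lemma IsSiftedDense.isIso (hG : IsSiftedDense G) {X Y : V} (f : X ⟶ Y)
    (h : ∀ Z ∈ G, Function.Bijective fun z : Z ⟶ X => z ≫ f) : IsIso f := by
  obtain ⟨J, _, _, D, y, hD, hy, hc⟩ := hG.exists_cover Y
  choose g hg using fun j => (h _ (hD j)).2 (y j)
  obtain ⟨k, hk, -⟩ := hc X g (fun i j u => (h _ (hD i)).1 (by
    simp only [Category.assoc]
    exact ((congrArg _ (hg j)).trans (hy i j u)).trans (hg i).symm))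
  have hkf : k ≫ f = 𝟙 Y := hc.hom_ext hy fun j => by
    rw [← Category.assoc, hk, Category.comp_id]
    exact hg j
  refine ⟨k, hG.hom_ext fun Z hZ z => (h Z hZ).1 ?_, hkf⟩
  simp only [Category.assoc, hkf, Category.comp_id]

/-- Sifted colimits in `V` are detected by the functors `V(Z,-)` with `Z ∈ G`. -/
lemma IsSiftedDense.isColim [HasColimits V] (hG : IsSiftedDense G) {J : Type v} [SmallCategory J]
    [IsSifted J] {D : J ⥤ V} {X : V} {x : ∀ j, D.obj j ⟶ X}
    (hx : ∀ i j (u : i ⟶ j), D.map u ≫ x j = x i)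
    (h : ∀ Z ∈ G, IsColimT (fun j => Z ⟶ D.obj j) (fun _ _ u a => a ≫ D.map u)
      (fun j a => a ≫ x j)) : IsColim D.obj (fun _ _ u => D.map u) x := by
  have h0 := isColim_colimit D
  obtain ⟨f, hf, -⟩ := h0 X x hx
  have : IsIso f := hG.isIso f fun Z hZ => by
    refine ((hG.sfp Z hZ).isColimT (fun i j u => colimit.w D u) h0).bijective ?_ (h Z hZ) ?_ ?_
    · intro i j u a
      rw [Category.assoc, colimit.w]
    · intro i j u a
      rw [Category.assoc, hx]
    · intro j a
      rw [Category.assoc, hf]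
  exact h0.of_isIso f hf

/-- Sifted colimits in `V` commute with finite products. -/
lemma IsSiftedDense.isColim_pi [HasColimits V] [HasLimits V] (hG : IsSiftedDense G) {J : Type v}
    [SmallCategory J] [IsSifted J] {ι : Type v} [Finite ι] (D : ι → J ⥤ V) {X : ι → V}
    (x : ∀ i j, (D i).obj j ⟶ X i) (hx : ∀ i j k (u : j ⟶ k), (D i).map u ≫ x i k = x i j)
    (h : ∀ i, IsColim (D i).obj (fun _ _ u => (D i).map u) (x i)) :
    IsColim (fun j => ∏ᶜ fun i => (D i).obj j) (fun _ _ u => Limits.Pi.map fun i => (D i).map u)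
      (X := ∏ᶜ X) fun j => Limits.Pi.map fun i => x i j := by
  let P : J ⥤ V :=
    { obj := fun j => ∏ᶜ fun i => (D i).obj j
      map := fun u => Limits.Pi.map fun i => (D i).map u
      map_id := fun j => by apply Pi.hom_ext; intro i; simp
      map_comp := fun f g => by apply Pi.hom_ext; intro i; simp }
  have hP : ∀ j k (u : j ⟶ k), P.map u ≫ (Limits.Pi.map fun i => x i k) =
      Limits.Pi.map fun i => x i j := by
    intro j k u
    apply Pi.hom_ext
    intro i
    simp only [P, Category.assoc, Limits.Pi.map_π, Limits.Pi.map_π_assoc, hx]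
  refine hG.isColim (D := P) hP fun Z hZ => ?_
  refine (IsColimT.pi (fun i => D i ⋙ coyoneda.obj (op Z)) (X := fun i => (Z ⟶ X i))
    (fun i j a => a ≫ x i j) ?_ fun i => (hG.sfp Z hZ).isColimT (hx i) (h i)).of_equiv
    (fun j => ⟨fun a => Pi.lift a, fun f i => f ≫ Pi.π _ i, fun f => by funext i; simp,
      fun f => by apply Pi.hom_ext; intro i; simp⟩)
    ⟨fun a => Pi.lift a, fun f i => f ≫ Pi.π _ i, fun f => by funext i; simp,
      fun f => by apply Pi.hom_ext; intro i; simp⟩ ?_ ?_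
  · intro i j k u a
    change (a ≫ (D i).map u) ≫ _ = _
    rw [Category.assoc, hx]
  · intro j k u a
    apply Pi.hom_ext
    intro i
    simp [P]
  · intro j a
    apply Pi.hom_ext
    intro i
    simp

end Detect

section SF

variable {V : Type u} [Category.{v} V] [MonoidalCategory V] [SymmetricCategory V]
  [MonoidalClosed V] [HasColimits V] {G : Set V}

/-- An object all of whose tensor products with the generators are strongly finitely presentable
in the ordinary category is strongly finitely presentable in the `V`-category `V`. -/
lemma IsSiftedDense.isStronglyFinitelyPresentable (hG : IsSiftedDense G) {X : V}
    (hX : ∀ Z ∈ G, IsSFP₀ (X ⊗ Z)) : IsStronglyFinitelyPresentable V X := by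
  rw [isStronglyFinitelyPresentable_iff]
  intro J _ _ D Y y hy hc
  rw [conical_self_iff] at hc
  refine hG.isColim (D := D ⋙ under (rep X)) (fmap_compat (rep X) hy) fun Z hZ => ?_
  let D' : J ⥤ V :=
    { obj := fun j => dob D j
      map := fun {i j} u => un (dmap D i j u)
      map_id := fun i => by rw [dmap_id, un_eId]
      map_comp := fun f g => by rw [dmap_comp, un_ecomp] }
  refine ((hX Z hZ).isColimT (D := D') (fun i j u => ?_) hc).of_equiv
    (fun j => ⟨fun a => cc a, fun a => uc a, fun a => uc_cc a, fun a => cc_uc a⟩)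
    ⟨fun a => cc a, fun a => uc a, fun a => uc_cc a, fun a => cc_uc a⟩ ?_ ?_
  · change un (dmap D i j u) ≫ un (y j) = _
    rw [← un_ecomp, hy]
  · intro i j u a
    apply uc_injective
    change uc (cc (a ≫ un (dmap D i j u))) = uc (cc a ≫ fmap (rep X) (dmap D i j u))
    rw [fmap_rep, uc_comp_post, uc_cc, uc_cc]
  · intro j a
    apply uc_injective
    change uc (cc (a ≫ un (y j))) = uc (cc a ≫ fmap (rep X) (y j))
    rw [fmap_rep, uc_comp_post, uc_cc, uc_cc]

/-- The unit is strongly finitely presentable in the `V`-category `V`, as `V(I,-)` is the identity,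
whether or not it is so in the ordinary category. -/
lemma isStronglyFinitelyPresentable_unit : IsStronglyFinitelyPresentable V (𝟙_ V) := by
  rw [isStronglyFinitelyPresentable_iff]
  intro J _ _ D Y y hy hc
  rw [conical_self_iff] at hc
  let e : ∀ X : V, X ≅ EnrichedCategory.Hom (V := V) (𝟙_ V) X := fun X =>
    { hom := cc (λ_ X).hom
      inv := (λ_ _).inv ≫ uc (𝟙 _)
      hom_inv_id := by
        rw [leftUnitor_inv_naturality_assoc, ← uc_natural_left, Category.comp_id, uc_cc]
        simp
      inv_hom_id := by
        apply uc_injective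
        rw [uc_natural_left, uc_cc, leftUnitor_naturality]
        simp }
  have he : ∀ (X Z : V) (f : 𝟙_ V ⟶ EnrichedCategory.Hom (V := V) X Z),
      un f ≫ (e Z).hom = (e X).hom ≫ fmap (rep (𝟙_ V)) f := fun X Z f => by
    apply uc_injective
    rw [fmap_rep, uc_comp_post, uc_natural_left, uc_cc, uc_cc, leftUnitor_naturality]
  exact hc.of_iso (fun j => e _) (e Y) (fun i j u => he _ _ _) (fun j => he _ _ _)

end SF

/-! ### The weight for conical colimits -/

lemma leftUnitor_inv_rightUnitor_hom_assoc (V : Type u) [Category.{v} V] [MonoidalCategory V]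
    {X : V} (f : 𝟙_ V ⟶ X) : (λ_ (𝟙_ V)).inv ≫ (ρ_ (𝟙_ V)).hom ≫ f = f := by
  rw [← unitors_equal, Iso.inv_hom_id_assoc]

lemma rightUnitor_inv_leftUnitor_hom_assoc (V : Type u) [Category.{v} V] [MonoidalCategory V]
    {X : V} (f : 𝟙_ V ⟶ X) : (ρ_ (𝟙_ V)).inv ≫ (λ_ (𝟙_ V)).hom ≫ f = f := by
  rw [unitors_equal, Iso.inv_hom_id_assoc]

section Copower

variable {V : Type u} [Category.{v} V] [MonoidalCategory V] [SymmetricCategory V]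
  [MonoidalClosed V] [HasColimits V]

variable (V) in
/-- The coproduct of copies of the unit object indexed by a set. -/
def copow (S : Type v) : V := ∐ fun _ : S => 𝟙_ V

variable (V) in
/-- The coprojections of `copow`. -/
def copowι {S : Type v} (s : S) : 𝟙_ V ⟶ copow V S := Sigma.ι (fun _ : S => 𝟙_ V) s

/-- The universal property of `copow`. -/
def copowDesc {S : Type v} {X : V} (f : S → (𝟙_ V ⟶ X)) : copow V S ⟶ X := Sigma.desc f

@[simp]
lemma copowι_desc {S : Type v} {X : V} (f : S → (𝟙_ V ⟶ X)) (s : S) :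
    copowι V s ≫ copowDesc f = f s := Sigma.ι_desc _ _

@[simp]
lemma copowι_desc_assoc {S : Type v} {X Y : V} (f : S → (𝟙_ V ⟶ X)) (s : S) (g : X ⟶ Y) :
    copowι V s ≫ copowDesc f ≫ g = f s ≫ g := by
  rw [← Category.assoc, copowι_desc]

lemma copow_hom_ext {S : Type v} {X : V} {f g : copow V S ⟶ X}
    (h : ∀ s, copowι V s ≫ f = copowι V s ≫ g) : f = g := Sigma.hom_ext _ _ h

lemma copow_left_ext {S : Type v} {X Y : V} {f g : X ⊗ copow V S ⟶ Y}
    (h : ∀ s, X ◁ copowι V s ≫ f = X ◁ copowι V s ≫ g) : f = g := by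
  apply MonoidalClosed.curry_injective
  apply copow_hom_ext
  intro s
  rw [← MonoidalClosed.curry_natural_left, ← MonoidalClosed.curry_natural_left, h]

lemma copow_ext₂ {S S' : Type v} {Y : V} {f g : copow V S ⊗ copow V S' ⟶ Y}
    (h : ∀ s s', (copowι V s ⊗ₘ copowι V s') ≫ f = (copowι V s ⊗ₘ copowι V s') ≫ g) : f = g := by
  apply copow_left_ext
  intro s'
  rw [← cancel_epi (ρ_ _).inv]
  apply copow_hom_ext
  intro s
  have := h s s'
  rw [MonoidalCategory.tensorHom_def, Category.assoc, Category.assoc] at this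
  rw [rightUnitor_inv_naturality_assoc, rightUnitor_inv_naturality_assoc, this]

variable {J : Type v} [SmallCategory J]

/-- The objects of the free `V`-category on an ordinary category. -/
def FreeV (J : Type v) : Type v := J

/-- The `j`-th object of the free `V`-category on `J`. -/
def FreeV.of {J : Type v} (j : J) : FreeV J := j

/-- The object of `J` underlying an object of the free `V`-category. -/
def FreeV.to {J : Type v} (j : FreeV J) : J := j

variable (V) in
/-- Composition with a morphism of `J`, on the hom-objects of the free `V`-category. -/
def copowPost (i : J) {j k : J} (g : j ⟶ k) : copow V (i ⟶ j) ⟶ copow V (i ⟶ k) :=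
  copowDesc fun f => copowι V (f ≫ g)

lemma copowPost_comp (i : J) {j k l : J} (g : j ⟶ k) (h : k ⟶ l) :
    copowPost V i g ≫ copowPost V i h = copowPost V i (g ≫ h) := by
  apply copow_hom_ext
  intro f
  simp [copowPost]

variable (V) in
/-- Composition in the free `V`-category. -/
def freeComp (i j k : J) : copow V (i ⟶ j) ⊗ copow V (j ⟶ k) ⟶ copow V (i ⟶ k) :=
  MonoidalClosed.uncurry (copowDesc fun g =>
    MonoidalClosed.curry ((ρ_ (copow V (i ⟶ j))).hom ≫ copowPost V i g))

lemma ι_freeComp (i : J) {j k : J} (g : j ⟶ k) :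
    copow V (i ⟶ j) ◁ copowι V g ≫ freeComp V i j k = (ρ_ _).hom ≫ copowPost V i g := by
  rw [freeComp, ← MonoidalClosed.uncurry_natural_left, copowι_desc, MonoidalClosed.uncurry_curry]

lemma ι_ι_freeComp {i j k : J} (f : i ⟶ j) (g : j ⟶ k) :
    (copowι V f ⊗ₘ copowι V g) ≫ freeComp V i j k = (ρ_ _).hom ≫ copowι V (f ≫ g) := by
  rw [MonoidalCategory.tensorHom_def, Category.assoc, ι_freeComp, rightUnitor_naturality_assoc,
    copowPost, copowι_desc]

lemma ι_freeComp_assoc (i : J) {j k : J} (g : j ⟶ k) {X : V} (f : copow V (i ⟶ k) ⟶ X) :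
    copow V (i ⟶ j) ◁ copowι V g ≫ freeComp V i j k ≫ f = (ρ_ _).hom ≫ copowPost V i g ≫ f := by
  rw [← Category.assoc, ι_freeComp, Category.assoc]

lemma ι_ι_freeComp_assoc {i j k : J} (f : i ⟶ j) (g : j ⟶ k) {X : V}
    (h : copow V (i ⟶ k) ⟶ X) :
    (copowι V f ⊗ₘ copowι V g) ≫ freeComp V i j k ≫ h = (ρ_ _).hom ≫ copowι V (f ≫ g) ≫ h := by
  rw [← Category.assoc, ι_ι_freeComp, Category.assoc]

lemma freeComp_post (i j : J) {k l : J} (h : k ⟶ l) :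
    freeComp V i j k ≫ copowPost V i h = _ ◁ copowPost V j h ≫ freeComp V i j l := by
  apply copow_left_ext
  intro g
  rw [ι_freeComp_assoc, copowPost_comp, ← MonoidalCategory.whiskerLeft_comp_assoc, copowPost,
    copowPost, copowι_desc, ι_freeComp]
  rfl

/-- The free `V`-category on an ordinary category. -/
instance freeV : EnrichedCategory V (FreeV J) where
  Hom i j := copow V (i.to ⟶ j.to)
  id i := copowι V (𝟙 i.to)
  comp i j k := freeComp V i.to j.to k.to
  id_comp i j := by
    apply copow_hom_ext
    intro g
    rw [leftUnitor_inv_naturality_assoc, whisker_exchange_assoc, ι_freeComp,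
      rightUnitor_naturality_assoc, copowPost, copowι_desc, ← unitors_equal]
    simp
  comp_id i j := by
    rw [ι_freeComp, Iso.inv_hom_id_assoc]
    apply copow_hom_ext
    intro g
    simp [copowPost]
  assoc i j k l := by
    rw [Iso.inv_comp_eq]
    apply copow_left_ext
    intro h
    rw [whisker_exchange_assoc, ι_freeComp, rightUnitor_naturality_assoc, freeComp_post,
      associator_naturality_right_assoc, ← MonoidalCategory.whiskerLeft_comp_assoc, ι_freeComp]
    simp

variable (V) in
/-- The morphism of the free `V`-category given by a morphism of `J`. -/
def frι {i j : FreeV J} (f : i.to ⟶ j.to) : 𝟙_ V ⟶ (i ⟶[V] j) :=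
  copowι V f

variable {K : Type w} [EnrichedCategory V K]

/-- The `V`-functor on the free `V`-category given by an ordinary diagram. -/
@[reducible]
def freeFunctor (D : J ⥤ ForgetEnrichment V K) : EnrichedFunctor V (FreeV J) K where
  obj j := dob D j.to
  map i j := copowDesc fun u => dmap D i.to j.to u
  map_id i := (copowι_desc _ _).trans (dmap_id _ _)
  map_comp i j k := by
    apply copow_ext₂
    intro f g
    refine (ι_ι_freeComp_assoc f g _).trans ?_
    rw [copowι_desc, dmap_comp, tensorHom_comp_tensorHom_assoc, copowι_desc, copowι_desc, ecomp,
      ← unitors_equal, Iso.hom_inv_id_assoc]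

lemma frι_freeFunctor (D : J ⥤ ForgetEnrichment V K) {i j : FreeV J} (u : i.to ⟶ j.to) :
    frι V u ≫ (freeFunctor D).map i j = dmap D i.to j.to u := copowι_desc _ _

lemma frι_comp {i j k : FreeV J} (f : i.to ⟶ j.to) (g : j.to ⟶ k.to) :
    ecomp (frι V f) (frι V g) = frι V (i := i) (j := k) (f ≫ g) := by
  rw [ecomp, Iso.inv_comp_eq]
  refine (ι_ι_freeComp f g).trans ?_
  rw [unitors_equal]
  rfl

/-- The ordinary diagram underlying a `V`-functor on the free `V`-category. -/
@[simps]
def freeDiag (R : EnrichedFunctor V (FreeV J) K) : J ⥤ ForgetEnrichment V K where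
  obj j := ForgetEnrichment.of V (R.obj (FreeV.of j))
  map {i j} u := ForgetEnrichment.homOf V
    (frι V (i := FreeV.of i) (j := FreeV.of j) u ≫ R.map (FreeV.of i) (FreeV.of j))
  map_id i := by
    have h : frι V (i := FreeV.of i) (j := FreeV.of i) (𝟙 i) ≫ R.map (FreeV.of i) (FreeV.of i) =
      eId V _ := R.map_id (FreeV.of i)
    rw [h]
    exact ForgetEnrichment.homOf_eId _ _
  map_comp {i j k} f g := by
    have h := frι_comp (V := V) (i := FreeV.of i) (j := FreeV.of j) (k := FreeV.of k) f g
    refine (congrArg (fun z => ForgetEnrichment.homOf V (z ≫ R.map _ _)) h.symm).trans ?_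
    rw [ecomp_map]
    exact (homTo_comp' (ForgetEnrichment.homOf V (frι V f ≫ R.map _ _))
      (ForgetEnrichment.homOf V (frι V g ≫ R.map _ _))).symm

variable (V J) in
/-- The weight for conical colimits of shape `J`: it is constant at the unit object. -/
@[reducible]
def unitWeight : EnrichedFunctor V (FreeV J)ᵒᵖ V where
  obj _ := 𝟙_ V
  map a b := copowDesc (S := (b.unop.to ⟶ a.unop.to)) fun _ => eId V (𝟙_ V)
  map_id a := copowι_desc _ _
  map_comp a b c := by
    rw [eComp_op_eq]
    apply copow_ext₂ (S := (b.unop.to ⟶ a.unop.to)) (S' := (c.unop.to ⟶ b.unop.to))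
    intro f g
    rw [tensorHom_comp_tensorHom_assoc, copowι_desc, copowι_desc, eId_comp_tensor, Category.assoc]
    have h := BraidedCategory.braiding_naturality_assoc (copowι V f) (copowι V g)
      (freeComp V c.unop.to b.unop.to a.unop.to ≫ copowDesc fun _ => eId V (𝟙_ V))
    refine h.trans ?_
    rw [ι_ι_freeComp_assoc, copowι_desc, ← unitors_equal]
    simp
    rw [unitors_equal]

lemma act_unitWeight {i j : FreeV J} (u : i.to ⟶ j.to) :
    𝟙_ V ◁ frι V u ≫ act (unitWeight V J) (op j) (op i) = (ρ_ _).hom := by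
  have h := uc_natural_left (frι V u) ((unitWeight V J).map (op j) (op i))
  refine h.symm.trans ?_
  rw [← uc_eId]
  exact congrArg uc (copowι_desc _ _)

lemma free_act_ext {X Y : V} {i j : FreeV J}
    {f g : X ⊗ (op j ⟶[V] op i) ⟶ Y}
    (h : ∀ u : i.to ⟶ j.to, X ◁ frι V u ≫ f = X ◁ frι V u ≫ g) : f = g :=
  copow_left_ext (S := (i.to ⟶ j.to)) h

/-- A graded transformation out of the unit weight is a compatible family. -/
@[simps]
def GNat.ofCompat {W : V} {Q : EnrichedFunctor V (FreeV J)ᵒᵖ V}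
    (t : ∀ j : FreeV J, W ⟶ Q.obj (op j))
    (ht : ∀ (i j : FreeV J) (u : i.to ⟶ j.to),
      t j ≫ fmap Q (a := op j) (b := op i) (frι V u) = t i) :
    GNat W (unitWeight V J) Q where
  app a := (ρ_ W).hom ≫ t a.unop
  natural := by
    rintro ⟨j⟩ ⟨i⟩
    rw [Iso.eq_inv_comp]
    apply free_act_ext
    intro u
    have h1 : Q.obj (op j) ◁ frι V u ≫ act Q (op j) (op i) =
        (ρ_ _).hom ≫ fmap Q (a := op j) (b := op i) (frι V u) := by
      rw [fmap, Iso.hom_inv_id_assoc]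
    have h3 := associator_naturality_right_assoc W (𝟙_ V) (frι V u)
      (W ◁ act (unitWeight V J) (op j) (op i) ≫ (ρ_ W).hom ≫ t i)
    refine h3.trans ?_
    have h4 := congrArg (fun z => W ◁ z ≫ (ρ_ W).hom ≫ t i) (act_unitWeight (V := V) u)
    simp only [MonoidalCategory.whiskerLeft_comp, Category.assoc] at h4
    refine (congrArg ((α_ _ _ _).hom ≫ ·) h4).trans ?_
    have h6 := whisker_exchange_assoc ((ρ_ W).hom ≫ t j) (frι V u) (act Q (op j) (op i))
    refine Eq.trans ?_ h6.symm
    refine Eq.trans ?_ (congrArg (((ρ_ W).hom ≫ t j) ▷ _ ≫ ·) h1).symm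
    rw [rightUnitor_naturality_assoc, Category.assoc, ht]
    simp

lemma GNat.compat {W : V} {Q : EnrichedFunctor V (FreeV J)ᵒᵖ V} (φ : GNat W (unitWeight V J) Q)
    {i j : FreeV J} (u : i.to ⟶ j.to) :
    ((ρ_ W).inv ≫ φ.app (op j)) ≫ fmap Q (a := op j) (b := op i) (frι V u) =
    (ρ_ W).inv ≫ φ.app (op i) := by
  have h := φ.fmap_naturality (a := op j) (b := op i) (frι V u)
  rw [Category.assoc, ← h, fmap, act_unitWeight]
  simp

/-- An ungraded transformation into `K(R-, X)` is a weighted cocone. -/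
@[simps]
def GNat.toCocone {D : Type w'} [EnrichedCategory V D] {F : EnrichedFunctor V Dᵒᵖ V}
    {R : EnrichedFunctor V D K} {X : K} (φ : GNat (𝟙_ V) F (nerveObj R X)) :
    WeightedCocone F R X where
  leg a := (λ_ _).inv ≫ φ.app (op a)
  natural a b := by
    have h := (natural_cocone_iff (W := 𝟙_ V) (F := F) (R := R) (X := X)
      (fun a => (ρ_ _).hom ≫ (λ_ _).inv ≫ φ.app (op a)) a b).2 (by
        simpa using φ.natural (op b) (op a))
    rw [tensor_comp_eq, Category.assoc, whiskerLeft_rightUnitor, Category.assoc,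
      Iso.cancel_iso_inv_left, rightUnitor_naturality_assoc, cancel_epi] at h
    exact h

lemma fmap_nerveObj_frι (R : EnrichedFunctor V (FreeV J) K) (Y : K) {i j : FreeV J}
    (u : i.to ⟶ j.to) :
    fmap (nerveObj R Y) (a := op j) (b := op i) (frι V u) = pre (frι V u ≫ R.map i j) Y :=
  fmap_nerveObj R Y (frι V u)

/-- The weighted cocone given by a compatible family of legs. -/
def conicalCocone (R : EnrichedFunctor V (FreeV J) K) {X : K} (x : ∀ j, 𝟙_ V ⟶ (R.obj j ⟶[V] X))
    (hx : ∀ (i j : FreeV J) (u : i.to ⟶ j.to), ecomp (frι V u ≫ R.map i j) (x j) = x i) :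
    WeightedCocone (unitWeight V J) R X :=
  (GNat.ofCompat (Q := nerveObj R X) x fun i j u => by
    rw [fmap_nerveObj_frι]; exact (comp_pre _ _).trans (hx i j u)).toCocone

lemma conicalCocone_leg (R : EnrichedFunctor V (FreeV J) K) {X : K}
    (x : ∀ j, 𝟙_ V ⟶ (R.obj j ⟶[V] X)) (hx) (j : FreeV J) :
    (conicalCocone R x hx).leg j = x j := by
  exact (leftUnitor_inv_rightUnitor_hom_assoc V (x j))

/-- Colimits weighted by `unitWeight` are conical colimits. -/
lemma unitWeight_isColimit_iff {R : EnrichedFunctor V (FreeV J) K} {X : K}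
    (c : WeightedCocone (unitWeight V J) R X) :
    c.IsColimit ↔ ∀ (Y : K) (W : V) (t : ∀ j : FreeV J, W ⟶ (R.obj j ⟶[V] Y)),
      (∀ (i j : FreeV J) (u : i.to ⟶ j.to), t j ≫ pre (frι V u ≫ R.map i j) Y = t i) →
        ∃! f : W ⟶ (X ⟶[V] Y), ∀ j, f ≫ pre (c.leg j) Y = t j := by
  have key : ∀ (Y : K) (W : V) (f : W ⟶ (X ⟶[V] Y)) (j : FreeV J),
      (β_ W (𝟙_ V)).hom ≫ (c.leg j ⊗ₘ f) ≫ eComp V (R.obj j) X Y =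
        (ρ_ W).hom ≫ f ≫ pre (c.leg j) Y := by
    intro Y W f j
    have h := comp_pre_eq (c.leg j) f
    rw [Iso.eq_inv_comp] at h
    rw [← h]
    simp
  rw [WeightedCocone.isColimit_iff]
  constructor
  · intro h Y W t ht
    refine (existsUnique_congr fun f => forall_congr' fun j => ?_).1
      (h W Y (GNat.ofCompat (Q := nerveObj R Y) t fun i j u => by
        rw [fmap_nerveObj_frι]; exact ht i j u))
    refine Iff.trans (Eq.congr (key Y W f j) rfl) ?_
    exact cancel_epi (ρ_ W).hom
  · intro h W Y t
    refine (existsUnique_congr fun f => forall_congr' fun j => ?_).1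
      (h Y W (fun j => (ρ_ W).inv ≫ t.app (op j)) fun i j u => by
        rw [← fmap_nerveObj_frι]
        exact t.compat u)
    refine Iff.trans ?_ (Eq.congr (key Y W f j) rfl).symm
    rw [Iso.eq_inv_comp]

/-- The conical colimit of a diagram as a weighted colimit. -/
lemma conicalCocone_isColimit_iff (D : J ⥤ ForgetEnrichment V K) {X : K}
    (x : ∀ j, 𝟙_ V ⟶ (dob D j ⟶[V] X)) (hx) :
    (conicalCocone (freeFunctor D) (X := X) x hx).IsColimit ↔ Conical D x := by
  rw [unitWeight_isColimit_iff]
  have key : ∀ {i j : FreeV J} (u : i.to ⟶ j.to),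
    frι V u ≫ (freeFunctor D).map i j = dmap D i.to j.to u := frι_freeFunctor D
  refine forall_congr' fun Y => forall_congr' fun W => forall_congr' fun t => ?_
  refine imp_congr ?_ ?_
  · refine forall_congr' fun i => forall_congr' fun j => forall_congr' fun u => ?_
    rw [key]
    rfl
  · refine existsUnique_congr fun f => forall_congr' fun j => ?_
    exact Iff.of_eq (congrArg (fun z => f ≫ pre z Y = t j)
      (conicalCocone_leg (freeFunctor D) (X := X) x hx j))

lemma isCompat_free {D : J ⥤ ForgetEnrichment V K} {X : K} {x : ∀ j, 𝟙_ V ⟶ (dob D j ⟶[V] X)}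
    (hx : IsCompat D x) (i j : FreeV J) (u : i.to ⟶ j.to) :
    ecomp (frι V u ≫ (freeFunctor D).map i j) (x j) = x i := by
  have := hx i.to j.to u
  rw [frι_freeFunctor]
  exact this

lemma WeightedCocone.leg_compat {R : EnrichedFunctor V (FreeV J) K} {X : K}
    (c : WeightedCocone (unitWeight V J) R X) (i j : FreeV J) (u : i.to ⟶ j.to) :
    ecomp (frι V u ≫ R.map i j) (c.leg j) = c.leg i := by
  have h := c.gnat.compat u
  rw [fmap_nerveObj_frι] at h
  have h2 : ∀ j : FreeV J, (ρ_ (𝟙_ V)).inv ≫ c.gnat.app (op j) = c.leg j := fun j => by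
    exact rightUnitor_inv_leftUnitor_hom_assoc V (c.leg j)
  rw [h2 j, h2 i] at h
  exact (comp_pre _ _).symm.trans h

/-- A `V`-category with colimits weighted by `unitWeight` has conical colimits. -/
lemma exists_conical (D : J ⥤ ForgetEnrichment V K)
    (h : ∃ (X : K) (c : WeightedCocone (unitWeight V J) (freeFunctor D) X), c.IsColimit) :
    ∃ (X : K) (x : ∀ j, 𝟙_ V ⟶ (dob D j ⟶[V] X)), IsCompat D x ∧ Conical D x := by
  obtain ⟨X, c, hc⟩ := h
  have hx : IsCompat D (X := X) c.leg := fun i j u => by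
    have := c.leg_compat (FreeV.of i) (FreeV.of j) u
    exact (congrArg (fun z => ecomp z (c.leg j))
      (frι_freeFunctor D (i := FreeV.of i) (j := FreeV.of j) u)).symm.trans this
  refine ⟨X, c.leg, hx, (conicalCocone_isColimit_iff D (X := X) c.leg (isCompat_free hx)).1 ?_⟩
  have : conicalCocone (freeFunctor D) (X := X) c.leg (isCompat_free hx) = c := by
    obtain ⟨l, hl⟩ := c
    have : (conicalCocone (freeFunctor D) (X := X) l (isCompat_free hx)).leg = l :=
      funext fun j => conicalCocone_leg _ _ _ j
    generalize conicalCocone (freeFunctor D) (X := X) l (isCompat_free hx) = c' at this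
    obtain ⟨l', hl'⟩ := c'
    obtain rfl : l' = l := this
    rfl
  rw [this]
  exact hc

/-- The coend with the unit weight is an ordinary colimit. -/
lemma coend_unitWeight_isColim (T : EnrichedFunctor V (FreeV J) V) :
    IsColim (fun j : J => T.obj (FreeV.of j))
      (fun i j u => fmap T (a := FreeV.of i) (b := FreeV.of j) (frι V u))
      (X := coend (unitWeight V J) T)
      (fun j => un ((coendCocone (unitWeight V J) T).leg (FreeV.of j))) := by
  have h := (unitWeight_isColimit_iff _).1 (coendCocone_isColimit (unitWeight V J) T)
  have h2 : Conical (freeDiag T) (X := coend (unitWeight V J) T)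
      (fun j => (coendCocone (unitWeight V J) T).leg (FreeV.of j)) := h
  have h3 := (conical_self_iff (freeDiag T) (X := coend (unitWeight V J) T)
    (fun j => (coendCocone (unitWeight V J) T).leg (FreeV.of j))).1 h2
  simp only [← un_comp_map]
  exact h3

end Copower

/-! ### Products of powers and coproducts of copowers -/

section Discrete

variable {V : Type u} [Category.{v} V] [MonoidalCategory V] [SymmetricCategory V]
  [MonoidalClosed V] [HasColimits V]
variable {ι : Type v} {K : Type w} [EnrichedCategory V K]

open Classical in
/-- The action on homs of the `V`-functor given by a family of objects. -/
def famMap (s : FreeDiscrete ι → K) (i j : FreeDiscrete ι) : discHom V i j ⟶ (s i ⟶[V] s j) :=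
  if h : i = j then discε V i j ≫ eId V (s i) ≫ eqToHom (by rw [h])
  else (discHomInitial h).to _

lemma famMap_self (s : FreeDiscrete ι → K) (i : FreeDiscrete ι) :
    famMap s i i = discε V i i ≫ eId V (s i) := by
  rw [famMap, dif_pos rfl, eqToHom_refl, Category.comp_id]

/-- The `V`-functor on the free `V`-category on a discrete category given by a family. -/
@[reducible]
def famFunctor (s : FreeDiscrete ι → K) : EnrichedFunctor V (FreeDiscrete ι) K where
  obj i := s i
  map i j := famMap s i j
  map_id i := by
    change eqToHom (discHom_self (V := V) i).symm ≫ famMap s i i = _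
    rw [famMap_self, discε_self]
    simp
  map_comp i j k := by
    by_cases h : i = j
    · subst h
      change discComp V i i k ≫ famMap s i k = (famMap s i i ⊗ₘ famMap s i k) ≫ _
      rw [discComp_self, famMap_self, comp_tensor_eq_assoc, Category.assoc]
      exact congrArg (_ ≫ ·) (eId_comp_tensor _).symm
    · exact (initialTensor _ (discHomInitial h)).hom_ext _ _

open Classical in
/-- The action on homs of the `V`-functor given by a family of objects, on the opposite of the
free `V`-category. -/
def famMapOp (s : FreeDiscrete ι → K) (i j : FreeDiscrete ι) : discHom V j i ⟶ (s i ⟶[V] s j) :=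
  if h : i = j then discε V j i ≫ eId V (s i) ≫ eqToHom (by rw [h])
  else (discHomInitial (Ne.symm h)).to _

lemma famMapOp_self (s : FreeDiscrete ι → K) (i : FreeDiscrete ι) :
    famMapOp s i i = discε V i i ≫ eId V (s i) := by
  rw [famMapOp, dif_pos rfl, eqToHom_refl, Category.comp_id]

/-- The `V`-functor on the opposite of the free `V`-category on a discrete category given by a
family. -/
@[reducible]
def famFunctorOp (s : FreeDiscrete ι → K) : EnrichedFunctor V (FreeDiscrete ι)ᵒᵖ K where
  obj i := s i.unop
  map i j := famMapOp s i.unop j.unop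
  map_id i := by
    change eqToHom (discHom_self (V := V) i.unop).symm ≫ famMapOp s i.unop i.unop = _
    rw [famMapOp_self, discε_self]
    simp
  map_comp := by
    rintro ⟨i⟩ ⟨j⟩ ⟨k⟩
    by_cases h : k = j
    · subst h
      change ((β_ _ _).hom ≫ discComp V k k i) ≫ famMapOp s i k =
        (famMapOp s i k ⊗ₘ famMapOp s k k) ≫ _
      rw [discComp_self, famMapOp_self, tensor_comp_eq_assoc, Category.assoc, Category.assoc]
      refine Eq.trans ?_ (congrArg (_ ≫ ·) (comp_eId_tensor _).symm)
      rw [← BraidedCategory.braiding_naturality_right_assoc, braiding_leftUnitor_assoc]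
    · exact (tensorInitial _ (discHomInitial h)).hom_ext _ _

lemma isIso_eId_disc (i : FreeDiscrete ι) : IsIso (eId V (op i : (FreeDiscrete ι)ᵒᵖ)) := by
  change IsIso (eqToHom (discHom_self (V := V) i).symm)
  infer_instance

/-- A graded transformation out of a constant weight on a discrete category is a family of
morphisms. -/
@[simps]
def GNat.ofFamily {C W : V} {Q : EnrichedFunctor V (FreeDiscrete ι)ᵒᵖ V}
    (t : ∀ i : FreeDiscrete ι, W ⊗ C ⟶ Q.obj (op i)) : GNat W (constWeight ι C) Q where
  app a := t a.unop
  natural := by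
    rintro ⟨i⟩ ⟨j⟩
    by_cases h : j = i
    · subst h
      have := isIso_eId_disc (V := V) j
      refine (cancel_epi (W ◁ C ◁ eId V (op j : (FreeDiscrete ι)ᵒᵖ))).1 ?_
      have h1 := act_id (constWeight ι C) (op j)
      have h2 := act_id Q (op j)
      have h3 := (MonoidalCategory.whiskerLeft_comp_assoc W (C ◁ eId V (op j : (FreeDiscrete ι)ᵒᵖ))
        (act (constWeight ι C) (op j) (op j)) (t j)).symm.trans
          (congrArg (fun z => W ◁ z ≫ t j) h1)
      refine Eq.trans h3 ?_
      have h4 := associator_inv_naturality_right_assoc W C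
        (eId V (op j : (FreeDiscrete ι)ᵒᵖ)) (t j ▷ _ ≫ act Q (op j) (op j))
      refine Eq.trans ?_ h4.symm
      have h5 := whisker_exchange_assoc (t j) (eId V (op j : (FreeDiscrete ι)ᵒᵖ))
        (act Q (op j) (op j))
      refine Eq.trans ?_ (congrArg ((α_ _ _ _).inv ≫ ·) h5).symm
      rw [h2]
      have h6 : W ◁ (ρ_ C).hom ≫ t j =
          (α_ W C (𝟙_ V)).inv ≫ t j ▷ 𝟙_ V ≫ (ρ_ (Q.obj (op j))).hom := by
        rw [rightUnitor_naturality, whiskerLeft_rightUnitor, Category.assoc]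
      exact h6
    · exact (tensorInitial W (tensorInitial C (discHomInitial h))).hom_ext _ _

/-- An ungraded transformation into `K(X, S-)` is a weighted cone. -/
@[simps]
def GNat.toCone {D : Type w'} [EnrichedCategory V D] {F : EnrichedFunctor V D V}
    {S : EnrichedFunctor V D K} {X : K} (φ : GNat (𝟙_ V) F (vcomp S (rep X))) :
    WeightedCone F S X where
  leg a := (λ_ _).inv ≫ φ.app a
  natural a b := by
    have h := φ.toParamCone.natural a b
    rw [GNat.toParamCone_leg] at h
    rw [comp_tensor_eq, Category.assoc, h]
    simp

/-- The cone over a family of objects with the given legs. -/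
def famCone {C : V} {S : EnrichedFunctor V (FreeDiscrete ι)ᵒᵖ K} {X : K}
    (x : ∀ i : FreeDiscrete ι, C ⟶ (X ⟶[V] S.obj (op i))) : WeightedCone (constWeight ι C) S X :=
  (GNat.ofFamily (Q := vcomp S (rep X)) fun i => (λ_ _).hom ≫ x i).toCone

lemma famCone_leg {C : V} {S : EnrichedFunctor V (FreeDiscrete ι)ᵒᵖ K} {X : K}
    (x : ∀ i : FreeDiscrete ι, C ⟶ (X ⟶[V] S.obj (op i))) (i : (FreeDiscrete ι)ᵒᵖ) :
    (famCone x).leg i = x i.unop := by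
  change (λ_ _).inv ≫ (λ_ _).hom ≫ x i.unop = _
  simp

/-- The cocone under a family of objects with the given legs. -/
def famCocone {C : V} {R : EnrichedFunctor V (FreeDiscrete ι) K} {X : K}
    (x : ∀ i : FreeDiscrete ι, C ⟶ (R.obj i ⟶[V] X)) : WeightedCocone (constWeight ι C) R X :=
  (GNat.ofFamily (Q := nerveObj R X) fun i => (λ_ _).hom ≫ x i).toCocone

lemma famCocone_leg {C : V} {R : EnrichedFunctor V (FreeDiscrete ι) K} {X : K}
    (x : ∀ i : FreeDiscrete ι, C ⟶ (R.obj i ⟶[V] X)) (i : FreeDiscrete ι) :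
    (famCocone x).leg i = x i := by
  change (λ_ _).inv ≫ (λ_ _).hom ≫ x i = _
  simp

/-- The elementary form of a limit with a constant weight on a discrete category. -/
lemma famCone_isLimit_iff {C : V} {S : EnrichedFunctor V (FreeDiscrete ι)ᵒᵖ K} {X : K}
    (c : WeightedCone (constWeight ι C) S X) : c.IsLimit ↔
      ∀ (Y : K) (W : V) (t : ∀ i : FreeDiscrete ι, W ⊗ C ⟶ (Y ⟶[V] S.obj (op i))),
        ∃! f : W ⟶ (Y ⟶[V] X), ∀ i, (f ⊗ₘ c.leg (op i)) ≫ eComp V Y X (S.obj (op i)) = t i := by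
  rw [WeightedCone.isLimit_iff]
  constructor
  · intro h Y W t
    refine (existsUnique_congr fun f => ?_).1 (h W Y (GNat.ofFamily (Q := vcomp S (rep Y)) t))
    exact ⟨fun H i => H (op i), fun H i => H i.unop⟩
  · intro h W Y t
    refine (existsUnique_congr fun f => ?_).1 (h Y W fun i => t.app (op i))
    exact ⟨fun H i => H i.unop, fun H i => H (op i)⟩

/-- The elementary form of a colimit with a constant weight on a discrete category. -/
lemma famCocone_isColimit_iff {C : V} {R : EnrichedFunctor V (FreeDiscrete ι) K} {X : K}
    (c : WeightedCocone (constWeight ι C) R X) : c.IsColimit ↔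
      ∀ (Y : K) (W : V) (t : ∀ i : FreeDiscrete ι, C ⊗ W ⟶ (R.obj i ⟶[V] Y)),
        ∃! f : W ⟶ (X ⟶[V] Y), ∀ i, (c.leg i ⊗ₘ f) ≫ eComp V (R.obj i) X Y = t i := by
  constructor
  · intro h Y W t
    exact h W Y (GNat.ofFamily (Q := nerveObj R Y) fun i =>
      (β_ W C).hom ≫ t i).toParamCocone |>.imp fun f hf => ⟨fun i => by
        refine (hf.1 i).trans ?_
        exact SymmetricCategory.symmetry_assoc C W (t i), fun g hg => hf.2 g fun i => by
        refine (hg i).trans ?_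
        exact (SymmetricCategory.symmetry_assoc C W (t i)).symm⟩
  · intro h W Y t
    exact h Y W t.leg

/-- The elementary form of a limit in `V` with a constant weight on a discrete category. -/
lemma famCone_isLimit_iff_self {C : V} {S : EnrichedFunctor V (FreeDiscrete ι)ᵒᵖ V} {X : V}
    (c : WeightedCone (constWeight ι C) S X) : c.IsLimit ↔
      ∀ (W : V) (t : ∀ i : FreeDiscrete ι, W ⊗ C ⟶ S.obj (op i)),
        ∃! f : W ⟶ X, ∀ i, f ▷ C ≫ uc (c.leg (op i)) = t i := by
  rw [WeightedCone.isLimit_iff_gnat]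
  constructor
  · intro h W t
    refine (existsUnique_congr fun f => ?_).1 (h W (GNat.ofFamily (Q := S) t))
    exact ⟨fun H i => H (op i), fun H i => H i.unop⟩
  · intro h W t
    refine (existsUnique_congr fun f => ?_).1 (h W fun i => t.app (op i))
    exact ⟨fun H i => H i.unop, fun H i => H (op i)⟩

end Discrete

/-! ### Weights whose limits commute with sifted colimits -/

section NatIso

variable {V : Type u} [Category.{v} V] [MonoidalCategory V] [SymmetricCategory V]
  [MonoidalClosed V]
variable {D : Type w'} [EnrichedCategory V D] {K : Type w} [EnrichedCategory V K]

lemma fmap_natural {P P' : EnrichedFunctor V K V} (n : ∀ X, P.obj X ⟶ P'.obj X)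
    (hn : ∀ X Y, act P X Y ≫ n Y = n X ▷ _ ≫ act P' X Y) {X Y : K} (f : 𝟙_ V ⟶ (X ⟶[V] Y)) :
    fmap P f ≫ n Y = n X ≫ fmap P' f := by
  rw [fmap, fmap, Category.assoc, Category.assoc, hn, whisker_exchange_assoc,
    rightUnitor_inv_naturality_assoc]

lemma WeightedCone.map_isLimit_of_natIso {P P' : EnrichedFunctor V K V}
    (n : ∀ X, P.obj X ≅ P'.obj X)
    (hn : ∀ X Y, act P X Y ≫ (n Y).hom = (n X).hom ▷ _ ≫ act P' X Y)
    {L : EnrichedFunctor V D V} {S : EnrichedFunctor V D K} {X : K} (c : WeightedCone L S X)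
    (h : (c.map P).IsLimit) : (c.map P').IsLimit := by
  rw [WeightedCone.isLimit_iff_gnat] at h ⊢
  intro W φ
  have hn' : ∀ X Y, act P' X Y ≫ (n Y).inv = (n X).inv ▷ _ ≫ act P X Y := fun X Y => by
    rw [Iso.comp_inv_eq, Category.assoc, hn, ← comp_whiskerRight_assoc, Iso.inv_hom_id]
    simp
  let ψ : ∀ a, W ⊗ L.obj a ⟶ P'.obj (S.obj a) := φ.app
  have hψ : ∀ a b, W ◁ act L a b ≫ ψ b = (α_ _ _ _).inv ≫ ψ a ▷ _ ≫
      P'.obj (S.obj a) ◁ S.map a b ≫ act P' (S.obj a) (S.obj b) := fun a b => by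
    have h1 : act (S.comp V P') a b = _ := act_vcomp S P' a b
    exact (φ.natural a b).trans (congrArg (fun z => (α_ _ _ _).inv ≫ ψ a ▷ _ ≫ z) h1)
  have key : ∀ a b, W ◁ act L a b ≫ ψ b ≫ (n (S.obj b)).inv =
      (α_ _ _ _).inv ≫ (ψ a ≫ (n (S.obj a)).inv) ▷ _ ≫
        P.obj (S.obj a) ◁ S.map a b ≫ act P (S.obj a) (S.obj b) := fun a b => by
    rw [reassoc_of% (hψ a b), hn', comp_whiskerRight_assoc, whisker_exchange_assoc]
  let φ' : GNat W L (S.comp V P) :=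
    { app := fun a => ψ a ≫ (n (S.obj a)).inv
      natural := fun a b => by
        have h1 : act (S.comp V P) a b = _ := act_vcomp S P a b
        exact (key a b).trans (congrArg
          (fun z => (α_ _ _ _).inv ≫ (ψ a ≫ (n (S.obj a)).inv) ▷ _ ≫ z) h1).symm }
  refine (existsUnique_congr fun f => forall_congr' fun a => ?_).1
    (existsUnique_iso (n X).symm (h W φ'))
  have h4 : uc ((c.map P).leg a) = P.obj X ◁ c.leg a ≫ act P X (S.obj a) := uc_natural_left _ _
  have h5 : uc ((c.map P').leg a) = P'.obj X ◁ c.leg a ≫ act P' X (S.obj a) := uc_natural_left _ _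
  rw [h4, h5]
  change (f ≫ (n X).inv) ▷ L.obj a ≫ P.obj X ◁ c.leg a ≫ act P X (S.obj a) =
    ψ a ≫ (n (S.obj a)).inv ↔ f ▷ L.obj a ≫ P'.obj X ◁ c.leg a ≫ act P' X (S.obj a) = ψ a
  rw [comp_whiskerRight_assoc, ← whisker_exchange_assoc, ← hn', Iso.eq_comp_inv]
  simp

end NatIso

section Eval

variable {V : Type u} [Category.{v} V] [MonoidalCategory V] [SymmetricCategory V]
  [MonoidalClosed V] [HasLimits V]
variable {B : Type v} [EnrichedCategory V B]

/-- The Yoneda isomorphism `[B,V](B(b,-), Q) ≅ Q b`. -/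
@[simps]
def yonedaIso (b : B) (Q : EnrichedFunctor V B V) : (rep (V := V) b ⟶[V] Q) ≅ Q.obj b where
  hom := (ρ_ _).inv ≫ _ ◁ eId V b ≫ (evL (rep b) Q).app b
  inv := (yonL (𝟙 (Q.obj b))).lift
  hom_inv_id := by
    apply natHom_hom_ext
    intro a
    rw [comp_whiskerRight_assoc, GNat.lift_evL, yonL_app, id_whiskerRight, Category.id_comp,
      id_whiskerRight, Category.id_comp]
    conv_rhs => rw [GNat.eq_yonL (evL (rep b) Q)]
    rfl
  inv_hom_id := by
    rw [rightUnitor_inv_naturality_assoc, ← whisker_exchange_assoc, GNat.lift_evL, yonL_eval]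

lemma yonedaIso_natural (b : B) (Q Q' : EnrichedFunctor V B V) :
    act (rep (V := V) (rep (V := V) b)) Q Q' ≫ (yonedaIso b Q').hom =
      (yonedaIso b Q).hom ▷ _ ≫ act (evFunctor V b) Q Q' := by
  rw [act_rep, act_evFunctor, yonedaIso_hom, yonedaIso_hom,
    BraidedCategory.braiding_naturality_left_assoc, rightUnitor_inv_naturality_assoc,
    ← whisker_exchange_assoc, eComp_evL, MonoidalCategory.whiskerLeft_comp_assoc,
    MonoidalCategory.whiskerLeft_comp_assoc, whisker_exchange_assoc,
    associator_naturality_right_assoc]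
  simp

/-- Limits in a functor category are computed pointwise. -/
lemma WeightedCone.IsLimit.map_ev {D : Type w'} [EnrichedCategory V D]
    {L : EnrichedFunctor V D V} {S : EnrichedFunctor V D (EnrichedFunctor V B V)}
    {Q : EnrichedFunctor V B V} {c : WeightedCone L S Q} (h : c.IsLimit) (b : B) :
    (c.map (evFunctor V b)).IsLimit :=
  WeightedCone.map_isLimit_of_natIso (P := rep (rep (V := V) b)) (P' := evFunctor V b)
    (yonedaIso b) (yonedaIso_natural b) c (WeightedCone.map_rep_isLimit h (rep b))

lemma fmap_ev_ext {F G : EnrichedFunctor V B V} {α β : 𝟙_ V ⟶ (F ⟶[V] G)}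
    (h : ∀ b, fmap (evFunctor V b) α = fmap (evFunctor V b) β) : α = β := by
  apply natHom_hom_ext
  intro b
  have := h b
  rwa [fmap_evFunctor, fmap_evFunctor, Iso.cancel_iso_inv_left] at this

lemma fmap_ev_lift {F G : EnrichedFunctor V B V} (φ : GNat (𝟙_ V) F G) (b : B) :
    fmap (evFunctor V b) φ.lift = (λ_ _).inv ≫ φ.app b := by
  rw [fmap_evFunctor, GNat.lift_evL]

lemma fmap_swap_ev {C : Type v} [EnrichedCategory V C]
    (R : EnrichedFunctor V B (EnrichedFunctor V C V)) {c c' : C} (f : 𝟙_ V ⟶ (c ⟶[V] c')) (b : B) :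
    fmap (evFunctor V b) (f ≫ (swap R).map c c') = fmap (R.obj b) f := by
  have h := fmap_vcomp (swap R) (evFunctor V b) f
  refine h.symm.trans ?_
  rw [fmap, fmap]
  exact congrArg (fun z => (ρ_ _).inv ≫ (R.obj b).obj c ◁ f ≫ z) (act_ofBiaction _ _ _ _ _ _ _ _)

/-- A weighted cone in `V` is a limit cone if and only if the comparison map with the object of
natural transformations is invertible. -/
lemma WeightedCone.isLimit_iff_isIso {L S : EnrichedFunctor V B V} {X : V}
    (c : WeightedCone L S X) : c.IsLimit ↔ IsIso (GNat.lift c.gnat) := by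
  rw [c.isLimit_iff_gnat]
  have key : ∀ (W : V) (g : W ⟶ X) (φ : GNat W L S),
      (∀ a, g ▷ _ ≫ uc (c.leg a) = φ.app a) ↔ g ≫ GNat.lift c.gnat = φ.lift := by
    intro W g φ
    constructor
    · intro h
      apply natHom_hom_ext
      intro a
      rw [comp_whiskerRight_assoc, GNat.lift_evL, GNat.lift_evL, ← h]
      rfl
    · intro h a
      rw [← GNat.lift_evL, ← h, comp_whiskerRight_assoc, GNat.lift_evL]
      rfl
  simp only [key]
  constructor
  · intro h
    refine isIso_of_existsUnique _ fun W y => ?_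
    have := h W ((evL L S).restrict y)
    have h2 : GNat.lift ((evL L S).restrict y) = y := natHom_hom_ext fun a => by
      rw [GNat.lift_evL]; rfl
    rwa [h2] at this
  · intro h W φ
    exact ⟨φ.lift ≫ inv (GNat.lift c.gnat), by simp, fun g hg => by rw [← hg]; simp⟩

end Eval

section Good

variable {V : Type u} [Category.{v} V] [MonoidalCategory V] [SymmetricCategory V]
  [MonoidalClosed V] [HasLimits V]
variable {B : Type v} [EnrichedCategory V B]

/-- Limits weighted by `L` commute in `V` with sifted colimits: `[B,V](L,-)` preserves the sifted
colimits in `[B,V]` that are computed pointwise. -/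
def CommutesWithSifted (L : EnrichedFunctor V B V) : Prop :=
  ∀ (J : Type v) [SmallCategory J] [IsSifted J]
    (D : J ⥤ ForgetEnrichment V (EnrichedFunctor V B V)) (X : EnrichedFunctor V B V)
    (x : ∀ j, 𝟙_ V ⟶ (dob D j ⟶[V] X)), IsCompat D x → (∀ b, Pres (evFunctor V b) D x) →
      Pres (rep L) D x

lemma commutesWithSifted_rep (b : B) : CommutesWithSifted (rep (V := V) b) := by
  intro J _ _ D X x _ h
  exact (h b).of_natIso (fun Q => (yonedaIso b Q).symm) fun Q Q' f => by
    rw [Iso.symm_hom, Iso.symm_hom, Iso.comp_inv_eq, Category.assoc,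
      fmap_natural (P := rep (rep (V := V) b)) (P' := evFunctor V b)
        (fun Q => (yonedaIso b Q).hom) (yonedaIso_natural b), Iso.inv_hom_id_assoc]

variable {M : Type w} [EnrichedCategory V M]

lemma isCompat_forget {K : Type w'} [EnrichedCategory V K] (P : EnrichedFunctor V M K)
    {J : Type v} [SmallCategory J]
    {D : J ⥤ ForgetEnrichment V M} {X : M} {x : ∀ j, 𝟙_ V ⟶ (dob D j ⟶[V] X)}
    (hx : IsCompat D x) :
    IsCompat (D ⋙ P.forget) (X := P.obj X) fun j => x j ≫ P.map _ _ := by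
  intro i j u
  have := congrArg (· ≫ P.map (dob D i) X) (hx i j u)
  exact (ecomp_map P _ _).symm.trans this

lemma pres_forget {K : Type w'} [EnrichedCategory V K] (P : EnrichedFunctor V M K)
    (Q : EnrichedFunctor V K V) {J : Type v} [SmallCategory J]
    {D : J ⥤ ForgetEnrichment V M} {X : M} {x : ∀ j, 𝟙_ V ⟶ (dob D j ⟶[V] X)} :
    Pres Q (D ⋙ P.forget) (X := P.obj X) (fun j => x j ≫ P.map _ _) ↔ Pres (vcomp P Q) D x := by
  unfold Pres
  simp only [fmap_vcomp]
  exact Iff.rfl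

/-- A strongly finitely presentable object of `V` preserves the sifted colimits in `V` which are
the images of diagrams under `V`-functors. -/
lemma Pres.comp_sf {G : V} (hG : IsStronglyFinitelyPresentable V G) {P : EnrichedFunctor V M V}
    {J : Type v} [SmallCategory J] [IsSifted J]
    {D : J ⥤ ForgetEnrichment V M} {X : M} {x : ∀ j, 𝟙_ V ⟶ (dob D j ⟶[V] X)}
    (hx : IsCompat D x) (h : Pres P D x) : Pres (vcomp P (rep G)) D x := by
  rw [← pres_forget]
  refine (isStronglyFinitelyPresentable_iff G).1 hG J _ _ _ (isCompat_forget P hx) ?_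
  rw [conical_self_iff]
  simp only [un_comp_map]
  have h2 : ∀ i j (u : i ⟶ j), un (dmap (D ⋙ P.forget) i j u) = fmap P (dmap D i j u) :=
    fun i j u => un_comp_map P (dmap D i j u)
  simp only [h2]
  exact h

/-- The comparison `M(C,Y) ≅ [Aᵒᵖ,V](L, M(R-,Y))` for a weighted colimit `C = L * R`. -/
def colimitComparison {A : Type v} [EnrichedCategory V A] {L : EnrichedFunctor V Aᵒᵖ V}
    {R : EnrichedFunctor V A M} {C : M} (c : WeightedCocone L R C) (Y : M) :
    (C ⟶[V] Y) ⟶ (L ⟶[V] nerveObj R Y) := (c.param (𝟙 (C ⟶[V] Y))).toGNat.lift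

lemma colimitComparison_evL {A : Type v} [EnrichedCategory V A] {L : EnrichedFunctor V Aᵒᵖ V}
    {R : EnrichedFunctor V A M} {C : M} (c : WeightedCocone L R C) (Y : M) {W : V}
    (f : W ⟶ (C ⟶[V] Y)) (a : A) :
    (f ≫ colimitComparison c Y) ▷ _ ≫ (evL L (nerveObj R Y)).app (op a) =
      (β_ W _).hom ≫ (c.leg a ⊗ₘ f) ≫ eComp V (R.obj a) C Y := by
  rw [colimitComparison, comp_whiskerRight_assoc, GNat.lift_evL, ParamCocone.toGNat_app,
    BraidedCategory.braiding_naturality_left_assoc]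
  change _ ≫ _ ◁ f ≫ (c.leg a ⊗ₘ 𝟙 _) ≫ eComp V (R.obj a) C Y = _
  rw [← tensor_comp_eq_assoc, Category.comp_id]

/-- A weighted cocone is a colimit cocone if and only if the comparison maps are invertible. -/
lemma WeightedCocone.isColimit_iff_isIso {A : Type v} [EnrichedCategory V A]
    {L : EnrichedFunctor V Aᵒᵖ V} {R : EnrichedFunctor V A M} {C : M}
    (c : WeightedCocone L R C) : c.IsColimit ↔ ∀ Y, IsIso (colimitComparison c Y) := by
  rw [WeightedCocone.isColimit_iff]
  have key : ∀ (W : V) (Y : M) (f : W ⟶ (C ⟶[V] Y)) (t : GNat W L (nerveObj R Y)),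
      (∀ a, (β_ W (L.obj (op a))).hom ≫ (c.leg a ⊗ₘ f) ≫ eComp V (R.obj a) C Y = t.app (op a)) ↔
        f ≫ colimitComparison c Y = t.lift := by
    intro W Y f t
    simp only [← colimitComparison_evL]
    constructor
    · intro h
      apply natHom_hom_ext
      rintro ⟨a⟩
      rw [h a, GNat.lift_evL]
    · intro h a
      rw [h, GNat.lift_evL]
  simp only [key]
  constructor
  · intro h Y
    refine isIso_of_existsUnique _ fun W y => ?_
    have := h W Y ((evL L _).restrict y)
    have h2 : GNat.lift ((evL L (nerveObj R Y)).restrict y) = y := natHom_hom_ext fun a => by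
      rw [GNat.lift_evL]; rfl
    rwa [h2] at this
  · intro h W Y t
    have := h Y
    exact ⟨t.lift ≫ inv (colimitComparison c Y), by simp, fun g hg => by rw [← hg]; simp⟩

lemma colimitComparison_natural {A : Type v} [EnrichedCategory V A]
    {L : EnrichedFunctor V Aᵒᵖ V} {R : EnrichedFunctor V A M} {C : M}
    (c : WeightedCocone L R C) {Y Z : M} (f : 𝟙_ V ⟶ (Y ⟶[V] Z)) :
    post C f ≫ colimitComparison c Z =
      colimitComparison c Y ≫ post L (f ≫ (nerve R).map Y Z) := by
  apply natHom_hom_ext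
  rintro ⟨a⟩
  have h1 := post_evL L (f ≫ (nerve R).map Y Z) (op a)
  rw [colimitComparison_evL, comp_whiskerRight_assoc]
  refine Eq.trans ?_ (congrArg (colimitComparison c Y ▷ _ ≫ ·) h1).symm
  have h2 := fmap_nerve_ev R a f
  rw [fmap_vcomp] at h2
  have h3 := colimitComparison_evL c Y (𝟙 _) a
  rw [Category.id_comp] at h3
  refine Eq.trans ?_ (congrArg (colimitComparison c Y ▷ _ ≫ (evL L _).app (op a) ≫ ·) h2).symm
  rw [reassoc_of% h3, tensorHom_id, MonoidalCategory.tensorHom_def, Category.assoc, eComp_post]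

/-- A colimit with a weight that commutes with sifted colimits preserves the sifted colimits that
are preserved by all the objects of the diagram. -/
lemma CommutesWithSifted.pres {A : Type v} [EnrichedCategory V A] {L : EnrichedFunctor V Aᵒᵖ V}
    (hL : CommutesWithSifted L) {R : EnrichedFunctor V A M} {C : M} {c : WeightedCocone L R C}
    (hc : c.IsColimit) {J : Type v} [SmallCategory J] [IsSifted J] {D : J ⥤ ForgetEnrichment V M}
    {X : M} {x : ∀ j, 𝟙_ V ⟶ (dob D j ⟶[V] X)} (hx : IsCompat D x)
    (h : ∀ a, Pres (rep (R.obj a)) D x) : Pres (rep C) D x := by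
  have h1 := hL J (D ⋙ (nerve R).forget) _ _ (isCompat_forget (nerve R) hx) (by
    rintro ⟨a⟩
    rw [pres_forget]
    refine Pres.of_natIso (P := rep (R.obj a)) (Q := vcomp (nerve R) (evFunctor V (op a)))
      (fun Y => Iso.refl _) (fun Y Z f => ?_) (h a)
    have h1 := fmap_nerve_ev R a f
    have h2 := fmap_rep (R.obj a) f
    refine (Category.comp_id _).trans (Eq.trans ?_ (Category.id_comp _).symm)
    exact h2.trans h1.symm)
  rw [pres_forget] at h1
  have := c.isColimit_iff_isIso.1 hc
  refine h1.of_natIso (fun Y => (asIso (colimitComparison c Y)).symm) fun Y Z f => ?_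
  rw [Iso.symm_hom, Iso.symm_hom, Iso.comp_inv_eq, Category.assoc, fmap_rep, asIso_hom, asIso_inv,
    colimitComparison_natural, fmap_vcomp, fmap_rep]
  simp

end Good

/-! ### Finite products and powers commute with sifted colimits -/

section GoodWeights

variable {V : Type u} [Category.{v} V] [MonoidalCategory V] [SymmetricCategory V]
  [MonoidalClosed V] [HasLimits V] [HasColimits V]

section Const

variable {ι : Type v} (C : V) (Q : EnrichedFunctor V (FreeDiscrete ι)ᵒᵖ V)

/-- The components of a natural transformation out of a constant weight. -/
def constEv (i : FreeDiscrete ι) : (constWeight ι C ⟶[V] Q) ⊗ C ⟶ Q.obj (op i) :=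
  (evL (constWeight ι C) Q).app (op i)

variable {Q} in
lemma constEv_natural {Q' : EnrichedFunctor V (FreeDiscrete ι)ᵒᵖ V} (f : 𝟙_ V ⟶ (Q ⟶[V] Q'))
    (i : FreeDiscrete ι) :
    post (constWeight ι C) f ▷ C ≫ constEv C Q' i =
      constEv C Q i ≫ fmap (evFunctor V (op i)) f :=
  post_evL (constWeight ι C) f (op i)

variable {C Q} in
lemma lift_constEv {W : V} (t : ∀ i : FreeDiscrete ι, W ⊗ C ⟶ Q.obj (op i))
    (i : FreeDiscrete ι) : (GNat.ofFamily (C := C) t).lift ▷ C ≫ constEv C Q i = t i :=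
  GNat.lift_evL (GNat.ofFamily (C := C) t) (op i)

variable {C Q} in
lemma constEv_hom_ext {W : V} {f g : W ⟶ (constWeight ι C ⟶[V] Q)}
    (h : ∀ i, f ▷ C ≫ constEv C Q i = g ▷ C ≫ constEv C Q i) : f = g :=
  natHom_hom_ext fun i => h i.unop

/-- `[Aᵒᵖ,V](C, Q)` is a product of copies of `[C, Q i]`, for `A` discrete and `C` a constant
weight. -/
def constIso : (∏ᶜ fun i : FreeDiscrete ι => EnrichedCategory.Hom (V := V) C (Q.obj (op i))) ≅
    (constWeight ι C ⟶[V] Q) where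
  hom := (GNat.ofFamily (C := C) fun i => (β_ _ _).hom ≫ uc (Limits.Pi.π _ i)).lift
  inv := Limits.Pi.lift fun i => cc ((β_ _ _).hom ≫ constEv C Q i)
  hom_inv_id := by
    apply Limits.Pi.hom_ext
    intro i
    rw [Category.assoc, Limits.Pi.lift_π, Category.id_comp]
    apply uc_injective
    rw [uc_natural_left, uc_cc, BraidedCategory.braiding_naturality_right_assoc, lift_constEv,
      SymmetricCategory.symmetry_assoc]
  inv_hom_id := by
    apply constEv_hom_ext
    intro i
    rw [comp_whiskerRight, Category.assoc, lift_constEv, id_whiskerRight, Category.id_comp,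
      BraidedCategory.braiding_naturality_left_assoc, ← uc_natural_left, Limits.Pi.lift_π, uc_cc,
      SymmetricCategory.symmetry_assoc]

variable {Q} in
lemma constIso_natural {Q' : EnrichedFunctor V (FreeDiscrete ι)ᵒᵖ V} (f : 𝟙_ V ⟶ (Q ⟶[V] Q')) :
    Limits.Pi.map (fun i : FreeDiscrete ι => post C (f ≫ (evFunctor V (op i)).map Q Q')) ≫
      (constIso C Q').hom = (constIso C Q).hom ≫ post (constWeight ι C) f := by
  rw [← Iso.eq_comp_inv]
  apply Limits.Pi.hom_ext
  intro i
  rw [Limits.Pi.map_π]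
  apply uc_injective
  rw [Category.assoc, Category.assoc]
  have h1 : (constIso C Q').inv ≫ Limits.Pi.π _ i = cc ((β_ _ _).hom ≫ constEv C Q' i) :=
    Limits.Pi.lift_π _ _
  rw [h1, uc_comp_post, uc_natural_left, uc_natural_left, uc_cc,
    BraidedCategory.braiding_naturality_right_assoc, constEv_natural,
    BraidedCategory.braiding_naturality_right_assoc]
  have h2 : (constIso C Q).hom ▷ C ≫ constEv C Q i = _ := lift_constEv _ i
  rw [reassoc_of% h2, un_comp_map, SymmetricCategory.symmetry_assoc]

end Const

variable {G₀ : Set V}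

/-- Finite products and powers by strongly finitely presentable objects commute in `V` with sifted
colimits. -/
lemma IsSiftedDense.commutesWithSifted_constWeight (hG : IsSiftedDense G₀) (ι : Type v) [Finite ι]
    {C : V} (hC : IsStronglyFinitelyPresentable V C) :
    CommutesWithSifted (constWeight ι C) := by
  intro J _ _ D X x hx h
  have : Finite (FreeDiscrete ι) := ‹Finite ι›
  have h1 := hG.isColim_pi (ι := FreeDiscrete ι)
    (fun i => dunder (vcomp (evFunctor V (op i)) (rep C)) D)
    (fun i j => fmap (vcomp (evFunctor V (op i)) (rep C)) (x j))
    (fun i j k u => fmap_compat _ hx j k u)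
    (fun i => Pres.comp_sf hC hx (h (op i)))
  refine h1.of_iso (fun j => constIso C (dob D j)) (constIso C X) (fun i j u => ?_) (fun j => ?_)
  · rw [fmap_rep]
    refine Eq.trans ?_ (constIso_natural C (dmap D i j u))
    refine congrArg (fun z => Limits.Pi.map z ≫ _) (funext fun k => ?_)
    exact (fmap_vcomp _ _ _).trans (fmap_rep _ _)
  · rw [fmap_rep]
    refine Eq.trans ?_ (constIso_natural C (x j))
    refine congrArg (fun z => Limits.Pi.map z ≫ _) (funext fun k => ?_)
    exact (fmap_vcomp _ _ _).trans (fmap_rep _ _)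

lemma IsSiftedDense.commutesWithSifted_strongGen (hG : IsSiftedDense G₀) {A : Type v}
    [EnrichedCategory V A] {F : EnrichedFunctor V Aᵒᵖ V} (hF : StrongGen V A F) :
    CommutesWithSifted F := by
  cases hF with
  | finiteProduct ι => exact hG.commutesWithSifted_constWeight ι isStronglyFinitelyPresentable_unit
  | power C hC => exact hG.commutesWithSifted_constWeight _ hC

/-- A limit weighted by a colimit `F * S` is an `F`-weighted limit of limits weighted by the values
of `S`, so commutation with sifted colimits passes to the saturation. -/
lemma commutesWithSifted_saturation {Ψ : WeightClass V}
    (hΨ : ∀ (A : Type v) [EnrichedCategory V A] (F : EnrichedFunctor V Aᵒᵖ V), Ψ A F →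
      CommutesWithSifted F) {A : Type v} [iA : EnrichedCategory V A]
    {F : EnrichedFunctor V Aᵒᵖ V} (hF : Saturation Ψ A F) : CommutesWithSifted F := by
  induction hF with
  | base A F hF => exact hΨ A F hF
  | representable A a => rw [homFunctor_eq]; exact commutesWithSifted_rep (op a)
  | colimit D A F S L c hc hF hS ihF ihS =>
    intro J _ _ E X x hx h
    exact ihF.pres hc hx fun d => ihS d J E X x hx h

end GoodWeights

/-! ### Weights of sifted colimits are flat -/

section Flat

variable {V : Type u} [Category.{v} V] [MonoidalCategory V] [SymmetricCategory V]
  [MonoidalClosed V] [HasLimits V] [HasColimits V]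
variable {J : Type v} [SmallCategory J]

/-- A `V`-natural transformation as an ungraded element of `GNat`. -/
def GNat.ofNatural {A : Type w} [EnrichedCategory V A] {P P' : EnrichedFunctor V A V}
    (n : ∀ X, P.obj X ⟶ P'.obj X) (hn : ∀ X Y, act P X Y ≫ n Y = n X ▷ _ ≫ act P' X Y) :
    GNat (𝟙_ V) P P' where
  app a := (λ_ _).hom ≫ n a
  natural a b := by
    rw [leftUnitor_naturality_assoc, hn]
    simp

lemma vcomp_natural {A : Type w} [EnrichedCategory V A] {K : Type w'} [EnrichedCategory V K]
    (S : EnrichedFunctor V A K) {P P' : EnrichedFunctor V K V}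
    (n : ∀ X, P.obj X ⟶ P'.obj X) (hn : ∀ X Y, act P X Y ≫ n Y = n X ▷ _ ≫ act P' X Y) (a b : A) :
    act (vcomp S P) a b ≫ n (S.obj b) = n (S.obj a) ▷ _ ≫ act (vcomp S P') a b := by
  rw [act_vcomp, act_vcomp, Category.assoc, hn, whisker_exchange_assoc]

variable (J) in
/-- The coprojections of the colimit `unitWeight * T`. -/
def unitι (T : EnrichedFunctor V (FreeV J) V) (j : FreeV J) : T.obj j ⟶ coend (unitWeight V J) T :=
  un ((coendCocone (unitWeight V J) T).leg j)

lemma unitι_compat (T : EnrichedFunctor V (FreeV J) V) (i j : FreeV J) (u : i.to ⟶ j.to) :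
    fmap T (frι V u) ≫ unitι J T j = unitι J T i := by
  have h := congrArg un ((coendCocone (unitWeight V J) T).leg_compat i j u)
  rwa [un_ecomp, un_comp_map] at h

lemma unitι_natural (T T' : EnrichedFunctor V (FreeV J) V) (j : FreeV J) :
    act (evFunctor V j) T T' ≫ unitι J T' j =
      unitι J T j ▷ _ ≫ act (weightedColimitFunctor (unitWeight V J)) T T' := by
  let m : (T ⟶[V] T') ⟶ EnrichedCategory.Hom (V := V) (coend (unitWeight V J) T)
      (coend (unitWeight V J) T') :=
    (weightedColimitFunctor (unitWeight V J)).map T T'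
  have h1 : (λ_ _).inv ≫ ((coendCocone (unitWeight V J) T).leg j ⊗ₘ m) ≫ eComp V _ _ _ =
      (λ_ _).inv ≫ (β_ _ _).hom ≫
        (evalMap T T' j ⊗ₘ (coendCocone (unitWeight V J) T').leg j) ≫ eComp V _ _ _ :=
    congrArg (fun z => (λ_ _).inv ≫ z) (colimMap_spec (coendCocone_isColimit (unitWeight V J) T)
      (coendCocone (unitWeight V J) T') j)
  have h4 : m ≫ pre ((coendCocone (unitWeight V J) T).leg j) _ =
      evalMap T T' j ≫ post _ ((coendCocone (unitWeight V J) T').leg j) := by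
    rw [comp_pre_eq, comp_post_eq]
    refine h1.trans ?_
    change (λ_ _).inv ≫ (β_ (𝟙_ V) _).hom ≫ _ = _
    simp
  have h5 := congrArg uc h4
  rw [uc_comp_pre, uc_comp_post] at h5
  exact h5.symm

variable {D : Type v} [EnrichedCategory V D]

/-- The legs of the pointwise conical colimit of a diagram of `V`-functors. -/
def pointwiseι (S : EnrichedFunctor V D (EnrichedFunctor V (FreeV J) V)) (j : FreeV J) :
    𝟙_ V ⟶ ((swap S).obj j ⟶[V] vcomp S (weightedColimitFunctor (unitWeight V J))) :=
  (GNat.ofNatural (P := vcomp S (evFunctor V j))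
    (P' := vcomp S (weightedColimitFunctor (unitWeight V J))) (fun d => unitι J (S.obj d) j)
    (vcomp_natural S (P := evFunctor V j) (P' := weightedColimitFunctor (unitWeight V J))
      (fun T => unitι J T j) fun T T' => unitι_natural T T' j)).lift

lemma fmap_pointwiseι (S : EnrichedFunctor V D (EnrichedFunctor V (FreeV J) V)) (j : FreeV J)
    (d : D) : fmap (evFunctor V d) (pointwiseι S j) = unitι J (S.obj d) j := by
  refine (fmap_ev_lift (GNat.ofNatural (P := vcomp S (evFunctor V j))
    (P' := vcomp S (weightedColimitFunctor (unitWeight V J))) (fun d => unitι J (S.obj d) j)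
    (vcomp_natural S (P := evFunctor V j) (P' := weightedColimitFunctor (unitWeight V J))
      (fun T => unitι J T j) fun T T' => unitι_natural T T' j)) d).trans ?_
  exact Iso.inv_hom_id_assoc (λ_ ((S.obj d).obj j)) _

lemma isCompat_pointwiseι (S : EnrichedFunctor V D (EnrichedFunctor V (FreeV J) V)) :
    IsCompat (freeDiag (swap S)) (X := vcomp S (weightedColimitFunctor (unitWeight V J)))
      fun j => pointwiseι S (FreeV.of j) := by
  intro i j u
  apply fmap_ev_ext
  intro d
  refine (fmap_comp _ _ _).trans ?_
  refine Eq.trans ?_ (fmap_pointwiseι S (FreeV.of i) d).symm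
  have h1 := fmap_swap_ev S (frι V (i := FreeV.of i) (j := FreeV.of j) u) d
  have h2 := fmap_pointwiseι S (FreeV.of j) d
  refine (congr (congrArg (fun z w => z ≫ w) h1) h2).trans ?_
  exact unitι_compat (S.obj d) _ _ u

lemma pres_pointwiseι (S : EnrichedFunctor V D (EnrichedFunctor V (FreeV J) V)) (d : D) :
    Pres (evFunctor V d) (freeDiag (swap S))
      (X := vcomp S (weightedColimitFunctor (unitWeight V J)))
      fun j => pointwiseι S (FreeV.of j) := by
  refine IsColim.congr (coend_unitWeight_isColim (S.obj d)) (fun i j u => ?_) (fun j => ?_)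
  · exact (fmap_swap_ev S (frι V (i := FreeV.of i) (j := FreeV.of j) u) d).symm
  · exact (fmap_pointwiseι S (FreeV.of j) d).symm

section MapComparison

variable {K : Type w} [EnrichedCategory V K] {L : EnrichedFunctor V D V}
  {S : EnrichedFunctor V D K} {Q : K} (c : WeightedCone L S Q)

/-- The comparison map of the limit of the image of a diagram under a `V`-functor into `V`. -/
def mapComparison (P : EnrichedFunctor V K V) : P.obj Q ⟶ (L ⟶[V] vcomp S P) :=
  GNat.lift (WeightedCone.gnat (c.map P))

lemma mapComparison_evL (P : EnrichedFunctor V K V) (d : D) :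
    mapComparison c P ▷ _ ≫ (evL L (vcomp S P)).app d = P.obj Q ◁ c.leg d ≫ act P Q (S.obj d) := by
  refine (GNat.lift_evL _ d).trans ?_
  exact uc_natural_left _ _

lemma map_isLimit_iff (P : EnrichedFunctor V K V) :
    (c.map P).IsLimit ↔ IsIso (mapComparison c P) :=
  WeightedCone.isLimit_iff_isIso _

lemma mapComparison_natural {P P' : EnrichedFunctor V K V} (n : ∀ X, P.obj X ⟶ P'.obj X)
    (hn : ∀ X Y, act P X Y ≫ n Y = n X ▷ _ ≫ act P' X Y)
    (α : 𝟙_ V ⟶ (vcomp S P ⟶[V] vcomp S P'))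
    (hα : ∀ d, fmap (evFunctor V d) α = n (S.obj d)) :
    mapComparison c P ≫ post L α = n Q ≫ mapComparison c P' := by
  apply natHom_hom_ext
  intro d
  rw [comp_whiskerRight_assoc, comp_whiskerRight_assoc, mapComparison_evL, post_evL, hα]
  refine (Category.assoc _ _ _).symm.trans ?_
  refine (congrArg (· ≫ n (S.obj d)) (mapComparison_evL c P d)).trans ?_
  rw [Category.assoc, hn, whisker_exchange_assoc]

end MapComparison

lemma fmap_natural_act {A : Type v} [EnrichedCategory V A] {i j : A} (f : 𝟙_ V ⟶ (i ⟶[V] j))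
    (T T' : EnrichedFunctor V A V) :
    act (evFunctor V i) T T' ≫ fmap T' f = fmap T f ▷ _ ≫ act (evFunctor V j) T T' := by
  rw [act_evFunctor, act_evFunctor, Category.assoc, ← GNat.fmap_naturality,
    BraidedCategory.braiding_naturality_left_assoc]

lemma Pres.post {K : Type w} [EnrichedCategory V K] {L : K} {D : J ⥤ ForgetEnrichment V K} {X : K}
    {x : ∀ j, 𝟙_ V ⟶ (dob D j ⟶[V] X)} (h : Pres (rep L) D x) :
    IsColim (fun j => L ⟶[V] dob D j) (fun i j u => post L (dmap D i j u))
      (fun j => EnrichedLSFP.post L (x j)) :=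
  IsColim.congr h (fun _ _ _ => fmap_rep L _) (fun _ => fmap_rep L _)

/-- Weights whose limits commute with sifted colimits: the limits are preserved by sifted conical
colimits, regarded as weighted colimits. -/
lemma CommutesWithSifted.map_isLimit [IsSifted J] {L : EnrichedFunctor V D V}
    (hL : CommutesWithSifted L) {S : EnrichedFunctor V D (EnrichedFunctor V (FreeV J) V)}
    {Q : EnrichedFunctor V (FreeV J) V} {c : WeightedCone L S Q} (hc : c.IsLimit) :
    (c.map (weightedColimitFunctor (unitWeight V J))).IsLimit := by
  have hcj : ∀ j, IsIso (mapComparison c (evFunctor V j)) := fun j =>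
    (map_isLimit_iff c _).1 (hc.map_ev j)
  have h1 : IsColim (fun j : J => (L ⟶[V] (swap S).obj (FreeV.of j)))
      (fun i j u => post L (frι V (i := FreeV.of i) (j := FreeV.of j) u ≫ (swap S).map _ _))
      (fun j => post L (pointwiseι S (FreeV.of j))) :=
    (hL J (freeDiag (swap S)) (vcomp S (weightedColimitFunctor (unitWeight V J)))
      (fun j => pointwiseι S (FreeV.of j)) (isCompat_pointwiseι S) (pres_pointwiseι S)).post
  have hnat : ∀ (i j : FreeV J) (u : i.to ⟶ j.to),
      mapComparison c (evFunctor V i) ≫ post L (frι V u ≫ (swap S).map i j) =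
        fmap Q (frι V u) ≫ mapComparison c (evFunctor V j) := fun i j u =>
    mapComparison_natural (P := evFunctor V i) (P' := evFunctor V j) c
      (fun T => fmap T (frι V u)) (fmap_natural_act _) _ (fmap_swap_ev S (frι V u))
  rw [map_isLimit_iff]
  have h2 := fun j : J => mapComparison_natural (P := evFunctor V (FreeV.of j))
      (P' := weightedColimitFunctor (unitWeight V J)) c (fun T => unitι J T (FreeV.of j))
      (fun T T' => unitι_natural T T' _) (pointwiseι S (FreeV.of j)) (fmap_pointwiseι S _)
  refine IsColim.isIso (coend_unitWeight_isColim Q) (fun i j u => unitι_compat Q _ _ u)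
    (x' := fun j => mapComparison c (evFunctor V (FreeV.of j)) ≫ post L (pointwiseι S (FreeV.of j)))
    ?_ ?_ fun j => (h2 j).symm
  · refine h1.of_iso
      (fun j => (@asIso _ _ _ _ (mapComparison c (evFunctor V (FreeV.of j))) (hcj _)).symm)
      (Iso.refl _) (fun i j u => ?_) (fun j => ?_)
    · rw [Iso.symm_hom, Iso.symm_hom, Iso.comp_inv_eq, Category.assoc, Iso.eq_inv_comp]
      exact hnat _ _ u
    · rw [Iso.symm_hom]
      exact (Category.comp_id _).trans (Iso.inv_hom_id_assoc _ _).symm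
  · intro i j u
    refine (Category.assoc _ _ _).symm.trans ?_
    refine (congrArg (· ≫ post L (pointwiseι S (FreeV.of j)))
      (hnat (FreeV.of i) (FreeV.of j) u).symm).trans ?_
    refine (Category.assoc _ _ _).trans ?_
    refine congrArg (mapComparison c (evFunctor V (FreeV.of i)) ≫ ·) ?_
    refine (post_comp _ _ _).symm.trans ?_
    exact congrArg (fun z => post L z) (isCompat_pointwiseι S i j u)

lemma isFlat_unitWeight [IsSifted J] {Φ : WeightClass V}
    (hΦ : ∀ (A : Type v) [EnrichedCategory V A] (F : EnrichedFunctor V Aᵒᵖ V), Φ A F →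
      CommutesWithSifted F) : IsFlat Φ (unitWeight V J) :=
  fun A _ F hF _ _ _ hc => (hΦ A F hF).map_isLimit hc

end Flat

/-! ### Pointwise limits and colimits in functor categories -/

section Pointwise

variable {V : Type u} [Category.{v} V] [MonoidalCategory V] [SymmetricCategory V]
  [MonoidalClosed V] [HasLimits V]
variable {B : Type v} [EnrichedCategory V B] {K : Type w} [EnrichedCategory V K]
variable {D : Type w'} [EnrichedCategory V D]

lemma comp_evalMap_natural {F G : EnrichedFunctor V B K} {W : V} (f : W ⟶ (F ⟶[V] G)) (a b : B) :
    (F.map a b ⊗ₘ (f ≫ evalMap F G b)) ≫ eComp V (F.obj a) (F.obj b) (G.obj b) =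
      (β_ _ _).hom ≫ ((f ≫ evalMap F G a) ⊗ₘ G.map a b) ≫
        eComp V (F.obj a) (G.obj a) (G.obj b) := by
  rw [tensor_comp_eq_assoc, evalMap_natural, BraidedCategory.braiding_naturality_right_assoc,
    comp_tensor_eq_assoc]

/-- A cone in a functor category is a limit cone if it is one pointwise. -/
lemma WeightedCone.isLimit_of_ev {L : EnrichedFunctor V D V}
    {S : EnrichedFunctor V D (EnrichedFunctor V B K)} {Q : EnrichedFunctor V B K}
    (c : WeightedCone L S Q) (h : ∀ b, (c.map (evFunctor K b)).IsLimit) : c.IsLimit := by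
  intro W X t
  let tb : ∀ b, ParamCone L (S.comp V (evFunctor K b)) W (X.obj b) := fun b =>
    { leg := fun a => t.leg a ≫ evalMap X (S.obj a) b
      natural := fun a a' => by
        have h1 := t.natural a a' =≫ evalMap X (S.obj a') b
        rw [Category.assoc, eComp_evalMap, tensorHom_comp_tensorHom_assoc] at h1
        simp only [Category.assoc] at h1
        exact h1 }
  choose g hg hu using fun b => h b W (X.obj b) (tb b)
  have hg' : ∀ b a, (g b ⊗ₘ (c.leg a ≫ evalMap Q (S.obj a) b)) ≫ eComp V (X.obj b) (Q.obj b) _ =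
      t.leg a ≫ evalMap X (S.obj a) b := hg
  let γ : NatFamily X Q W :=
    { app := g
      natural := fun b b' => by
        refine ((h b') _ (X.obj b) (WeightedCone.param _ ((X.map b b' ⊗ₘ g b') ≫
          eComp V (X.obj b) (X.obj b') (Q.obj b')))).unique (fun a => rfl) (fun a => ?_)
        change _ = ((X.map b b' ⊗ₘ g b') ≫ eComp V _ _ _ ⊗ₘ
          (c.leg a ≫ evalMap Q (S.obj a) b')) ≫ eComp V _ _ _
        change (((β_ _ _).hom ≫ (g b ⊗ₘ Q.map b b') ≫ eComp V _ _ _) ⊗ₘ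
          (c.leg a ≫ evalMap Q (S.obj a) b')) ≫ eComp V _ _ _ = _
        have h1 := comp_assoc' (X.map b b') (g b') (c.leg a ≫ evalMap Q (S.obj a) b')
        have h2 := comp_assoc' (g b) (Q.map b b') (c.leg a ≫ evalMap Q (S.obj a) b')
        have h3 := comp_assoc' (g b) (c.leg a ≫ evalMap Q (S.obj a) b) ((S.obj a).map b b')
        rw [eq_comm, Iso.inv_comp_eq] at h1 h2
        rw [h1, hg', comp_evalMap_natural, comp_tensor_eq_assoc, h2, comp_evalMap_natural,
          tensor_comp_eq_assoc, h3, hg', BraidedCategory.braiding_tensor_right_hom]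
        simp only [Category.assoc]
        exact (Iso.hom_inv_id_assoc _ _).symm }
  refine ⟨natHomLift γ, fun a => ?_, fun f hf => ?_⟩
  · apply natHom_ext
    intro b
    change _ ≫ evalMap X (S.obj a) b = _ ≫ evalMap X (S.obj a) b
    have h1 : natHomLift γ ≫ evalMap X Q b = g b := natHomLift_app γ b
    rw [Category.assoc, eComp_evalMap, tensorHom_comp_tensorHom_assoc, h1, hg']
  · apply natHom_ext
    intro b
    refine Eq.trans ?_ (natHomLift_app γ b).symm
    refine hu b _ fun a => ?_
    have h1 := hf a =≫ evalMap X (S.obj a) b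
    rw [Category.assoc, eComp_evalMap, tensorHom_comp_tensorHom_assoc] at h1
    exact h1

/-- A cocone in a functor category is a colimit cocone if it is one pointwise. -/
lemma WeightedCocone.isColimit_of_ev {H : EnrichedFunctor V Dᵒᵖ V}
    {R : EnrichedFunctor V D (EnrichedFunctor V B K)} {C : EnrichedFunctor V B K}
    (c : WeightedCocone H R C) (h : ∀ b, (c.map (evFunctor K b)).IsColimit) : c.IsColimit := by
  intro W X t
  let tb : ∀ b, ParamCocone H (R.comp V (evFunctor K b)) W (X.obj b) := fun b =>
    { leg := fun a => t.leg a ≫ evalMap (R.obj a) X b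
      natural := fun a a' => by
        have h1 := t.natural a a' =≫ evalMap (R.obj a) X b
        rw [Category.assoc, eComp_evalMap, tensorHom_comp_tensorHom_assoc] at h1
        simp only [Category.assoc] at h1
        exact h1 }
  choose g hg hu using fun b => h b W (X.obj b) (tb b)
  have hg' : ∀ b a, ((c.leg a ≫ evalMap (R.obj a) C b) ⊗ₘ g b) ≫ eComp V _ (C.obj b) (X.obj b) =
      t.leg a ≫ evalMap (R.obj a) X b := hg
  let γ : NatFamily C X W :=
    { app := g
      natural := fun b b' => by
        refine (h b).hom_ext fun a => ?_
        change ((c.leg a ≫ evalMap (R.obj a) C b) ⊗ₘ ((C.map b b' ⊗ₘ g b') ≫ eComp V _ _ _)) ≫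
          eComp V _ _ _ = ((c.leg a ≫ evalMap (R.obj a) C b) ⊗ₘ ((β_ _ _).hom ≫
            (g b ⊗ₘ X.map b b') ≫ eComp V _ _ _)) ≫ eComp V _ _ _
        have h1 := comp_assoc' ((R.obj a).map b b') (c.leg a ≫ evalMap (R.obj a) C b') (g b')
        have h2 := comp_evalMap_natural (c.leg a) b b'
        have h3 : ((c.leg a ≫ evalMap (R.obj a) C b) ⊗ₘ C.map b b') ≫ eComp V _ _ _ =
            (β_ _ _).hom ≫ ((R.obj a).map b b' ⊗ₘ (c.leg a ≫ evalMap (R.obj a) C b')) ≫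
              eComp V _ _ _ := by
          rw [h2, SymmetricCategory.symmetry_assoc]
        rw [eq_comm, Iso.inv_comp_eq] at h1
        rw [comp_assoc', h3, comp_tensor_eq_assoc, h1, hg', comp_evalMap_natural,
          tensor_comp_eq_assoc, comp_assoc', hg', BraidedCategory.braiding_tensor_right_hom]
        have h4 : (β_ (H.obj (op a)) (b ⟶[V] b')).hom ▷ W ≫
            (β_ (b ⟶[V] b') (H.obj (op a))).hom ▷ W =
            𝟙 _ := by
          rw [← comp_whiskerRight, SymmetricCategory.symmetry, id_whiskerRight]
        simp only [Category.assoc, Iso.hom_inv_id_assoc]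
        rw [reassoc_of% h4]
        exact Iso.inv_hom_id_assoc _ _ }
  refine ⟨natHomLift γ, fun a => ?_, fun f hf => ?_⟩
  · apply natHom_ext
    intro b
    change _ ≫ evalMap (R.obj a) X b = _ ≫ evalMap (R.obj a) X b
    have h1 : natHomLift γ ≫ evalMap C X b = g b := natHomLift_app γ b
    rw [Category.assoc, eComp_evalMap, tensorHom_comp_tensorHom_assoc, h1, hg']
  · apply natHom_ext
    intro b
    refine Eq.trans ?_ (natHomLift_app γ b).symm
    refine hu b _ fun a => ?_
    have h1 := hf a =≫ evalMap (R.obj a) X b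
    rw [Category.assoc, eComp_evalMap, tensorHom_comp_tensorHom_assoc] at h1
    exact h1

end Pointwise

section PointwiseColimits

variable {V : Type u} [Category.{v} V] [MonoidalCategory V] [SymmetricCategory V]
  [MonoidalClosed V] [HasLimits V] [HasColimits V]
variable {B : Type v} [EnrichedCategory V B] {C : Type v} [EnrichedCategory V C]

/-- Conical colimits in functor categories are computed pointwise. -/
lemma Conical.of_pres {J : Type v} [SmallCategory J]
    {D : J ⥤ ForgetEnrichment V (EnrichedFunctor V B V)} {X : EnrichedFunctor V B V}
    {x : ∀ j, 𝟙_ V ⟶ (dob D j ⟶[V] X)} (hx : IsCompat D x)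
    (h : ∀ b, Pres (evFunctor V b) D x) : Conical D x := by
  rw [← conicalCocone_isColimit_iff D x (isCompat_free hx)]
  refine WeightedCocone.isColimit_of_ev _ fun b => ?_
  rw [unitWeight_isColimit_iff]
  intro Y W t ht
  have h1 : Conical (D ⋙ (evFunctor V b).forget) (X := X.obj b)
      fun j => x j ≫ (evFunctor V b).map _ _ := by
    rw [conical_self_iff]
    exact IsColim.congr (h b) (fun i j u => (un_comp_map (evFunctor V b) (dmap D i j u)).symm)
      (fun j => (un_comp_map (evFunctor V b) (x j)).symm)
  have h2 := h1 Y W (fun j => t (FreeV.of j)) fun i j u => by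
    refine Eq.trans ?_ (ht (FreeV.of i) (FreeV.of j) u)
    refine congrArg (fun z => t (FreeV.of j) ≫ pre z Y) ?_
    refine Eq.trans ?_ (Category.assoc _ _ _)
    exact (congrArg (· ≫ (evFunctor V b).map _ _)
      (frι_freeFunctor D (i := FreeV.of i) (j := FreeV.of j) u)).symm
  refine (existsUnique_congr fun f => forall_congr' fun j => ?_).1 h2
  refine Eq.congr (congrArg (fun z => f ≫ pre z Y) ?_) rfl
  exact congrArg (· ≫ (evFunctor V b).map _ _) (conicalCocone_leg (freeFunctor D) x _ j).symm

variable (H : EnrichedFunctor V Bᵒᵖ V) (R : EnrichedFunctor V B (EnrichedFunctor V C V))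

/-- The pointwise weighted colimit of a diagram of `V`-functors. -/
@[reducible]
def pointwiseColimit : EnrichedFunctor V C V := vcomp (swap R) (weightedColimitFunctor H)

/-- The legs of the pointwise weighted colimit. -/
def pointwiseLeg (b : B) : NatFamily (R.obj b) (pointwiseColimit H R) (H.obj (op b)) where
  app c := (coendCocone H ((swap R).obj c)).leg b
  natural c c' := by
    have h1 := colimMap_spec (coendCocone_isColimit H ((swap R).obj c))
      (coendCocone H ((swap R).obj c')) b
    have h2 : (swap R).map c c' ≫ evalMap _ _ b = (R.obj b).map c c' := by
      refine (ofBiaction_map_evalMap _ _ _ _ _ b c c').trans ?_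
      exact cc_uc _
    change _ = (β_ _ _).hom ≫ ((coendCocone H ((swap R).obj c)).leg b ⊗ₘ ((swap R).map c c' ≫
      colimMap (coendCocone_isColimit H ((swap R).obj c)) (coendCocone H ((swap R).obj c')))) ≫ _
    refine Eq.trans ?_ (congrArg ((β_ _ _).hom ≫ ·) (tensor_comp_eq_assoc _ _ _ _)).symm
    refine Eq.trans ?_ (congrArg (fun z => (β_ _ _).hom ≫ _ ◁ (swap R).map c c' ≫ z) h1).symm
    have h3 := BraidedCategory.braiding_naturality_right_assoc (H.obj (op b)) ((swap R).map c c')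
      ((evalMap ((swap R).obj c) ((swap R).obj c') b ⊗ₘ (coendCocone H ((swap R).obj c')).leg b) ≫
        eComp V _ _ _)
    refine Eq.trans ?_ (congrArg ((β_ _ _).hom ≫ ·) h3).symm
    refine Eq.trans ?_ (SymmetricCategory.symmetry_assoc _ _ _).symm
    refine Eq.trans ?_ (comp_tensor_eq_assoc _ _ _ _)
    exact congrArg (fun z => (z ⊗ₘ (coendCocone H ((swap R).obj c')).leg b) ≫ eComp V _ _ _) h2.symm

/-- The pointwise weighted colimit of a diagram of `V`-functors, as a cocone. -/
def pointwiseCocone : WeightedCocone H R (pointwiseColimit H R) where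
  leg b := natHomLift (pointwiseLeg H R b)
  natural a b := by
    apply natHom_ext
    intro c
    change _ ≫ evalMap _ _ c = _ ≫ evalMap _ _ c
    have h1 : ∀ b, natHomLift (pointwiseLeg H R b) ≫ evalMap _ _ c =
      (coendCocone H ((swap R).obj c)).leg b := fun b => natHomLift_app _ c
    rw [Category.assoc, eComp_evalMap, tensorHom_comp_tensorHom_assoc, Category.assoc, h1, h1]
    exact (coendCocone H ((swap R).obj c)).natural a b

lemma WeightedCocone.ext_leg {A : Type w'} [EnrichedCategory V A] {K : Type w}
    [EnrichedCategory V K] {F : EnrichedFunctor V Aᵒᵖ V} {S : EnrichedFunctor V A K} {X : K}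
    {c c' : WeightedCocone F S X} (h : ∀ a, c.leg a = c'.leg a) : c = c' := by
  obtain ⟨l, _⟩ := c
  obtain ⟨l', _⟩ := c'
  obtain rfl : l = l' := funext h
  rfl

lemma pointwiseCocone_map_ev (c : C) :
    (pointwiseCocone H R).map (evFunctor V c) = coendCocone H ((swap R).obj c) :=
  WeightedCocone.ext_leg fun b => natHomLift_app (pointwiseLeg H R b) c

lemma pointwiseCocone_isColimit : (pointwiseCocone H R).IsColimit := by
  refine WeightedCocone.isColimit_of_ev _ fun c => ?_
  rw [pointwiseCocone_map_ev]
  exact coendCocone_isColimit H _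

end PointwiseColimits

/-! ### The category of elements of a continuous functor -/

section Elements

variable {V : Type u} [Category.{v} V] [MonoidalCategory V] [SymmetricCategory V]
  [MonoidalClosed V]
variable {T : Type w} [EnrichedCategory V T]

/-- The component at `s` of the transformation `T(t,-) ⟶ F` which corresponds to `x : I ⟶ F t`. -/
def elMap (F : EnrichedFunctor V T V) {t : T} (x : 𝟙_ V ⟶ F.obj t) (s : T) :
    (t ⟶[V] s) ⟶ F.obj s :=
  (λ_ _).inv ≫ x ▷ _ ≫ act F t s

lemma elMap_comp_fmap (F : EnrichedFunctor V T V) {t p : T} (x : 𝟙_ V ⟶ F.obj t)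
    (g : 𝟙_ V ⟶ (t ⟶[V] p)) (s : T) : elMap F (x ≫ fmap F g) s = pre g s ≫ elMap F x s := by
  rw [elMap, elMap, comp_whiskerRight_assoc, ← act_pre, ← whisker_exchange_assoc,
    leftUnitor_inv_naturality_assoc]

lemma elMap_rep (r : T) {t : T} (x : 𝟙_ V ⟶ (r ⟶[V] t)) (s : T) :
    elMap (rep (V := V) r) x s = pre x s := by
  rw [elMap, act_rep]; rfl

lemma elMap_post (F : EnrichedFunctor V T V) {t : T} (x : 𝟙_ V ⟶ F.obj t) {s s' : T}
    (g : 𝟙_ V ⟶ (s ⟶[V] s')) : post t g ≫ elMap F x s' = elMap F x s ≫ fmap F g := by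
  rw [elMap, elMap, leftUnitor_inv_naturality_assoc, whisker_exchange_assoc, act_post]
  simp

lemma eId_elMap (F : EnrichedFunctor V T V) {t : T} (x : 𝟙_ V ⟶ F.obj t) :
    eId V t ≫ elMap F x t = x := by
  rw [elMap, leftUnitor_inv_naturality_assoc, whisker_exchange_assoc, act_id,
    rightUnitor_naturality]
  exact leftUnitor_inv_rightUnitor_hom_assoc V x

lemma comp_elMap (F : EnrichedFunctor V T V) {t s : T} (x : 𝟙_ V ⟶ F.obj t)
    (g : 𝟙_ V ⟶ (t ⟶[V] s)) : g ≫ elMap F x s = x ≫ fmap F g := by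
  rw [elMap, fmap, leftUnitor_inv_naturality_assoc, whisker_exchange_assoc,
    rightUnitor_inv_naturality_assoc, unitors_inv_equal]

/-- The objects of the category of elements of a `V`-functor `F : T ⟶ V`: pairs of an object `t`
and `x : I ⟶ F t`. -/
structure El (F : EnrichedFunctor V T V) where
  /-- the underlying object -/
  ob : T
  /-- the element -/
  el : 𝟙_ V ⟶ F.obj ob

/-- The category of elements of `F`, with the direction of the morphisms for which
`(t, x) ↦ T(t,-)` is covariant. -/
instance (F : EnrichedFunctor V T V) : Category.{v} (El F) where
  Hom e e' := {g : 𝟙_ V ⟶ (e'.ob ⟶[V] e.ob) // e'.el ≫ fmap F g = e.el}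
  id e := ⟨eId V e.ob, by rw [fmap_id, Category.comp_id]⟩
  comp f g := ⟨ecomp g.1 f.1, by rw [fmap_comp, ← Category.assoc, g.2, f.2]⟩
  id_comp {e e'} f := Subtype.ext (by
    change ecomp f.1 (eId V e.ob) = f.1
    rw [← comp_post, post_id, Category.comp_id])
  comp_id {e e'} f := Subtype.ext (by
    change ecomp (eId V e'.ob) f.1 = f.1
    rw [← comp_pre, pre_id, Category.comp_id])
  assoc f g h := Subtype.ext (by
    change ecomp h.1 (ecomp g.1 f.1) = ecomp (ecomp h.1 g.1) f.1
    rw [← comp_post, post_comp, ← Category.assoc, comp_post, comp_post])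

end Elements

section Continuous

variable {V : Type u} [Category.{v} V] [MonoidalCategory V] [SymmetricCategory V]
  [MonoidalClosed V] [HasLimits V] [HasColimits V]
variable {T : Type v} [EnrichedCategory V T]

lemma preservesLimitsIn_rep (Ψ : WeightClass V) {K : Type w} [EnrichedCategory V K] (t : K) :
    PreservesLimitsIn Ψ (rep (V := V) t) :=
  fun _ _ _ _ _ _ _ hc => WeightedCone.map_rep_isLimit hc t

/-- Finite products, and their preservation, in terms of elements. -/
lemma HasLimitsIn.exists_product (hT : HasLimitsIn (StrongGen V) T) (ι : Type v) [Finite ι]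
    (s : ι → T) : ∃ (p : T) (π : ∀ i, 𝟙_ V ⟶ (p ⟶[V] s i)),
      ∀ F : EnrichedFunctor V T V, PreservesLimitsIn (StrongGen V) F →
        ∀ y : ∀ i, 𝟙_ V ⟶ F.obj (s i), ∃! x : 𝟙_ V ⟶ F.obj p, ∀ i, x ≫ fmap F (π i) = y i := by
  obtain ⟨p, c, hc⟩ := hT _ _ (StrongGen.finiteProduct ι) (famFunctorOp s)
  refine ⟨p, fun i => c.leg (op i), fun F hF y => ?_⟩
  have h := (famCone_isLimit_iff_self _).1 (hF _ _ (StrongGen.finiteProduct ι) _ _ c hc)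
    (𝟙_ V) (fun i => (ρ_ _).hom ≫ y i)
  refine (existsUnique_congr fun x => forall_congr' fun i => ?_).1 h
  have h1 : uc ((c.map F).leg (op i)) = F.obj p ◁ c.leg (op i) ≫ act F p (s i) :=
    uc_natural_left _ _
  refine (Eq.congr (congrArg (x ▷ _ ≫ ·) h1) rfl).trans ?_
  have h2 : x ▷ 𝟙_ V ≫ F.obj p ◁ c.leg (op i) ≫ act F p (s i) = (ρ_ _).hom ≫ y i ↔
      x ≫ fmap F (c.leg (op i)) = y i := by
    rw [← Iso.inv_comp_eq, ← rightUnitor_inv_naturality_assoc]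
    exact Iff.rfl
  exact h2

/-- Powers, and their preservation, in terms of elements. -/
lemma HasLimitsIn.exists_power (hT : HasLimitsIn (StrongGen V) T) {Z : V}
    (hZ : IsStronglyFinitelyPresentable V Z) (s : T) : ∃ (p : T) (π : Z ⟶ (p ⟶[V] s)),
      ∀ F : EnrichedFunctor V T V, PreservesLimitsIn (StrongGen V) F →
        ∀ y : Z ⟶ F.obj s, ∃! x : 𝟙_ V ⟶ F.obj p, π ≫ elMap F x s = y := by
  obtain ⟨p, c, hc⟩ := hT _ _ (StrongGen.power Z hZ) (famFunctorOp fun _ => s)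
  refine ⟨p, c.leg (op PUnit.unit), fun F hF y => ?_⟩
  have h := (famCone_isLimit_iff_self _).1 (hF _ _ (StrongGen.power Z hZ) _ _ c hc)
    (𝟙_ V) (fun i => (λ_ _).hom ≫ y)
  refine (existsUnique_congr fun x => ?_).1 h
  have h1 : ∀ i, uc ((c.map F).leg (op i)) = F.obj p ◁ c.leg (op i) ≫ act F p s :=
    fun i => uc_natural_left _ _
  have h2 : x ▷ Z ≫ F.obj p ◁ c.leg (op PUnit.unit) ≫ act F p s = (λ_ _).hom ≫ y ↔
      c.leg (op PUnit.unit) ≫ elMap F x s = y := by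
    rw [← Iso.inv_comp_eq, elMap, leftUnitor_inv_naturality_assoc, whisker_exchange_assoc]
    exact Iff.rfl
  refine Iff.trans ?_ h2
  constructor
  · intro H
    refine Eq.trans ?_ (H PUnit.unit)
    exact (congrArg (x ▷ _ ≫ ·) (h1 PUnit.unit)).symm
  · intro H i
    refine Eq.trans ?_ H
    exact congrArg (x ▷ _ ≫ ·) (h1 i)

/-- The category of elements of a functor that preserves finite products is sifted. -/
lemma isSifted_el (hT : HasLimitsIn (StrongGen V) T) {F : EnrichedFunctor V T V}
    (hF : PreservesLimitsIn (StrongGen V) F) : IsSifted (El F) := by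
  have : Nonempty (El F) := by
    obtain ⟨p, π, h⟩ := hT.exists_product PEmpty.{v + 1} PEmpty.elim
    obtain ⟨x, -, -⟩ := h F hF fun i => i.elim
    exact ⟨⟨p, x⟩⟩
  have : HasBinaryCoproducts (El F) := by
    have (e e' : El F) : HasColimit (pair e e') := by
      obtain ⟨p, π, h⟩ := hT.exists_product (ULift.{v} Bool) fun b => if b.down then e.ob else e'.ob
      obtain ⟨x, hx, -⟩ := h F hF fun b => match b with
        | ⟨true⟩ => e.el
        | ⟨false⟩ => e'.el
      let P : El F := ⟨p, x⟩
      let i₁ : e ⟶ P := ⟨π ⟨true⟩, hx ⟨true⟩⟩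
      let i₂ : e' ⟶ P := ⟨π ⟨false⟩, hx ⟨false⟩⟩
      have key : ∀ {r : El F} (f : e ⟶ r) (g : e' ⟶ r), ∃! k : P ⟶ r, i₁ ≫ k = f ∧ i₂ ≫ k = g := by
        intro r f g
        obtain ⟨k, hk, hu⟩ := h (rep r.ob) (preservesLimitsIn_rep _ r.ob) fun b => match b with
          | ⟨true⟩ => f.1
          | ⟨false⟩ => g.1
        have hk1 : ecomp k (π ⟨true⟩) = f.1 := by
          rw [← comp_post, ← fmap_rep]; exact hk ⟨true⟩
        have hk2 : ecomp k (π ⟨false⟩) = g.1 := by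
          rw [← comp_post, ← fmap_rep]; exact hk ⟨false⟩
        refine ⟨⟨k, ?_⟩, ⟨Subtype.ext hk1, Subtype.ext hk2⟩, fun m hm => Subtype.ext (hu _ ?_)⟩
        · refine (h F hF (fun b => x ≫ fmap F (π b))).unique (fun b => ?_) fun b => rfl
          rw [hx, Category.assoc]
          rcases b with ⟨_ | _⟩
          · rw [← fmap_comp, hk2]; exact g.2
          · rw [← fmap_comp, hk1]; exact f.2
        · rintro ⟨_ | _⟩
          · rw [fmap_rep]; exact (comp_post _ _).trans (congrArg Subtype.val hm.2)
          · rw [fmap_rep]; exact (comp_post _ _).trans (congrArg Subtype.val hm.1)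
      exact ⟨⟨⟨_, BinaryCofan.isColimitMk (inl := i₁) (inr := i₂)
        (fun s => (key s.inl s.inr).choose)
        (fun s => (key s.inl s.inr).choose_spec.1.1) (fun s => (key s.inl s.inr).choose_spec.1.2)
        (fun s m h1 h2 => (key s.inl s.inr).choose_spec.2 m ⟨h1, h2⟩)⟩⟩⟩
    exact hasBinaryCoproducts_of_hasColimit_pair _
  exact IsSifted.isSifted_of_hasBinaryCoproducts_and_nonempty

/-- The diagram of the objects `T(t,s)` indexed by the category of elements. -/
def elDiagram (F : EnrichedFunctor V T V) (s : T) : El F ⥤ V where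
  obj e := (e.ob ⟶[V] s)
  map g := pre g.1 s
  map_id _ := pre_id _ _
  map_comp _ _ := pre_comp _ _ _

/-- A continuous functor is a sifted colimit of representables, and this colimit is already one
on the level of the underlying category of `V`: as the strongly finitely presentable objects
detect sifted colimits, the powers in `T` reduce the claim to the co-Yoneda lemma for the
functor of elements. -/
lemma IsSiftedDense.isColim_elements {G₀ : Set V} (hG : IsSiftedDense G₀)
    (hG' : ∀ Z ∈ G₀, IsStronglyFinitelyPresentable V Z) (hT : HasLimitsIn (StrongGen V) T)
    {F : EnrichedFunctor V T V} (hF : PreservesLimitsIn (StrongGen V) F) (s : T) :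
    IsColim (fun e : El F => (e.ob ⟶[V] s)) (fun (e e' : El F) (g : e ⟶ e') => pre g.1 s)
      (fun e => elMap F e.el s) := by
  have := isSifted_el hT hF
  refine hG.isColim (D := elDiagram F s) (fun e e' g => ?_) fun Z hZ => ?_
  · change pre g.1 s ≫ elMap F e'.el s = elMap F e.el s
    rw [← elMap_comp_fmap, g.2]
  · obtain ⟨p, π, hp⟩ := hT.exists_power (hG' Z hZ) s
    intro Y τ hτ
    choose x hx hu using hp F hF
    refine ⟨fun y => τ ⟨p, x y⟩ π, fun e a => ?_, fun f hf => ?_⟩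
    · obtain ⟨g, hg, -⟩ := hp (rep e.ob) (preservesLimitsIn_rep _ e.ob) a
      have hg' : π ≫ pre g s = a := by rw [← elMap_rep]; exact hg
      have hg2 : e.el ≫ fmap F g = x (a ≫ elMap F e.el s) := by
        refine hu _ _ ?_
        change π ≫ elMap F (e.el ≫ fmap F g) s = _
        rw [elMap_comp_fmap, reassoc_of% hg']
        rfl
      have := hτ ⟨p, x (a ≫ elMap F e.el s)⟩ e ⟨g, hg2⟩ π
      refine this.symm.trans ?_
      exact congrArg (τ e) hg'
    · funext y
      have h1 : π ≫ elMap F (x y) s = y := hx y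
      have h2 : f (π ≫ elMap F (x y) s) = _ := hf ⟨p, x y⟩ π
      rwa [h1] at h2

end Continuous

/-! ### Strongly finitely presentable objects of `V` form an essentially small class -/

lemma IsColimT.exists_eq {J : Type v} [SmallCategory J] {o : J → Type v}
    {m : ∀ i j : J, (i ⟶ j) → o i → o j} {X : Type v} {x : ∀ j, o j → X} (h : IsColimT o m x) (y : X) :
    ∃ j a, x j a = y := by
  have h1 := (h (ULift.{v} Prop) (fun _ _ => ⟨True⟩) fun _ _ _ _ => rfl).unique
    (y₁ := fun _ => ⟨True⟩) (y₂ := fun y => ⟨∃ j a, x j a = y⟩) (fun _ _ => rfl)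
    (fun j a => congrArg ULift.up (eq_true ⟨j, a, rfl⟩))
  exact of_eq_true (congrArg ULift.down (congrFun h1 y)).symm

section EssentiallySmall

variable {V : Type u} [Category.{v} V] [MonoidalCategory V] [SymmetricCategory V]
  [MonoidalClosed V] [HasLimits V] [HasColimits V]
variable {J : Type v} [SmallCategory J]

lemma nm_id (X : V) : nm (𝟙 X) = eId V X := by rw [← un_eId, nm_un]

lemma nm_comp {X Y Z : V} (f : X ⟶ Y) (g : Y ⟶ Z) : nm (f ≫ g) = ecomp (nm f) (nm g) := by
  rw [← nm_un (ecomp _ _), un_ecomp, un_nm, un_nm]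

/-- A diagram in `V`, as a diagram in the underlying category of the `V`-category `V`. -/
@[simps]
def selfDiagram (D : J ⥤ V) : J ⥤ ForgetEnrichment V V where
  obj j := ForgetEnrichment.of V (D.obj j)
  map u := ForgetEnrichment.homOf V (nm (D.map u))
  map_id j := by
    rw [D.map_id, nm_id]
    exact ForgetEnrichment.homOf_eId _ _
  map_comp {i j k} f g := by
    rw [D.map_comp, nm_comp]
    exact (homTo_comp' (ForgetEnrichment.homOf V (nm (D.map f)))
      (ForgetEnrichment.homOf V (nm (D.map g)))).symm

/-- The diagram of the hom-objects from `X` to the objects of a diagram. -/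
@[simps]
def homDiagram (X : V) (D : J ⥤ V) : J ⥤ V where
  obj j := EnrichedCategory.Hom (V := V) X (D.obj j)
  map u := post X (nm (D.map u))
  map_id j := by rw [D.map_id, nm_id, post_id]
  map_comp f g := by rw [D.map_comp, nm_comp, post_comp]

/-- The defining property of a strongly finitely presentable object of the `V`-category `V`, for
diagrams in the ordinary category `V`. -/
lemma IsStronglyFinitelyPresentable.isColim {X : V} (hX : IsStronglyFinitelyPresentable V X)
    [IsSifted J] {D : J ⥤ V} {Y : V} {y : ∀ j, D.obj j ⟶ Y}
    (hy : ∀ i j (u : i ⟶ j), D.map u ≫ y j = y i) (h : IsColim D.obj (fun _ _ u => D.map u) y) :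
    IsColim (fun j => EnrichedCategory.Hom (V := V) X (D.obj j))
      (fun _ _ u => post X (nm (D.map u)))
      (fun j => post X (nm (y j))) := by
  have h1 : IsCompat (selfDiagram D) (X := Y) fun j => nm (y j) := fun i j u => by
    change ecomp (nm (D.map u)) (nm (y j)) = nm (y i)
    rw [← nm_comp, hy]
  refine ((isStronglyFinitelyPresentable_iff X).1 hX J (selfDiagram D) Y _ h1 ?_).post
  rw [conical_self_iff]
  exact IsColim.congr h (fun i j u => (un_nm _).symm) (fun j => (un_nm _).symm)

variable {K : Type v} {κ : Type v} (Z : κ → V) (I : K → V) (i : ∀ k, I k ⟶ 𝟙_ V)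

/-- The data which determine a strongly finitely presentable object `X` up to isomorphism: a
coproduct `P` of objects of the given small set, and an endomorphism `P ⊗ I k ⟶ P` for each member
`I k` of a sifted cover of the unit object. -/
def SFData : Type v := Σ d : K → κ, ∀ k, (∐ fun k => Z (d k)) ⊗ I k ⟶ ∐ fun k => Z (d k)

/-- `X` is a quotient `q` of the object `P`, and the canonical maps `X ⊗ I k ⟶ X` lift along `q`,
so that the given endomorphisms of `P` arise from `q` and the lifts. -/
def HasSFData (X : V) (d : SFData Z I) : Prop :=
  ∃ (q : (∐ fun k => Z (d.1 k)) ⟶ X) (s : ∀ k, X ⊗ I k ⟶ ∐ fun k => Z (d.1 k)),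
    (∀ k, s k ≫ q = X ◁ i k ≫ (ρ_ X).hom) ∧ ∀ k, q ▷ I k ≫ s k = d.2 k

variable {Z I i}

variable [SmallCategory K] {I : K ⥤ V} {i : ∀ k, I.obj k ⟶ 𝟙_ V}
  (hi : ∀ k l (u : k ⟶ l), I.map u ≫ i l = i k)
  (hI : IsColim I.obj (fun _ _ u => I.map u) i)

include hi hI in
lemma unit_cover_ext {X Y : V} {f g : X ⟶ Y}
    (h : ∀ k, (X ◁ i k ≫ (ρ_ X).hom) ≫ f = (X ◁ i k ≫ (ρ_ X).hom) ≫ g) : f = g := by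
  rw [← cancel_epi (ρ_ X).hom]
  refine (hI.whiskerLeft X).hom_ext (fun k l u => ?_) fun k => by simpa using h k
  rw [← MonoidalCategory.whiskerLeft_comp, hi]

include hi hI in
/-- Two objects with the same data are quotients of the same object, and each of the two quotient
maps factors through the other: as both `X` and `X'` are covered by their tensor products with the `I k`,
the map `X ⟶ X'` can be given on the `X ⊗ I k`, by the lift to `P` followed by `P ⟶ X'`. -/
lemma HasSFData.exists_map {X X' : V} {d : SFData Z I.obj} (h : HasSFData Z I.obj i X d)
    (h' : HasSFData Z I.obj i X' d) : ∃ (q : (∐ fun k => Z (d.1 k)) ⟶ X)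
      (q' : (∐ fun k => Z (d.1 k)) ⟶ X'), Epi q ∧ Epi q' ∧ (∃ f, q ≫ f = q') ∧ ∃ g, q' ≫ g = q := by
  obtain ⟨q, s, h1, h2⟩ := h
  obtain ⟨q', s', h1', h2'⟩ := h'
  have epi : ∀ {X : V} {q : (∐ fun k => Z (d.1 k)) ⟶ X} {s : ∀ k, X ⊗ I.obj k ⟶ _},
      (∀ k, s k ≫ q = X ◁ i k ≫ (ρ_ X).hom) → Epi q := fun h1 => ⟨fun f g hfg =>
    unit_cover_ext hi hI fun k => by rw [← h1 k, Category.assoc, hfg, Category.assoc]⟩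
  have key : ∀ {X X' : V} {q : (∐ fun k => Z (d.1 k)) ⟶ X} {s : ∀ k, X ⊗ I.obj k ⟶ _}
      {q' : (∐ fun k => Z (d.1 k)) ⟶ X'} {s' : ∀ k, X' ⊗ I.obj k ⟶ _},
      (∀ k, s k ≫ q = X ◁ i k ≫ (ρ_ X).hom) → (∀ k, q ▷ I.obj k ≫ s k = d.2 k) →
      (∀ k, s' k ≫ q' = X' ◁ i k ≫ (ρ_ X').hom) → (∀ k, q' ▷ I.obj k ≫ s' k = d.2 k) →
      ∃ f, q ≫ f = q' := by
    intro X X' q s q' s' h1 h2 h1' h2'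
    have := epi h1
    have h3 : ∀ k, q ▷ I.obj k ≫ s k ≫ q' = q' ▷ I.obj k ≫ X' ◁ i k ≫ (ρ_ X').hom := fun k => by
      rw [reassoc_of% (h2 k), ← h1', ← h2' k, Category.assoc]
    have hepi : ∀ k, Epi (q ▷ I.obj k) := fun k => ⟨fun {Y} f g hfg => by
      have h4 : ∀ f : X ⊗ I.obj k ⟶ Y, q ≫ MonoidalClosed.curry ((β_ _ _).hom ≫ f) =
          MonoidalClosed.curry ((β_ _ _).hom ≫ q ▷ I.obj k ≫ f) := fun f => by
        rw [← MonoidalClosed.curry_natural_left, BraidedCategory.braiding_naturality_right_assoc]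
      have h5 : MonoidalClosed.curry ((β_ _ _).hom ≫ f) =
          MonoidalClosed.curry ((β_ _ _).hom ≫ g) := by
        rw [← cancel_epi q, h4, h4, hfg]
      exact (cancel_epi _).1 (MonoidalClosed.curry_injective h5)⟩
    obtain ⟨f, hf, -⟩ := (hI.whiskerLeft X) X' (fun k => s k ≫ q') fun k l u => by
      have := hepi k
      rw [← cancel_epi (q ▷ I.obj k), ← whisker_exchange_assoc, h3, h3, whisker_exchange_assoc,
        ← MonoidalCategory.whiskerLeft_comp_assoc, hi]
    refine ⟨(ρ_ X).inv ≫ f, unit_cover_ext hi hI fun k => ?_⟩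
    have h6 := rightUnitor_naturality q
    rw [Category.assoc, Category.assoc, ← reassoc_of% h6, Iso.hom_inv_id_assoc,
      whisker_exchange_assoc, hf, h3, ← whisker_exchange_assoc, rightUnitor_naturality]
  exact ⟨q, q', epi h1, epi h1', key h1 h2 h1' h2', key h1' h2' h1 h2⟩

include hi hI in
lemma HasSFData.nonempty_iso {X X' : V} {d : SFData Z I.obj} (h : HasSFData Z I.obj i X d)
    (h' : HasSFData Z I.obj i X' d) : Nonempty (X ≅ X') := by
  obtain ⟨q, q', _, _, ⟨f, hf⟩, g, hg⟩ := h.exists_map hi hI h'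
  exact ⟨⟨f, g, by rw [← cancel_epi q, reassoc_of% hf, hg, Category.comp_id],
    by rw [← cancel_epi q', reassoc_of% hg, hf, Category.comp_id]⟩⟩

/-- As the members `I k` of the cover of the unit are strongly finitely presentable in the ordinary
sense, the morphisms `I k ⟶ V(X,X)` factor through objects of a sifted diagram with colimit `X`. -/
lemma exists_sfData (hG : IsSiftedDense (Set.range Z)) (hIG : ∀ k, I.obj k ∈ Set.range Z) {X : V}
    (hX : IsStronglyFinitelyPresentable V X) : ∃ d : SFData Z I.obj, HasSFData Z I.obj i X d := by
  obtain ⟨J, _, _, D, x, hD, hx, hc⟩ := hG.exists_cover X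
  have h1 := hX.isColim hx hc
  have h0 : ∀ i j (u : i ⟶ j), post X (nm (D.map u)) ≫ post X (nm (x j)) = post X (nm (x i)) :=
    fun i j u => by rw [← post_comp, ← nm_comp, hx]
  have h2 : ∀ k, ∃ (c : κ) (a : X ⊗ I.obj k ⟶ Z c) (b : Z c ⟶ X),
      a ≫ b = X ◁ i k ≫ (ρ_ X).hom := fun k => by
    have h3 := (hG.sfp _ (hIG k)).isColimT (D := homDiagram X D) h0 h1
    obtain ⟨j, a, ha⟩ := h3.exists_eq (i k ≫ eId V X)
    obtain ⟨c, hc⟩ := hD j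
    let a' : I.obj k ⟶ EnrichedCategory.Hom (V := V) X (D.obj j) := a
    have h4 : uc a' ≫ x j = X ◁ i k ≫ (ρ_ X).hom := by
      have h5 : uc (a' ≫ post X (nm (x j))) = uc (i k ≫ eId V X) := congrArg uc ha
      rw [uc_comp_post, uc_natural_left, uc_eId, un_nm] at h5
      exact h5
    exact ⟨c, uc a' ≫ eqToHom hc.symm, eqToHom hc ≫ x j, by
      rw [Category.assoc, eqToHom_trans_assoc, eqToHom_refl, Category.id_comp, h4]⟩
  choose c a b hab using h2
  let q : (∐ fun k => Z (c k)) ⟶ X := Sigma.desc b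
  let s : ∀ k, X ⊗ I.obj k ⟶ ∐ fun k => Z (c k) := fun k => a k ≫ Sigma.ι (fun k => Z (c k)) k
  exact ⟨⟨c, fun k => q ▷ I.obj k ≫ s k⟩, q, s, fun k => by simp [q, s, hab], fun k => rfl⟩

/-- The strongly finitely presentable objects of the `V`-category `V` form an essentially small
class. -/
lemma IsLocallySFPTensor.exists_small (hV : IsLocallySFPTensor V) :
    ∃ (Ξ : Type v) (r : Ξ → V), (∀ ξ, IsStronglyFinitelyPresentable V (r ξ)) ∧
      ∀ X : V, IsStronglyFinitelyPresentable V X → ∃ ξ, Nonempty (X ≅ r ξ) := by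
  obtain ⟨⟨G, hG, hG1, hG2⟩, -⟩ := hV
  let Z : Shrink.{v} G → V := fun c => ((equivShrink G).symm c).1
  have hZ : Set.range Z = G := by
    ext X
    constructor
    · rintro ⟨c, rfl⟩
      exact ((equivShrink G).symm c).2
    · intro hX
      exact ⟨equivShrink G ⟨X, hX⟩, by simp [Z]⟩
  have hd : IsSiftedDense (Set.range Z) := by
    rw [hZ]
    exact ⟨hG1, hG2⟩
  obtain ⟨K, _, _, I, i, hIG, hi, hI⟩ := hd.exists_cover (𝟙_ V)
  let Ξ := {d : SFData Z I.obj // ∃ X, IsStronglyFinitelyPresentable V X ∧ HasSFData Z I.obj i X d}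
  refine ⟨Ξ, fun ξ => ξ.2.choose, fun ξ => ξ.2.choose_spec.1, fun X hX => ?_⟩
  obtain ⟨d, hd⟩ := exists_sfData hd hIG hX
  have h : ∃ X, IsStronglyFinitelyPresentable V X ∧ HasSFData Z I.obj i X d := ⟨X, hX, hd⟩
  exact ⟨⟨d, h⟩, hd.nonempty_iso hi hI h.choose_spec.2⟩

/-- The closure of strongly finitely presentable objects under the tensor product makes the
generators strongly finitely presentable in the enriched sense as well. -/
lemma IsLocallySFPTensor.exists_dense (hV : IsLocallySFPTensor V) : ∃ G₀ : Set V,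
    IsSiftedDense G₀ ∧ ∀ Z ∈ G₀, IsStronglyFinitelyPresentable V Z := by
  obtain ⟨⟨G, hG, hG1, hG2⟩, ht⟩ := hV
  have h : IsSiftedDense G := ⟨hG1, hG2⟩
  exact ⟨G, h, fun Z hZ => h.isStronglyFinitelyPresentable fun Z' hZ' => ht _ _ (hG1 _ hZ)
    (hG1 _ hZ')⟩

end EssentiallySmall

/-! ### Equivalences of `V`-categories -/

section Equivalences

variable {V : Type u} [Category.{v} V] [MonoidalCategory V] [SymmetricCategory V]
  [MonoidalClosed V]
variable {C : Type w} [EnrichedCategory V C] {D : Type w'} [EnrichedCategory V D]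

lemma NatFamily.map_post {F G : EnrichedFunctor V C D} (t : NatFamily F G (𝟙_ V)) (a b : C) :
    F.map a b ≫ post _ (t.app b) = G.map a b ≫ pre (t.app a) _ := by
  rw [comp_post_eq, comp_pre_eq, t.natural]
  simp

/-- An ungraded natural family from its naturality in the form of an equality of maps. -/
@[simps]
def NatFamily.ofPost {F G : EnrichedFunctor V C D} (t : ∀ a, 𝟙_ V ⟶ (F.obj a ⟶[V] G.obj a))
    (ht : ∀ a b, F.map a b ≫ post _ (t b) = G.map a b ≫ pre (t a) _) : NatFamily F G (𝟙_ V) where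
  app := t
  natural a b := by
    have h := ht a b
    rw [comp_post_eq, comp_pre_eq, Iso.inv_comp_eq] at h
    rw [h]
    simp

lemma homOf_ecomp {X Y Z : C} (f : 𝟙_ V ⟶ (X ⟶[V] Y)) (g : 𝟙_ V ⟶ (Y ⟶[V] Z)) :
    ForgetEnrichment.homOf V (ecomp f g) =
      ForgetEnrichment.homOf V f ≫ ForgetEnrichment.homOf V g := by
  have h := homTo_comp' (ForgetEnrichment.homOf V f) (ForgetEnrichment.homOf V g)
  exact (congrArg (ForgetEnrichment.homOf V) h).symm

lemma VIso.isIso_homOf {X Y : C} (e : VIso (V := V) X Y) :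
    IsIso (ForgetEnrichment.homOf V e.hom) := by
  refine ⟨ForgetEnrichment.homOf V e.inv, ?_, ?_⟩
  · rw [← homOf_ecomp, e.hom_inv]
    exact ForgetEnrichment.homOf_eId _ _
  · rw [← homOf_ecomp, e.inv_hom]
    exact ForgetEnrichment.homOf_eId _ _

/-- The isomorphism given by a morphism which is invertible in the underlying category. -/
@[reducible]
def VIso.ofIsIso {X Y : C} (f : 𝟙_ V ⟶ (X ⟶[V] Y)) (hf : IsIso (ForgetEnrichment.homOf V f)) :
    VIso (V := V) X Y where
  hom := f
  inv := ForgetEnrichment.homTo V (CategoryTheory.inv (ForgetEnrichment.homOf V f))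
  hom_inv := by
    have h := congrArg (ForgetEnrichment.homTo V) (IsIso.hom_inv_id (ForgetEnrichment.homOf V f))
    rw [homTo_comp', ForgetEnrichment.homTo_id] at h
    exact h
  inv_hom := by
    have h := congrArg (ForgetEnrichment.homTo V) (IsIso.inv_hom_id (ForgetEnrichment.homOf V f))
    rw [homTo_comp', ForgetEnrichment.homTo_id] at h
    exact h

/-- A fully faithful `V`-functor. -/
def IsFF (E : EnrichedFunctor V C D) : Prop := ∀ X Y, IsIso (E.map X Y)

variable {E : EnrichedFunctor V C D}

/-- A fully faithful `V`-functor reflects isomorphisms. -/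
def IsFF.viso (hE : IsFF E) {X Y : C} (e : VIso (V := V) (E.obj X) (E.obj Y)) :
    VIso (V := V) X Y :=
  have := hE X Y
  have := hE Y X
  have := hE X X
  have := hE Y Y
  { hom := e.hom ≫ inv (E.map X Y)
    inv := e.inv ≫ inv (E.map Y X)
    hom_inv := by
      rw [← cancel_mono (E.map X X), ecomp_map]
      simp [e.hom_inv, E.map_id]
    inv_hom := by
      rw [← cancel_mono (E.map Y Y), ecomp_map]
      simp [e.inv_hom, E.map_id] }

lemma IsFF.viso_hom_map (hE : IsFF E) {X Y : C} (e : VIso (V := V) (E.obj X) (E.obj Y)) :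
    (hE.viso e).hom ≫ E.map X Y = e.hom := by
  have := hE X Y
  change (e.hom ≫ inv (E.map X Y)) ≫ _ = _
  simp

section Inverse

variable (hE : IsFF E) (X : D → C) (e : ∀ d, VIso (V := V) (E.obj (X d)) d)

/-- The hom-maps of the inverse of a fully faithful and essentially surjective `V`-functor. -/
def inverseMap (d d' : D) : (d ⟶[V] d') ⟶ (X d ⟶[V] X d') :=
  have := hE (X d) (X d')
  pre (e d).hom d' ≫ post (E.obj (X d)) (e d').inv ≫ inv (E.map (X d) (X d'))

lemma inverseMap_map (d d' : D) : inverseMap hE X e d d' ≫ E.map (X d) (X d') =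
    pre (e d).hom d' ≫ post (E.obj (X d)) (e d').inv := by
  have := hE (X d) (X d')
  simp [inverseMap]

/-- The inverse of a fully faithful and essentially surjective `V`-functor. -/
@[reducible]
def inverseFunctor : EnrichedFunctor V D C where
  obj := X
  map d d' := inverseMap hE X e d d'
  map_id d := by
    have := hE (X d) (X d)
    rw [← cancel_mono (E.map (X d) (X d)), Category.assoc, inverseMap_map, E.map_id,
      ← Category.assoc, comp_pre, ← comp_post, post_id, Category.comp_id, comp_post, (e d).hom_inv]
  map_comp d d' d'' := by
    have := hE (X d) (X d'')
    rw [← cancel_mono (E.map (X d) (X d'')), Category.assoc, inverseMap_map, Category.assoc,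
      E.map_comp, tensorHom_comp_tensorHom_assoc, inverseMap_map, inverseMap_map]
    have h1 := tensor_comp_eq' (pre (e d).hom d' ≫ post (E.obj (X d)) (e d').inv)
      (pre (e d').hom d'') (post (E.obj (X d')) (e d'').inv)
    rw [h1, Category.assoc, eComp_post, ← Category.assoc, ← Category.assoc]
    congr 1
    have h2 := tensor_pre_eComp (pre (e d).hom d' ≫ post (E.obj (X d)) (e d').inv)
      (𝟙 (d' ⟶[V] d'')) (e d').hom
    rw [Category.id_comp, Category.assoc, ← post_comp, (e d').inv_hom, post_id, Category.comp_id,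
      tensorHom_id] at h2
    rw [h2, pre_eComp]

include hE e in
lemma isEquivalentTo_of_ff : IsEquivalentTo V C D := by
  refine ⟨E, inverseFunctor hE X e, ?_, ?_⟩
  · refine ⟨NatFamily.ofPost (fun c => (hE.viso (e (E.obj c))).hom) fun a b => ?_,
      fun c => (hE.viso (e (E.obj c))).isIso_homOf⟩
    have := hE (X (E.obj a)) b
    change (E.map a b ≫ inverseMap hE X e _ _) ≫ post _ _ = 𝟙 _ ≫ pre _ _
    rw [Category.id_comp, ← cancel_mono (E.map _ _), Category.assoc, post_map, pre_map,
      IsFF.viso_hom_map, IsFF.viso_hom_map, Category.assoc, reassoc_of% (inverseMap_map hE X e),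
      ← post_comp, (e (E.obj b)).inv_hom, post_id, Category.comp_id]
  · refine ⟨NatFamily.ofPost (fun d => (e d).hom) fun a b => ?_, fun d => (e d).isIso_homOf⟩
    change (inverseMap hE X e _ _ ≫ E.map _ _) ≫ post _ _ = 𝟙 _ ≫ pre _ _
    rw [Category.id_comp, inverseMap_map, Category.assoc, ← post_comp, (e b).inv_hom, post_id,
      Category.comp_id]

end Inverse

lemma NaturallyIsomorphic.isIso_map {F : EnrichedFunctor V C C}
    (h : NaturallyIsomorphic F (EnrichedFunctor.id V C)) (X Y : C) : IsIso (F.map X Y) := by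
  obtain ⟨t, ht⟩ := h
  let e : ∀ X, VIso (V := V) (F.obj X) X := fun X => VIso.ofIsIso (t.app X) (ht X)
  have h1 : F.map X Y ≫ post (F.obj X) (e Y).hom = 𝟙 _ ≫ pre (e X).hom Y := t.map_post X Y
  have h2 : F.map X Y ≫ ((e Y).post (F.obj X)).hom = ((e X).pre Y).hom :=
    h1.trans (Category.id_comp _)
  have h3 : F.map X Y = ((e X).pre Y).hom ≫ ((e Y).post (F.obj X)).inv := by
    rw [← h2, Category.assoc, Iso.hom_inv_id, Category.comp_id]
  rw [h3]
  infer_instance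

/-- Equivalences are fully faithful. -/
lemma isFF_of_isEquivalentTo {E' : EnrichedFunctor V D C}
    (h : NaturallyIsomorphic (E.comp V E') (EnrichedFunctor.id V C))
    (h' : NaturallyIsomorphic (E'.comp V E) (EnrichedFunctor.id V D)) : IsFF E := by
  intro X Y
  have h1 : IsIso (E.map X Y ≫ E'.map _ _) := h.isIso_map X Y
  have h2 : IsIso (E'.map (E.obj X) (E.obj Y) ≫ E.map _ _) := h'.isIso_map _ _
  have h3 : IsIso (E'.map (E.obj X) (E.obj Y)) := by
    refine ⟨inv (E.map X Y ≫ E'.map _ _) ≫ E.map X Y, ?_, by simp⟩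
    have h4 : Mono (E'.map (E.obj X) (E.obj Y)) := mono_of_mono _ (E.map _ _)
    rw [← cancel_mono (E'.map (E.obj X) (E.obj Y))]
    simp
  exact IsIso.of_isIso_comp_right _ (E'.map (E.obj X) (E.obj Y))

/-- The inclusion of a full sub-`V`-category. -/
@[reducible]
def fullSubInclusion (P : D → Prop) : EnrichedFunctor V (FullSub P) D where
  obj X := X.1
  map X Y := 𝟙 (X.1 ⟶[V] Y.1)
  map_id X := Category.comp_id _
  map_comp X Y Z := by
    change eComp V X.1 Y.1 Z.1 ≫ 𝟙 (X.1 ⟶[V] Z.1) =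
      (𝟙 (X.1 ⟶[V] Y.1) ⊗ₘ 𝟙 (Y.1 ⟶[V] Z.1)) ≫ eComp V X.1 Y.1 Z.1
    simp

/-- The corestriction of a `V`-functor to a full sub-`V`-category. -/
@[reducible]
def fullSubLift (P : D → Prop) (E : EnrichedFunctor V C D) (hE : ∀ X, P (E.obj X)) :
    EnrichedFunctor V C (FullSub P) where
  obj X := ⟨E.obj X, hE X⟩
  map X Y := E.map X Y
  map_id X := E.map_id X
  map_comp X Y Z := E.map_comp X Y Z

lemma isEquivalentTo_fullSub_iff (P : D → Prop) :
    IsEquivalentTo V C (FullSub P) ↔ ∃ E : EnrichedFunctor V C D, IsFF E ∧ (∀ X, P (E.obj X)) ∧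
      ∀ Y, P Y → ∃ X, Nonempty (VIso (V := V) (E.obj X) Y) := by
  constructor
  · rintro ⟨E, E', h, h'⟩
    refine ⟨vcomp E (fullSubInclusion P), fun X Y => ?_, fun X => (E.obj X).2, fun Y hY => ?_⟩
    · have := isFF_of_isEquivalentTo h h' X Y
      change IsIso (E.map X Y ≫ 𝟙 _)
      rw [Category.comp_id]
      exact this
    · obtain ⟨t, ht⟩ := h'
      let e := VIso.ofIsIso (t.app ⟨Y, hY⟩) (ht ⟨Y, hY⟩)
      exact ⟨E'.obj ⟨Y, hY⟩, ⟨⟨e.hom, e.inv, e.hom_inv, e.inv_hom⟩⟩⟩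
  · rintro ⟨E, hE, hP, hs⟩
    choose X e using hs
    refine isEquivalentTo_of_ff (E := fullSubLift P E hP) (fun X Y => hE X Y)
      (fun Y => X Y.1 Y.2) fun Y => ?_
    let e' := (e Y.1 Y.2).some
    exact ⟨e'.hom, e'.inv, e'.hom_inv, e'.inv_hom⟩

end Equivalences

/-! ### Nerves along a dense family of objects -/

section Pointwise

variable {V : Type u} [Category.{v} V] [MonoidalCategory V] [SymmetricCategory V]
  [MonoidalClosed V]

lemma elMap_vcomp {M : Type w} [EnrichedCategory V M] {K : Type w'} [EnrichedCategory V K]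
    (S : EnrichedFunctor V M K) (P : EnrichedFunctor V K V) {t : M}
    (x : 𝟙_ V ⟶ P.obj (S.obj t)) (s : M) :
    elMap (vcomp S P) x s = S.map t s ≫ elMap P x (S.obj s) := by
  rw [elMap, elMap, act_vcomp, leftUnitor_inv_naturality_assoc, whisker_exchange_assoc]

lemma VIso.isIso_fmap {K : Type w} [EnrichedCategory V K] (P : EnrichedFunctor V K V) {X Y : K}
    (e : VIso (V := V) X Y) : IsIso (EnrichedLSFP.fmap P e.hom) :=
  (inferInstance : IsIso (e.fmap P).hom)

lemma VIso.isIso_pre {K : Type w} [EnrichedCategory V K] {X Y : K}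
    (e : VIso (V := V) X Y) (Z : K) : IsIso (EnrichedLSFP.pre e.hom Z) :=
  (inferInstance : IsIso (e.pre Z).hom)

lemma VIso.isIso_post {K : Type w} [EnrichedCategory V K] {X Y : K}
    (e : VIso (V := V) X Y) (Z : K) : IsIso (EnrichedLSFP.post Z e.hom) :=
  (inferInstance : IsIso (e.post Z).hom)

/-- Two colimits of the same diagram are isomorphic. -/
lemma Conical.exists_iso {J : Type v} [SmallCategory J] {K : Type w} [EnrichedCategory V K]
    {D : J ⥤ ForgetEnrichment V K} {X Y : K} {x : ∀ j, 𝟙_ V ⟶ (dob D j ⟶[V] X)}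
    {y : ∀ j, 𝟙_ V ⟶ (dob D j ⟶[V] Y)} (hx : IsCompat D x) (hy : IsCompat D y)
    (h : Conical D x) (h' : Conical D y) :
    ∃ e : VIso (V := V) X Y, ∀ j, ecomp (x j) e.hom = y j := by
  obtain ⟨f, hf, -⟩ := h Y (𝟙_ V) y fun i j u => by rw [comp_pre, hy]
  obtain ⟨g, hg, -⟩ := h' X (𝟙_ V) x fun i j u => by rw [comp_pre, hx]
  simp only [comp_pre] at hf hg
  refine ⟨⟨f, g, ?_, ?_⟩, hf⟩
  · refine (h X (𝟙_ V) x fun i j u => by rw [comp_pre, hx]).unique (fun j => ?_) fun j => ?_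
    · rw [← comp_post, Category.assoc, post_pre, ← Category.assoc, comp_pre, hf, comp_post, hg]
    · rw [comp_pre, ← comp_post, post_id, Category.comp_id]
  · refine (h' Y (𝟙_ V) y fun i j u => by rw [comp_pre, hy]).unique (fun j => ?_) fun j => ?_
    · rw [← comp_post, Category.assoc, post_pre, ← Category.assoc, comp_pre, hg, comp_post, hf]
    · rw [comp_pre, ← comp_post, post_id, Category.comp_id]

variable [HasLimits V] {T : Type v} [EnrichedCategory V T]

lemma act_fmap_ev {F G : EnrichedFunctor V T V} (α : 𝟙_ V ⟶ (F ⟶[V] G)) (t s : T) :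
    act F t s ≫ fmap (evFunctor V s) α = fmap (evFunctor V t) α ▷ _ ≫ act G t s := by
  have h := (evL F G).natural t s
  rw [fmap_evFunctor, fmap_evFunctor, leftUnitor_inv_naturality_assoc, whisker_exchange_assoc,
    h]
  simp

lemma elMap_fmap_ev {F G : EnrichedFunctor V T V} (α : 𝟙_ V ⟶ (F ⟶[V] G)) {t : T}
    (x : 𝟙_ V ⟶ F.obj t) (s : T) :
    elMap F x s ≫ fmap (evFunctor V s) α = elMap G (x ≫ fmap (evFunctor V t) α) s := by
  rw [elMap, elMap, Category.assoc, Category.assoc, act_fmap_ev, comp_whiskerRight_assoc]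

/-- A `V`-natural transformation with invertible components is invertible. -/
lemma exists_viso {F G : EnrichedFunctor V T V} (α : 𝟙_ V ⟶ (F ⟶[V] G))
    (h : ∀ t, IsIso (fmap (evFunctor V t) α)) : ∃ e : VIso (V := V) F G, e.hom = α := by
  let n : ∀ t, G.obj t ⟶ F.obj t := fun t =>
    @CategoryTheory.inv _ _ _ _ (fmap (evFunctor V t) α) (h t)
  have h1 : ∀ t, fmap (evFunctor V t) α ≫ n t = 𝟙 _ := fun t =>
    @IsIso.hom_inv_id _ _ _ _ (fmap (evFunctor V t) α) (h t)
  have h2 : ∀ t, n t ≫ fmap (evFunctor V t) α = 𝟙 _ := fun t =>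
    @IsIso.inv_hom_id _ _ _ _ (fmap (evFunctor V t) α) (h t)
  have hn : ∀ t s, act G t s ≫ n s = n t ▷ _ ≫ act F t s := fun t s => by
    have := h s
    rw [← cancel_mono (fmap (evFunctor V s) α), Category.assoc, Category.assoc, act_fmap_ev, h2,
      ← comp_whiskerRight_assoc, h2, id_whiskerRight, Category.id_comp, Category.comp_id]
  have h3 : ∀ t, fmap (evFunctor V t) (GNat.ofNatural n hn).lift = n t := fun t => by
    rw [fmap_ev_lift]
    exact Iso.inv_hom_id_assoc _ _
  refine ⟨⟨α, (GNat.ofNatural n hn).lift, ?_, ?_⟩, rfl⟩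
  · refine fmap_ev_ext fun t => ?_
    rw [fmap_comp, h3, fmap_id]
    exact h1 t
  · refine fmap_ev_ext fun t => ?_
    rw [fmap_comp, h3, fmap_id]
    exact h2 t

end Pointwise

section NerveData

variable {V : Type u} [Category.{v} V] [MonoidalCategory V] [SymmetricCategory V]
  [MonoidalClosed V] [HasLimits V]
variable {T : Type v} [EnrichedCategory V T] {M : Type w} [EnrichedCategory V M]

/-- A family of objects `X_t` of `M` and of universal elements which make `N Y` isomorphic to
`t ↦ M(X_t, Y)`, such that the full subcategory of the `X_t` is the opposite of `T`. -/
structure NerveData (N : EnrichedFunctor V M (EnrichedFunctor V T V)) where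
  /-- the objects `X_t` -/
  ob : T → M
  /-- the universal elements -/
  el : ∀ t, 𝟙_ V ⟶ (N.obj (ob t)).obj t
  isIso_left : ∀ t X, IsIso (elMap (vcomp N (evFunctor V t)) (el t) X)
  isIso_right : ∀ t s, IsIso (elMap (N.obj (ob t)) (el t) s)

namespace NerveData

variable {N : EnrichedFunctor V M (EnrichedFunctor V T V)} (d : NerveData N)

/-- The isomorphism `M(X_t, Y) ≅ (N Y) t`. -/
def homIso (t : T) (Y : M) : (d.ob t ⟶[V] Y) ≅ (N.obj Y).obj t :=
  @asIso _ _ _ _ (elMap (vcomp N (evFunctor V t)) (d.el t) Y) (d.isIso_left t Y)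

lemma homIso_hom (t : T) (Y : M) :
    (d.homIso t Y).hom = elMap (vcomp N (evFunctor V t)) (d.el t) Y := rfl

lemma homIso_natural (t : T) {Y Z : M} (f : 𝟙_ V ⟶ (Y ⟶[V] Z)) :
    post (d.ob t) f ≫ (d.homIso t Z).hom =
      (d.homIso t Y).hom ≫ fmap (evFunctor V t) (f ≫ N.map Y Z) := by
  rw [homIso_hom, homIso_hom, elMap_post, fmap_vcomp]

lemma comp_homIso (t : T) {Y : M} (f : 𝟙_ V ⟶ (d.ob t ⟶[V] Y)) :
    f ≫ (d.homIso t Y).hom = d.el t ≫ fmap (evFunctor V t) (f ≫ N.map _ Y) := by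
  rw [homIso_hom, comp_elMap, fmap_vcomp]

/-- The isomorphism `T(t,s) ≅ M(X_s, X_t)`. -/
def obIso (t s : T) : (t ⟶[V] s) ≅ (d.ob s ⟶[V] d.ob t) :=
  @asIso _ _ _ _ (elMap (N.obj (d.ob t)) (d.el t) s) (d.isIso_right t s) ≪≫
    (d.homIso s (d.ob t)).symm

lemma obIso_homIso (t s : T) : (d.obIso t s).hom ≫ (d.homIso s (d.ob t)).hom =
    elMap (N.obj (d.ob t)) (d.el t) s := by
  change (_ ≫ (d.homIso s (d.ob t)).inv) ≫ (d.homIso s (d.ob t)).hom = _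
  rw [Category.assoc, Iso.inv_hom_id, Category.comp_id]
  rfl

lemma obIso_post (t s : T) {Y : M} (f : 𝟙_ V ⟶ (d.ob t ⟶[V] Y)) :
    (d.obIso t s).hom ≫ post (d.ob s) f ≫ (d.homIso s Y).hom =
      elMap (N.obj Y) (f ≫ (d.homIso t Y).hom) s := by
  rw [homIso_natural, ← Category.assoc, obIso_homIso, elMap_fmap_ev, ← comp_homIso]

lemma comp_obIso_homIso (t s : T) (g : 𝟙_ V ⟶ (t ⟶[V] s)) :
    (g ≫ (d.obIso t s).hom) ≫ (d.homIso s (d.ob t)).hom = d.el t ≫ fmap (N.obj (d.ob t)) g := by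
  rw [Category.assoc, obIso_homIso, comp_elMap]

lemma pre_obIso {t t' : T} (g : 𝟙_ V ⟶ (t' ⟶[V] t)) (s : T) :
    pre g s ≫ (d.obIso t' s).hom =
      (d.obIso t s).hom ≫ post (d.ob s) (g ≫ (d.obIso t' t).hom) := by
  rw [← cancel_mono (d.homIso s (d.ob t')).hom, Category.assoc, Category.assoc, obIso_post,
    obIso_homIso, comp_obIso_homIso, elMap_comp_fmap]

lemma eId_obIso (t : T) : eId V t ≫ (d.obIso t t).hom = eId V (d.ob t) := by
  rw [← cancel_mono (d.homIso t (d.ob t)).hom, comp_obIso_homIso, fmap_id, Category.comp_id,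
    homIso_hom, eId_elMap]

/-- The morphism `X_t ⟶ Y` which corresponds to an element of `(N Y) t`. -/
def mor {t : T} {Y : M} (x : 𝟙_ V ⟶ (N.obj Y).obj t) : 𝟙_ V ⟶ (d.ob t ⟶[V] Y) :=
  x ≫ (d.homIso t Y).inv

lemma mor_homIso {t : T} {Y : M} (x : 𝟙_ V ⟶ (N.obj Y).obj t) :
    d.mor x ≫ (d.homIso t Y).hom = x := by
  rw [mor, Category.assoc, Iso.inv_hom_id, Category.comp_id]

/-- The diagram of the objects `X_t` indexed by the elements of a `V`-functor `T ⟶ V`. -/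
@[reducible]
def diagram (F : EnrichedFunctor V T V) : El F ⥤ ForgetEnrichment V M where
  obj e := ForgetEnrichment.of V (d.ob e.ob)
  map {e e'} g := ForgetEnrichment.homOf V (g.1 ≫ (d.obIso e'.ob e.ob).hom)
  map_id e := by
    refine (congrArg (ForgetEnrichment.homOf V) (d.eId_obIso e.ob)).trans ?_
    exact ForgetEnrichment.homOf_eId _ _
  map_comp {e e' e''} f g := by
    rw [← homOf_ecomp]
    refine congrArg (ForgetEnrichment.homOf V) ?_
    change ecomp g.1 f.1 ≫ (d.obIso e''.ob e.ob).hom = _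
    rw [← comp_pre, Category.assoc, pre_obIso, ← Category.assoc, comp_post]

lemma dmap_diagram (F : EnrichedFunctor V T V) {e e' : El F} (g : e ⟶ e') :
    dmap (d.diagram F) e e' g = g.1 ≫ (d.obIso e'.ob e.ob).hom := rfl

lemma isCompat_mor (Y : M) :
    IsCompat (d.diagram (N.obj Y)) (X := Y) fun e => d.mor e.el := by
  intro e e' g
  change ecomp (g.1 ≫ (d.obIso e'.ob e.ob).hom) (d.mor e'.el) = d.mor e.el
  rw [← cancel_mono (d.homIso e.ob Y).hom, mor_homIso, ← comp_post, Category.assoc,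
    Category.assoc, obIso_post, mor_homIso, comp_elMap, g.2]

variable [HasColimits V] {G₀ : Set V} (hG : IsSiftedDense G₀)
    (hG' : ∀ Z ∈ G₀, IsStronglyFinitelyPresentable V Z) (hT : HasLimitsIn (StrongGen V) T)

include hG hG' hT

/-- A continuous functor is, pointwise, the colimit of the `M(X_s, X_t)` over its elements. -/
lemma isColim_continuous {F : EnrichedFunctor V T V} (hF : PreservesLimitsIn (StrongGen V) F)
    (s : T) : IsColim (fun e : El F => (d.ob s ⟶[V] d.ob e.ob))
      (fun (e e' : El F) (g : e ⟶ e') => post (d.ob s) (dmap (d.diagram F) e e' g))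
      (fun e => (d.obIso e.ob s).inv ≫ elMap F e.el s) := by
  refine (hG.isColim_elements hG' hT hF s).of_iso (fun e => d.obIso e.ob s) (Iso.refl _)
    (fun e e' g => ?_) fun e => ?_
  · rw [dmap_diagram]
    exact d.pre_obIso g.1 s
  · rw [Iso.hom_inv_id_assoc]
    exact Category.comp_id _

/-- The `V`-functors `M(X_s,-)` see every object `Y` as the colimit of the `X_t` over the elements
of `N Y`. -/
lemma pres_mor {Y : M} (hY : PreservesLimitsIn (StrongGen V) (N.obj Y)) (s : T) :
    Pres (rep (d.ob s)) (d.diagram (N.obj Y)) (X := Y) fun e => d.mor e.el := by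
  have h : IsColim (fun e : El (N.obj Y) => (d.ob s ⟶[V] d.ob e.ob))
      (fun (e e' : El (N.obj Y)) (g : e ⟶ e') =>
        post (d.ob s) (dmap (d.diagram (N.obj Y)) e e' g))
      (fun e => post (d.ob s) (d.mor e.el)) := by
    refine (d.isColim_continuous hG hG' hT hY s).of_iso (fun e => Iso.refl _) (d.homIso s Y).symm
      (fun e e' g => ?_) fun e => ?_
    · exact (Category.comp_id _).trans (Category.id_comp _).symm
    · rw [Category.assoc, Iso.inv_comp_eq]
      refine Eq.trans ?_ (congrArg (_ ≫ ·) (Category.id_comp _).symm)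
      have h1 := d.obIso_post e.ob s (d.mor e.el)
      rw [mor_homIso] at h1
      change elMap (N.obj Y) e.el s ≫ (d.homIso s Y).inv = _
      rw [← h1, Category.assoc, Category.assoc, Iso.hom_inv_id, Category.comp_id]
  exact h.congr (fun e e' g => (fmap_rep (d.ob s) _).symm) fun e => (fmap_rep (d.ob s) _).symm

/-- If the `X_t` are strongly finitely presentable and strongly generating, then every object `Y`
is the colimit of the `X_t` over the elements of `N Y`. -/
lemma conical_mor (hN : ∀ Y, PreservesLimitsIn (StrongGen V) (N.obj Y))
    (hM : ∀ (J : Type v) [SmallCategory J] [IsSifted J] (D : J ⥤ ForgetEnrichment V M),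
      ∃ (X : M) (x : ∀ j, 𝟙_ V ⟶ (dob D j ⟶[V] X)), IsCompat D x ∧ Conical D x)
    (hP : ∀ t, IsStronglyFinitelyPresentable V (d.ob t))
    (hs : ∀ (X Y : M) (f : 𝟙_ V ⟶ (X ⟶[V] Y)), (∀ t, IsIso (post (d.ob t) f)) →
      ∃ e : VIso (V := V) X Y, e.hom = f) (Y : M) :
    Conical (d.diagram (N.obj Y)) (X := Y) fun e => d.mor e.el := by
  have := isSifted_el hT (hN Y)
  obtain ⟨C, x, hx, hC⟩ := hM _ (d.diagram (N.obj Y))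
  have hY := d.isCompat_mor Y
  obtain ⟨f, hf, -⟩ := hC Y (𝟙_ V) (fun e => d.mor e.el) fun i j u => by rw [comp_pre, hY]
  have hf' : ∀ e : El (N.obj Y), ecomp (x e) f = d.mor e.el := fun e => by
    rw [← hf, comp_pre]
  obtain ⟨e, rfl⟩ := hs C Y f fun t => by
    have h1 := (isStronglyFinitelyPresentable_iff _).1 (hP t) _ _ _ x hx hC
    rw [← fmap_rep]
    refine IsColim.isIso h1 (fmap_compat (rep (d.ob t)) hx) (d.pres_mor hG hG' hT (hN Y) t)
      (fmap_compat (rep (d.ob t)) hY) fun e => ?_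
    exact (fmap_comp (rep (d.ob t)) (x e) f).symm.trans
      (congrArg (fmap (rep (d.ob t))) (hf' e))
  intro Z W t ht
  obtain ⟨k, hk, hu⟩ := hC Z W t ht
  have h2 : ∀ j, pre (d.mor j.el) Z = pre e.hom Z ≫ pre (x j) Z := fun j => by
    rw [← pre_comp, hf']
  have h3 : pre e.inv Z ≫ pre e.hom Z = 𝟙 _ := (e.pre Z).inv_hom_id
  have h4 : pre e.hom Z ≫ pre e.inv Z = 𝟙 _ := (e.pre Z).hom_inv_id
  refine ⟨k ≫ pre e.inv Z, fun j => ?_, fun k' hk' => ?_⟩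
  · change (k ≫ pre e.inv Z) ≫ pre (d.mor j.el) Z = t j
    rw [h2, Category.assoc, reassoc_of% h3, hk]
  · rw [← hu (k' ≫ pre e.hom Z) fun j => by rw [Category.assoc, ← h2, hk'], Category.assoc, h4,
      Category.comp_id]

end NerveData

end NerveData

/-! ### Recognition of categories of continuous functors -/

section NerveData

variable {V : Type u} [Category.{v} V] [MonoidalCategory V] [SymmetricCategory V]
  [MonoidalClosed V] [HasLimits V]
variable {T : Type v} [EnrichedCategory V T] {M : Type w} [EnrichedCategory V M]

lemma elMap_ev_eId (t : T) (P : EnrichedFunctor V T V) :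
    elMap (evFunctor V t) (t := rep (V := V) t) (eId V t) P = (yonedaIso t P).hom := by
  rw [yonedaIso_hom, elMap, act_evFunctor, BraidedCategory.braiding_naturality_left_assoc]
  simp

namespace NerveData

variable {N : EnrichedFunctor V M (EnrichedFunctor V T V)} (d : NerveData N)

lemma exists_viso_rep (t : T) : ∃ e : VIso (V := V) (rep (V := V) t) (N.obj (d.ob t)),
    eId V t ≫ fmap (evFunctor V t) e.hom = d.el t := by
  have h : ∀ s, fmap (evFunctor V s) (yonL (d.el t)).lift =
      elMap (N.obj (d.ob t)) (d.el t) s := fun s => by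
    rw [fmap_ev_lift, yonL_app]
    rfl
  obtain ⟨e, he⟩ := exists_viso (yonL (d.el t)).lift fun s => by
    rw [h]
    exact d.isIso_right t s
  refine ⟨e, ?_⟩
  rw [he, h]
  exact eId_elMap _ _

lemma isIso_elMap_ev (t : T) (P : EnrichedFunctor V T V) :
    IsIso (elMap (evFunctor V t) (d.el t) P) := by
  obtain ⟨e, he⟩ := d.exists_viso_rep t
  have h := elMap_comp_fmap (evFunctor V t) (t := rep (V := V) t) (eId V t) e.hom P
  rw [he, elMap_ev_eId] at h
  rw [h]
  have := e.isIso_pre P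
  infer_instance

lemma isIso_map (t : T) (Y : M) : IsIso (N.map (d.ob t) Y) := by
  have h := elMap_vcomp N (evFunctor V t) (d.el t) Y
  have h1 := d.isIso_elMap_ev t (N.obj Y)
  have h2 := d.isIso_left t Y
  rw [h] at h2
  exact IsIso.of_isIso_comp_right _ (elMap (evFunctor V t) (d.el t) (N.obj Y))

/-- The objects `N X_t`, which are the representable functors up to isomorphism, in the category
of all `V`-functors. -/
@[reducible]
def base : NerveData (EnrichedFunctor.id V (EnrichedFunctor V T V)) where
  ob t := N.obj (d.ob t)
  el := d.el
  isIso_left t P := by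
    have h := elMap_vcomp (EnrichedFunctor.id V (EnrichedFunctor V T V)) (evFunctor V t)
      (t := N.obj (d.ob t)) (d.el t) P
    rw [h]
    have := d.isIso_elMap_ev t P
    change IsIso (𝟙 _ ≫ elMap (evFunctor V t) (d.el t) P)
    rw [Category.id_comp]
    infer_instance
  isIso_right := d.isIso_right

lemma map_base_homIso (t : T) (Y : M) :
    N.map (d.ob t) Y ≫ (d.base.homIso t (N.obj Y)).hom = (d.homIso t Y).hom := by
  rw [homIso_hom, homIso_hom, elMap_vcomp N (evFunctor V t) (d.el t) Y]
  refine congrArg (N.map (d.ob t) Y ≫ ·) ?_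
  refine (elMap_vcomp (EnrichedFunctor.id V (EnrichedFunctor V T V)) (evFunctor V t)
    (t := N.obj (d.ob t)) (d.el t) (N.obj Y)).trans ?_
  exact Category.id_comp _

lemma base_obIso (t s : T) :
    (d.base.obIso t s).hom = (d.obIso t s).hom ≫ N.map (d.ob s) (d.ob t) := by
  rw [← cancel_mono (d.base.homIso s (N.obj (d.ob t))).hom, Category.assoc, map_base_homIso]
  exact (d.base.obIso_homIso t s).trans (d.obIso_homIso t s).symm

lemma base_mor {t : T} {Y : M} (x : 𝟙_ V ⟶ (N.obj Y).obj t) :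
    d.base.mor (Y := N.obj Y) x = d.mor x ≫ N.map (d.ob t) Y := by
  rw [← cancel_mono (d.base.homIso t (N.obj Y)).hom, Category.assoc, map_base_homIso]
  exact (d.base.mor_homIso (Y := N.obj Y) x).trans (d.mor_homIso x).symm

lemma isCompat_base (F : EnrichedFunctor V T V) :
    IsCompat (d.diagram F ⋙ N.forget) (X := F) fun e => d.base.mor (Y := F) e.el := by
  intro e e' g
  refine Eq.trans ?_ (d.base.isCompat_mor F e e' g)
  refine congrArg (fun z => ecomp z (d.base.mor (Y := F) e'.el)) ?_
  change (g.1 ≫ (d.obIso e'.ob e.ob).hom) ≫ N.map _ _ = g.1 ≫ (d.base.obIso e'.ob e.ob).hom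
  rw [base_obIso, Category.assoc]

variable [HasColimits V] {G₀ : Set V} (hG : IsSiftedDense G₀)
    (hG' : ∀ Z ∈ G₀, IsStronglyFinitelyPresentable V Z) (hT : HasLimitsIn (StrongGen V) T)

include hG hG' hT

/-- A continuous functor is the colimit of the representables over its elements. -/
lemma conical_base {F : EnrichedFunctor V T V} (hF : PreservesLimitsIn (StrongGen V) F) :
    Conical (d.diagram F ⋙ N.forget) (X := F) fun e => d.base.mor (Y := F) e.el := by
  refine Conical.of_pres (d.isCompat_base F) fun s => ?_
  have h := d.base.pres_mor hG hG' hT (Y := F) hF s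
  have h1 : Pres (evFunctor V s) (d.base.diagram F) (X := F)
      fun e => d.base.mor (Y := F) e.el := by
    refine Pres.of_natIso (P := rep (d.base.ob s)) (Q := evFunctor V s)
      (fun P => d.base.homIso s P) (fun P Q f => ?_) h
    rw [fmap_rep]
    refine (d.base.homIso_natural s f).trans ?_
    exact congrArg (fun z => (d.base.homIso s P).hom ≫ fmap (evFunctor V s) z) (Category.comp_id f)
  refine IsColim.congr h1 (fun e e' g => ?_) fun e => rfl
  refine congrArg (fmap (evFunctor V s)) ?_
  change g.1 ≫ (d.base.obIso e'.ob e.ob).hom = (g.1 ≫ (d.obIso e'.ob e.ob).hom) ≫ N.map _ _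
  rw [base_obIso, Category.assoc]

/-- `N` is fully faithful if every object `Y` is the colimit of the `X_t` over the elements
of `N Y`. -/
lemma isFF (hN : ∀ Y, PreservesLimitsIn (StrongGen V) (N.obj Y))
    (hC : ∀ Y, Conical (d.diagram (N.obj Y)) (X := Y) fun e => d.mor e.el) : IsFF N := by
  intro X Y
  obtain ⟨b, hb⟩ : ∃ b : ∀ e : El (N.obj X), 𝟙_ V ⟶ (N.obj (d.ob e.ob) ⟶[V] N.obj X),
    ∀ e, b e = d.base.mor (Y := N.obj X) e.el := ⟨_, fun _ => rfl⟩
  have hX : Conical (d.diagram (N.obj X) ⋙ N.forget) (X := N.obj X) b := by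
    rw [funext hb]
    exact d.conical_base hG hG' hT (hN X)
  have hc : ∀ (e e' : El (N.obj X)) (g : e ⟶ e'),
      ecomp (dmap (d.diagram (N.obj X)) e e' g ≫ N.map (d.ob e.ob) (d.ob e'.ob)) (b e') = b e := by
    rw [funext hb]
    exact d.isCompat_base (N.obj X)
  have h1 : ∀ e : El (N.obj X), pre (d.mor e.el) Y ≫ N.map (d.ob e.ob) Y =
      N.map X Y ≫ pre (b e) (N.obj Y) := fun e => by
    rw [pre_map, hb, base_mor]
  have hiso : ∀ t, IsIso (N.map (d.ob t) Y) := fun t => d.isIso_map t Y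
  have h4 : ∀ (e e' : El (N.obj X)) (g : e ⟶ e'), pre (b e') (N.obj Y) ≫
      pre (dmap (d.diagram (N.obj X)) e e' g ≫ N.map (d.ob e.ob) (d.ob e'.ob)) (N.obj Y) =
      pre (b e) (N.obj Y) := fun e e' g => by rw [← pre_comp, hc]
  refine isIso_of_existsUnique _ fun W y => ?_
  have h2 := hC X Y W (fun e => y ≫ pre (b e) (N.obj Y) ≫ inv (N.map (d.ob e.ob) Y))
    fun e e' g => by
      have h5 : pre (dmap (d.diagram (N.obj X)) e e' g) Y ≫ N.map (d.ob e.ob) Y =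
          N.map (d.ob e'.ob) Y ≫ pre (dmap (d.diagram (N.obj X)) e e' g ≫
            N.map (d.ob e.ob) (d.ob e'.ob)) (N.obj Y) := pre_map N Y _
      rw [← cancel_mono (N.map (d.ob e.ob) Y), Category.assoc, h5]
      simp only [Category.assoc, IsIso.inv_hom_id, Category.comp_id, IsIso.inv_hom_id_assoc, h4]
  refine (existsUnique_congr fun f => ?_).1 h2
  have h3 : (∀ e : El (N.obj X), f ≫ pre (d.mor e.el) Y =
      y ≫ pre (b e) (N.obj Y) ≫ inv (N.map (d.ob e.ob) Y)) ↔
      ∀ e : El (N.obj X), (f ≫ N.map X Y) ≫ pre (b e) (N.obj Y) = y ≫ pre (b e) (N.obj Y) := by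
    refine forall_congr' fun e => ?_
    rw [← Category.assoc y, IsIso.eq_comp_inv, Category.assoc, Category.assoc, h1]
  refine h3.trans ⟨fun h => ?_, fun h e => by rw [h]⟩
  refine (hX (N.obj Y) W (fun e => y ≫ pre (b e) (N.obj Y)) fun e e' g => ?_).unique h fun e => rfl
  rw [Category.assoc]
  exact congrArg (y ≫ ·) (h4 e e' g)

/-- Every continuous functor is in the image of `N` if the `X_t` are strongly finitely
presentable. -/
lemma exists_viso_obj
    (hM : ∀ (J : Type v) [SmallCategory J] [IsSifted J] (D : J ⥤ ForgetEnrichment V M),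
      ∃ (X : M) (x : ∀ j, 𝟙_ V ⟶ (dob D j ⟶[V] X)), IsCompat D x ∧ Conical D x)
    (hP : ∀ t, IsStronglyFinitelyPresentable V (d.ob t)) {F : EnrichedFunctor V T V}
    (hF : PreservesLimitsIn (StrongGen V) F) :
    ∃ X, Nonempty (VIso (V := V) (N.obj X) F) := by
  have := isSifted_el hT hF
  obtain ⟨C, x, hx, hC⟩ := hM _ (d.diagram F)
  have h1 : Conical (d.diagram F ⋙ N.forget) (X := N.obj C) fun e => x e ≫ N.map _ _ := by
    refine Conical.of_pres (isCompat_forget N hx) fun s => ?_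
    rw [pres_forget]
    refine Pres.of_natIso (P := rep (d.ob s)) (Q := vcomp N (evFunctor V s))
      (fun P => d.homIso s P) (fun P Q f => ?_)
      ((isStronglyFinitelyPresentable_iff _).1 (hP s) _ _ _ x hx hC)
    rw [fmap_rep, fmap_vcomp]
    exact d.homIso_natural s f
  obtain ⟨e, -⟩ := Conical.exists_iso (isCompat_forget N hx) (d.isCompat_base F) h1
    (d.conical_base hG hG' hT hF)
  exact ⟨C, ⟨e⟩⟩

end NerveData

end NerveData

/-! ### Finite coproducts of copowers -/

section Copowers

variable {V : Type u} [Category.{v} V] [MonoidalCategory V] [SymmetricCategory V]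
  [MonoidalClosed V]
variable {M : Type w} [EnrichedCategory V M]

/-- The family `x i : Z ⟶ M(s i, C)` exhibits `C` as the coproduct of the copowers of the objects
`s i` by `Z`. -/
def IsCopower (Z : V) {ι : Type v} (s : ι → M) {C : M} (x : ∀ i, Z ⟶ (s i ⟶[V] C)) : Prop :=
  ∀ (Y : M) (W : V) (t : ∀ i, Z ⊗ W ⟶ (s i ⟶[V] Y)),
    ∃! f : W ⟶ (C ⟶[V] Y), ∀ i, (x i ⊗ₘ f) ≫ eComp V (s i) C Y = t i

lemma IsCopower.reindex {Z : V} {ι κ : Type v} {s : ι → M} {C : M} {x : ∀ i, Z ⟶ (s i ⟶[V] C)}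
    (e : κ ≃ ι) (h : IsCopower Z (fun k => s (e k)) (fun k => x (e k))) : IsCopower Z s x := by
  intro Y W t
  refine (existsUnique_congr fun f => ?_).1 (h Y W fun k => t (e k))
  exact e.forall_congr_right (q := fun i => (x i ⊗ₘ f) ≫ eComp V (s i) C Y = t i)

lemma IsCopower.of_iso {Z Z' : V} {ι : Type v} {s : ι → M} {C : M} {x : ∀ i, Z ⟶ (s i ⟶[V] C)}
    (h : IsCopower Z s x) (e : Z' ≅ Z) : IsCopower Z' s fun i => e.hom ≫ x i := by
  intro Y W t
  refine (existsUnique_congr fun f => forall_congr' fun i => ?_).1 (h Y W fun i => e.inv ▷ W ≫ t i)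
  rw [comp_tensor_eq_assoc]
  exact (Iso.eq_inv_comp (whiskerRightIso e W))

variable [HasLimits V] [HasColimits V]

lemma isCopower_iff {Z : V} {ι : Type v} (s : FreeDiscrete ι → M) {C : M}
    (x : ∀ i : FreeDiscrete ι, Z ⟶ (s i ⟶[V] C)) :
    (famCocone (R := famFunctor s) x).IsColimit ↔ IsCopower Z (ι := ι) s x := by
  rw [famCocone_isColimit_iff]
  refine forall_congr' fun Y => forall_congr' fun W => forall_congr' fun t =>
    existsUnique_congr fun f => forall_congr' fun i => ?_
  rw [famCocone_leg]
  rfl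

lemma IsCocomplete.exists_copower (hM : IsCocomplete V M) (Z : V) {ι : Type v} (s : ι → M) :
    ∃ (C : M) (x : ∀ i, Z ⟶ (s i ⟶[V] C)), IsCopower Z s x := by
  obtain ⟨C, c, hc⟩ := hM _ (constWeight ι Z) (famFunctor s)
  refine ⟨C, fun i => c.leg i, ?_⟩
  refine (isCopower_iff (ι := ι) s (fun i => c.leg i)).1 ?_
  convert hc using 1
  exact WeightedCocone.ext_leg fun i => famCocone_leg _ _

lemma IsCopower.isStronglyFinitelyPresentable {G₀ : Set V} (hG : IsSiftedDense G₀)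
    {Z : V} (hZ : IsStronglyFinitelyPresentable V Z) {ι : Type v} [Finite ι] {s : ι → M} {C : M}
    {x : ∀ i, Z ⟶ (s i ⟶[V] C)} (h : IsCopower Z s x)
    (hs : ∀ i, IsStronglyFinitelyPresentable V (s i)) : IsStronglyFinitelyPresentable V C := by
  rw [isStronglyFinitelyPresentable_iff]
  intro J _ _ D Y y hy hY
  exact (hG.commutesWithSifted_constWeight ι hZ).pres ((isCopower_iff s x).2 h) hy
    fun i => (isStronglyFinitelyPresentable_iff _).1 (hs i) _ D Y y hy hY

end Copowers

/-! ### The theory of a family of objects -/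

section Induced

variable {V : Type u} [Category.{v} V] [MonoidalCategory V] [SymmetricCategory V]
  [MonoidalClosed V] [HasLimits V]
variable {M : Type w} [EnrichedCategory V M] {Λ : Type v}

/-- The indices of a family of objects of `M`, as the objects of a `V`-category with the
hom-objects of `M`. -/
def Induced (_ : Λ → M) : Type v := Λ

variable (o : Λ → M)

/-- The object of `M` with a given index. -/
@[reducible]
def Induced.ob {o : Λ → M} (i : Induced o) : M := o i

/-- The `V`-category structure with the hom-objects of `M`. -/
instance induced : EnrichedCategory V (Induced o) where
  Hom i j := i.ob ⟶[V] j.ob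
  id i := eId V i.ob
  comp i j k := eComp V i.ob j.ob k.ob
  id_comp i j := e_id_comp V i.ob j.ob
  comp_id i j := e_comp_id V i.ob j.ob
  assoc i j k l := e_assoc V i.ob j.ob k.ob l.ob

/-- The fully faithful `V`-functor given by a family of objects. -/
@[reducible]
def inducedFunctor : EnrichedFunctor V (Induced o) M where
  obj i := i.ob
  map i j := 𝟙 (i.ob ⟶[V] j.ob)
  map_id i := Category.comp_id _
  map_comp i j k := by
    change eComp V i.ob j.ob k.ob ≫ 𝟙 (i.ob ⟶[V] k.ob) =
      (𝟙 (i.ob ⟶[V] j.ob) ⊗ₘ 𝟙 (j.ob ⟶[V] k.ob)) ≫ eComp V i.ob j.ob k.ob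
    simp

lemma act_nerveObj_induced (X : M) (a b : (Induced o)ᵒᵖ) :
    act (nerveObj (inducedFunctor o) X) a b =
      (β_ (a.unop.ob ⟶[V] X) (b.unop.ob ⟶[V] a.unop.ob)).hom ≫
        eComp V b.unop.ob a.unop.ob X := by
  rw [act_nerveObj]
  refine congrArg ((β_ (a.unop.ob ⟶[V] X) (b.unop.ob ⟶[V] a.unop.ob)).hom ≫ ·) ?_
  change 𝟙 (b.unop.ob ⟶[V] a.unop.ob) ▷ _ ≫ eComp V b.unop.ob a.unop.ob X = _
  rw [id_whiskerRight, Category.id_comp]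

/-- The nerve of a family of objects. -/
@[reducible]
def inducedNerveData : NerveData (nerve (inducedFunctor (V := V) o)) where
  ob t := t.unop.ob
  el t := eId V t.unop.ob
  isIso_left t X := by
    have h : elMap (vcomp (nerve (inducedFunctor (V := V) o)) (evFunctor V t))
        (t := t.unop.ob) (eId V t.unop.ob) X = 𝟙 (t.unop.ob ⟶[V] X) := by
      have h1 := act_nerve_ev (inducedFunctor (V := V) o) t.unop t.unop.ob X
      have h2 : act (vcomp (nerve (inducedFunctor (V := V) o)) (evFunctor V t)) t.unop.ob X =
        eComp V t.unop.ob t.unop.ob X := h1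
      rw [elMap, h2]
      exact e_id_comp V t.unop.ob X
    rw [h]
    exact (inferInstance : IsIso (𝟙 (t.unop.ob ⟶[V] X)))
  isIso_right t s := by
    have h : elMap (nerveObj (inducedFunctor (V := V) o) t.unop.ob) (t := t) (eId V t.unop.ob) s =
        𝟙 (s.unop.ob ⟶[V] t.unop.ob) := by
      rw [elMap, act_nerveObj_induced]
      change (λ_ (s.unop.ob ⟶[V] t.unop.ob)).inv ≫ eId V t.unop.ob ▷ (s.unop.ob ⟶[V] t.unop.ob) ≫
        (β_ (t.unop.ob ⟶[V] t.unop.ob) (s.unop.ob ⟶[V] t.unop.ob)).hom ≫ eComp V _ _ _ = _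
      rw [BraidedCategory.braiding_naturality_left_assoc, ← e_comp_id V s.unop.ob t.unop.ob]
      simp
    change IsIso (elMap (nerveObj (inducedFunctor (V := V) o) t.unop.ob) (eId V t.unop.ob) s)
    rw [h]
    exact (inferInstance : IsIso (𝟙 (s.unop.ob ⟶[V] t.unop.ob)))

variable {o} [HasColimits V]

/-- A coproduct of copowers in `M` of objects of the family is a product of powers in the opposite
of the `V`-category of the family, provided it belongs to the family; this limit is preserved by
the nerves of the objects of `M`. -/
lemma IsCopower.exists_isLimit {Z : V} {ι : Type v}
    {S : EnrichedFunctor V (FreeDiscrete ι)ᵒᵖ (Induced o)ᵒᵖ} {a : Induced o}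
    {x : ∀ i : FreeDiscrete ι, Z ⟶ ((S.obj (op i)).unop.ob ⟶[V] a.ob)}
    (h : IsCopower Z (ι := ι) (fun i => (S.obj (op i)).unop.ob) x) :
    ∃ c : WeightedCone (constWeight ι Z) S (op a), c.IsLimit ∧
      ∀ X, (c.map (nerveObj (inducedFunctor o) X)).IsLimit := by
  have key : ∀ (X : M) (W : V)
      (t : ∀ i : FreeDiscrete ι, W ⊗ Z ⟶ ((S.obj (op i)).unop.ob ⟶[V] X)),
      ∃! f : W ⟶ (a.ob ⟶[V] X), ∀ i : FreeDiscrete ι,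
        (f ⊗ₘ x i) ≫ (β_ _ _).hom ≫ eComp V (S.obj (op i)).unop.ob a.ob X = t i := by
    intro X W t
    refine (existsUnique_congr fun f => forall_congr' fun i => ?_).1
      (h X W fun i => (β_ _ _).hom ≫ t i)
    rw [BraidedCategory.braiding_naturality_assoc, ← Iso.eq_inv_comp]
    have hβ : (β_ W Z).inv = (β_ Z W).hom := by
      rw [← SymmetricCategory.braiding_swap_eq_inv_braiding]
    rw [hβ]
  let x' : ∀ i : FreeDiscrete ι, Z ⟶ (op a ⟶[V] S.obj (op i)) := x
  refine ⟨famCone x', ?_, fun X => ?_⟩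
  · rw [famCone_isLimit_iff]
    intro Y W t
    refine (existsUnique_congr fun f => forall_congr' fun i => ?_).1 (key Y.unop.ob W t)
    rw [famCone_leg]
    rfl
  · rw [famCone_isLimit_iff_self]
    intro W t
    refine (existsUnique_congr fun f => forall_congr' fun i => ?_).1 (key X W t)
    have h1 : uc (((famCone x').map (nerveObj (inducedFunctor o) X)).leg (op i)) =
        (a.ob ⟶[V] X) ◁ x i ≫ (β_ (a.ob ⟶[V] X) ((S.obj (op i)).unop.ob ⟶[V] a.ob)).hom ≫
        eComp V (S.obj (op i)).unop.ob a.ob X := by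
      have h2 : uc (((famCone x').map (nerveObj (inducedFunctor o) X)).leg (op i)) =
        (a.ob ⟶[V] X) ◁ (famCone x').leg (op i) ≫
          act (nerveObj (inducedFunctor o) X) (op a) (S.obj (op i)) := uc_natural_left _ _
      rw [h2, famCone_leg, act_nerveObj_induced]
      rfl
    rw [MonoidalCategory.tensorHom_def, Category.assoc]
    exact Eq.congr (congrArg (f ▷ Z ≫ ·) h1.symm) rfl

end Induced

/-! ### Closing a family under finite coproducts of copowers -/

section Closure

variable {V : Type u} [Category.{v} V] [MonoidalCategory V] [SymmetricCategory V]
  [MonoidalClosed V] [HasLimits V] [HasColimits V]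
variable {M : Type w} [EnrichedCategory V M]

/-- Formal finite coproducts of copowers, iterated, with generators indexed by `Γ` and copowers by
a family of objects indexed by `Ξ`. -/
inductive CopowerTerm (Γ Ξ : Type v) : Type v
  | gen (γ : Γ) : CopowerTerm Γ Ξ
  | copower (ξ : Ξ) (n : ℕ) (s : Fin n → CopowerTerm Γ Ξ) : CopowerTerm Γ Ξ

variable {Γ Ξ : Type v} (hM : IsCocomplete V M) (g : Γ → M) (r : Ξ → V)

/-- The object of `M` described by a term. -/
def CopowerTerm.eval : CopowerTerm Γ Ξ → M
  | gen γ => g γ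
  | copower ξ n s =>
    (hM.exists_copower (r ξ) fun i : ULift.{v} (Fin n) => (s i.down).eval).choose

/-- The coprojections of a formal coproduct of copowers. -/
lemma CopowerTerm.exists_isCopower (ξ : Ξ) (n : ℕ) (s : Fin n → CopowerTerm Γ Ξ) :
    ∃ x : ∀ i : ULift.{v} (Fin n), r ξ ⟶ ((s i.down).eval hM g r ⟶[V]
      (copower ξ n s).eval hM g r), IsCopower (r ξ)
        (fun i : ULift.{v} (Fin n) => (s i.down).eval hM g r) x := by
  have h := (hM.exists_copower (r ξ)
    fun i : ULift.{v} (Fin n) => (s i.down).eval hM g r).choose_spec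
  rw [CopowerTerm.eval]
  exact h

include hM in
/-- The closure of a small family of objects under finite coproducts and copowers by strongly
finitely presentable objects: a property of objects which is stable under these colimits holds
throughout it. -/
theorem IsCocomplete.exists_nerveData (hV : IsLocallySFPTensor V) (Q : M → Prop)
    (hQ : ∀ (Z : V), IsStronglyFinitelyPresentable V Z → ∀ (ι : Type v) [Finite ι] (s : ι → M)
      (C : M) (x : ∀ i, Z ⟶ (s i ⟶[V] C)), IsCopower Z s x → (∀ i, Q (s i)) → Q C)
    (hg : ∀ γ, Q (g γ)) :
    ∃ (T : Type v) (_ : EnrichedCategory V T) (N : EnrichedFunctor V M (EnrichedFunctor V T V))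
      (d : NerveData N), HasLimitsIn (StrongGen V) T ∧
        (∀ Y, PreservesLimitsIn (StrongGen V) (N.obj Y)) ∧ (∀ t, Q (d.ob t)) ∧
        ∀ γ, ∃ t, d.ob t = g γ := by
  obtain ⟨Ξ, r, hr, hr'⟩ := hV.exists_small
  let o : CopowerTerm Γ Ξ → M := CopowerTerm.eval hM g r
  have key : ∀ (Z : V), IsStronglyFinitelyPresentable V Z → ∀ (ι : Type v) [Finite ι]
      (S : EnrichedFunctor V (FreeDiscrete ι)ᵒᵖ (Induced o)ᵒᵖ),
      ∃ (a : (Induced o)ᵒᵖ) (c : WeightedCone (constWeight ι Z) S a), c.IsLimit ∧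
        ∀ X, (c.map (nerveObj (inducedFunctor o) X)).IsLimit := by
    intro Z hZ ι _ S
    obtain ⟨ξ, ⟨φ⟩⟩ := hr' Z hZ
    obtain ⟨n, ⟨e⟩⟩ := Finite.exists_equiv_fin ι
    let e' : ULift.{v} (Fin n) ≃ ι := Equiv.ulift.trans e.symm
    let s : Fin n → CopowerTerm Γ Ξ := fun i => (S.obj (op (e.symm i))).unop
    obtain ⟨x, hx⟩ := CopowerTerm.exists_isCopower hM g r ξ n s
    let a : Induced o := CopowerTerm.copower ξ n s
    have hy : ∃ y : ∀ i : ι, r ξ ⟶ (o (S.obj (op i)).unop ⟶[V] o a),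
        ∀ k, y (e' k) = x k := by
      let P : ι → Type v := fun i => r ξ ⟶ (o (S.obj (op i)).unop ⟶[V] o a)
      exact ⟨Equiv.piCongrLeft P e' x, Equiv.piCongrLeft_apply_apply P e' x⟩
    obtain ⟨y, hy⟩ := hy
    have h1 : IsCopower (r ξ) (fun i : ι => o (S.obj (op i)).unop) y := by
      refine IsCopower.reindex e' ?_
      have : (fun k => y (e' k)) = x := funext hy
      rw [this]
      exact hx
    obtain ⟨c, hc, hc'⟩ := (h1.of_iso φ).exists_isLimit (a := a)
    exact ⟨op a, c, hc, hc'⟩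
  have hlim : ∀ (A : Type v) [EnrichedCategory V A] (F : EnrichedFunctor V Aᵒᵖ V),
      StrongGen V A F → ∀ S : EnrichedFunctor V Aᵒᵖ (Induced o)ᵒᵖ,
      ∃ (a : (Induced o)ᵒᵖ) (c : WeightedCone F S a), c.IsLimit ∧
        ∀ X, (c.map (nerveObj (inducedFunctor o) X)).IsLimit := by
    intro A _ F hF S
    cases hF with
    | finiteProduct ι => exact key _ isStronglyFinitelyPresentable_unit ι S
    | power Z hZ => exact key Z hZ _ S
  refine ⟨(Induced o)ᵒᵖ, inferInstance, nerve (inducedFunctor o), inducedNerveData o, ?_, ?_,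
    ?_, fun γ => ⟨op (CopowerTerm.gen γ), rfl⟩⟩
  · intro A _ F hF S
    obtain ⟨a, c, hc, -⟩ := hlim A F hF S
    exact ⟨a, c, hc⟩
  · intro Y A _ F hF S L c hc
    obtain ⟨a, c₀, hc₀, hc₀'⟩ := hlim A F hF S
    exact hc.map_of_map hc₀ _ (hc₀' Y)
  · rintro ⟨t⟩
    change Q (CopowerTerm.eval hM g r t)
    induction t with
    | gen γ => exact hg γ
    | copower ξ n s ih =>
      obtain ⟨x, hx⟩ := CopowerTerm.exists_isCopower hM g r ξ n s
      exact hQ _ (hr ξ) _ _ _ x hx fun i => ih i.down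

end Closure

section StrongGenerator

variable {V : Type u} [Category.{v} V] [MonoidalCategory V] [SymmetricCategory V]
  [MonoidalClosed V] [HasLimits V]
variable {M : Type w} [EnrichedCategory V M]

/-- If `f : X ⟶ Y` is inverted by the functors `M(R a,-)`, it is inverted by `M(C,-)` for every
colimit `C` of `R`. -/
lemma WeightedCocone.IsColimit.isIso_post {A : Type v} [EnrichedCategory V A]
    {L : EnrichedFunctor V Aᵒᵖ V} {R : EnrichedFunctor V A M} {C : M} {c : WeightedCocone L R C}
    (hc : c.IsColimit) {X Y : M} (f : 𝟙_ V ⟶ (X ⟶[V] Y)) (h : ∀ a, IsIso (post (R.obj a) f)) :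
    IsIso (post C f) := by
  obtain ⟨e, he⟩ := exists_viso (f ≫ (nerve R).map X Y) fun a => by
    have h1 := fmap_nerve_ev R a.unop f
    rw [fmap_vcomp] at h1
    have h2 : fmap (evFunctor V a) (f ≫ (nerve R).map X Y) = post (R.obj a.unop) f := h1
    rw [h2]
    exact h a.unop
  have h1 := colimitComparison_natural c f
  rw [← he] at h1
  have h2 := e.isIso_post L
  have h3 := c.isColimit_iff_isIso.1 hc X
  have h4 := c.isColimit_iff_isIso.1 hc Y
  have h5 : IsIso (post C f ≫ colimitComparison c Y) := by
    rw [h1]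
    infer_instance
  exact IsIso.of_isIso_comp_right _ (colimitComparison c Y)

lemma exists_viso_of_isIso_post {X Y : M} (f : 𝟙_ V ⟶ (X ⟶[V] Y)) (hX : IsIso (post X f))
    (hY : IsIso (post Y f)) : ∃ e : VIso (V := V) X Y, e.hom = f := by
  have h1 : ecomp (eId V Y ≫ inv (post Y f)) f = eId V Y := by
    rw [← comp_post, Category.assoc, IsIso.inv_hom_id, Category.comp_id]
  refine ⟨⟨f, eId V Y ≫ inv (post Y f), ?_, h1⟩, rfl⟩
  rw [← cancel_mono (post X f)]
  have h2 : ecomp f (eId V Y ≫ inv (post Y f)) ≫ post X f = f := by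
    rw [← comp_post, Category.assoc, ← post_comp, h1, post_id, Category.comp_id]
  rw [h2, comp_post, ← comp_pre, pre_id, Category.comp_id]

end StrongGenerator

/-! ### Categories of models from locally presentable categories -/

section Models

variable {V : Type u} [Category.{v} V] [MonoidalCategory V] [SymmetricCategory V]
  [MonoidalClosed V] [HasLimits V] [HasColimits V]
variable {M : Type w} [EnrichedCategory V M]

lemma IsCocomplete.exists_conical (hM : IsCocomplete V M) {J : Type v} [SmallCategory J]
    (D : J ⥤ ForgetEnrichment V M) :
    ∃ (X : M) (x : ∀ j, 𝟙_ V ⟶ (dob D j ⟶[V] X)), IsCompat D x ∧ Conical D x :=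
  EnrichedLSFP.exists_conical D (hM _ _ _)

/-- Every object of `M` is a weighted colimit of objects of the family `g`. -/
def IsColimitGenerated {Γ : Type v} (g : Γ → M) : Prop :=
  ∀ X : M, ∃ (B : Type v) (_ : EnrichedCategory V B) (H : EnrichedFunctor V Bᵒᵖ V)
    (R : EnrichedFunctor V B M) (c : WeightedCocone H R X), (∀ b, ∃ γ, R.obj b = g γ) ∧ c.IsColimit

omit [HasColimits V] in
/-- A family which generates under colimits is strongly generating. -/
lemma IsColimitGenerated.exists_viso {Γ : Type v} {g : Γ → M}
    (hgen : IsColimitGenerated (V := V) g) {X Y : M} (f : 𝟙_ V ⟶ (X ⟶[V] Y))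
    (hf : ∀ γ, IsIso (post (g γ) f)) : ∃ e : VIso (V := V) X Y, e.hom = f := by
  have h1 : ∀ C : M, IsIso (post C f) := by
    intro C
    obtain ⟨B, _, H, R, c, hR, hc⟩ := hgen C
    refine hc.isIso_post f fun b => ?_
    obtain ⟨γ, hb⟩ := hR b
    rw [hb]
    exact hf γ
  exact exists_viso_of_isIso_post f (h1 X) (h1 Y)

/-- A small, strongly generating family of strongly finitely presentable objects of a cocomplete `M`
can be enlarged to one of which every object is a canonical sifted colimit. -/
theorem IsCocomplete.exists_conical_nerveData (hM : IsCocomplete V M) (hV : IsLocallySFPTensor V)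
    {Γ : Type v} (g : Γ → M) (hg : ∀ γ, IsStronglyFinitelyPresentable V (g γ))
    (hs : ∀ (X Y : M) (f : 𝟙_ V ⟶ (X ⟶[V] Y)), (∀ γ, IsIso (post (g γ) f)) →
      ∃ e : VIso (V := V) X Y, e.hom = f) (Q : M → Prop)
    (hQ : ∀ (Z : V), IsStronglyFinitelyPresentable V Z → ∀ (ι : Type v) [Finite ι] (s : ι → M)
      (C : M) (x : ∀ i, Z ⟶ (s i ⟶[V] C)), IsCopower Z s x → (∀ i, Q (s i)) → Q C)
    (hgQ : ∀ γ, Q (g γ)) :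
    ∃ (T : Type v) (_ : EnrichedCategory V T) (N : EnrichedFunctor V M (EnrichedFunctor V T V))
      (d : NerveData N), HasLimitsIn (StrongGen V) T ∧
        (∀ Y, PreservesLimitsIn (StrongGen V) (N.obj Y)) ∧
        (∀ t, IsStronglyFinitelyPresentable V (d.ob t)) ∧ (∀ t, Q (d.ob t)) ∧
        ∀ Y, Conical (d.diagram (N.obj Y)) (X := Y) fun e => d.mor e.el := by
  obtain ⟨G₀, hG, hG'⟩ := hV.exists_dense
  obtain ⟨T, _, N, d, hT, hN, hd, hγ⟩ := hM.exists_nerveData g hV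
    (fun X => IsStronglyFinitelyPresentable V X ∧ Q X)
    (fun Z hZ ι _ s C x hx h => ⟨hx.isStronglyFinitelyPresentable hG hZ fun i => (h i).1,
      hQ Z hZ ι s C x hx fun i => (h i).2⟩) fun γ => ⟨hg γ, hgQ γ⟩
  refine ⟨T, _, N, d, hT, hN, fun t => (hd t).1, fun t => (hd t).2, ?_⟩
  refine d.conical_mor hG hG' hT hN (fun J _ _ D => hM.exists_conical D) (fun t => (hd t).1) ?_
  intro X Y f hf
  refine hs X Y f fun γ => ?_
  obtain ⟨t, ht⟩ := hγ γ
  rw [← ht]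
  exact hf t

/-- A cocomplete `V`-category which is generated under colimits by a small family of strongly
finitely presentable objects is equivalent to a category of continuous functors. -/
theorem IsCocomplete.exists_isEquivalentTo (hM : IsCocomplete V M) (hV : IsLocallySFPTensor V)
    {Γ : Type v} (g : Γ → M) (hg : ∀ γ, IsStronglyFinitelyPresentable V (g γ))
    (hgen : IsColimitGenerated (V := V) g) :
    ∃ (T : Type v) (_ : EnrichedCategory V T), HasLimitsIn (StrongGen V) T ∧
      IsEquivalentTo V M (ContinuousFunctors (StrongGen V) T) := by
  obtain ⟨G₀, hG, hG'⟩ := hV.exists_dense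
  obtain ⟨T, _, N, d, hT, hN, hd, -, hC⟩ := hM.exists_conical_nerveData hV g hg
    (fun _ _ f hf => hgen.exists_viso f hf) (fun _ => True)
    (fun _ _ _ _ _ _ _ _ _ => trivial) fun _ => trivial
  refine ⟨T, _, hT, (isEquivalentTo_fullSub_iff _).2 ⟨N, d.isFF hG hG' hT hN hC, hN, ?_⟩⟩
  intro F hF
  exact d.exists_viso_obj hG hG' hT (fun J _ _ D => hM.exists_conical D) hd hF

end Models

section Conical

variable {V : Type u} [Category.{v} V] [MonoidalCategory V] [SymmetricCategory V]
  [MonoidalClosed V] [HasColimits V]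
variable {M : Type w} [EnrichedCategory V M]

lemma conicalCocone_map_isColimit_iff {J : Type v} [SmallCategory J]
    {D : J ⥤ ForgetEnrichment V M} {X : M} {x : ∀ j, 𝟙_ V ⟶ (dob D j ⟶[V] X)}
    (hx : IsCompat D x) {K : Type w'} [EnrichedCategory V K] (P : EnrichedFunctor V M K) :
    ((conicalCocone (freeFunctor D) (X := X) x (isCompat_free hx)).map P).IsColimit ↔
      Conical (D ⋙ P.forget) (X := P.obj X) fun j => x j ≫ P.map _ _ := by
  rw [unitWeight_isColimit_iff]
  refine forall_congr' fun Y => forall_congr' fun W => forall_congr' fun t => ?_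
  have h1 : ∀ (i j : J) (u : i ⟶ j), (frι V (i := FreeV.of i) (j := FreeV.of j) u ≫
      (freeFunctor D).map (FreeV.of i) (FreeV.of j)) ≫ P.map _ _ = dmap D i j u ≫ P.map _ _ :=
    fun i j u => congrArg (· ≫ P.map _ _)
      (frι_freeFunctor D (i := FreeV.of i) (j := FreeV.of j) u)
  refine imp_congr ?_ ?_
  · refine forall_congr' fun i => forall_congr' fun j => forall_congr' fun u => ?_
    refine Eq.congr (congrArg (fun z => t j ≫ pre z Y) ?_) rfl
    refine Eq.trans ?_ (h1 i j u)
    exact (Category.assoc _ _ _).symm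
  · refine existsUnique_congr fun f => forall_congr' fun j => ?_
    refine Eq.congr (congrArg (fun z => f ≫ pre z Y) ?_) rfl
    exact congrArg (· ≫ P.map _ _) (conicalCocone_leg (freeFunctor D) x _ j)

/-- A functor into `V` preserves a conical colimit if and only if it does so in the underlying
category of `V`. -/
lemma conical_forget_iff_pres {J : Type v} [SmallCategory J]
    {D : J ⥤ ForgetEnrichment V M} {X : M} {x : ∀ j, 𝟙_ V ⟶ (dob D j ⟶[V] X)}
    (P : EnrichedFunctor V M V) :
    (Conical (D ⋙ P.forget) (X := P.obj X) fun j => x j ≫ P.map _ _) ↔ Pres P D x := by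
  rw [conical_self_iff]
  constructor
  · intro h
    exact IsColim.congr h (fun i j u => un_comp_map P (dmap D i j u))
      (fun j => un_comp_map P (x j))
  · intro h
    exact IsColim.congr h (fun i j u => (un_comp_map P (dmap D i j u)).symm)
      (fun j => (un_comp_map P (x j)).symm)

end Conical

lemma exists_shrink {M : Type w} {G : Set M} [Small.{v} G] {X : M} (hX : X ∈ G) :
    ∃ γ : Shrink.{v} G, X = ((equivShrink G).symm γ).1 :=
  ⟨equivShrink G ⟨X, hX⟩, by simp⟩

section Presentable

variable {V : Type u} [Category.{v} V] [MonoidalCategory V] [SymmetricCategory V]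
  [MonoidalClosed V] [HasLimits V] [HasColimits V]
variable {M : Type w} [EnrichedCategory V M]

/-- The weights of sifted conical colimits are flat with respect to the saturation of the weights
for finite products and powers by strongly finitely presentable objects. -/
lemma IsSiftedDense.isFlat_unitWeight {G₀ : Set V} (hG : IsSiftedDense G₀) (J : Type v)
    [SmallCategory J] [IsSifted J] : IsFlat (Saturation (StrongGen V)) (unitWeight V J) :=
  EnrichedLSFP.isFlat_unitWeight fun _ _ _ hF =>
    commutesWithSifted_saturation (fun _ _ _ hF => hG.commutesWithSifted_strongGen hF) hF

/-- Sifted colimits are colimits with a flat weight, so presentability implies strong finite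
presentability. -/
lemma IsPresentable.isStronglyFinitelyPresentable {G₀ : Set V} (hG : IsSiftedDense G₀) {X : M}
    (hX : IsPresentable (Saturation (StrongGen V)) X) : IsStronglyFinitelyPresentable V X := by
  rw [isStronglyFinitelyPresentable_iff]
  intro J _ _ D Y y hy hY
  rw [← conical_forget_iff_pres, ← conicalCocone_map_isColimit_iff hy]
  exact hX _ _ (hG.isFlat_unitWeight J) _ _ _ ((conicalCocone_isColimit_iff D y _).2 hY)

lemma IsLocallyStronglyFinitelyPresentable.exists_isEquivalentTo (hV : IsLocallySFPTensor V)
    (h : IsLocallyStronglyFinitelyPresentable V M) :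
    ∃ (T : Type v) (_ : EnrichedCategory V T), HasLimitsIn (StrongGen V) T ∧
      IsEquivalentTo V M (ContinuousFunctors (StrongGen V) T) := by
  obtain ⟨hM, G, hG, hsf, hX⟩ := h
  refine hM.exists_isEquivalentTo hV (fun γ : Shrink.{v} G => ((equivShrink G).symm γ).1)
    (fun γ => hsf _ ((equivShrink G).symm γ).2) fun X => ?_
  obtain ⟨J, _, _, D, c, hc, hD, hcol⟩ := hX X
  obtain rfl : ForgetEnrichment.to V c.pt = X := congrArg (ForgetEnrichment.to V) hc
  refine ⟨FreeV J, inferInstance, unitWeight V J, freeFunctor D,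
    conicalCocone (freeFunctor D) _ (isCompat_free (isCompat_cocone c)), fun j => ?_, ?_⟩
  · exact exists_shrink (hD j.to)
  · exact (conicalCocone_isColimit_iff D _ _).2 ((isConicalColimit_iff c).1 hcol)

lemma IsLocallyPresentable.exists_isEquivalentTo (hV : IsLocallySFPTensor V)
    (h : IsLocallyPresentable (Saturation (StrongGen V)) M) :
    ∃ (T : Type v) (_ : EnrichedCategory V T), HasLimitsIn (StrongGen V) T ∧
      IsEquivalentTo V M (ContinuousFunctors (StrongGen V) T) := by
  obtain ⟨G₀, hG₀, -⟩ := hV.exists_dense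
  obtain ⟨hM, G, hG, hsf, hX⟩ := h
  refine hM.exists_isEquivalentTo hV (fun γ : Shrink.{v} G => ((equivShrink G).symm γ).1)
    (fun γ => (hsf _ ((equivShrink G).symm γ).2).isStronglyFinitelyPresentable hG₀) fun X => ?_
  obtain ⟨B, _, H, R, c, -, hR, hc⟩ := hX X
  refine ⟨B, _, H, R, c, fun b => exists_shrink (hR b), hc⟩

end Presentable

/-! ### Reflections and colimits -/

section Reflection

variable {V : Type u} [Category.{v} V] [MonoidalCategory V] [SymmetricCategory V]
  [MonoidalClosed V]
variable {M : Type w} [EnrichedCategory V M] {K : Type w'} [EnrichedCategory V K]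

/-- Preservation of a colimit is invariant under natural isomorphism. -/
lemma WeightedCocone.map_isColimit_of_natIso {A : Type v} [EnrichedCategory V A]
    {P P' : EnrichedFunctor V M K} (n : ∀ X, VIso (V := V) (P.obj X) (P'.obj X))
    (hn : ∀ X Y, P.map X Y ≫ post (P.obj X) (n Y).hom = P'.map X Y ≫ pre (n X).hom (P'.obj Y))
    {H : EnrichedFunctor V Aᵒᵖ V} {R : EnrichedFunctor V A M} {X : M} (c : WeightedCocone H R X)
    (h : (c.map P).IsColimit) : (c.map P').IsColimit := by
  have hn' : ∀ X Y, P'.map X Y ≫ post (P'.obj X) (n Y).inv =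
      P.map X Y ≫ pre (n X).inv (P.obj Y) := by
    intro X Y
    have h1 : ∀ Z, pre (n X).hom Z ≫ pre (n X).inv Z = 𝟙 _ := fun Z =>
      ((n X).pre Z).hom_inv_id
    have h2 : ∀ Z, post Z (n Y).hom ≫ post Z (n Y).inv = 𝟙 _ := fun Z =>
      ((n Y).post Z).hom_inv_id
    calc P'.map X Y ≫ post (P'.obj X) (n Y).inv
        = P'.map X Y ≫ (pre (n X).hom _ ≫ pre (n X).inv _) ≫ post (P'.obj X) (n Y).inv := by
          rw [h1, Category.id_comp]
      _ = (P'.map X Y ≫ pre (n X).hom _) ≫ post (P.obj X) (n Y).inv ≫ pre (n X).inv _ := by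
          rw [post_pre]
          simp only [Category.assoc]
      _ = P.map X Y ≫ pre (n X).inv (P.obj Y) := by
          rw [← hn, Category.assoc, reassoc_of% (h2 (P.obj X))]
  intro W Y t
  let l : ∀ a, H.obj (op a) ⊗ W ⟶ (P'.obj (R.obj a) ⟶[V] Y) := t.leg
  let t' : ParamCocone H (vcomp R P) W Y :=
    { leg := fun a => l a ≫ pre (n (R.obj a)).hom Y
      natural := fun a b => by
        have h1 : ((R.map a b ≫ P'.map _ _) ⊗ₘ l b) ≫ eComp V _ (P'.obj (R.obj b)) Y =
          (α_ _ _ _).inv ≫ lact H a b ▷ W ≫ l a := t.natural a b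
        change ((R.map a b ≫ P.map _ _) ⊗ₘ (l b ≫ pre (n (R.obj b)).hom Y)) ≫
          eComp V _ (P.obj (R.obj b)) Y =
            (α_ _ _ _).inv ≫ lact H a b ▷ W ≫ l a ≫ pre (n (R.obj a)).hom Y
        rw [tensor_pre_eComp, Category.assoc, hn, ← Category.assoc, comp_tensor_eq',
          Category.assoc, pre_eComp, reassoc_of% h1] }
  have h1 := existsUnique_iso ((n X).symm.pre Y).symm (h W Y t')
  refine (existsUnique_congr fun f => forall_congr' fun a => ?_).1 h1
  have h2 : ((c.leg a ≫ P.map _ _) ⊗ₘ (f ≫ pre (n X).hom Y)) ≫ eComp V _ (P.obj X) Y =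
      (((c.leg a ≫ P'.map _ _) ⊗ₘ f) ≫ eComp V (P'.obj (R.obj a)) (P'.obj X) Y) ≫
        pre (n (R.obj a)).hom Y := by
    rw [tensor_pre_eComp, Category.assoc, hn, ← Category.assoc, comp_tensor_eq',
      Category.assoc, pre_eComp, Category.assoc]
  have h3 := (n (R.obj a)).isIso_pre Y
  refine Iff.trans ?_ (cancel_mono (pre (n (R.obj a)).hom Y))
  exact Eq.congr h2 rfl

/-- Fully faithful `V`-functors reflect conical colimits. -/
lemma Conical.of_forget {E : EnrichedFunctor V M K} (hE : IsFF E) {J : Type v} [SmallCategory J]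
    {D : J ⥤ ForgetEnrichment V M} {X : M} {x : ∀ j, 𝟙_ V ⟶ (dob D j ⟶[V] X)}
    (h : Conical (D ⋙ E.forget) (X := E.obj X) fun j => x j ≫ E.map _ _) : Conical D x := by
  intro Y W t ht
  have h1 : ∀ i j (u : i ⟶ j), (t j ≫ E.map (dob D j) Y) ≫
      pre (dmap D i j u ≫ E.map (dob D i) (dob D j)) (E.obj Y) = t i ≫ E.map (dob D i) Y := by
    intro i j u
    rw [Category.assoc, ← pre_map, ← Category.assoc, ht]
  have h2 := h (E.obj Y) W (fun j => t j ≫ E.map (dob D j) Y) h1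
  have hXY := hE X Y
  refine (existsUnique_congr fun f => forall_congr' fun j => ?_).1
    (existsUnique_iso (asIso (E.map X Y)) h2)
  have := hE (dob D j) Y
  refine Iff.trans ?_ (cancel_mono (E.map (dob D j) Y))
  refine Eq.congr ?_ rfl
  change (f ≫ E.map X Y) ≫ pre (x j ≫ E.map _ _) (E.obj Y) = _
  rw [Category.assoc, ← pre_map, Category.assoc]

/-- The morphism `η : P ⟶ E X` is a universal arrow from `P` to the `V`-functor `E`. -/
def IsUniversalArrow (E : EnrichedFunctor V M K) {P : K} {X : M} (η : 𝟙_ V ⟶ (P ⟶[V] E.obj X)) :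
    Prop :=
  ∀ Y, IsIso (E.map X Y ≫ pre η (E.obj Y))

/-- A universal arrow from a weighted colimit in `K` gives a weighted colimit in `M`. -/
lemma IsUniversalArrow.exists_isColimit {E : EnrichedFunctor V M K} (hE : IsFF E)
    {A : Type v} [EnrichedCategory V A] {H : EnrichedFunctor V Aᵒᵖ V} {R : EnrichedFunctor V A M}
    {P : K} {c : WeightedCocone H (vcomp R E) P} (hc : c.IsColimit) {X : M}
    {η : 𝟙_ V ⟶ (P ⟶[V] E.obj X)} (hη : IsUniversalArrow E η) :
    ∃ c' : WeightedCocone H R X, c'.IsColimit ∧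
      ∀ a, c'.leg a ≫ E.map (R.obj a) X = c.leg a ≫ post (E.obj (R.obj a)) η := by
  have hE' : ∀ a Y, IsIso (E.map (R.obj a) Y) := fun a Y => hE _ _
  have hleg : ∀ a, ∃ l : H.obj (op a) ⟶ (R.obj a ⟶[V] X),
      l ≫ E.map (R.obj a) X = c.leg a ≫ post (E.obj (R.obj a)) η := fun a =>
    ⟨(c.leg a ≫ post (E.obj (R.obj a)) η) ≫ inv (E.map (R.obj a) X), by simp⟩
  choose l hl using hleg
  have hmap : ∀ {a} {Y Z : M} {Q Q' : V} (f : Q ⟶ (R.obj a ⟶[V] Y)) (g : Q' ⟶ (Y ⟶[V] Z)),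
      ((f ⊗ₘ g) ≫ eComp V (R.obj a) Y Z) ≫ E.map (R.obj a) Z =
        ((f ≫ E.map (R.obj a) Y) ⊗ₘ (g ≫ E.map Y Z)) ≫ eComp V _ (E.obj Y) (E.obj Z) := by
    intro a Y Z Q Q' f g
    rw [Category.assoc, E.map_comp, tensorHom_comp_tensorHom_assoc]
  let c' : WeightedCocone H R X :=
    { leg := l
      natural := fun a b => by
        have h1 : ((R.map a b ≫ E.map _ _) ⊗ₘ c.leg b) ≫ eComp V _ (E.obj (R.obj b)) P =
          lact H a b ≫ c.leg a := c.natural a b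
        rw [← cancel_mono (E.map (R.obj a) X), hmap, hl, tensor_comp_eq', Category.assoc,
          eComp_post, reassoc_of% h1, Category.assoc, hl] }
  refine ⟨c', fun W Y t => ?_, hl⟩
  let t' : ParamCocone H (vcomp R E) W (E.obj Y) :=
    { leg := fun a => t.leg a ≫ E.map (R.obj a) Y
      natural := fun a b => by
        have h1 := t.natural a b =≫ E.map (R.obj a) Y
        rw [hmap] at h1
        simpa only [Category.assoc] using h1 }
  have h1 := hη Y
  refine (existsUnique_congr fun f => forall_congr' fun a => ?_).1
    (existsUnique_iso (asIso (E.map X Y ≫ pre η (E.obj Y))) (hc W (E.obj Y) t'))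
  refine Iff.trans ?_ (cancel_mono (E.map (R.obj a) Y))
  refine Eq.congr ?_ rfl
  have h2 : (c.leg a ⊗ₘ (f ≫ E.map X Y ≫ pre η (E.obj Y))) ≫
      eComp V (E.obj (R.obj a)) P (E.obj Y) =
      ((l a ⊗ₘ f) ≫ eComp V (R.obj a) X Y) ≫ E.map (R.obj a) Y := by
    rw [hmap, hl, ← Category.assoc f, tensor_pre_eComp]
  exact h2

section Colimit

variable (E : EnrichedFunctor V M K) {J : Type v} [SmallCategory J] (D : J ⥤ ForgetEnrichment V K)
  (L : J → M) (η : ∀ j, 𝟙_ V ⟶ (dob D j ⟶[V] E.obj (L j)))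

lemma pre_universalArrow {Q Q' : K} {X X' : M} (η : 𝟙_ V ⟶ (Q ⟶[V] E.obj X))
    (η' : 𝟙_ V ⟶ (Q' ⟶[V] E.obj X')) (x : 𝟙_ V ⟶ (Q ⟶[V] Q')) (l : 𝟙_ V ⟶ (X ⟶[V] X'))
    (h : l ≫ E.map X X' ≫ pre η (E.obj X') = ecomp x η') (Y : M) :
    pre l Y ≫ E.map X Y ≫ pre η (E.obj Y) = E.map X' Y ≫ pre η' (E.obj Y) ≫ pre x (E.obj Y) := by
  rw [← Category.assoc, pre_map, Category.assoc, ← pre_comp, ← comp_pre, Category.assoc, h,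
    pre_comp]

variable {D L η}

/-- The diagram in `M` induced by universal arrows from the objects of a diagram in `K`. -/
@[reducible]
def reflectedDiagram (hη : ∀ j, IsUniversalArrow E (η j))
    (l : ∀ i j, (i ⟶ j) → (𝟙_ V ⟶ (L i ⟶[V] L j)))
    (hl : ∀ i j (u : i ⟶ j), l i j u ≫ E.map _ _ ≫ pre (η i) (E.obj (L j)) =
      ecomp (dmap D i j u) (η j)) : J ⥤ ForgetEnrichment V M where
  obj j := ForgetEnrichment.of V (L j)
  map {i j} u := ForgetEnrichment.homOf V (l i j u)
  map_id i := by
    refine (congrArg (ForgetEnrichment.homOf V) ?_).trans (ForgetEnrichment.homOf_eId _ _)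
    have := hη i (L i)
    rw [← cancel_mono (E.map (L i) (L i) ≫ pre (η i) (E.obj (L i))), hl, ← Category.assoc,
      E.map_id, comp_pre, dmap_id, ← comp_pre, pre_id, Category.comp_id, ← comp_post, post_id,
      Category.comp_id]
  map_comp {i j k} u v := by
    rw [← homOf_ecomp]
    refine congrArg (ForgetEnrichment.homOf V) ?_
    have := hη i (L k)
    rw [← cancel_mono (E.map (L i) (L k) ≫ pre (η i) (E.obj (L k))), hl,
      ← comp_pre (l i j u), Category.assoc,
        pre_universalArrow E (η i) (η j) (dmap D i j u) (l i j u) (hl i j u)]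
    have h1 : l j k v ≫ E.map (L j) (L k) ≫ pre (η j) (E.obj (L k)) ≫
        pre (dmap D i j u) (E.obj (L k)) =
        ecomp (dmap D j k v) (η k) ≫ pre (dmap D i j u) (E.obj (L k)) := by
      rw [← hl]
      simp only [Category.assoc]
    rw [h1, dmap_comp, ← comp_pre, pre_comp, ← Category.assoc, comp_pre, comp_pre, comp_pre]

/-- An object which is a colimit of objects that have universal arrows to `E` has one itself. -/
lemma Conical.exists_universalArrow (hη : ∀ j, IsUniversalArrow E (η j)) {P : K}
    {x : ∀ j, 𝟙_ V ⟶ (dob D j ⟶[V] P)} (hx : IsCompat D x) (hP : Conical D x)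
    (hM : ∀ D' : J ⥤ ForgetEnrichment V M, ∃ (X : M) (x : ∀ j, 𝟙_ V ⟶ (dob D' j ⟶[V] X)),
      IsCompat D' x ∧ Conical D' x) :
    ∃ (X : M) (θ : 𝟙_ V ⟶ (P ⟶[V] E.obj X)), IsUniversalArrow E θ := by
  have h1 : ∀ i j (u : i ⟶ j), ∃ l : 𝟙_ V ⟶ (L i ⟶[V] L j),
      l ≫ E.map _ _ ≫ pre (η i) (E.obj (L j)) = ecomp (dmap D i j u) (η j) := fun i j u => by
    have := hη i (L j)
    exact ⟨ecomp (dmap D i j u) (η j) ≫ inv (E.map _ _ ≫ pre (η i) (E.obj (L j))), by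
      rw [Category.assoc, IsIso.inv_hom_id, Category.comp_id]⟩
  choose l hl using h1
  obtain ⟨X, z', hz', hX'⟩ := hM (reflectedDiagram E hη l hl)
  let z : ∀ j, 𝟙_ V ⟶ (L j ⟶[V] X) := z'
  have hz : ∀ i j (u : i ⟶ j), ecomp (l i j u) (z j) = z i := hz'
  have hX : ∀ (Y : M) (W : V) (t : ∀ j, W ⟶ (L j ⟶[V] Y)),
    (∀ i j (u : i ⟶ j), t j ≫ pre (l i j u) Y = t i) →
      ∃! f : W ⟶ (X ⟶[V] Y), ∀ j, f ≫ pre (z j) Y = t j := hX'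
  have hl' := fun i j u => pre_universalArrow E (η i) (η j) (dmap D i j u) (l i j u) (hl i j u)
  obtain ⟨θ, hθ, -⟩ := hP (E.obj X) (𝟙_ V)
    (fun j => z j ≫ E.map (L j) X ≫ pre (η j) (E.obj X)) fun i j u => by
      have h2 := congrArg (z j ≫ ·) (hl' i j u X)
      simp only [Category.assoc] at h2 ⊢
      rw [← h2, ← Category.assoc, comp_pre, hz]
  refine ⟨X, θ, fun Y => ?_⟩
  have h3 : ∀ j, E.map X Y ≫ pre θ (E.obj Y) ≫ pre (x j) (E.obj Y) =
      pre (z j) Y ≫ E.map (L j) Y ≫ pre (η j) (E.obj Y) := fun j =>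
    (pre_universalArrow E (η j) θ (x j) (z j) (by rw [← comp_pre, hθ]) Y).symm
  refine isIso_of_existsUnique _ fun W y => ?_
  have hψ : ∀ j, IsIso (E.map (L j) Y ≫ pre (η j) (E.obj Y)) := fun j => hη j Y
  have h4 := hX Y W
    (fun j => y ≫ pre (x j) (E.obj Y) ≫ inv (E.map (L j) Y ≫ pre (η j) (E.obj Y)))
    fun i j u => by
      have h5 := hl' i j u Y
      rw [← cancel_mono (E.map (L i) Y ≫ pre (η i) (E.obj Y)), Category.assoc, h5,
        ← Category.assoc (E.map (L j) Y)]
      simp only [Category.assoc, IsIso.inv_hom_id, Category.comp_id]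
      have h6 : inv (E.map (L j) Y ≫ pre (η j) (E.obj Y)) ≫ E.map (L j) Y ≫
          pre (η j) (E.obj Y) ≫ pre (dmap D i j u) (E.obj Y) = pre (dmap D i j u) (E.obj Y) := by
        rw [← Category.assoc (E.map (L j) Y), IsIso.inv_hom_id_assoc]
      rw [h6, ← pre_comp, hx]
  refine (existsUnique_congr fun f => ?_).1 h4
  have h7 : (∀ j, f ≫ pre (z j) Y =
      y ≫ pre (x j) (E.obj Y) ≫ inv (E.map (L j) Y ≫ pre (η j) (E.obj Y))) ↔
      ∀ j, (f ≫ E.map X Y ≫ pre θ (E.obj Y)) ≫ pre (x j) (E.obj Y) = y ≫ pre (x j) (E.obj Y) := by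
    refine forall_congr' fun j => ?_
    rw [← Category.assoc y, IsIso.eq_comp_inv, Category.assoc, Category.assoc, Category.assoc, h3]
  refine h7.trans ⟨fun h => ?_, fun h j => by rw [h]⟩
  refine (hP (E.obj Y) W (fun j => y ≫ pre (x j) (E.obj Y)) fun i j u => ?_).unique h fun j => rfl
  rw [Category.assoc, ← pre_comp, hx]

end Colimit

end Reflection

/-! ### Colimits of continuous functors -/

section MapComp

variable {V : Type u} [Category.{v} V] [MonoidalCategory V] [SymmetricCategory V]
  [MonoidalClosed V]
variable {D : Type v} [EnrichedCategory V D] {M : Type w} [EnrichedCategory V M]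
  {K : Type w'} [EnrichedCategory V K]

lemma vcomp_assoc {C : Type v} [EnrichedCategory V C] {L : Type*} [EnrichedCategory V L]
    (S : EnrichedFunctor V C M) (P : EnrichedFunctor V M K) (Q : EnrichedFunctor V K L) :
    vcomp S (vcomp P Q) = vcomp (vcomp S P) Q := by
  simp only [vcomp]
  congr 1
  funext a b
  exact (Category.assoc _ _ _).symm

lemma WeightedCone.map_vcomp_isLimit_iff {L : Type*} [EnrichedCategory V L]
    {F : EnrichedFunctor V D V} {S : EnrichedFunctor V D M} {X : M} (c : WeightedCone F S X)
    (P : EnrichedFunctor V M K) (Q : EnrichedFunctor V K L) :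
    (c.map (vcomp P Q)).IsLimit ↔ ((c.map P).map Q).IsLimit := by
  have key : ∀ {S' S'' : EnrichedFunctor V D L} {Y : L} (h : S' = S'')
      (c' : WeightedCone F S' Y) (c'' : WeightedCone F S'' Y)
      (_ : ∀ a, HEq (c'.leg a) (c''.leg a)), c'.IsLimit ↔ c''.IsLimit := by
    rintro S' _ Y rfl c' c'' h
    refine forall_congr' fun W => forall_congr' fun Z => forall_congr' fun t =>
      existsUnique_congr fun f => forall_congr' fun a => ?_
    rw [eq_of_heq (h a)]
  exact key (vcomp_assoc S P Q) _ _ fun a => heq_of_eq (Category.assoc _ _ _).symm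

lemma WeightedCocone.map_vcomp_isColimit_iff {L : Type*} [EnrichedCategory V L]
    {F : EnrichedFunctor V Dᵒᵖ V} {S : EnrichedFunctor V D M} {X : M} (c : WeightedCocone F S X)
    (P : EnrichedFunctor V M K) (Q : EnrichedFunctor V K L) :
    (c.map (vcomp P Q)).IsColimit ↔ ((c.map P).map Q).IsColimit := by
  have key : ∀ {S' S'' : EnrichedFunctor V D L} {Y : L} (h : S' = S'')
      (c' : WeightedCocone F S' Y) (c'' : WeightedCocone F S'' Y)
      (_ : ∀ a, HEq (c'.leg a) (c''.leg a)), c'.IsColimit ↔ c''.IsColimit := by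
    rintro S' _ Y rfl c' c'' h
    refine forall_congr' fun W => forall_congr' fun Z => forall_congr' fun t =>
      existsUnique_congr fun f => forall_congr' fun a => ?_
    rw [eq_of_heq (h a)]
  exact key (vcomp_assoc S P Q) _ _ fun a => heq_of_eq (Category.assoc _ _ _).symm

end MapComp

section FlatColimits

variable {V : Type u} [Category.{v} V] [MonoidalCategory V] [SymmetricCategory V]
  [MonoidalClosed V] [HasLimits V] [HasColimits V]
variable {T : Type v} [EnrichedCategory V T]

/-- A flat colimit of continuous functors, calculated pointwise, is continuous. -/
lemma IsFlat.preservesLimitsIn {Φ Ψ : WeightClass V} {B : Type v} [EnrichedCategory V B]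
    {H : EnrichedFunctor V Bᵒᵖ V} (hH : IsFlat Φ H)
    (hΨ : ∀ (A : Type v) [EnrichedCategory V A] (F : EnrichedFunctor V Aᵒᵖ V), Ψ A F → Φ A F)
    {S : EnrichedFunctor V B (EnrichedFunctor V T V)} (hS : ∀ b, PreservesLimitsIn Ψ (S.obj b)) :
    PreservesLimitsIn Ψ (pointwiseColimit H S) := by
  intro A _ F hF R L c hc
  have h1 : (c.map (swap S)).IsLimit := by
    refine WeightedCone.isLimit_of_ev _ fun b => ?_
    rw [← WeightedCone.map_vcomp_isLimit_iff]
    refine WeightedCone.map_isLimit_of_natIso (P := S.obj b)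
      (P' := vcomp (swap S) (evFunctor V b)) (fun t => Iso.refl _) (fun t t' => ?_) c
      (hS b A F hF R L c hc)
    have h2 : act (vcomp (swap S) (evFunctor V b)) t t' = act (S.obj b) t t' :=
      act_ofBiaction _ _ _ _ _ b t t'
    rw [h2]
    exact (Category.comp_id _).trans
      ((congrArg (· ≫ act (S.obj b) t t') (id_whiskerRight _ _)).trans (Category.id_comp _)).symm
  exact (WeightedCone.map_vcomp_isLimit_iff c _ _).2 (hH A F (hΨ A F hF) _ _ _ h1)

lemma WeightedCocone.IsColimit.map_ev {B : Type v} [EnrichedCategory V B]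
    {H : EnrichedFunctor V Bᵒᵖ V} {S : EnrichedFunctor V B (EnrichedFunctor V T V)}
    {P : EnrichedFunctor V T V} {c : WeightedCocone H S P} (hc : c.IsColimit) (t : T) :
    (c.map (evFunctor V t)).IsColimit := by
  refine hc.map_of_map (pointwiseCocone_isColimit H S) _ ?_
  rw [pointwiseCocone_map_ev]
  exact coendCocone_isColimit _ _

lemma isCocomplete_functorCategory : IsCocomplete V (EnrichedFunctor V T V) :=
  fun _ _ H S => ⟨_, pointwiseCocone H S, pointwiseCocone_isColimit H S⟩

lemma Conical.pres_ev {J : Type v} [SmallCategory J]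
    {D : J ⥤ ForgetEnrichment V (EnrichedFunctor V T V)} {X : EnrichedFunctor V T V}
    {x : ∀ j, 𝟙_ V ⟶ (dob D j ⟶[V] X)} (hx : IsCompat D x) (h : Conical D x) (t : T) :
    Pres (evFunctor V t) D x := by
  rw [← conical_forget_iff_pres, ← conicalCocone_map_isColimit_iff hx]
  exact ((conicalCocone_isColimit_iff D x _).2 h).map_ev t

/-- By the Yoneda lemma `[T,V](T(t,-),-)` is evaluation at `t`, and colimits are pointwise. -/
lemma isStronglyFinitelyPresentable_rep (t : T) :
    IsStronglyFinitelyPresentable V (rep (V := V) t) := by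
  rw [isStronglyFinitelyPresentable_iff]
  intro J _ _ D Y y hy hY
  refine Pres.of_natIso (P := evFunctor V t) (Q := rep (rep (V := V) t))
    (fun P => (yonedaIso t P).symm) (fun P Q f => ?_) (hY.pres_ev hy t)
  have h := fmap_natural (P := rep (rep (V := V) t)) (P' := evFunctor V t)
    (fun P => (yonedaIso t P).hom) (yonedaIso_natural t) f
  change _ ≫ (yonedaIso t Q).inv = (yonedaIso t P).inv ≫ _
  rw [Iso.comp_inv_eq, Category.assoc, h, Iso.inv_hom_id_assoc]

/-- The isomorphism in the `V`-category `V` given by an isomorphism of the underlying category. -/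
@[reducible]
def nmIso {X Y : V} (e : X ≅ Y) : VIso (V := V) X Y where
  hom := nm e.hom
  inv := nm e.inv
  hom_inv := by rw [← nm_comp, e.hom_inv_id, nm_id]
  inv_hom := by rw [← nm_comp, e.inv_hom_id, nm_id]

lemma map_post_nm {M : Type w} [EnrichedCategory V M] {P P' : EnrichedFunctor V M V}
    (n : ∀ X, P.obj X ⟶ P'.obj X)
    (hn : ∀ X Y, act P X Y ≫ n Y = n X ▷ _ ≫ act P' X Y) (X Y : M) :
    P.map X Y ≫ post (P.obj X) (nm (n Y)) = P'.map X Y ≫ pre (nm (n X)) (P'.obj Y) := by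
  apply uc_injective
  rw [uc_comp_post, uc_comp_pre, un_nm, un_nm]
  exact hn X Y

end FlatColimits

section ConstLimits

variable {V : Type u} [Category.{v} V] [MonoidalCategory V] [SymmetricCategory V]
  [MonoidalClosed V] [HasLimits V] [HasColimits V]
variable {T : Type v} [EnrichedCategory V T]

/-- Products of powers, and their preservation by continuous functors. -/
lemma HasLimitsIn.exists_product_power (hT : HasLimitsIn (StrongGen V) T) {Z : V}
    (hZ : IsStronglyFinitelyPresentable V Z) (ι : Type v) [Finite ι] (s : ι → T) :
    ∃ (p : T) (π : ∀ i, Z ⟶ (p ⟶[V] s i)),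
      ∀ F : EnrichedFunctor V T V, PreservesLimitsIn (StrongGen V) F →
        ∀ (W : V) (y : ∀ i, W ⊗ Z ⟶ F.obj (s i)), ∃! f : W ⟶ F.obj p,
          ∀ i, f ▷ Z ≫ F.obj p ◁ π i ≫ act F p (s i) = y i := by
  have h1 : ∀ i, ∃ (q : T) (ρ : Z ⟶ (q ⟶[V] s i)),
      ∀ F : EnrichedFunctor V T V, PreservesLimitsIn (StrongGen V) F →
        ∀ (W : V) (y : W ⊗ Z ⟶ F.obj (s i)), ∃! f : W ⟶ F.obj q,
          f ▷ Z ≫ F.obj q ◁ ρ ≫ act F q (s i) = y := by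
    intro i
    obtain ⟨q, c, hc⟩ := hT _ _ (StrongGen.power Z hZ) (famFunctorOp fun _ => s i)
    refine ⟨q, c.leg (op PUnit.unit), fun F hF W y => ?_⟩
    have h := (famCone_isLimit_iff_self _).1 (hF _ _ (StrongGen.power Z hZ) _ _ c hc) W fun _ => y
    have h1 : ∀ k, uc ((c.map F).leg (op k)) = F.obj q ◁ c.leg (op k) ≫ act F q (s i) :=
      fun k => uc_natural_left _ _
    refine (existsUnique_congr fun f => ?_).1 h
    have h2 : ∀ k, f ▷ Z ≫ uc ((c.map F).leg (op k)) =
      f ▷ Z ≫ F.obj q ◁ c.leg (op k) ≫ act F q (s i) := fun k => congrArg (f ▷ Z ≫ ·) (h1 k)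
    constructor
    · intro H
      exact (h2 PUnit.unit).symm.trans (H PUnit.unit)
    · intro H k
      exact (h2 k).trans H
  choose q ρ hρ using h1
  obtain ⟨p, c, hc⟩ := hT _ _ (StrongGen.finiteProduct ι) (famFunctorOp q)
  let g : ∀ i, 𝟙_ V ⟶ (p ⟶[V] q i) := fun i => c.leg (op i)
  refine ⟨p, fun i => ρ i ≫ pre (g i) (s i), fun F hF W y => ?_⟩
  choose x hx hu using fun i => hρ i F hF W (y i)
  have h := (famCone_isLimit_iff_self _).1 (hF _ _ (StrongGen.finiteProduct ι) _ _ c hc) W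
    fun i => (ρ_ W).hom ≫ x i
  refine (existsUnique_congr fun f => forall_congr' fun i => ?_).1 h
  have h2 : uc ((c.map F).leg (op i)) = F.obj p ◁ g i ≫ act F p (q i) :=
    uc_natural_left _ _
  refine (Eq.congr (congrArg (f ▷ _ ≫ ·) h2) rfl).trans ?_
  have h3 : f ▷ 𝟙_ V ≫ F.obj p ◁ g i ≫ act F p (q i) = (ρ_ _).hom ≫ x i ↔
      f ≫ fmap F (g i) = x i := by
    rw [← Iso.inv_comp_eq, ← rightUnitor_inv_naturality_assoc]
    exact Iff.rfl
  refine h3.trans ?_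
  have h4 : f ▷ Z ≫ F.obj p ◁ (ρ i ≫ pre (g i) (s i)) ≫ act F p (s i) =
      (f ≫ fmap F (g i)) ▷ Z ≫ F.obj (q i) ◁ ρ i ≫ act F (q i) (s i) := by
    rw [MonoidalCategory.whiskerLeft_comp_assoc, comp_whiskerRight_assoc, act_pre,
      whisker_exchange_assoc]
  refine Iff.trans ?_ (Eq.congr h4.symm rfl)
  constructor
  · intro H
    rw [H]
    exact hx i
  · intro H
    exact hu i _ H

end ConstLimits

section Reflective

variable {V : Type u} [Category.{v} V] [MonoidalCategory V] [SymmetricCategory V]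
  [MonoidalClosed V] [HasLimits V] [HasColimits V]
variable {T : Type v} [EnrichedCategory V T]

/-- The functor `P` has a representable reflection in the continuous functors. -/
def HasRepReflection (P : EnrichedFunctor V T V) : Prop :=
  ∃ (t : T) (η : 𝟙_ V ⟶ (P ⟶[V] rep (V := V) t)), ∀ F : EnrichedFunctor V T V,
    PreservesLimitsIn (StrongGen V) F → IsIso (pre η F)

lemma hasRepReflection_rep (t : T) : HasRepReflection (rep (V := V) t) :=
  ⟨t, eId V _, fun F _ => by
    rw [pre_id]
    infer_instance⟩

/-- Composition with a morphism of representables, in terms of the action of `T`. -/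
lemma comp_yonedaIso {W Z : V} {p t : T} {F : EnrichedFunctor V T V} (π : Z ⟶ (p ⟶[V] t))
    (f : W ⟶ (rep (V := V) p ⟶[V] F)) :
    (((π ≫ (yonedaIso t (rep (V := V) p)).inv) ⊗ₘ f) ≫
      eComp V (rep (V := V) t) (rep (V := V) p) F) ≫ (yonedaIso t F).hom =
      (β_ _ _).hom ≫ (f ≫ (yonedaIso p F).hom) ▷ Z ≫ F.obj p ◁ π ≫ act F p t := by
  have h1 := yonedaIso_natural t (rep (V := V) p) F
  rw [act_rep] at h1
  have h2 : (evL (rep p) F).app t = (yonedaIso p F).hom ▷ _ ≫ act F p t := by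
    conv_lhs => rw [GNat.eq_yonL (evL (rep p) F)]
    rw [yonL_app]
    rfl
  have h3 : ((π ≫ (yonedaIso t (rep (V := V) p)).inv) ⊗ₘ f) ≫
      (yonedaIso t (rep (V := V) p)).hom ▷ _ = π ⊗ₘ f := by
    rw [← comp_tensor_eq', Category.assoc, Iso.inv_hom_id, Category.comp_id]
  rw [Category.assoc, h1, reassoc_of% h3, act_evFunctor, BraidedCategory.braiding_naturality_assoc,
    h2, MonoidalCategory.tensorHom_def, comp_whiskerRight_assoc, Category.assoc,
    whisker_exchange_assoc]

/-- The functors with a representable reflection are closed under finite coproducts of copowers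
by strongly finitely presentable objects, as `T` has the corresponding limits. -/
lemma IsCopower.hasRepReflection (hT : HasLimitsIn (StrongGen V) T) {Z : V}
    (hZ : IsStronglyFinitelyPresentable V Z) (ι : Type v) [Finite ι]
    {s : ι → EnrichedFunctor V T V} {C : EnrichedFunctor V T V} {x : ∀ i, Z ⟶ (s i ⟶[V] C)}
    (hC : IsCopower Z s x) (hs : ∀ i, HasRepReflection (s i)) : HasRepReflection C := by
  choose t η hη using hs
  obtain ⟨p, π, hp⟩ := hT.exists_product_power hZ ι t
  obtain ⟨θ, hθ, -⟩ := hC (rep p) (𝟙_ V) fun i =>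
    (ρ_ Z).hom ≫ π i ≫ (yonedaIso (t i) (rep (V := V) p)).inv ≫ pre (η i) (rep (V := V) p)
  have hθ' : ∀ i, x i ≫ post (s i) θ =
      π i ≫ (yonedaIso (t i) (rep (V := V) p)).inv ≫ pre (η i) (rep (V := V) p) := fun i => by
    rw [comp_post_eq, hθ, Iso.inv_hom_id_assoc]
  refine ⟨p, θ, fun F hF => ?_⟩
  refine isIso_of_existsUnique _ fun W y => ?_
  have hη' : ∀ i, IsIso (pre (η i) F) := fun i => hη i F hF
  have h1 := hp F hF W fun i => (β_ _ _).hom ≫ ((x i ⊗ₘ y) ≫ eComp V (s i) C F) ≫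
    inv (pre (η i) F) ≫ (yonedaIso (t i) F).hom
  refine (existsUnique_congr fun f => ?_).1 (existsUnique_iso (yonedaIso p F) h1)
  have h2 : ∀ i, (x i ⊗ₘ (f ≫ pre θ F)) ≫ eComp V (s i) C F =
      (((π i ≫ (yonedaIso (t i) (rep (V := V) p)).inv) ⊗ₘ f) ≫
        eComp V (rep (V := V) (t i)) (rep (V := V) p) F) ≫ pre (η i) F := fun i => by
    rw [tensor_pre_eComp, hθ', ← Category.assoc (π i), comp_tensor_eq', Category.assoc, pre_eComp,
      Category.assoc]
  have h3 : ∀ i, ((f ≫ (yonedaIso p F).hom) ▷ Z ≫ F.obj p ◁ π i ≫ act F p (t i) =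
      (β_ _ _).hom ≫ ((x i ⊗ₘ y) ≫ eComp V (s i) C F) ≫
        inv (pre (η i) F) ≫ (yonedaIso (t i) F).hom) ↔
      (x i ⊗ₘ (f ≫ pre θ F)) ≫ eComp V (s i) C F = (x i ⊗ₘ y) ≫ eComp V (s i) C F := fun i => by
    have h4 := comp_yonedaIso (F := F) (π i) f
    rw [h2, ← IsIso.eq_comp_inv (pre (η i) F), ← cancel_mono (yonedaIso (t i) F).hom, h4,
      ← cancel_epi (β_ Z W).hom, SymmetricCategory.symmetry_assoc]
    simp only [Category.assoc]
  refine (forall_congr' h3).trans ⟨fun h => ?_, fun h i => by rw [h]⟩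
  exact (hC F W fun i => (x i ⊗ₘ y) ≫ eComp V (s i) C F).unique h fun i => rfl

end Reflective

/-! ### Categories of continuous functors are locally presentable -/

section Semantics

variable {V : Type u} [Category.{v} V] [MonoidalCategory V] [SymmetricCategory V]
  [MonoidalClosed V] [HasLimits V]
variable {T : Type v} [EnrichedCategory V T] {M : Type w} [EnrichedCategory V M]
variable {N : EnrichedFunctor V M (EnrichedFunctor V T V)}

lemma act_rep_elMap (F : EnrichedFunctor V M V) {t : M} (x : 𝟙_ V ⟶ F.obj t) (s s' : M) :
    act (rep (V := V) t) s s' ≫ elMap F x s' = elMap F x s ▷ _ ≫ act F s s' := by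
  rw [act_rep, elMap, elMap, leftUnitor_inv_naturality_assoc, whisker_exchange_assoc, act_comp]
  simp

/-- A fully faithful functor to `[T,V]` whose image contains the representables is a nerve. -/
lemma IsFF.nonempty_nerveData (hN : IsFF N)
    (hs : ∀ t, ∃ X, Nonempty (VIso (V := V) (N.obj X) (rep (V := V) t))) :
    Nonempty (NerveData N) := by
  choose X e' using hs
  let e : ∀ t, VIso (V := V) (rep (V := V) t) (N.obj (X t)) := fun t => (e' t).some.symm
  refine ⟨⟨X, fun t => eId V t ≫ fmap (evFunctor V t) (e t).hom, fun t Y => ?_, fun t s => ?_⟩⟩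
  · have h1 := elMap_vcomp N (evFunctor V t) (t := X t)
      (eId V t ≫ fmap (evFunctor V t) (e t).hom) Y
    have h2 := elMap_comp_fmap (evFunctor V t) (t := rep (V := V) t) (eId V t) (e t).hom (N.obj Y)
    rw [elMap_ev_eId] at h2
    rw [h1, h2]
    have := hN (X t) Y
    have := (e t).isIso_pre (N.obj Y)
    infer_instance
  · have h1 := elMap_fmap_ev (e t).hom (t := t) (eId V t) s
    have h2 : elMap (rep (V := V) t) (eId V t) s = 𝟙 _ := by rw [elMap_rep, pre_id]
    rw [← h1, h2]
    have := (e t).isIso_fmap (evFunctor V s)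
    exact (inferInstance : IsIso (𝟙 _ ≫ fmap (evFunctor V s) (e t).hom))

variable [HasColimits V]

/-- The `V`-functor `N` is an equivalence from `M` to the `V`-category of continuous functors
on `T`. -/
structure IsSemantics (N : EnrichedFunctor V M (EnrichedFunctor V T V)) : Prop where
  isFF : IsFF N
  preservesLimitsIn : ∀ X, PreservesLimitsIn (StrongGen V) (N.obj X)
  exists_viso : ∀ F, PreservesLimitsIn (StrongGen V) F → ∃ X, Nonempty (VIso (V := V) (N.obj X) F)

namespace IsSemantics

variable (hN : IsSemantics N)

include hN

lemma nonempty_nerveData : Nonempty (NerveData N) :=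
  hN.isFF.nonempty_nerveData fun t => hN.exists_viso _ (preservesLimitsIn_rep _ t)

/-- Flat colimits in `M` exist and are calculated pointwise. -/
lemma exists_flat_colimit {B : Type v} [EnrichedCategory V B] {H : EnrichedFunctor V Bᵒᵖ V}
    (hH : IsFlat (Saturation (StrongGen V)) H) (R : EnrichedFunctor V B M) :
    ∃ (X : M) (c : WeightedCocone H R X), c.IsColimit ∧ (c.map N).IsColimit := by
  have hP := hH.preservesLimitsIn (Ψ := StrongGen V) (fun A _ F hF => Saturation.base A F hF)
    (S := vcomp R N) fun b => hN.preservesLimitsIn (R.obj b)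
  obtain ⟨X, ⟨e⟩⟩ := hN.exists_viso _ hP
  have hη : IsUniversalArrow N e.inv := fun Y => by
    have := hN.isFF X Y
    have := e.symm.isIso_pre (N.obj Y)
    exact (inferInstance : IsIso (N.map X Y ≫ pre e.symm.hom (N.obj Y)))
  obtain ⟨c, hc, hl⟩ := hη.exists_isColimit hN.isFF (pointwiseCocone_isColimit H (vcomp R N))
  exact ⟨X, c, hc, (pointwiseCocone_isColimit H (vcomp R N)).of_iso (c.map N) e.symm hl⟩

/-- The objects `X_t` corepresent the evaluations, which preserve flat colimits. -/
lemma isPresentable_ob (d : NerveData N) (t : T) :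
    IsPresentable (Saturation (StrongGen V)) (d.ob t) := by
  intro B _ H hH R C c hc
  obtain ⟨X, c₀, hc₀, h⟩ := hN.exists_flat_colimit hH R
  refine hc.map_of_map hc₀ _ ?_
  have h1 := (WeightedCocone.map_vcomp_isColimit_iff c₀ N (evFunctor V t)).2 (h.map_ev t)
  have hn : ∀ X Y, act (rep (d.ob t)) X Y ≫ (d.homIso t Y).hom =
      (d.homIso t X).hom ▷ _ ≫ act (vcomp N (evFunctor V t)) X Y := fun X Y =>
    act_rep_elMap (vcomp N (evFunctor V t)) (d.el t) X Y
  refine WeightedCocone.map_isColimit_of_natIso (P := vcomp N (evFunctor V t))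
    (P' := rep (d.ob t)) (fun X => nmIso (d.homIso t X).symm) (fun X Y => ?_) c₀ h1
  refine map_post_nm (P := vcomp N (evFunctor V t)) (P' := rep (d.ob t))
    (fun X => (d.homIso t X).inv) (fun X Y => ?_) X Y
  rw [Iso.comp_inv_eq, Category.assoc, hn, ← comp_whiskerRight_assoc, Iso.inv_hom_id,
    id_whiskerRight, Category.id_comp]

variable (hV : IsLocallySFPTensor V)

include hV

lemma exists_conical {J : Type v} [SmallCategory J] [IsSifted J] (D : J ⥤ ForgetEnrichment V M) :
    ∃ (X : M) (x : ∀ j, 𝟙_ V ⟶ (dob D j ⟶[V] X)), IsCompat D x ∧ Conical D x := by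
  obtain ⟨G₀, hG, -⟩ := hV.exists_dense
  obtain ⟨X, c, hc, -⟩ := hN.exists_flat_colimit (hG.isFlat_unitWeight J) (freeFunctor D)
  exact EnrichedLSFP.exists_conical D ⟨X, c, hc⟩

variable (hT : HasLimitsIn (StrongGen V) T)

include hT

lemma conical_mor (d : NerveData N) (Y : M) :
    Conical (d.diagram (N.obj Y)) (X := Y) fun e => d.mor e.el := by
  obtain ⟨G₀, hG, hG'⟩ := hV.exists_dense
  obtain ⟨b, hb⟩ : ∃ b : ∀ e : El (N.obj Y), 𝟙_ V ⟶ (N.obj (d.ob e.ob) ⟶[V] N.obj Y),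
    ∀ e, b e = d.base.mor (Y := N.obj Y) e.el := ⟨_, fun _ => rfl⟩
  have h : Conical (d.diagram (N.obj Y) ⋙ N.forget) (X := N.obj Y) b := by
    rw [funext hb]
    exact d.conical_base hG hG' hT (hN.preservesLimitsIn Y)
  have h1 : b = fun e : El (N.obj Y) => d.mor e.el ≫ N.map (d.ob e.ob) Y :=
    funext fun e => (hb e).trans (d.base_mor e.el)
  rw [h1] at h
  exact Conical.of_forget (E := N) (D := d.diagram (N.obj Y)) (X := Y)
    (x := fun e => d.mor e.el) hN.isFF h

/-- Every `V`-functor has a reflection in the continuous ones: it is a sifted colimit of functors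
with a representable reflection. -/
lemma exists_universalArrow (P : EnrichedFunctor V T V) :
    ∃ (X : M) (θ : 𝟙_ V ⟶ (P ⟶[V] N.obj X)), IsUniversalArrow N θ := by
  obtain ⟨G₀, hG, hG'⟩ := hV.exists_dense
  obtain ⟨d⟩ := hN.nonempty_nerveData
  obtain ⟨T', _, N', d', hT', hN', -, hQ, hC⟩ :=
    (isCocomplete_functorCategory (V := V) (T := T)).exists_conical_nerveData hV
      (fun t : T => rep (V := V) t) isStronglyFinitelyPresentable_rep
      (fun X Y f hf => EnrichedLSFP.exists_viso f fun t => by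
        have h := fmap_natural (P := rep (rep (V := V) t)) (P' := evFunctor V t)
          (fun P => (yonedaIso t P).hom) (yonedaIso_natural t) f
        have h1 := hf t
        rw [← fmap_rep] at h1
        have h2 : IsIso (fmap (rep (rep (V := V) t)) f ≫ (yonedaIso t Y).hom) := inferInstance
        rw [h] at h2
        exact IsIso.of_isIso_comp_left (yonedaIso t X).hom _)
      HasRepReflection
      (fun Z hZ ι _ s C x hx h => hx.hasRepReflection hT hZ ι h) hasRepReflection_rep
  have := isSifted_el hT' (hN' P)
  have h1 : ∀ j : El (N'.obj P), ∃ (X : M) (η : 𝟙_ V ⟶ (d'.ob j.ob ⟶[V] N.obj X)),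
      IsUniversalArrow N η := by
    intro j
    obtain ⟨t, η, hη⟩ := hQ j.ob
    obtain ⟨e, -⟩ := d.exists_viso_rep t
    refine ⟨d.ob t, ecomp η e.hom, fun Y => ?_⟩
    have h2 := hN.isFF (d.ob t) Y
    have h3 := hη _ (hN.preservesLimitsIn Y)
    have h4 := e.isIso_pre (N.obj Y)
    rw [pre_comp]
    infer_instance
  choose L η hη using h1
  exact Conical.exists_universalArrow N (D := d'.diagram (N'.obj P)) (L := L) (η := η) hη
    (d'.isCompat_mor P) (hC P) fun D' => hN.exists_conical hV D'

/-- Colimits in `M` are the reflections of the pointwise colimits. -/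
lemma isCocomplete : IsCocomplete V M := by
  intro A _ F R
  obtain ⟨X, θ, hθ⟩ := hN.exists_universalArrow hV hT (pointwiseColimit F (vcomp R N))
  obtain ⟨c, hc, -⟩ := hθ.exists_isColimit hN.isFF (pointwiseCocone_isColimit F (vcomp R N))
  exact ⟨X, c, hc⟩

lemma isLocallyPresentable : IsLocallyPresentable (Saturation (StrongGen V)) M := by
  obtain ⟨G₀, hG, -⟩ := hV.exists_dense
  obtain ⟨d⟩ := hN.nonempty_nerveData
  refine ⟨hN.isCocomplete hV hT, Set.range d.ob, inferInstance, ?_, fun X => ?_⟩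
  · rintro _ ⟨t, rfl⟩
    exact hN.isPresentable_ob d t
  · have := isSifted_el hT (hN.preservesLimitsIn X)
    refine ⟨FreeV (El (N.obj X)), inferInstance, unitWeight V _,
      freeFunctor (d.diagram (N.obj X)),
      conicalCocone (freeFunctor (d.diagram (N.obj X))) (X := X) (fun e => d.mor e.to.el)
        (isCompat_free (d.isCompat_mor X)),
      hG.isFlat_unitWeight _, fun b => ⟨b.to.ob, rfl⟩, ?_⟩
    exact (conicalCocone_isColimit_iff _ _ _).2 (hN.conical_mor hV hT d X)

lemma isLocallyStronglyFinitelyPresentable : IsLocallyStronglyFinitelyPresentable V M := by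
  obtain ⟨G₀, hG, -⟩ := hV.exists_dense
  obtain ⟨d⟩ := hN.nonempty_nerveData
  refine ⟨hN.isCocomplete hV hT, Set.range d.ob, inferInstance, ?_, fun X => ?_⟩
  · rintro _ ⟨t, rfl⟩
    exact (hN.isPresentable_ob d t).isStronglyFinitelyPresentable hG
  · have := isSifted_el hT (hN.preservesLimitsIn X)
    refine ⟨El (N.obj X), inferInstance, this, d.diagram (N.obj X),
      mkCocone _ (fun e => d.mor e.el) (d.isCompat_mor X), rfl, fun e => ⟨e.ob, rfl⟩, ?_⟩
    rw [isConicalColimit_iff]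
    exact hN.conical_mor hV hT d X

end IsSemantics

lemma IsEquivalentTo.exists_isSemantics
    (h : IsEquivalentTo V M (ContinuousFunctors (StrongGen V) T)) :
    ∃ N : EnrichedFunctor V M (EnrichedFunctor V T V), IsSemantics N := by
  obtain ⟨N, h1, h2, h3⟩ := (isEquivalentTo_fullSub_iff _).1 h
  exact ⟨N, h1, h2, h3⟩

end Semantics

end EnrichedLSFP

end

theorem mainTheorem5 {V : Type u} [Category.{v} V] [MonoidalCategory V] [SymmetricCategory V]
    [MonoidalClosed V] [HasLimits V] [HasColimits V] (hV : EnrichedLSFP.IsLocallySFPTensor V)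
    (M : Type w) [EnrichedCategory V M] :
    List.TFAE [
      EnrichedLSFP.IsLocallyStronglyFinitelyPresentable V M,
      EnrichedLSFP.IsLocallyPresentable
        (EnrichedLSFP.Saturation (EnrichedLSFP.StrongGen V)) M,
      ∃ (T : Type v) (_ : EnrichedCategory V T),
        EnrichedLSFP.HasLimitsIn (EnrichedLSFP.StrongGen V) T ∧
          EnrichedLSFP.IsEquivalentTo V M
            (EnrichedLSFP.ContinuousFunctors (EnrichedLSFP.StrongGen V) T)] := by
  tfae_have 1 → 3 := fun h => h.exists_isEquivalentTo hV
  tfae_have 2 → 3 := fun h => h.exists_isEquivalentTo hV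
  tfae_have 3 → 1 := by
    rintro ⟨T, _, hT, h⟩
    obtain ⟨N, hN⟩ := h.exists_isSemantics
    exact hN.isLocallyStronglyFinitelyPresentable hV hT
  tfae_have 3 → 2 := by
    rintro ⟨T, _, hT, h⟩
    obtain ⟨N, hN⟩ := h.exists_isSemantics
    exact hN.isLocallyPresentable hV hT
  tfae_finish
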